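/- **Setting.** Let $X$ be a smooth irreducible algebraic variety over $\mathbb C$ of dimension $N$, covered by finitely many affine open sets $U_i$, each with fixed local parameters $x^{(i)}_1,\dots,x^{(i)}_N\in\mathcal O_X(U_i)$, i.e. functions whose differentials form a basis of the $\mathcal O_X(U_i)$-module $\Omega^1_X(U_i)$. On $\mathcal O_X(W)$, $W\subset U_i$ open, let $\partial^{(i)}_p=\partial/\partial x^{(i)}_p$ be the partial derivatives, so $df=\sum_p(\partial^{(i)}_pf)\,dx^{(i)}_p$. Let $\mathfrak g$ be a finite-dimensional simple complex Lie algebra with symmetric invariant bilinear form $(\cdot|\cdot)$, let $h^\vee\in\mathbb C$ be defined by (Killing form) $=2h^\vee(\cdot|\cdot)$ (the dual Coxeter number when the form is the normalized one), and let $c\in\mathbb C$, $c\neq-h^\vee$. Let $$V=V_{\mathrm{Hei}}\otimes V_{\mathfrak{gl}_N}\otimes V_{\mathfrak g}\otimes V_{\mathrm{Vir}}$$ be the tensor product of the following vertex algebras. (1) $V_{\mathrm{Hei}}=\mathbb C[u_p(-j),v_p(-j)\mid 1\le p\le N,\ j\ge1]$ is the Fock space with $[u_p(m),v_q(s)]=m\delta_{pq}\delta_{m,-s}$,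 other brackets zero, $u_p(0)=v_p(0)=0$. (2) $V_{\mathfrak{gl}_N}$ is the universal enveloping vertex algebra of $\widehat{\mathfrak{gl}}_N$ at level $1$ for the form $\mathrm{Tr}(AB)$. (3) $V_{\mathfrak g}$ is the universal enveloping vertex algebra of $\widehat{\mathfrak g}$ at level $c$. (4) $V_{\mathrm{Vir}}$ is the universal enveloping vertex algebra of the Virasoro algebra with central charge $-\frac{c\dim\mathfrak g}{c+h^\vee}$. The generating fields are $u_p(z)$, $v_p(z)$, $E_{ab}(z)$, $g(z)$ ($g\in\mathfrak g$), all of the form $a(z)=\sum_n a(n)z^{-n-1}$, with generators $a(-1)\mathbf 1$, and $\omega^{\mathrm{Vir}}(z)=\sum_nL(n)z^{-n-2}$, with generator $\omega^{\mathrm{Vir}}=L(-2)\mathbf 1$; each acts in its own tensor factor. **Theorem 2.5.** (a) *Local vertex algebras.* $V$ carries a unique vertex algebra structure with vacuum $\mathbf 1=\mathbf 1^{\otimes4}$ and the above generating fields. For every $i$ and every open $W\subset U_i$, with $x=x^{(i)}$ and $\partial=\partial^{(i)}$, there is a unique vertex algebra structure on $V\otimes\mathcal O_X(W)$ with vacuum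 $\mathbf 1\otimes1$ such that the generating fields of $V$ are the fields of the corresponding elements of $V\otimes1$, acting on $V$ as before except that $v_p(0)=\partial_p$, and such that $$Y(\mathbf 1\otimes f,z)=\sum_{s\in\mathbb Z_+^N}\frac1{s!}\,\bar u(z)^s\otimes\partial^sf,\qquad \bar u_p(z)=\sum_{j\ne0}\frac1j u_p(-j)z^j .$$ For this structure: * $Y(a_{(-j-1)}w,z)=\,:\!\tfrac1{j!}\partial_z^{\,j}Y(a,z)\,Y(w,z)\!:$ for every generator $a$ of $V$, $j\ge0$ and $w\in V\otimes\mathcal O_X(W)$, where $:\!A(z)B(z)\!:\ =A(z)_-B(z)+B(z)A(z)_+$ with $A(z)_-=\sum_{n<0}A_{(n)}z^{-n-1}$ and $A(z)_+=\sum_{n\ge0}A_{(n)}z^{-n-1}$; * $D(\nu\otimes f)=D\nu\otimes f+\sum_pu_p(-1)\nu\otimes\partial_pf$ for $\nu\in V$, $f\in\mathcal O_X(W)$; * $\nu\mapsto\nu\otimes1$ is a homomorphism of vertex algebras $V\to V\otimes\mathcal O_X(W)$; * for open $W'\subset W$ the restriction map $V\otimes\mathcal O_X(W)\to V\otimes\mathcal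 O_X(W')$ is a homomorphism of vertex algebras. (b) *Gluing maps.* For all $i,j$ and every open $W\subset U_i\cap U_j$, write $x,\partial$ for the parameters and partial derivatives of $U_i$ and $\tilde x,\tilde\partial$ for those of $U_j$, and put tildes on the generators of the copy of $V\otimes\mathcal O_X(W)$ whose vertex algebra structure comes from $U_j$. There is a unique homomorphism of vertex algebras $\Phi_{ij}$ from $V\otimes\mathcal O_X(W)$ with the structure from $U_j$ to $V\otimes\mathcal O_X(W)$ with the structure from $U_i$ such that (sums over repeated indices) $$\begin{aligned} \Phi_{ij}(f)&=f\quad(f\in\mathcal O_X(W)),\\ \Phi_{ij}(\tilde u_a(-1)\mathbf 1)&=u_p(-1)\,\partial_p\tilde x_a,\\ \Phi_{ij}(\tilde v_a(-1)\mathbf 1)&=v_p(-1)\,\tilde\partial_ax_p+E_{sp}(-1)\,\partial_s\tilde\partial_ax_p,\\ \Phi_{ij}(\tilde E_{ab}(-1)\mathbf 1)&=E_{sp}(-1)\,(\partial_s\tilde x_a)(\tilde\partial_bx_p)+u_s(-1)\,\tilde\partial_b\partial_s\tilde x_a,\\ \Phi_{ij}(g(-1)\mathbf 1)&=g(-1)\mathbf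 1\quad(g\in\mathfrak g),\qquad \Phi_{ij}(\tilde\omega^{\mathrm{Vir}})=\omega^{\mathrm{Vir}}. \end{aligned}$$ Each $\Phi_{ij}$ is an isomorphism, the $\Phi_{ij}$ commute with restriction to smaller open sets, and $\Phi_{ij}\circ\Phi_{jk}=\Phi_{ik}$ over every open subset of $U_i\cap U_j\cap U_k$. (c) *The sheaf.* There is a sheaf $\mathcal V$ of vertex algebras on $X$ (a sheaf of vector spaces with vertex algebra structures on all $\mathcal V(W)$ for which the restriction maps are homomorphisms), together with isomorphisms of vertex algebras $\theta_i:\mathcal V(W)\to V\otimes\mathcal O_X(W)$ (with the structure from $U_i$) for all $i$ and all open $W\subset U_i$, compatible with restriction, such that $\theta_i=\Phi_{ij}\circ\theta_j$ over every open subset of $U_i\cap U_j$. If $(\mathcal V',\theta')$ is another such pair, there is a unique isomorphism $e:\mathcal V\to\mathcal V'$ of sheaves of vertex algebras with $\theta'_i\circ e=\theta_i$ for all $i$. -/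

import Mathlib

open CategoryTheory AlgebraicGeometry TopologicalSpace Opposite
open scoped TensorProduct KaehlerDifferential

noncomputable section
namespace VOASheaf

section Geometry
variable {X : Scheme.{0}}

/-- The ring `𝒪_X(U)` of regular functions on an open subset `U` of a scheme `X` over `ℂ`. -/
def Reg (_π : X ⟶ Spec (.of ℂ)) (U : X.Opens) : Type := Γ(X, U)

variable (π : X ⟶ Spec (.of ℂ))

instance (U : X.Opens) : CommRing (Reg π U) := inferInstanceAs (CommRing Γ(X, U))

/-- The constants `ℂ → 𝒪_X(U)` given by the structure morphism `X ⟶ Spec ℂ`. -/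
def Reg.const (U : X.Opens) : ℂ →+* Reg π U :=
  ((Scheme.ΓSpecIso (.of ℂ)).inv ≫ π.appTop ≫ X.presheaf.map (homOfLE le_top).op).hom

instance (U : X.Opens) : Algebra ℂ (Reg π U) := (Reg.const π U).toAlgebra

/-- Restriction of regular functions from `V` to `U ≤ V`. -/
def Reg.res {U V : X.Opens} (h : U ≤ V) : Reg π V →ₐ[ℂ] Reg π U where
  toRingHom := (X.presheaf.map (homOfLE h).op).hom
  commutes' r := by
    change (X.presheaf.map (homOfLE h).op).hom (((Scheme.ΓSpecIso (.of ℂ)).inv ≫ π.appTop ≫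
      X.presheaf.map (homOfLE le_top).op).hom r) = ((Scheme.ΓSpecIso (.of ℂ)).inv ≫ π.appTop ≫
      X.presheaf.map (homOfLE le_top).op).hom r
    rw [← CommRingCat.comp_apply, Category.assoc, Category.assoc, ← X.presheaf.map_comp]
    rfl

theorem Reg.res_res {U V W : X.Opens} (h : U ≤ V) (h' : V ≤ W) (f : Reg π W) :
    Reg.res π h (Reg.res π h' f) = Reg.res π (h.trans h') f := by
  have key : ∀ f : Γ(X, W), (X.presheaf.map (homOfLE h).op).hom
      ((X.presheaf.map (homOfLE h').op).hom f) =
      (X.presheaf.map (homOfLE (h.trans h')).op).hom f := fun f => by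
    rw [← CommRingCat.comp_apply, ← X.presheaf.map_comp]
    rfl
  exact key f

theorem Reg.ext_affine {W : X.Opens} {s t : Reg π W}
    (h : ∀ (A : X.Opens) (_ : IsAffineOpen A) (hAW : A ≤ W),
      Reg.res π hAW s = Reg.res π hAW t) : s = t := by
  let I := {A : X.Opens // IsAffineOpen A ∧ A ≤ W}
  refine X.sheaf.eq_of_locally_eq' (fun A : I => A.1) W (fun A => homOfLE A.2.2) ?_ s t
    (fun A => h A.1 A.2.1 A.2.2)
  intro x hx
  obtain ⟨_, ⟨A, hA, rfl⟩, hxA, hAW⟩ := X.isBasis_affineOpens.exists_subset_of_mem_open hx W.2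
  exact Opens.mem_iSup.2 ⟨(⟨A, hA, hAW⟩ : I), hxA⟩

theorem Reg.glue_affine {W : X.Opens}
    (s : ∀ A : X.Opens, IsAffineOpen A → A ≤ W → Reg π A)
    (h : ∀ (A B : X.Opens) (hA : IsAffineOpen A) (hB : IsAffineOpen B) (hBA : B ≤ A) (hAW : A ≤ W),
      Reg.res π hBA (s A hA hAW) = s B hB (hBA.trans hAW)) :
    ∃ t : Reg π W, ∀ (A : X.Opens) (hA : IsAffineOpen A) (hAW : A ≤ W),
      Reg.res π hAW t = s A hA hAW := by
  let I := {A : X.Opens // IsAffineOpen A ∧ A ≤ W}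
  obtain ⟨t, ht, -⟩ := X.sheaf.existsUnique_gluing' (fun A : I => A.1) W
    (fun A => homOfLE A.2.2) (fun x hx => by
      obtain ⟨_, ⟨A, hA, rfl⟩, hxA, hAW⟩ := X.isBasis_affineOpens.exists_subset_of_mem_open hx W.2
      exact Opens.mem_iSup.2 ⟨(⟨A, hA, hAW⟩ : I), hxA⟩)
    (fun A => s A.1 A.2.1 A.2.2) (fun A B => by
      refine Reg.ext_affine π (s := Reg.res π (inf_le_left : A.1 ⊓ B.1 ≤ A.1) (s A.1 A.2.1 A.2.2))
        (t := Reg.res π (inf_le_right : A.1 ⊓ B.1 ≤ B.1) (s B.1 B.2.1 B.2.2)) ?_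
      intro C hC hCW
      rw [Reg.res_res, Reg.res_res, h _ _ _ hC, h _ _ _ hC])
  exact ⟨t, fun A hA hAW => ht ⟨A, hA, hAW⟩⟩

/-- An affine open subset `U` of `X` with local (uniformizing) parameters `x_1, …, x_N`: regular
functions on `U` whose differentials form a basis of the `𝒪_X(U)`-module `Ω¹(U)`. -/
structure Chart (N : ℕ) where
  U : X.Opens
  isAffine : IsAffineOpen U
  x : Fin N → Reg π U
  linInd : LinearIndependent (Reg π U) fun p => KaehlerDifferential.D ℂ (Reg π U) (x p)
  span : Submodule.span (Reg π U) (Set.range fun p => KaehlerDifferential.D ℂ (Reg π U) (x p)) = ⊤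

variable {π} {N : ℕ} (κ : Chart π N)

/-- The local parameters of a chart, restricted to an open subset. -/
def Chart.param {W : X.Opens} (hW : W ≤ κ.U) (p : Fin N) : Reg π W := Reg.res π hW (κ.x p)

/-- The derivations `d_1, …, d_N` of `𝒪_X(W)` are the partial derivatives with respect to the local
parameters: `df = ∑_p d_p(f) dx_p` holds on every affine open subset of `W`. -/
def Chart.IsPartials {W : X.Opens} (hW : W ≤ κ.U)
    (d : Fin N → Derivation ℂ (Reg π W) (Reg π W)) : Prop :=
  ∀ (f : Reg π W) (A : X.Opens) (_ : IsAffineOpen A) (hAW : A ≤ W),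
    KaehlerDifferential.D ℂ (Reg π A) (Reg.res π hAW f) =
      ∑ p, Reg.res π hAW (d p f) • KaehlerDifferential.D ℂ (Reg π A) (κ.param (hAW.trans hW) p)

theorem Chart.exists_basis {A : X.Opens} (hA : IsAffineOpen A) (h : A ≤ κ.U) :
    ∃ b : Module.Basis (Fin N) (Reg π A) (Ω[Reg π A⁄ℂ]),
      ∀ p, b p = KaehlerDifferential.D ℂ (Reg π A) (κ.param h p) := by
  let _ : Algebra (Reg π κ.U) (Reg π A) := (Reg.res π h).toRingHom.toAlgebra
  have : IsScalarTower ℂ (Reg π κ.U) (Reg π A) :=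
    IsScalarTower.of_algebraMap_eq fun r => ((Reg.res π h).commutes r).symm
  have : Algebra.FormallyEtale (Reg π κ.U) (Reg π A) := by
    have := Scheme.Hom.etale_appLE (𝟙 X) κ.isAffine hA h
    rw [show (𝟙 X : X ⟶ X).appLE κ.U A h = X.presheaf.map (homOfLE h).op by
      simp only [Scheme.Hom.appLE, Scheme.Hom.id_app]; exact Category.id_comp _] at this
    have h2 : (algebraMap (Reg π κ.U) (Reg π A)).Etale := this
    rw [RingHom.etale_algebraMap] at h2
    infer_instance
  let b₀ : Module.Basis (Fin N) (Reg π κ.U) (Ω[Reg π κ.U⁄ℂ]) := Module.Basis.mk κ.linInd κ.span.ge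
  refine ⟨(Algebra.TensorProduct.basis (Reg π A) b₀).map
    (KaehlerDifferential.tensorKaehlerEquivOfFormallyEtale ℂ (Reg π κ.U) (Reg π A)), fun p => ?_⟩
  simp [b₀]
  rfl

theorem Chart.exists_partials {W : X.Opens} (hW : W ≤ κ.U) :
    ∃ d : Fin N → Derivation ℂ (Reg π W) (Reg π W), κ.IsPartials hW d := by
  have ex : ∀ f : Reg π W, ∃ g : Fin N → Reg π W, ∀ (A : X.Opens) (_ : IsAffineOpen A)
      (hAW : A ≤ W), KaehlerDifferential.D ℂ (Reg π A) (Reg.res π hAW f) =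
      ∑ p, Reg.res π hAW (g p) • KaehlerDifferential.D ℂ (Reg π A)
        (κ.param (hAW.trans hW) p) := by
    intro f
    choose b hb using fun (A : X.Opens) (hA : IsAffineOpen A) (h : A ≤ κ.U) =>
      κ.exists_basis hA h
    choose g hg using fun p : Fin N => Reg.glue_affine π (W := W)
      (fun A hA hAW => (b A hA (hAW.trans hW)).repr
        (KaehlerDifferential.D ℂ (Reg π A) (Reg.res π hAW f)) p) (by
      intro A B hA hB hBA hAW
      let _ : Algebra (Reg π A) (Reg π B) := (Reg.res π hBA).toRingHom.toAlgebra
      have : IsScalarTower ℂ (Reg π A) (Reg π B) :=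
        IsScalarTower.of_algebraMap_eq fun r => ((Reg.res π hBA).commutes r).symm
      have e := (b A hA (hAW.trans hW)).sum_repr
        (KaehlerDifferential.D ℂ (Reg π A) (Reg.res π hAW f))
      apply_fun KaehlerDifferential.map ℂ ℂ (Reg π A) (Reg π B) at e
      have hal : ∀ x, algebraMap (Reg π A) (Reg π B) x = Reg.res π hBA x := fun _ => rfl
      simp only [map_sum, map_smul, hb, KaehlerDifferential.map_D, hal, Chart.param,
        Reg.res_res] at e
      rw [← e, map_sum, Finset.sum_apply']
      have : ∀ i, KaehlerDifferential.D ℂ (Reg π B) (Reg.res π (hBA.trans (hAW.trans hW)) (κ.x i))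
        = b B hB (hBA.trans (hAW.trans hW)) i := fun i => (hb _ _ _ i).symm
      simp only [this, algebra_compatible_smul (Reg π B) (_ : Reg π A), hal, map_smul,
        Module.Basis.repr_self]
      simp [Finsupp.single_apply])
    refine ⟨g, fun A hA hAW => ?_⟩
    rw [← (b A hA (hAW.trans hW)).sum_repr (KaehlerDifferential.D ℂ (Reg π A) (Reg.res π hAW f))]
    exact Finset.sum_congr rfl fun p _ => by rw [hg p A hA hAW, hb]
  have uniq : ∀ g g' : Fin N → Reg π W, (∀ (A : X.Opens) (_ : IsAffineOpen A)
      (hAW : A ≤ W), ∑ p, Reg.res π hAW (g p) • KaehlerDifferential.D ℂ (Reg π A)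
        (κ.param (hAW.trans hW) p) = ∑ p, Reg.res π hAW (g' p) •
        KaehlerDifferential.D ℂ (Reg π A) (κ.param (hAW.trans hW) p)) → g = g' := by
    intro g g' h
    funext p
    refine Reg.ext_affine π fun A hA hAW => ?_
    obtain ⟨b, hb⟩ := κ.exists_basis hA (hAW.trans hW)
    have e := h A hA hAW
    simp only [← hb] at e
    have := congrArg (fun z => b.repr z p) e
    simpa [Finsupp.single_apply] using this
  choose g hg using ex
  refine ⟨fun p => Derivation.mk' ⟨⟨fun f => g f p, fun f f' => ?_⟩, fun r f => ?_⟩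
    (fun f f' => ?_), fun f A hA hAW => hg f A hA hAW⟩
  · refine congrFun (uniq (g (f + f')) (g f + g f') fun A hA hAW => ?_) p
    rw [← hg _ A hA, map_add, map_add, hg f A hA, hg f' A hA]
    simp [add_smul, Finset.sum_add_distrib]
  · refine congrFun (uniq (g (r • f)) (r • g f) fun A hA hAW => ?_) p
    rw [← hg _ A hA, map_smul, Derivation.map_smul, hg f A hA]
    simp [Finset.smul_sum]
  · refine congrFun (uniq (g (f * f')) (f • g f' + f' • g f) fun A hA hAW => ?_) p
    rw [← hg _ A hA, map_mul, Derivation.leibniz, hg f A hA, hg f' A hA]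
    simp [add_smul, Finset.sum_add_distrib, Finset.smul_sum, mul_smul]

/-- The partial derivative `∂_p = ∂/∂x_p` on `𝒪_X(W)` with respect to the local parameters of a
chart containing `W`. -/
def Chart.pd {W : X.Opens} (hW : W ≤ κ.U) (p : Fin N) : Derivation ℂ (Reg π W) (Reg π W) :=
  (κ.exists_partials hW).choose p

theorem Chart.pd_spec {W : X.Opens} (hW : W ≤ κ.U) : κ.IsPartials hW (κ.pd hW) :=
  (κ.exists_partials hW).choose_spec

end Geometry
section LieAlgebras

/-- A symmetric invariant bilinear form on a complex Lie algebra. -/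
structure InvForm (𝔞 : Type) [LieRing 𝔞] [LieAlgebra ℂ 𝔞] where
  form : LinearMap.BilinForm ℂ 𝔞
  symm : form.IsSymm
  inv : form.lieInvariant 𝔞

variable {𝔞 : Type} [LieRing 𝔞] [LieAlgebra ℂ 𝔞]

instance : Neg (InvForm 𝔞) where
  neg B := ⟨-B.form, ⟨fun x y => by simp [B.symm.eq x y]⟩, fun x y z => by simp [B.inv x y z]⟩

/-- The affine Lie algebra `ℂ[t,t⁻¹] ⊗ 𝔞 ⊕ ℂ C`, the central extension of the loop algebra with
`[tᵐ ⊗ a, tˢ ⊗ b] = tᵐ⁺ˢ ⊗ [a, b] + m δ_{m,-s} (a | b) C`, see `Affine.lie_mode_mode`. -/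
abbrev Affine (B : InvForm 𝔞) : Type :=
  LieAlgebra.ofTwoCocycle
    (LieAlgebra.LoopAlgebra.twoCocycleOfBilinear ℂ ℤ 𝔞 (-B).form (-B).inv (-B).symm)

/-- The element `a(m) = tᵐ ⊗ a` of the affine Lie algebra. -/
def Affine.mode (B : InvForm 𝔞) (a : 𝔞) (m : ℤ) : Affine B :=
  LieAlgebra.ofProd _ (AddMonoidAlgebra.single m (1 : ℂ) ⊗ₜ[ℂ] a, 0)

/-- The central element `C` of the affine Lie algebra. -/
def Affine.central (B : InvForm 𝔞) : Affine B :=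
  LieAlgebra.ofProd _ (0, (TrivialLieModule.equiv ℂ (LieAlgebra.loopAlgebra ℂ ℤ 𝔞) ℂ).symm 1)

theorem Affine.lie_mode_mode (B : InvForm 𝔞) (a b : 𝔞) (m s : ℤ) :
    ⁅Affine.mode B a m, Affine.mode B b s⁆ = Affine.mode B ⁅a, b⁆ (m + s) +
      (if m = -s then (m : ℂ) * B.form a b else 0) • Affine.central B := by
  refine congrArg (LieAlgebra.ofProd _) (Prod.ext ?_ ?_)
  · change ⁅AddMonoidAlgebra.single m (1 : ℂ) ⊗ₜ[ℂ] a, AddMonoidAlgebra.single s (1 : ℂ) ⊗ₜ[ℂ] b⁆ =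
      AddMonoidAlgebra.single (m + s) (1 : ℂ) ⊗ₜ[ℂ] ⁅a, b⁆ + _ • 0
    rw [LieAlgebra.ExtendScalars.bracket_tmul, AddMonoidAlgebra.single_mul_single, smul_zero,
      add_zero, one_mul]
  · change (TrivialLieModule.equiv ℂ (LieAlgebra.loopAlgebra ℂ ℤ 𝔞) ℂ).symm
      (LieAlgebra.LoopAlgebra.residuePairing ℂ ℤ 𝔞 (-B).form
        (AddMonoidAlgebra.single m (1 : ℂ) ⊗ₜ[ℂ] a) (AddMonoidAlgebra.single s (1 : ℂ) ⊗ₜ[ℂ] b)) + ⁅_, (0 : TrivialLieModule _ _ _)⁆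
        - ⁅_, (0 : TrivialLieModule _ _ _)⁆ = 0 + _ •
      (TrivialLieModule.equiv ℂ (LieAlgebra.loopAlgebra ℂ ℤ 𝔞) ℂ).symm 1
    rw [lie_zero, lie_zero, sub_zero, add_zero, zero_add, ← map_smul]
    congr 1
    have hB : (-B).form = -B.form := rfl
    simp only [LieAlgebra.LoopAlgebra.residuePairing_apply_apply,
      LieAlgebra.LoopAlgebra.toFinsupp_single_tmul, hB]
    rw [Finsupp.sum_single_index (by simp), Finsupp.single_apply]
    by_cases h : m = -s
    · subst h; simp
    · simp [h]

/-- The space underlying the Virasoro Lie algebra: finite linear combinations of the `L(m)`,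
`m ∈ ℤ`, plus multiples of the central element. -/
@[ext] structure Vir : Type where
  coeff : ℤ →₀ ℂ
  cen : ℂ

namespace Vir

def equivProd : Vir ≃ (ℤ →₀ ℂ) × ℂ where
  toFun x := (x.coeff, x.cen)
  invFun x := ⟨x.1, x.2⟩

instance : AddCommGroup Vir := equivProd.addCommGroup
instance : Module ℂ Vir := equivProd.module ℂ

@[simp] theorem coeff_add (x y : Vir) : (x + y).coeff = x.coeff + y.coeff := rfl
@[simp] theorem cen_add (x y : Vir) : (x + y).cen = x.cen + y.cen := rfl
@[simp] theorem coeff_smul (r : ℂ) (x : Vir) : (r • x).coeff = r • x.coeff := rfl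
@[simp] theorem cen_smul (r : ℂ) (x : Vir) : (r • x).cen = r • x.cen := rfl
@[simp] theorem coeff_zero : (0 : Vir).coeff = 0 := rfl
@[simp] theorem cen_zero : (0 : Vir).cen = 0 := rfl

/-- The bilinear map with `(L(m), L(s)) ↦ (m - s) L(m + s)`. -/
def wittBracket : (ℤ →₀ ℂ) →ₗ[ℂ] (ℤ →₀ ℂ) →ₗ[ℂ] (ℤ →₀ ℂ) :=
  Finsupp.lsum ℂ fun m => LinearMap.toSpanSingleton ℂ _
    (Finsupp.lsum ℂ fun s => ((m : ℂ) - s) • Finsupp.lsingle (m + s))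

/-- The bilinear form with `(L(m), L(s)) ↦ δ_{m,-s} (m³ - m) / 12`. -/
def cocycle : (ℤ →₀ ℂ) →ₗ[ℂ] (ℤ →₀ ℂ) →ₗ[ℂ] ℂ :=
  Finsupp.lsum ℂ fun m => LinearMap.toSpanSingleton ℂ _
    ((((m : ℂ) ^ 3 - m) / 12) • Finsupp.lapply (-m))

theorem wittBracket_single (m s : ℤ) (a b : ℂ) :
    wittBracket (Finsupp.single m a) (Finsupp.single s b) =
      Finsupp.single (m + s) (a * (((m : ℂ) - s) * b)) := by
  simp [wittBracket, -Finsupp.single_mul]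

theorem cocycle_single (m s : ℤ) (a b : ℂ) :
    cocycle (Finsupp.single m a) (Finsupp.single s b) =
      if m = -s then a * ((((m : ℂ) ^ 3 - m) / 12) * b) else 0 := by
  simp [cocycle, Finsupp.single_apply]
  grind

theorem wittBracket_skew (x y : ℤ →₀ ℂ) : wittBracket x y = - wittBracket y x := by
  induction x using Finsupp.induction_linear with
  | zero => simp
  | add x x' h h' => simp [h, h']; abel
  | single m a =>
    induction y using Finsupp.induction_linear with
    | zero => simp
    | add x x' h h' => simp [h, h']; abel
    | single s b =>
      rw [wittBracket_single, wittBracket_single, ← Finsupp.single_neg, add_comm m s]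
      congr 1; ring

theorem cocycle_skew (x y : ℤ →₀ ℂ) : cocycle x y = - cocycle y x := by
  induction x using Finsupp.induction_linear with
  | zero => simp
  | add x x' h h' => simp [h, h']; ring
  | single m a =>
    induction y using Finsupp.induction_linear with
    | zero => simp
    | add x x' h h' => simp [h, h']; ring
    | single s b =>
      rw [cocycle_single, cocycle_single]
      by_cases h : m = -s
      · subst h; simp; ring
      · rw [if_neg h, if_neg (by omega)]; simp

theorem wittBracket_jacobi (x y z : ℤ →₀ ℂ) : wittBracket x (wittBracket y z) =
    wittBracket (wittBracket x y) z + wittBracket y (wittBracket x z) := by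
  induction x using Finsupp.induction_linear with
  | zero => simp
  | add x x' h h' => simp only [map_add, LinearMap.add_apply, h, h']; abel
  | single m a =>
    induction y using Finsupp.induction_linear with
    | zero => simp
    | add x x' h h' => simp only [map_add, LinearMap.add_apply, h, h']; abel
    | single s b =>
      induction z using Finsupp.induction_linear with
      | zero => simp
      | add x x' h h' => simp only [map_add, h, h']; abel
      | single r c =>
        simp only [wittBracket_single]
        rw [show m + (s + r) = m + s + r by ring, show s + (m + r) = m + s + r by ring,
          ← Finsupp.single_add]
        congr 1; push_cast; ring

theorem cocycle_jacobi (x y z : ℤ →₀ ℂ) : cocycle x (wittBracket y z) =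
    cocycle (wittBracket x y) z + cocycle y (wittBracket x z) := by
  induction x using Finsupp.induction_linear with
  | zero => simp
  | add x x' h h' => simp only [map_add, LinearMap.add_apply, h, h']; abel
  | single m a =>
    induction y using Finsupp.induction_linear with
    | zero => simp
    | add x x' h h' => simp only [map_add, LinearMap.add_apply, h, h']; abel
    | single s b =>
      induction z using Finsupp.induction_linear with
      | zero => simp
      | add x x' h h' => simp only [map_add, h, h']; abel
      | single r c =>
        simp only [wittBracket_single, cocycle_single]
        by_cases h : m + s + r = 0
        · obtain rfl : m = -(s + r) := by omega
          rw [if_pos rfl, if_pos (by omega), if_pos (by omega)]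
          push_cast; ring
        · rw [if_neg (by omega), if_neg (by omega), if_neg (by omega)]; simp

/-- The Virasoro Lie algebra: `[L(m), L(s)] = (m - s) L(m + s) + δ_{m,-s} (m³ - m)/12 C`
and `C` is central. -/
instance : LieRing Vir where
  bracket x y := ⟨wittBracket x.coeff y.coeff, cocycle x.coeff y.coeff⟩
  add_lie x y z := by ext1 <;> simp
  lie_add x y z := by ext1 <;> simp
  lie_self x := by
    ext1
    · exact self_eq_neg.1 (wittBracket_skew _ _)
    · exact self_eq_neg.1 (cocycle_skew _ _)
  leibniz_lie x y z := Vir.ext (wittBracket_jacobi _ _ _) (cocycle_jacobi _ _ _)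

instance : LieAlgebra ℂ Vir where
  lie_smul r x y := Vir.ext (by simp [Bracket.bracket]) (by simp [Bracket.bracket])

/-- The basis element `L(m)` of the Virasoro algebra. -/
def L (m : ℤ) : Vir := ⟨Finsupp.single m 1, 0⟩

/-- The central element of the Virasoro algebra. -/
def central : Vir := ⟨0, 1⟩

theorem lie_L_L (m s : ℤ) : ⁅L m, L s⁆ = ((m : ℂ) - s) • L (m + s) +
    (if m = -s then ((m : ℂ) ^ 3 - m) / 12 else 0) • central := by
  refine Vir.ext ?_ ?_
  · simp [Bracket.bracket, L, central, wittBracket_single]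
    split_ifs <;> simp
  · simp [Bracket.bracket, L, central, cocycle_single]
    split_ifs <;> simp

end Vir

/-- The highest weight module `U(𝔩) ⊗_{U(𝔩₊ ⊕ ℂC)} ℂ 1` over a Lie algebra `𝔩`: it is generated by a
vector `1` which is annihilated by the subset `S` and on which `C` acts as the scalar `k`, and these
are its defining relations. -/
def Induced (𝔩 : Type) [LieRing 𝔩] [LieAlgebra ℂ 𝔩] (S : Set 𝔩) (C : 𝔩) (k : ℂ) : Type :=
  UniversalEnvelopingAlgebra ℂ 𝔩 ⧸ Ideal.span (UniversalEnvelopingAlgebra.ι ℂ '' S ∪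
    {UniversalEnvelopingAlgebra.ι ℂ C - algebraMap ℂ (UniversalEnvelopingAlgebra ℂ 𝔩) k})

namespace Induced
variable {𝔩 : Type} [LieRing 𝔩] [LieAlgebra ℂ 𝔩] {S : Set 𝔩} {C : 𝔩} {k : ℂ}

instance : AddCommGroup (Induced 𝔩 S C k) := inferInstanceAs (AddCommGroup (_ ⧸ _))
instance : Module (UniversalEnvelopingAlgebra ℂ 𝔩) (Induced 𝔩 S C k) :=
  inferInstanceAs (Module _ (_ ⧸ _))
instance : Module ℂ (Induced 𝔩 S C k) := inferInstanceAs (Module ℂ (_ ⧸ _))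
instance : IsScalarTower ℂ (UniversalEnvelopingAlgebra ℂ 𝔩) (Induced 𝔩 S C k) :=
  inferInstanceAs (IsScalarTower ℂ _ (_ ⧸ _))

/-- The highest weight vector. -/
def vac : Induced 𝔩 S C k := Submodule.Quotient.mk 1

/-- The action of a Lie algebra element. -/
def act (x : 𝔩) : Module.End ℂ (Induced 𝔩 S C k) :=
  Algebra.lsmul ℂ ℂ (Induced 𝔩 S C k) (UniversalEnvelopingAlgebra.ι ℂ x)

end Induced

/-- The universal enveloping vertex algebra of the affine Lie algebra of `𝔞` at level `k` (as a
vector space): `ℂ[t] ⊗ 𝔞` annihilates the vacuum vector and `C` acts as `k`. -/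
abbrev AffineVac (B : InvForm 𝔞) (k : ℂ) : Type :=
  Induced (Affine B) {x | ∃ (a : 𝔞) (m : ℤ), 0 ≤ m ∧ x = Affine.mode B a m} (Affine.central B) k

/-- The universal enveloping vertex algebra of the Virasoro Lie algebra with central charge `k` (as
a vector space): the `L(j)` with `j ≥ -1` annihilate the vacuum vector. -/
abbrev VirVac (k : ℂ) : Type :=
  Induced Vir {x | ∃ m : ℤ, -1 ≤ m ∧ x = Vir.L m} Vir.central k

end LieAlgebras
section VertexAlgebras

/-- A vertex algebra structure on a complex vector space `M`. The state-field correspondence is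
`Y(a,z) = ∑_n a_(n) z^{-n-1}`; here `Y a n` is the coefficient `a_(n)`. -/
@[ext] structure VertexAlgebra (M : Type) [AddCommGroup M] [Module ℂ M] where
  /-- the vacuum vector `1` -/
  vac : M
  /-- the infinitesimal translation -/
  D : Module.End ℂ M
  Y : M →ₗ[ℂ] (ℤ → Module.End ℂ M)
  truncation : ∀ a b : M, ∃ n₀ : ℤ, ∀ n : ℤ, n₀ ≤ n → Y a n b = 0
  /-- `[D, Y(a,z)] = d/dz Y(a,z)` -/
  translation : ∀ (a : M) (n : ℤ), D ∘ₗ Y a n - Y a n ∘ₗ D = -(n : ℂ) • Y a (n - 1)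
  /-- `Y(Da,z) = d/dz Y(a,z)` -/
  derivative : ∀ (a : M) (n : ℤ), Y (D a) n = -(n : ℂ) • Y a (n - 1)
  vacuum : ∀ n : ℤ, Y vac n = if n = -1 then LinearMap.id else 0
  replication_nonneg : ∀ (a : M) (n : ℤ), 0 ≤ n → Y a n vac = 0
  replication : ∀ a : M, Y a (-1) vac = a
  /-- `(z - w)ⁿ [Y(a,z), Y(b,w)] = 0` for `n` sufficiently large -/
  locality : ∀ a b : M, ∃ n₀ : ℕ, ∀ n : ℕ, n₀ ≤ n → ∀ k l : ℤ,
    ∑ i ∈ Finset.range (n + 1), ((-1 : ℂ) ^ i * (n.choose i : ℂ)) •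
      (Y a (k + n - i) ∘ₗ Y b (l + i) - Y b (l + i) ∘ₗ Y a (k + n - i)) = 0

/-- Homomorphisms of vertex algebras. -/
structure VertexAlgebra.IsHom {M M' : Type} [AddCommGroup M] [Module ℂ M] [AddCommGroup M']
    [Module ℂ M'] (A : VertexAlgebra M) (A' : VertexAlgebra M') (φ : M →ₗ[ℂ] M') : Prop where
  map_vac : φ A.vac = A'.vac
  map_Y : ∀ (a b : M) (n : ℤ), φ (A.Y a n b) = A'.Y (φ a) n (φ b)

/-- A sheaf of vertex algebras on a topological space: a sheaf of vector spaces with vertex algebra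
structures on the spaces of sections such that restrictions are homomorphisms. -/
structure VertexAlgebraSheaf (X : TopCat.{0}) where
  sheaf : TopCat.Sheaf (ModuleCat.{0} ℂ) X
  va : ∀ U : Opens X, VertexAlgebra (sheaf.presheaf.obj (op U))
  isHom_res : ∀ (U W : Opens X) (h : W ≤ U),
    (va U).IsHom (va W) (sheaf.presheaf.map (homOfLE h).op).hom

variable {M : Type} [AddCommGroup M] [Module ℂ M]

/-- The divided derivative `(1/j!) (d/dz)^j A(z)` of `A(z) = ∑_n A_(n) z^{-n-1}`. -/
def dividedDeriv (j : ℕ) (A : ℤ → Module.End ℂ M) : ℤ → Module.End ℂ M :=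
  fun n => ((-1 : ℂ) ^ j * ((Ring.choose n j : ℤ) : ℂ)) • A (n - j)

/-- The coefficients (at `z^{-n-1}`, applied to a vector) of the normally ordered product
`:A(z)B(z):  = A(z)₋ B(z) + B(z) A(z)₊`, where `A(z)₋ = ∑_{n<0} A_(n) z^{-n-1}` and
`A(z)₊ = ∑_{n≥0} A_(n) z^{-n-1}`. -/
def normalOrder (A B : ℤ → Module.End ℂ M) (n : ℤ) (w : M) : M :=
  ∑ᶠ k : ℕ, (A (-k - 1) (B (n + k) w) + B (n - k - 1) (A k w))

/-- The product `A(z) g(z)`, where `A(z) = ∑_m A_m z^m` has coefficients in `End M` and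
`g(z) = ∑_m g_m z^m` has coefficients in `M`. -/
def actSeries (A : ℤ → Module.End ℂ M) (g : ℤ → M) : ℤ → M :=
  fun n => ∑ᶠ m : ℤ, A m (g (n - m))

end VertexAlgebras

section TensorProductVOA

/-- The Fock space `ℂ[u_p(-j), v_p(-j)]`, `p = 1, …, N`, `j = 1, 2, …`. The variable
`Sum.inl (p, j)` is `u_p(-(j+1))`, and `Sum.inr (p, j)` is `v_p(-(j+1))`. -/
abbrev Fock (N : ℕ) : Type := MvPolynomial (Fin N × ℕ ⊕ Fin N × ℕ) ℂ

/-- The operator `u_p(m)` on the Fock space; `[u_p(m), v_q(s)] = m δ_{pq} δ_{m,-s}`. -/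
def Fock.u {N : ℕ} (p : Fin N) : ℤ → Module.End ℂ (Fock N)
  | Int.negSucc j => LinearMap.mulLeft ℂ (MvPolynomial.X (Sum.inl (p, j)))
  | Int.ofNat 0 => 0
  | Int.ofNat (j + 1) => ((j : ℂ) + 1) • (MvPolynomial.pderiv (Sum.inr (p, j))).toLinearMap

/-- The operator `v_p(m)` on the Fock space. -/
def Fock.v {N : ℕ} (p : Fin N) : ℤ → Module.End ℂ (Fock N)
  | Int.negSucc j => LinearMap.mulLeft ℂ (MvPolynomial.X (Sum.inr (p, j)))
  | Int.ofNat 0 => 0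
  | Int.ofNat (j + 1) => ((j : ℂ) + 1) • (MvPolynomial.pderiv (Sum.inl (p, j))).toLinearMap

section
attribute [local instance 100] LieRing.ofAssociativeRing

/-- The trace form `Tr(AB)` on `gl_N`. -/
def traceForm (N : ℕ) : InvForm (Matrix (Fin N) (Fin N) ℂ) where
  form := LinearMap.mk₂ ℂ (fun A B => (A * B).trace) (fun _ _ _ => by simp [add_mul])
    (fun _ _ _ => by simp) (fun _ _ _ => by simp [mul_add]) (fun _ _ _ => by simp)
  symm := ⟨fun A B => by simp [Matrix.trace_mul_comm A B]⟩
  inv A B C := by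
    simp only [LinearMap.mk₂_apply, LieRing.of_associative_ring_bracket, sub_mul, mul_sub,
      Matrix.trace_sub, mul_assoc]
    rw [Matrix.trace_mul_comm A (B * C), mul_assoc]
    ring

/-- The universal enveloping vertex algebra of affine `gl_N` at level `1` (as a vector space). -/
abbrev GlVac (N : ℕ) : Type := AffineVac (traceForm N) 1

/-- The operator `E_{ab}(m)`. -/
def GlVac.E {N : ℕ} (a b : Fin N) (m : ℤ) : Module.End ℂ (GlVac N) :=
  Induced.act (Affine.mode (traceForm N) (Matrix.single a b 1) m)

end

variable {𝔤 : Type} [LieRing 𝔤] [LieAlgebra ℂ 𝔤]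

/-- The space of the tensor product vertex algebra `V_Hei ⊗ V_gl_N ⊗ V_𝔤 ⊗ V_Vir`, where `V_𝔤` has
level `c` and `V_Vir` has central charge `k`. -/
abbrev VSpace (N : ℕ) (B : InvForm 𝔤) (c k : ℂ) : Type :=
  Fock N ⊗[ℂ] (GlVac N ⊗[ℂ] (AffineVac B c ⊗[ℂ] VirVac k))

/-- Labels of the generators `u_p(-1)1`, `v_p(-1)1`, `E_{ab}(-1)1`, `g(-1)1` (`g ∈ 𝔤`) and
`ω^Vir = L(-2)1` of the tensor product vertex algebra. -/
inductive Gen (N : ℕ) (𝔤 : Type) : Type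
  | u (p : Fin N)
  | v (p : Fin N)
  | E (a b : Fin N)
  | g (x : 𝔤)
  | vir

variable {N : ℕ} {B : InvForm 𝔤} {c k : ℂ}

/-- The vacuum vector of the tensor product. -/
def VSpace.vac : VSpace N B c k := 1 ⊗ₜ (Induced.vac ⊗ₜ (Induced.vac ⊗ₜ Induced.vac))

/-- The coefficient at `z^{-n-1}` of the generating field of a generator: `u_p(n)`, `v_p(n)`,
`E_{ab}(n)`, `g(n)`, and `L(n-1)`, acting in the corresponding tensor factor. -/
def VSpace.mode : Gen N 𝔤 → ℤ → Module.End ℂ (VSpace N B c k)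
  | .u p, n => LinearMap.rTensor _ (Fock.u p n)
  | .v p, n => LinearMap.rTensor _ (Fock.v p n)
  | .E a b, n => LinearMap.lTensor _ (LinearMap.rTensor _ (GlVac.E a b n))
  | .g x, n => LinearMap.lTensor _ (LinearMap.lTensor _ (LinearMap.rTensor _
      (Induced.act (Affine.mode B x n))))
  | .vir, n => LinearMap.lTensor _ (LinearMap.lTensor _ (LinearMap.lTensor _
      (Induced.act (Vir.L (n - 1)))))

/-- The generator with a given label, e.g. `u_p(-1)1` or `L(-2)1`. -/
def VSpace.state (a : Gen N 𝔤) : VSpace N B c k := VSpace.mode a (-1) VSpace.vac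

/-- The vertex algebra structure of the tensor product: the one with vacuum vector
`1 ⊗ 1 ⊗ 1 ⊗ 1` and with the given generating fields. -/
structure IsTensorStructure (A : VertexAlgebra (VSpace N B c k)) : Prop where
  vac : A.vac = VSpace.vac
  gen : ∀ (a : Gen N 𝔤) (n : ℤ), A.Y (VSpace.state a) n = VSpace.mode a n

end TensorProductVOA

section Local

variable {X : Scheme.{0}} {π : X ⟶ Spec (.of ℂ)} {N : ℕ}
  {𝔤 : Type} [LieRing 𝔤] [LieAlgebra ℂ 𝔤] {B : InvForm 𝔤} {c k : ℂ}

/-- The space `V ⊗ 𝒪_X(W)`. -/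
abbrev Loc (π : X ⟶ Spec (.of ℂ)) (N : ℕ) (B : InvForm 𝔤) (c k : ℂ) (W : X.Opens) : Type :=
  VSpace N B c k ⊗[ℂ] Reg π W

/-- The restriction map `V ⊗ 𝒪_X(W) → V ⊗ 𝒪_X(W')`. -/
def Loc.res {W W' : X.Opens} (h : W' ≤ W) : Loc π N B c k W →ₗ[ℂ] Loc π N B c k W' :=
  LinearMap.lTensor _ (Reg.res π h).toLinearMap

variable (κ : Chart π N) {W : X.Opens} (hW : W ≤ κ.U)

/-- The generating fields on `V ⊗ 𝒪_X(W)`, in the local parameters of a chart: the operators of `V`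
act in the first factor, except that `v_p(0) = ∂/∂x_p`. -/
def Loc.mode : Gen N 𝔤 → ℤ → Module.End ℂ (Loc π N B c k W)
  | .v p, n => if n = 0 then LinearMap.lTensor _ (κ.pd hW p).toLinearMap
      else LinearMap.rTensor _ (VSpace.mode (.v p) n)
  | a, n => LinearMap.rTensor _ (VSpace.mode a n)

/-- The coefficient at `z^n` of `ū_p(z) = ∑_{j ≠ 0} (1/j) u_p(-j) z^j`. -/
def Loc.ubar (p : Fin N) (n : ℤ) : Module.End ℂ (Loc π N B c k W) :=
  if n = 0 then 0 else (n : ℂ)⁻¹ • Loc.mode κ hW (.u p) (-n)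

/-- The series `ū(z)^s w = ū_1(z)^{s_1} ⋯ ū_N(z)^{s_N} w`. -/
def Loc.ubarPow (s : Fin N → ℕ) (w : Loc π N B c k W) : ℤ → Loc π N B c k W :=
  (List.finRange N).foldr (fun p g => (actSeries (Loc.ubar κ hW p))^[s p] g) (Pi.single 0 w)

/-- The iterated partial derivative `∂^s f = (∂_1)^{s_1} ⋯ (∂_N)^{s_N} f`. -/
def Chart.pdPow (s : Fin N → ℕ) (f : Reg π W) : Reg π W :=
  (List.finRange N).foldr (fun p g => (κ.pd hW p)^[s p] g) f

/-- The coefficient at `z^n` of `∑_{s ∈ ℤ₊^N} (1/s!) ū(z)^s ⊗ ∂^s f`, applied to `w`. -/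
def Loc.functionField (f : Reg π W) (n : ℤ) (w : Loc π N B c k W) : Loc π N B c k W :=
  ∑ᶠ s : Fin N → ℕ, (∏ p, ((s p).factorial : ℂ))⁻¹ •
    LinearMap.lTensor _ (LinearMap.mulLeft ℂ (κ.pdPow hW s f)) (Loc.ubarPow κ hW s w n)

/-- The element `ν ⊗ 1` for a generator `ν` of `V`. -/
def Loc.state (a : Gen N 𝔤) : Loc π N B c k W := VSpace.state a ⊗ₜ 1

/-- The vertex algebra structure on `V ⊗ 𝒪_X(W)` in the local parameters of a chart: the one with
vacuum vector `1 ⊗ 1`, with the given generating fields, and with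
`Y(1 ⊗ f, z) = ∑_s (1/s!) ū(z)^s ⊗ ∂^s f`. -/
structure IsLocalStructure (A : VertexAlgebra (Loc π N B c k W)) : Prop where
  vac : A.vac = VSpace.vac ⊗ₜ 1
  gen : ∀ (a : Gen N 𝔤) (n : ℤ), A.Y (Loc.state a) n = Loc.mode κ hW a n
  function : ∀ (f : Reg π W) (n : ℤ) (w : Loc π N B c k W),
    A.Y (VSpace.vac ⊗ₜ f) n w = Loc.functionField κ hW f (-n - 1) w

/-- The formulas for the gluing map from the local parameters `x̃` (chart `κ'`) to the local
parameters `x` (chart `κ`), on generators. -/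
structure IsGluing (κ κ' : Chart π N) {W : X.Opens} (h : W ≤ κ.U) (h' : W ≤ κ'.U)
    (Φ : Loc π N B c k W →ₗ[ℂ] Loc π N B c k W) : Prop where
  function : ∀ f : Reg π W, Φ (VSpace.vac ⊗ₜ f) = VSpace.vac ⊗ₜ f
  u : ∀ a, Φ (Loc.state (.u a)) = ∑ p, VSpace.state (.u p) ⊗ₜ κ.pd h p (κ'.param h' a)
  v : ∀ a, Φ (Loc.state (.v a)) = ∑ p, VSpace.state (.v p) ⊗ₜ κ'.pd h' a (κ.param h p) +
    ∑ s, ∑ p, VSpace.state (.E s p) ⊗ₜ κ.pd h s (κ'.pd h' a (κ.param h p))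
  E : ∀ a b, Φ (Loc.state (.E a b)) =
    ∑ s, ∑ p, VSpace.state (.E s p) ⊗ₜ (κ.pd h s (κ'.param h' a) * κ'.pd h' b (κ.param h p)) +
    ∑ s, VSpace.state (.u s) ⊗ₜ κ'.pd h' b (κ.pd h s (κ'.param h' a))
  g : ∀ x : 𝔤, Φ (Loc.state (.g x)) = Loc.state (.g x)
  vir : Φ (Loc.state .vir) = Loc.state .vir

/-- The sheaf `𝒱` of vertex algebras is obtained from the local vertex algebras `V ⊗ 𝒪_X(W)`, for
`W` contained in some `U_i`, by means of the gluing maps `Φ_ij`: there are isomorphisms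
`θ_i : 𝒱(W) → V ⊗ 𝒪_X(W)`, compatible with restriction, such that `θ_i = Φ_ij ∘ θ_j`. -/
structure IsGlued {ι : Type} (U : ι → X.Opens)
    (A : ∀ (i : ι) (W : X.Opens), W ≤ U i → VertexAlgebra (Loc π N B c k W))
    (Φ : ∀ (i j : ι) (W : X.Opens), W ≤ U i → W ≤ U j →
      (Loc π N B c k W ≃ₗ[ℂ] Loc π N B c k W))
    (𝒱 : VertexAlgebraSheaf X)
    (θ : ∀ (i : ι) (W : X.Opens), W ≤ U i →
      (𝒱.sheaf.presheaf.obj (op W) ≃ₗ[ℂ] Loc π N B c k W)) : Prop where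
  isHom : ∀ i W (h : W ≤ U i), (𝒱.va W).IsHom (A i W h) (θ i W h).toLinearMap
  res : ∀ i W W' (h : W ≤ U i) (h' : W' ≤ W) (a : 𝒱.sheaf.presheaf.obj (op W)),
    θ i W' (h'.trans h) ((𝒱.sheaf.presheaf.map (homOfLE h').op).hom a) = Loc.res h' (θ i W h a)
  glue : ∀ i j W (hi : W ≤ U i) (hj : W ≤ U j) (a : 𝒱.sheaf.presheaf.obj (op W)),
    θ i W hi a = Φ i j W hi hj (θ j W hj a)

end Local

end VOASheaf
end

/-!
The theorem is an application of three tools for vertex algebras, none of which is in Mathlib.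

* *Existence.* Mutually local, translation covariant fields that generate a space from the vacuum
  vector are the generating fields of a vertex algebra (`VField.exists_vertexAlgebra`). The fields
  of all states are products of the given ones; they are local by Dong's lemma (`VField.dong`), and
  well defined by Goddard's uniqueness theorem (`VField.Covariant.ext_of_local`). The products are
  residues of formal distributions in two variables, `residueProd`; their calculus also gives the
  commutator formula and the formula for the fields of `a_(n)b`.
* *The algebra `V ⊗ R`.* For a ring `R` with commuting derivations `d_1, …, d_N`, the commutation
  relations of the generating fields of `V ⊗ R` are the ones of `V`. The field of a function `f` is
  `exp(∑ ū_p(z) d_p) f`. An operator whose commutators with the `ū_p(z)` are known acts on this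
  exponential like a derivation (`map_expField`); this gives `[v_p(m), f_(n)] = (d_p f)_(m+n)` and
  translation covariance, hence the vertex algebra (`LocalModel.exists_vertexAlgebra`).
* *The universal property of `V ⊗ R`.* Call functions and states in a vertex algebra a
  `Realization` if they have the operator products of `1 ⊗ R` and of the generators of `V`. As `V`
  is induced from a one-dimensional representation in each of its factors, `V ⊗ R` is freely
  generated by `1 ⊗ R` subject to linear relations, so a realization gives a linear map
  (`Realization.exists_linearMap`). It intertwines the fields of the generators by construction, and
  the ones of the functions as these are determined by their commutators and by
  `D f = ∑ u_p(-1) d_p f` (`Realization.isHom`).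

In these terms the gluing maps exist because the images of the generators prescribed by the formulas
for `Φ_ij` form a realization for the partial derivatives with respect to the other parameters
(`Realization.changeCoordinates`). This is a computation with products of the states
`∑ u_p(-1) ω_p`, `∑ v_p(-1) τ_p` and `∑ E_{ab}(-1) X_{ab}` of one-forms, vector fields and matrices
of functions. The formulas for `ũ_a` and `Ẽ_ab` attach states to the exact one-form `dx̃_a`, and to
this form together with the vector field `∂̃_b`; the one for `ṽ_a` attaches to the vector field
`∂̃_a = ∑ τ_p ∂_p` the state `∑ v_p(-1) τ_p + ∑ E_{sp}(-1) ∂_s τ_p`. Vector fields which commute have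
commuting states: the double contraction `∑ ∂_s τ_p ∂_p σ_s` from the product of the `v_p(-1) τ_p`
is cancelled by the trace form of `gl_N`, at level `1` exactly. The generators from `𝔤` and the
Virasoro algebra are unchanged, and their fields commute with the others.

A homomorphism from `V ⊗ R` is determined by its values on functions and generators, so
`Φ_ij ∘ Φ_jk = Φ_ik` is the transitivity of the formulas (`Realization.newState_newState`), which is
the chain rule and its derivative; bijectivity is the case `k = i`. Compatibility with restriction is
naturality in `R`.

Finally, `X` is a Noetherian space, so `V ⊗ 𝒪` is a sheaf even though `V` has infinite dimension
(`tensorReg_glue`). The sections over `W` of the glued sheaf are the families of elements of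
`V ⊗ 𝒪(W ∩ U_i)` which correspond to each other under the gluing maps; as the index set is finite,
the product of the vertex algebras over the `W ∩ U_i` is again a vertex algebra, and the families
form a subalgebra of it (`GluingDatum.va`).
-/

noncomputable section
namespace VOASheaf

/-! ### Residue products of formal distributions -/

section FormalSeries
variable {G H : Type*} [AddCommGroup G] [AddCommGroup H]

/-- Multiplication of a formal distribution `F(z,w) = ∑ F_{ij} z^{-i-1} w^{-j-1}` by `z - w`. -/
def shiftDiff (F : ℤ → ℤ → G) : ℤ → ℤ → G := fun i j => F (i + 1) j - F i (j + 1)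

theorem shiftDiff_iterate_zero (n : ℕ) : shiftDiff^[n] (fun _ _ => (0 : G)) = fun _ _ => 0 := by
  induction n with
  | zero => rfl
  | succ n ih =>
    rw [Function.iterate_succ_apply]
    convert ih using 2
    funext i j
    simp [shiftDiff]

theorem shiftDiff_iterate_add (n : ℕ) (F F' : ℤ → ℤ → G) :
    shiftDiff^[n] (fun i j => F i j + F' i j) =
      fun i j => shiftDiff^[n] F i j + shiftDiff^[n] F' i j := by
  induction n generalizing F F' with
  | zero => rfl
  | succ n ih =>
    simp only [Function.iterate_succ_apply]
    rw [← ih]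
    congr 1
    funext i j
    simp only [shiftDiff]
    abel

theorem shiftDiff_iterate_sub (n : ℕ) (F F' : ℤ → ℤ → G) :
    shiftDiff^[n] (fun i j => F i j - F' i j) =
      fun i j => shiftDiff^[n] F i j - shiftDiff^[n] F' i j := by
  induction n generalizing F F' with
  | zero => rfl
  | succ n ih =>
    simp only [Function.iterate_succ_apply]
    rw [← ih]
    congr 1
    funext i j
    simp only [shiftDiff]
    abel

theorem shiftDiff_iterate_map (φ : G →+ H) (n : ℕ) (F : ℤ → ℤ → G) (i j : ℤ) :
    shiftDiff^[n] (fun i j => φ (F i j)) i j = φ (shiftDiff^[n] F i j) := by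
  induction n generalizing F with
  | zero => rfl
  | succ n ih =>
    simp only [Function.iterate_succ_apply]
    have : (shiftDiff fun i j => φ (F i j)) = fun i j => φ (shiftDiff F i j) := by
      funext i j
      simp [shiftDiff]
    rw [this, ih]

/-- If `(z - w)ⁿ` kills `F`, so do all higher powers. -/
theorem shiftDiff_iterate_mono {n n' : ℕ} (h : n ≤ n') {F : ℤ → ℤ → G}
    (hF : shiftDiff^[n] F = fun _ _ => 0) : shiftDiff^[n'] F = fun _ _ => 0 := by
  obtain ⟨k, rfl⟩ := Nat.exists_eq_add_of_le h
  rw [add_comm, Function.iterate_add_apply, hF, shiftDiff_iterate_zero]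

/-- Exchanging the roles of the two variables. -/
theorem shiftDiff_iterate_swap (n : ℕ) (F : ℤ → ℤ → G) (i j : ℤ) :
    shiftDiff^[n] (fun i j => F j i) i j = (-1 : ℤ) ^ n • shiftDiff^[n] F j i := by
  induction n generalizing F with
  | zero => simp
  | succ n ih =>
    simp only [Function.iterate_succ_apply]
    have : (shiftDiff fun i j => F j i) = fun i j => (fun i j => -(shiftDiff F i j)) j i := by
      funext i j
      simp [shiftDiff]
    rw [this, ih]
    have := shiftDiff_iterate_map (-AddMonoidHom.id G) n (shiftDiff F) j i
    simp only [AddMonoidHom.neg_apply, AddMonoidHom.id_apply] at this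
    rw [this, pow_succ]
    simp

theorem sum_range_pascal (c : ℕ → ℕ → ℤ) (hc : ∀ n i, c (n + 1) (i + 1) = c n (i + 1) - c n i)
    (h0 : ∀ n, c n 0 = 1) (hz : ∀ n, c n (n + 1) = 0) (n : ℕ) (g : ℕ → G) :
    ∑ i ∈ Finset.range (n + 2), c (n + 1) i • g i =
      ∑ i ∈ Finset.range (n + 1), c n i • (g i - g (i + 1)) := by
  rw [Finset.sum_range_succ']
  simp only [hc, sub_smul, smul_sub, Finset.sum_sub_distrib, h0]
  rw [Finset.sum_range_succ (fun i => c n (i + 1) • g (i + 1)), hz,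
    Finset.sum_range_succ' (fun i => c n i • g i), h0]
  simp only [zero_smul]
  abel

/-- The binomial expansion of `(z - w)ⁿ F(z,w)`. -/
theorem shiftDiff_iterate_eq_sum (n : ℕ) (F : ℤ → ℤ → G) (k l : ℤ) :
    shiftDiff^[n] F k l = ∑ i ∈ Finset.range (n + 1),
      ((-1 : ℤ) ^ i * (n.choose i : ℤ)) • F (k + n - i) (l + i) := by
  induction n generalizing F with
  | zero => simp
  | succ n ih =>
    rw [Function.iterate_succ_apply, ih, sum_range_pascal (fun n i => (-1 : ℤ) ^ i * (n.choose i))]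
    · refine Finset.sum_congr rfl fun i _ => ?_
      simp only [shiftDiff]
      congr 3 <;> push_cast <;> ring
    · intro n i
      simp only [Nat.choose_succ_succ]
      push_cast
      ring
    · simp
    · simp

/-- The coefficient `(-1)^i (n choose i)` of `z^{n-i} w^i` in the expansion of `(z - w)^n`. -/
def sgnChoose (n : ℤ) (i : ℕ) : ℤ := (-1) ^ i * Ring.choose n i

theorem sgnChoose_zero_right (n : ℤ) : sgnChoose n 0 = 1 := by simp [sgnChoose]

theorem sgnChoose_zero_succ (i : ℕ) : sgnChoose 0 (i + 1) = 0 := by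
  simp [sgnChoose, Ring.choose_zero_succ]

theorem sgnChoose_succ_succ (n : ℤ) (i : ℕ) :
    sgnChoose (n + 1) (i + 1) = sgnChoose n (i + 1) - sgnChoose n i := by
  simp only [sgnChoose, Ring.choose_succ_succ]
  ring

theorem choose_mul_succ (n : ℤ) (i : ℕ) :
    ((i : ℤ) + 1) * Ring.choose n (i + 1) = (n - i) * Ring.choose n i := by
  have h1 := Ring.descPochhammer_eq_factorial_smul_choose n (i + 1)
  have h2 := Ring.descPochhammer_eq_factorial_smul_choose n i
  rw [descPochhammer_succ_right, Polynomial.smeval_mul, h2] at h1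
  simp [Nat.factorial_succ, Polynomial.smeval_sub, Polynomial.smeval_natCast] at h1
  have h3 : ((i.factorial : ℕ) : ℤ) ≠ 0 := by exact_mod_cast i.factorial_ne_zero
  apply mul_left_cancel₀ h3
  linear_combination -h1

theorem sgnChoose_mul_succ (n : ℤ) (i : ℕ) :
    ((i : ℤ) + 1) * sgnChoose n (i + 1) = (i - n) * sgnChoose n i := by
  simp only [sgnChoose]
  linear_combination (-1) ^ (i + 1) * choose_mul_succ n i

theorem sgnChoose_neg_one (i : ℕ) : sgnChoose (-1) i = 1 := by
  induction i with
  | zero => exact sgnChoose_zero_right _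
  | succ i ih =>
    have := sgnChoose_mul_succ (-1) i
    rw [ih] at this
    have h : (i : ℤ) + 1 ≠ 0 := by omega
    apply mul_left_cancel₀ h
    rw [this]; ring

/-- The residue in `z` of `ι_{z,w}(z-w)^n P(z,w) - ι_{w,z}(z-w)^n Q(z,w)`, where `ι_{z,w}` and
`ι_{w,z}` are the expansions in the domains `|z| > |w|` and `|w| > |z|`. For `P = a(z)b(w)x` and
`Q = b(w)a(z)x` this is the `n`-th product of the fields `a` and `b`, applied to `x`. -/
def residueProd (P Q : ℤ → ℤ → G) (n m : ℤ) : G :=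
  ∑ᶠ i : ℕ, sgnChoose n i • (P (n - i) (m + i) - (n.negOnePow : ℤ) • Q i (n + m - i))

/-- The condition that makes the sums in `residueProd` finite. -/
def ResidueBdd (P Q : ℤ → ℤ → G) : Prop :=
  ∃ K : ℤ, ∀ j, K ≤ j → ∀ i, P i j = 0 ∧ Q j i = 0

theorem residueProd_eq_sum {P Q : ℤ → ℤ → G} {K : ℤ} (h : ∀ j, K ≤ j → ∀ i, P i j = 0 ∧ Q j i = 0)
    (n m : ℤ) (L : ℕ) (hL : K ≤ L) (hL' : K ≤ m + L) :
    residueProd P Q n m = ∑ i ∈ Finset.range L,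
      sgnChoose n i • (P (n - i) (m + i) - (n.negOnePow : ℤ) • Q i (n + m - i)) := by
  refine finsum_eq_sum_of_support_subset _ fun i hi => ?_
  by_contra hiL
  simp only [Finset.coe_range, Set.mem_Iio, not_lt] at hiL
  refine hi ?_
  dsimp only
  rw [(h (m + i) (by omega) _).1, (h i (by omega) _).2]
  simp

theorem ResidueBdd.shiftDiff {P Q : ℤ → ℤ → G} (h : ResidueBdd P Q) :
    ResidueBdd (shiftDiff P) (shiftDiff Q) := by
  obtain ⟨K, h⟩ := h
  refine ⟨K, fun j hj i => ?_⟩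
  simp only [VOASheaf.shiftDiff]
  rw [(h j hj _).1, (h (j + 1) (by omega) _).1, (h j hj _).2, (h (j + 1) (by omega) _).2]
  simp

theorem ResidueBdd.sub {P Q P' Q' : ℤ → ℤ → G} (h : ResidueBdd P Q) (h' : ResidueBdd P' Q') :
    ResidueBdd (fun i j => P i j - P' i j) (fun i j => Q i j - Q' i j) := by
  obtain ⟨K, h⟩ := h
  obtain ⟨K', h'⟩ := h'
  refine ⟨max K K', fun j hj i => ?_⟩
  dsimp only
  rw [(h j (by omega) _).1, (h' j (by omega) _).1, (h j (by omega) _).2, (h' j (by omega) _).2]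
  simp

theorem ResidueBdd.add {P Q P' Q' : ℤ → ℤ → G} (h : ResidueBdd P Q) (h' : ResidueBdd P' Q') :
    ResidueBdd (fun i j => P i j + P' i j) (fun i j => Q i j + Q' i j) := by
  obtain ⟨K, h⟩ := h
  obtain ⟨K', h'⟩ := h'
  refine ⟨max K K', fun j hj i => ?_⟩
  dsimp only
  rw [(h j (by omega) _).1, (h' j (by omega) _).1, (h j (by omega) _).2, (h' j (by omega) _).2]
  simp

theorem ResidueBdd.map (φ : G →+ H) {P Q : ℤ → ℤ → G} (h : ResidueBdd P Q) :
    ResidueBdd (fun i j => φ (P i j)) (fun i j => φ (Q i j)) := by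
  obtain ⟨K, h⟩ := h
  refine ⟨K, fun j hj i => ?_⟩
  dsimp only
  rw [(h j hj _).1, (h j hj _).2]
  simp

theorem residueProd_map (φ : G →+ H) {P Q : ℤ → ℤ → G} (h : ResidueBdd P Q) (n m : ℤ) :
    residueProd (fun i j => φ (P i j)) (fun i j => φ (Q i j)) n m = φ (residueProd P Q n m) := by
  obtain ⟨K, h⟩ := h
  have h' : ∀ j, K ≤ j → ∀ i, φ (P i j) = 0 ∧ φ (Q j i) = 0 := fun j hj i => by
    rw [(h j hj _).1, (h j hj _).2]
    simp
  obtain ⟨L, hL⟩ : ∃ L : ℕ, K ≤ L ∧ K ≤ m + L := ⟨(K.toNat + (K - m).toNat), by omega, by omega⟩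
  rw [residueProd_eq_sum h n m L hL.1 hL.2, residueProd_eq_sum h' n m L hL.1 hL.2]
  simp

theorem residueProd_sub {P Q P' Q' : ℤ → ℤ → G} (h : ResidueBdd P Q) (h' : ResidueBdd P' Q')
    (n m : ℤ) : residueProd (fun i j => P i j - P' i j) (fun i j => Q i j - Q' i j) n m =
      residueProd P Q n m - residueProd P' Q' n m := by
  obtain ⟨K₂, hs⟩ := h.sub h'
  obtain ⟨K, h⟩ := h
  obtain ⟨K', h'⟩ := h'
  obtain ⟨L, hL⟩ : ∃ L : ℕ, K ≤ L ∧ K ≤ m + L ∧ K' ≤ L ∧ K' ≤ m + L ∧ K₂ ≤ L ∧ K₂ ≤ m + L :=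
    ⟨(K.toNat + (K - m).toNat + K'.toNat + (K' - m).toNat + K₂.toNat + (K₂ - m).toNat),
      by omega, by omega, by omega, by omega, by omega, by omega⟩
  rw [residueProd_eq_sum h n m L (by omega) (by omega),
    residueProd_eq_sum h' n m L (by omega) (by omega),
    residueProd_eq_sum hs n m L (by omega) (by omega), ← Finset.sum_sub_distrib]
  refine Finset.sum_congr rfl fun i _ => ?_
  module

theorem residueProd_add {P Q P' Q' : ℤ → ℤ → G} (h : ResidueBdd P Q) (h' : ResidueBdd P' Q')
    (n m : ℤ) : residueProd (fun i j => P i j + P' i j) (fun i j => Q i j + Q' i j) n m =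
      residueProd P Q n m + residueProd P' Q' n m := by
  obtain ⟨K₂, hs⟩ := h.add h'
  obtain ⟨K, h⟩ := h
  obtain ⟨K', h'⟩ := h'
  obtain ⟨L, hL⟩ : ∃ L : ℕ, K ≤ L ∧ K ≤ m + L ∧ K' ≤ L ∧ K' ≤ m + L ∧ K₂ ≤ L ∧ K₂ ≤ m + L :=
    ⟨(K.toNat + (K - m).toNat + K'.toNat + (K' - m).toNat + K₂.toNat + (K₂ - m).toNat),
      by omega, by omega, by omega, by omega, by omega, by omega⟩
  rw [residueProd_eq_sum h n m L (by omega) (by omega),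
    residueProd_eq_sum h' n m L (by omega) (by omega),
    residueProd_eq_sum hs n m L (by omega) (by omega), ← Finset.sum_add_distrib]
  refine Finset.sum_congr rfl fun i _ => ?_
  module

theorem residueProd_zero_left (G : Type*) [AddCommGroup G] (n m : ℤ) :
    residueProd (fun _ _ => (0 : G)) (fun _ _ => 0) n m = 0 := by
  simp [residueProd]

/-- Multiplication of `P` and `Q` by `z - w` raises the index of the product by one. -/
theorem residueProd_shiftDiff {P Q : ℤ → ℤ → G} (h : ResidueBdd P Q) (n m : ℤ) :
    residueProd (shiftDiff P) (shiftDiff Q) n m = residueProd P Q (n + 1) m := by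
  obtain ⟨K', hs⟩ := h.shiftDiff
  obtain ⟨K, h⟩ := h
  obtain ⟨L, hL⟩ : ∃ L : ℕ, K ≤ L ∧ K ≤ m + L ∧ K' ≤ L ∧ K' ≤ m + L :=
    ⟨(K.toNat + (K - m).toNat + K'.toNat + (K' - m).toNat), by omega, by omega, by omega, by omega⟩
  rw [residueProd_eq_sum h (n + 1) m (L + 1) (by omega) (by omega),
    residueProd_eq_sum hs n m L (by omega) (by omega)]
  have tel : ∀ k : ℕ, ∑ i ∈ Finset.range k, sgnChoose n i •
        (shiftDiff P (n - i) (m + i) - (n.negOnePow : ℤ) • shiftDiff Q i (n + m - i)) =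
      (∑ i ∈ Finset.range (k + 1), sgnChoose (n + 1) i • (P (n + 1 - i) (m + i) -
        ((n + 1).negOnePow : ℤ) • Q i (n + 1 + m - i))) - sgnChoose n k • (P (n + 1 - k) (m + k) -
        ((n + 1).negOnePow : ℤ) • Q k (n + 1 + m - k)) := by
    intro k
    induction k with
    | zero => simp [sgnChoose_zero_right]
    | succ k ih =>
      rw [Finset.sum_range_succ, ih, Finset.sum_range_succ _ (k + 1), sgnChoose_succ_succ]
      simp only [shiftDiff, Int.negOnePow_succ]
      push_cast
      rw [show n - (k : ℤ) + 1 = n + 1 - k by ring, show n + 1 - ((k : ℤ) + 1) = n - k by ring,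
        show m + ((k : ℤ) + 1) = m + k + 1 by ring, show n + m - k + 1 = n + 1 + m - k by ring,
        show n + 1 + m - ((k : ℤ) + 1) = n + m - k by ring]
      module
  rw [tel, (h (m + L) (by omega) _).1, (h L (by omega) _).2]
  simp

theorem residueProd_shiftDiff_iterate {P Q : ℤ → ℤ → G} (h : ResidueBdd P Q) (N : ℕ) (n m : ℤ) :
    residueProd (shiftDiff^[N] P) (shiftDiff^[N] Q) n m = residueProd P Q (n + N) m := by
  induction N generalizing P Q n with
  | zero => simp
  | succ N ih =>
    rw [Function.iterate_succ_apply, Function.iterate_succ_apply, ih h.shiftDiff,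
      residueProd_shiftDiff h]
    congr 1
    push_cast
    ring

theorem residueProd_zero (P Q : ℤ → ℤ → G) (m : ℤ) :
    residueProd P Q 0 m = P 0 m - Q 0 m := by
  rw [residueProd, finsum_eq_single _ 0]
  · simp [sgnChoose_zero_right]
  · intro i hi
    obtain ⟨i, rfl⟩ := Nat.exists_eq_succ_of_ne_zero hi
    rw [Nat.succ_eq_add_one, sgnChoose_zero_succ, zero_smul]

/-- For `n ≥ 0` the product only depends on `P - Q`. -/
theorem residueProd_natCast {P Q : ℤ → ℤ → G} (h : ResidueBdd P Q) (n : ℕ) (m : ℤ) :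
    residueProd P Q n m = shiftDiff^[n] (fun i j => P i j - Q i j) 0 m := by
  have := residueProd_shiftDiff_iterate h n 0 m
  rw [zero_add] at this
  rw [← this, residueProd_zero, shiftDiff_iterate_sub]

/-- The derivative `∂_w` of a residue product is the residue product of the sum of the derivatives
`∂_z` and `∂_w`. -/
theorem residueProd_translation {P Q : ℤ → ℤ → G} (h : ResidueBdd P Q) (n m : ℤ) :
    residueProd (fun i j => -i • P (i - 1) j + -j • P i (j - 1))
      (fun i j => -i • Q (i - 1) j + -j • Q i (j - 1)) n m = -m • residueProd P Q n (m - 1) := by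
  obtain ⟨K, h⟩ := h
  have hs : ∀ j, K + 1 ≤ j → ∀ i, (-i • P (i - 1) j + -j • P i (j - 1)) = 0 ∧
      (-j • Q (j - 1) i + -i • Q j (i - 1)) = 0 := fun j hj i => by
    rw [(h j (by omega) _).1, (h (j - 1) (by omega) _).1, (h (j - 1) (by omega) _).2,
      (h j (by omega) _).2]
    simp
  obtain ⟨L, hL⟩ : ∃ L : ℕ, K + 1 ≤ L ∧ K + 1 ≤ m + L :=
    ⟨((K + 1).toNat + (K + 1 - m).toNat), by omega, by omega⟩
  rw [residueProd_eq_sum hs n m L (by omega) (by omega),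
    residueProd_eq_sum h n (m - 1) L (by omega) (by omega)]
  have tel : ∀ k : ℕ, ∑ i ∈ Finset.range k, sgnChoose n i •
        ((-(n - i) • P (n - i - 1) (m + i) + -(m + i) • P (n - i) (m + i - 1)) -
          (n.negOnePow : ℤ) • (-(i : ℤ) • Q (i - 1) (n + m - i) + -(n + m - i) • Q i (n + m - i - 1))) =
      -m • (∑ i ∈ Finset.range k, sgnChoose n i • (P (n - i) (m - 1 + i) -
        (n.negOnePow : ℤ) • Q i (n + (m - 1) - i))) + ((k : ℤ) * sgnChoose n k) •
        (P (n - k) (m + k - 1) - (n.negOnePow : ℤ) • Q (k - 1) (n + m - k)) := by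
    intro k
    induction k with
    | zero => simp
    | succ k ih =>
      rw [Finset.sum_range_succ, ih, Finset.sum_range_succ, smul_add]
      push_cast
      rw [sgnChoose_mul_succ, show n - ((k : ℤ) + 1) = n - k - 1 by ring,
        show m + ((k : ℤ) + 1) - 1 = m + k by ring, show (k : ℤ) + 1 - 1 = k by ring,
        show n + m - ((k : ℤ) + 1) = n + m - k - 1 by ring,
        show m - 1 + (k : ℤ) = m + k - 1 by ring,
        show n + (m - 1) - (k : ℤ) = n + m - k - 1 by ring]
      module
  rw [tel, (h (m + L - 1) (by omega) _).1, (h (L - 1) (by omega) _).2]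
  simp

/-- A formal distribution killed by a power of `z - w` is determined by its `(z-w)^j`-moments. -/
theorem eq_sum_of_shiftDiff_iterate_eq_zero (N : ℕ) (F : ℤ → ℤ → G)
    (hF : shiftDiff^[N] F = fun _ _ => 0) (m n : ℤ) :
    F m n = ∑ j ∈ Finset.range N, Ring.choose m j • shiftDiff^[j] F 0 (m + n - j) := by
  induction N generalizing F m n with
  | zero => simpa using congrFun (congrFun hF m) n
  | succ N ih =>
    rw [Function.iterate_succ_apply] at hF
    have step : ∀ m n : ℤ, F (m + 1) n - F m (n + 1) =
        (∑ j ∈ Finset.range (N + 1), Ring.choose (m + 1) j • shiftDiff^[j] F 0 (m + 1 + n - j)) -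
        ∑ j ∈ Finset.range (N + 1), Ring.choose m j • shiftDiff^[j] F 0 (m + (n + 1) - j) := by
      intro m n
      rw [← Finset.sum_sub_distrib, Finset.sum_range_succ']
      have := ih (shiftDiff F) hF m n
      rw [shiftDiff] at this
      rw [this]
      simp only [Ring.choose_zero_right, Nat.cast_zero]
      rw [show m + (n + 1) - (0 : ℤ) = m + 1 + n - 0 by ring, sub_self, add_zero]
      refine Finset.sum_congr rfl fun j _ => ?_
      rw [show m + (n + 1) = m + 1 + n by ring, ← sub_smul, Ring.choose_succ_succ,
        add_sub_cancel_right, ← Function.iterate_succ_apply,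
        show m + 1 + n - ((j + 1 : ℕ) : ℤ) = m + n - j by push_cast; ring]
    have base : ∀ n : ℤ, F 0 n =
        ∑ j ∈ Finset.range (N + 1), Ring.choose (0 : ℤ) j • shiftDiff^[j] F 0 (0 + n - j) := by
      intro n
      rw [Finset.sum_range_succ', Finset.sum_eq_zero]
      · simp
      · intro i _
        rw [Ring.choose_zero_succ, zero_smul]
    induction m using Int.induction_on generalizing n with
    | zero => exact base n
    | succ i hi =>
      have := step i n
      rw [hi (n + 1)] at this
      simpa using this
    | pred i hi =>
      have := step (-(i : ℤ) - 1) (n - 1)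
      rw [show -(i : ℤ) - 1 + 1 = -i by ring, hi (n - 1), show n - 1 + 1 = n by ring] at this
      simpa using this

/-- Conversely, distributions of this form are killed by a power of `z - w`. -/
theorem shiftDiff_iterate_eq_zero_of_eq_sum (N : ℕ) (c : ℕ → ℤ → G) :
    shiftDiff^[N] (fun m n => ∑ j ∈ Finset.range N, Ring.choose m j • c j (m + n)) =
      fun _ _ => 0 := by
  induction N generalizing c with
  | zero => simp
  | succ N ih =>
    rw [Function.iterate_succ_apply]
    convert ih (fun j m => c (j + 1) (m + 1)) using 2
    funext m n
    simp only [shiftDiff]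
    rw [← Finset.sum_sub_distrib, Finset.sum_range_succ']
    simp only [Ring.choose_zero_right]
    rw [show m + (n + 1) = m + 1 + n by ring, sub_self, add_zero]
    refine Finset.sum_congr rfl fun j _ => ?_
    rw [← sub_smul, Ring.choose_succ_succ, add_sub_cancel_right,
      show m + 1 + n = m + n + 1 by ring]

end FormalSeries

/-! ### The combinatorics of Dong's lemma -/

section ThreeVariables
variable {G : Type*} [AddCommGroup G]

/-- Multiplication of `F(z,w,x)` by `z - x`. -/
def shiftDiff₁₃ (F : ℤ → ℤ → ℤ → G) : ℤ → ℤ → ℤ → G :=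
  fun i j l => F (i + 1) j l - F i j (l + 1)

/-- Multiplication of `F(z,w,x)` by `w - x`. -/
def shiftDiff₂₃ (F : ℤ → ℤ → ℤ → G) : ℤ → ℤ → ℤ → G :=
  fun i j l => F i (j + 1) l - F i j (l + 1)

theorem shiftDiff₁₃_iterate_apply (r : ℕ) (F : ℤ → ℤ → ℤ → G) (i j l : ℤ) :
    shiftDiff₁₃^[r] F i j l = shiftDiff^[r] (fun i l => F i j l) i l := by
  induction r generalizing F with
  | zero => rfl
  | succ r ih => rw [Function.iterate_succ_apply, ih, Function.iterate_succ_apply]; rfl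

theorem shiftDiff₂₃_iterate_apply (r : ℕ) (F : ℤ → ℤ → ℤ → G) (i j l : ℤ) :
    shiftDiff₂₃^[r] F i j l = shiftDiff^[r] (fun j l => F i j l) j l := by
  induction r generalizing F with
  | zero => rfl
  | succ r ih => rw [Function.iterate_succ_apply, ih, Function.iterate_succ_apply]; rfl

theorem shiftDiff₁₃_comm₂₃ :
    Function.Commute (shiftDiff₁₃ (G := G)) shiftDiff₂₃ := by
  intro F
  funext i j l
  simp only [shiftDiff₁₃, shiftDiff₂₃]
  abel

theorem shiftDiff_iterate_shift (n : ℕ) (F : ℤ → ℤ → G) (a b i j : ℤ) :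
    shiftDiff^[n] (fun i j => F (i + a) (j + b)) i j = shiftDiff^[n] F (i + a) (j + b) := by
  induction n generalizing F with
  | zero => rfl
  | succ n ih =>
    have : (shiftDiff fun i j => F (i + a) (j + b)) = fun i j => shiftDiff F (i + a) (j + b) := by
      funext i j
      simp only [shiftDiff]
      rw [show i + 1 + a = i + a + 1 by ring, show j + 1 + b = j + b + 1 by ring]
    rw [Function.iterate_succ_apply, Function.iterate_succ_apply, this, ih]

/-- The data `P = a(z)b(w)c(x)`, `Q = b(w)a(z)c(x)`: the residue products in `z` are defined, and
`(z-w)^N P = (z-w)^N Q`. -/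
def LocalPair (N : ℕ) (P Q : ℤ → ℤ → ℤ → G) : Prop :=
  ∀ l, ResidueBdd (fun i j => P i j l) (fun i j => Q i j l) ∧
    shiftDiff^[N] (fun i j => P i j l) = shiftDiff^[N] (fun i j => Q i j l)

theorem ResidueBdd.shift {P Q : ℤ → ℤ → G} (h : ResidueBdd P Q) (a b : ℤ) :
    ResidueBdd (fun i j => P (i + a) (j + b)) (fun i j => Q (i + a) (j + b)) := by
  obtain ⟨K, h⟩ := h
  refine ⟨max (K - a) (K - b), fun j hj i => ?_⟩
  dsimp only
  rw [(h (j + b) (by omega) _).1, (h (j + a) (by omega) _).2]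
  simp

theorem LocalPair.shiftDiff₁₃ {N : ℕ} {P Q : ℤ → ℤ → ℤ → G} (h : LocalPair N P Q) :
    LocalPair N (shiftDiff₁₃ P) (shiftDiff₁₃ Q) := by
  refine fun l => ⟨?_, ?_⟩
  · have := (h l).1.shift 1 0
    simp only [add_zero] at this
    exact this.sub (h (l + 1)).1
  · simp only [VOASheaf.shiftDiff₁₃]
    rw [shiftDiff_iterate_sub, shiftDiff_iterate_sub]
    funext i j
    have h1 := shiftDiff_iterate_shift N (fun i j => P i j l) 1 0 i j
    have h2 := shiftDiff_iterate_shift N (fun i j => Q i j l) 1 0 i j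
    simp only [add_zero] at h1 h2
    rw [h1, h2, (h l).2, (h (l + 1)).2]

theorem LocalPair.shiftDiff₂₃ {N : ℕ} {P Q : ℤ → ℤ → ℤ → G} (h : LocalPair N P Q) :
    LocalPair N (shiftDiff₂₃ P) (shiftDiff₂₃ Q) := by
  refine fun l => ⟨?_, ?_⟩
  · have := (h l).1.shift 0 1
    simp only [add_zero] at this
    exact this.sub (h (l + 1)).1
  · simp only [VOASheaf.shiftDiff₂₃]
    rw [shiftDiff_iterate_sub, shiftDiff_iterate_sub]
    funext i j
    have h1 := shiftDiff_iterate_shift N (fun i j => P i j l) 0 1 i j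
    have h2 := shiftDiff_iterate_shift N (fun i j => Q i j l) 0 1 i j
    simp only [add_zero] at h1 h2
    rw [h1, h2, (h l).2, (h (l + 1)).2]

theorem LocalPair.shiftDiff₂₃_iterate {N : ℕ} {P Q : ℤ → ℤ → ℤ → G} (h : LocalPair N P Q) (r : ℕ) :
    LocalPair N (VOASheaf.shiftDiff₂₃^[r] P) (VOASheaf.shiftDiff₂₃^[r] Q) := by
  induction r with
  | zero => exact h
  | succ r ih =>
    rw [Function.iterate_succ_apply', Function.iterate_succ_apply']
    exact ih.shiftDiff₂₃

/-- The residue product in the first two of three variables. -/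
def residueProd₃ (P Q : ℤ → ℤ → ℤ → G) (n : ℤ) : ℤ → ℤ → G :=
  fun m l => residueProd (fun i j => P i j l) (fun i j => Q i j l) n m

theorem LocalPair.residueProd₃_shiftDiff₂₃ {N : ℕ} {P Q : ℤ → ℤ → ℤ → G} (h : LocalPair N P Q)
    (n : ℤ) : residueProd₃ (VOASheaf.shiftDiff₂₃ P) (VOASheaf.shiftDiff₂₃ Q) n =
      shiftDiff (residueProd₃ P Q n) := by
  funext m l
  simp only [residueProd₃, VOASheaf.shiftDiff₂₃, shiftDiff]
  have := (h l).1.shift 0 1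
  simp only [add_zero] at this
  rw [residueProd_sub this (h (l + 1)).1]
  congr 1
  simp only [residueProd]
  refine finsum_congr fun i => ?_
  rw [show m + 1 + (i : ℤ) = m + i + 1 by ring, show n + (m + 1) - (i : ℤ) = n + m - i + 1 by ring]

theorem LocalPair.residueProd₃_shiftDiff₂₃_iterate {N : ℕ} {P Q : ℤ → ℤ → ℤ → G}
    (h : LocalPair N P Q) (n : ℤ) (r : ℕ) :
    residueProd₃ (VOASheaf.shiftDiff₂₃^[r] P) (VOASheaf.shiftDiff₂₃^[r] Q) n =
      shiftDiff^[r] (residueProd₃ P Q n) := by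
  induction r with
  | zero => rfl
  | succ r ih =>
    rw [Function.iterate_succ_apply', Function.iterate_succ_apply',
      (h.shiftDiff₂₃_iterate r).residueProd₃_shiftDiff₂₃, ih, Function.iterate_succ_apply']

/-- `(w - x)[n] = [n](z - x) - [n+1]` as `w - x = (z - x) - (z - w)`. -/
theorem LocalPair.shiftDiff_residueProd₃ {N : ℕ} {P Q : ℤ → ℤ → ℤ → G} (h : LocalPair N P Q)
    (n : ℤ) : shiftDiff (residueProd₃ P Q n) = fun m l =>
      residueProd₃ (VOASheaf.shiftDiff₁₃ P) (VOASheaf.shiftDiff₁₃ Q) n m l -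
        residueProd₃ P Q (n + 1) m l := by
  rw [← h.residueProd₃_shiftDiff₂₃]
  funext m l
  simp only [residueProd₃]
  rw [← residueProd_shiftDiff (h l).1, ← residueProd_sub (h.shiftDiff₁₃ l).1 (h l).1.shiftDiff]
  congr 1 <;>
  · funext i j
    simp only [VOASheaf.shiftDiff₁₃, VOASheaf.shiftDiff₂₃, shiftDiff]
    abel

/-- The combinatorial core of Dong's lemma: a multiple of `(w - x)` can be traded either for a
factor `z - x`, a power of which kills `P` and `Q`, or for a higher product, and high products
vanish. -/
theorem LocalPair.shiftDiff_iterate_residueProd₃ (t : ℕ) {N : ℕ} {P Q : ℤ → ℤ → ℤ → G}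
    (h : LocalPair N P Q) (r : ℕ) (hP : VOASheaf.shiftDiff₁₃^[r] P = fun _ _ _ => 0)
    (hQ : VOASheaf.shiftDiff₁₃^[r] Q = fun _ _ _ => 0) (n : ℤ) (ht : (N - n).toNat + r ≤ t) :
    shiftDiff^[t] (residueProd₃ P Q n) = fun _ _ => 0 := by
  induction t generalizing P Q r n with
  | zero =>
    obtain rfl : r = 0 := by omega
    simp only [Function.iterate_zero, id_eq] at hP hQ ⊢
    subst hP hQ
    funext m l
    exact residueProd_zero_left G n m
  | succ t ih =>
    by_cases hn : (N : ℤ) ≤ n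
    · convert shiftDiff_iterate_zero (t + 1) using 2
      funext m l
      simp only [residueProd₃]
      lift n to ℕ using by omega
      rw [residueProd_natCast (h l).1, shiftDiff_iterate_mono (n := N) (by omega)]
      rw [shiftDiff_iterate_sub, (h l).2]
      simp
    · cases r with
      | zero =>
        simp only [Function.iterate_zero, id_eq] at hP hQ
        subst hP hQ
        convert shiftDiff_iterate_zero (t + 1) using 2
        funext m l
        exact residueProd_zero_left G n m
      | succ r =>
        rw [Function.iterate_succ_apply] at hP hQ
        rw [Function.iterate_succ_apply, h.shiftDiff_residueProd₃, shiftDiff_iterate_sub,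
          ih h.shiftDiff₁₃ r hP hQ n (by omega),
          ih h (r + 1) (by rwa [Function.iterate_succ_apply])
            (by rwa [Function.iterate_succ_apply]) (n + 1) (by omega)]
        simp

end ThreeVariables

/-! ### Fields and their products -/

section Fields
variable {M : Type*} [AddCommGroup M] [Module ℂ M]

theorem ResidueBdd.linearMap {M' : Type*} [AddCommGroup M'] [Module ℂ M'] (φ : M →ₗ[ℂ] M')
    {P Q : ℤ → ℤ → M} (h : ResidueBdd P Q) :
    ResidueBdd (fun i j => φ (P i j)) (fun i j => φ (Q i j)) := h.map φ.toAddMonoidHom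

theorem residueProd_linearMap {M' : Type*} [AddCommGroup M'] [Module ℂ M'] (φ : M →ₗ[ℂ] M')
    {P Q : ℤ → ℤ → M} (h : ResidueBdd P Q) (n m : ℤ) :
    residueProd (fun i j => φ (P i j)) (fun i j => φ (Q i j)) n m = φ (residueProd P Q n m) :=
  residueProd_map φ.toAddMonoidHom h n m

/-- A field `a(z) = ∑_n a_n z^{-n-1}` on a vector space: `a(z)x` is a Laurent series in `z` for
every vector `x`. -/
structure VField (M : Type*) [AddCommGroup M] [Module ℂ M] where
  /-- the coefficient `a_n` -/
  coeff : ℤ → Module.End ℂ M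
  trunc : ∀ x, ∃ n₀ : ℤ, ∀ n, n₀ ≤ n → coeff n x = 0

namespace VField

/-- Mutual locality of two families of operators: `(z - w)^N [a(z), b(w)] = 0` for some `N`. -/
def LocalModes (a b : ℤ → Module.End ℂ M) : Prop :=
  ∃ N : ℕ, shiftDiff^[N] (fun i j => a i * b j - b j * a i) = fun _ _ => 0

theorem LocalModes.symm {a b : ℤ → Module.End ℂ M} (h : LocalModes a b) : LocalModes b a := by
  obtain ⟨N, hN⟩ := h
  refine ⟨N, ?_⟩
  have e : (fun i j => b i * a j - a j * b i) =
      fun i j => (0 : Module.End ℂ M) - (fun i j => a i * b j - b j * a i) j i := by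
    funext i j
    rw [zero_sub, neg_sub]
  rw [e, shiftDiff_iterate_sub, shiftDiff_iterate_zero]
  funext i j
  rw [shiftDiff_iterate_swap, hN]
  simp

theorem LocalModes.of_comm {a b : ℤ → Module.End ℂ M} (h : ∀ i j, a i * b j = b j * a i) :
    LocalModes a b := ⟨0, by funext i j; simp [h]⟩

/-- Fields whose commutator is a finite combination of derivatives of the delta function are
local. -/
theorem LocalModes.of_sum {a b : ℤ → Module.End ℂ M} (N : ℕ) (c : ℕ → ℤ → Module.End ℂ M)
    (h : ∀ i j, a i * b j - b j * a i = ∑ k ∈ Finset.range N, Ring.choose i k • c k (i + j)) :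
    LocalModes a b := ⟨N, by simp only [h]; exact shiftDiff_iterate_eq_zero_of_eq_sum N c⟩

theorem LocalModes.add {a a' b : ℤ → Module.End ℂ M} (h : LocalModes a b) (h' : LocalModes a' b) :
    LocalModes (fun i => a i + a' i) b := by
  obtain ⟨N, hN⟩ := h
  obtain ⟨N', hN'⟩ := h'
  refine ⟨max N N', ?_⟩
  have e : (fun i j => (a i + a' i) * b j - b j * (a i + a' i)) =
      fun i j => (fun i j => a i * b j - b j * a i) i j +
        (fun i j => a' i * b j - b j * a' i) i j := by
    funext i j
    simp only [add_mul, mul_add]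
    abel
  rw [e, shiftDiff_iterate_add, shiftDiff_iterate_mono (le_max_left N N') hN,
    shiftDiff_iterate_mono (le_max_right N N') hN']
  simp

theorem LocalModes.smul {a b : ℤ → Module.End ℂ M} (c : ℂ) (h : LocalModes a b) :
    LocalModes (fun i => c • a i) b := by
  obtain ⟨N, hN⟩ := h
  refine ⟨N, ?_⟩
  funext i j
  have := shiftDiff_iterate_map (LinearMap.lsmul ℂ (Module.End ℂ M) c).toAddMonoidHom N
    (fun i j => a i * b j - b j * a i) i j
  rw [hN] at this
  simpa [smul_sub] using this

/-- The derivative of a local field is local. -/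
theorem LocalModes.deriv {a b : ℤ → Module.End ℂ M} (h : LocalModes a b) :
    LocalModes (fun i => -i • a (i - 1)) b := by
  obtain ⟨N, hN⟩ := h
  refine ⟨N + 1, ?_⟩
  have key : ∀ (N : ℕ) (F : ℤ → ℤ → Module.End ℂ M), shiftDiff^[N] F = (fun _ _ => 0) →
      shiftDiff^[N + 1] (fun i j => -i • F (i - 1) j) = fun _ _ => 0 := by
    intro N
    induction N with
    | zero =>
      intro F hF
      simp only [Function.iterate_zero, id_eq] at hF
      subst hF
      simp only [smul_zero]
      exact shiftDiff_iterate_zero _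
    | succ N ih =>
      intro F hF
      have e : shiftDiff (fun i j => -i • F (i - 1) j) =
          fun i j => (-i • (shiftDiff F) (i - 1) j) - F i j := by
        funext i j
        simp only [shiftDiff, add_sub_cancel_right, sub_add_cancel]
        module
      rw [Function.iterate_succ_apply] at hF
      rw [Function.iterate_succ_apply, e, shiftDiff_iterate_sub, ih _ hF,
        Function.iterate_succ_apply, hF]
      simp
  have e : (fun i j => -i • a (i - 1) * b j - b j * (-i • a (i - 1))) =
      fun i j => -i • (fun i j => a i * b j - b j * a i) (i - 1) j := by
    funext i j
    simp only [smul_mul_assoc, mul_smul_comm, smul_sub]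
  rw [e]
  exact key N _ hN

theorem residueBdd (a b : VField M) (x : M) :
    ResidueBdd (fun i j => a.coeff i (b.coeff j x)) (fun i j => b.coeff j (a.coeff i x)) := by
  obtain ⟨K, hK⟩ := a.trunc x
  obtain ⟨K', hK'⟩ := b.trunc x
  exact ⟨max K K', fun j hj i => by
    dsimp only
    rw [hK' j (by omega), hK j (by omega), map_zero, map_zero]
    simp⟩

/-- The `n`-th product of two fields. -/
def nprod (a b : VField M) (n : ℤ) : VField M where
  coeff m :=
    { toFun x := residueProd (fun i j => a.coeff i (b.coeff j x))
        (fun i j => b.coeff j (a.coeff i x)) n m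
      map_add' x y := by
        simp only [map_add]
        exact residueProd_add (a.residueBdd b x) (a.residueBdd b y) n m
      map_smul' c x := by
        simp only [map_smul, RingHom.id_apply]
        exact residueProd_linearMap (LinearMap.lsmul ℂ M c) (a.residueBdd b x) n m }
  trunc x := by
    obtain ⟨K, hK⟩ := a.trunc x
    obtain ⟨K', hK'⟩ := b.trunc x
    choose B hB using fun i : ℤ => b.trunc (a.coeff i x)
    let S := ∑ i ∈ Finset.range K.toNat, |B i|
    refine ⟨max K' (S + K.toNat - n), fun m hm => ?_⟩
    have hz : ∀ i : ℕ, sgnChoose n i • (a.coeff (n - i) (b.coeff (m + i) x) -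
        (n.negOnePow : ℤ) • b.coeff (n + m - i) (a.coeff i x)) = 0 := by
      intro i
      rw [hK' (m + i) (by omega), map_zero]
      by_cases hi : K ≤ i
      · rw [hK i hi]
        simp
      · rw [hB]
        · simp
        · have : |B i| ≤ S := Finset.single_le_sum (f := fun i : ℕ => |B i|)
            (fun i _ => abs_nonneg _) (Finset.mem_range.2 (by omega : i < K.toNat))
          have := le_abs_self (B i)
          omega
    simp only [LinearMap.coe_mk, AddHom.coe_mk, residueProd, hz, finsum_zero]

theorem nprod_coeff_apply (a b : VField M) (n m : ℤ) (x : M) :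
    (a.nprod b n).coeff m x = residueProd (fun i j => a.coeff i (b.coeff j x))
        (fun i j => b.coeff j (a.coeff i x)) n m := rfl

/-- **Dong's lemma**: products of mutually local fields are local with any field that is local with
both factors. -/
theorem dong {a b c : VField M} (hab : LocalModes a.coeff b.coeff)
    (hac : LocalModes a.coeff c.coeff) (hbc : LocalModes b.coeff c.coeff) (n : ℤ) :
    LocalModes (a.nprod b n).coeff c.coeff := by
  obtain ⟨N, hab⟩ := hab
  obtain ⟨r₁, hac⟩ := hac
  obtain ⟨r₂, hbc⟩ := hbc
  set r := max r₁ r₂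
  have hac := shiftDiff_iterate_mono (le_max_left r₁ r₂) hac
  have hbc := shiftDiff_iterate_mono (le_max_right r₁ r₂) hbc
  refine ⟨(N - n).toNat + r + r, ?_⟩
  funext m l
  ext x
  let P : ℤ → ℤ → ℤ → M := fun i j l =>
    a.coeff i (b.coeff j (c.coeff l x)) - c.coeff l (a.coeff i (b.coeff j x))
  let Q : ℤ → ℤ → ℤ → M := fun i j l =>
    b.coeff j (a.coeff i (c.coeff l x)) - c.coeff l (b.coeff j (a.coeff i x))
  have bd : ∀ l, ResidueBdd (fun i j => P i j l) (fun i j => Q i j l) := fun l =>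
    (a.residueBdd b (c.coeff l x)).sub ((a.residueBdd b x).linearMap (c.coeff l))
  have ev : ∀ (F : ℤ → ℤ → Module.End ℂ M) (r : ℕ) (y : M) (i j : ℤ),
      shiftDiff^[r] (fun i j => F i j y) i j = shiftDiff^[r] F i j y := fun F r y i j =>
    shiftDiff_iterate_map (LinearMap.applyₗ y).toAddMonoidHom r F i j
  have hPQ : LocalPair N P Q := by
    refine fun l => ⟨bd l, ?_⟩
    rw [← sub_eq_zero (a := shiftDiff^[N] _)]
    have e : (fun i j => P i j l - Q i j l) = fun i j =>
        (fun i j => a.coeff i * b.coeff j - b.coeff j * a.coeff i) i j (c.coeff l x) -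
        (c.coeff l).toAddMonoidHom
          ((fun i j => a.coeff i * b.coeff j - b.coeff j * a.coeff i) i j x) := by
      funext i j
      simp [P, Q]
      abel
    have e2 := shiftDiff_iterate_sub N (fun i j => P i j l) (fun i j => Q i j l)
    rw [e, shiftDiff_iterate_sub] at e2
    funext i j
    have := congrFun (congrFun e2 i) j
    dsimp only at this
    rw [Pi.sub_apply, Pi.sub_apply, ← this, ev,
      shiftDiff_iterate_map (c.coeff l).toAddMonoidHom, ev, hab]
    simp
  have kill : ∀ (F F' : ℤ → ℤ → ℤ → M), (∀ j, shiftDiff^[r] (fun i l => F i j l) = fun _ _ => 0) →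
      (∀ i, shiftDiff^[r] (fun j l => F' i j l) = fun _ _ => 0) →
      shiftDiff₁₃^[r] (shiftDiff₂₃^[r] fun i j l => F i j l + F' i j l) = fun _ _ _ => 0 := by
    intro F F' hF hF'
    have h1 : (shiftDiff₂₃^[r] fun i j l => F i j l + F' i j l) = shiftDiff₂₃^[r] F := by
      funext i j l
      rw [shiftDiff₂₃_iterate_apply, shiftDiff_iterate_add, hF', shiftDiff₂₃_iterate_apply]
      simp
    rw [h1, ((shiftDiff₁₃_comm₂₃.iterate_left r).iterate_right r).eq]
    have h2 : shiftDiff₁₃^[r] F = fun _ _ _ => 0 := by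
      funext i j l
      rw [shiftDiff₁₃_iterate_apply, hF]
    rw [h2]
    funext i j l
    rw [shiftDiff₂₃_iterate_apply, shiftDiff_iterate_zero]
  have hP : shiftDiff₁₃^[r] (shiftDiff₂₃^[r] P) = fun _ _ _ => 0 := by
    have e : P = fun i j l =>
        (fun i l => a.coeff i * c.coeff l - c.coeff l * a.coeff i) i l (b.coeff j x) +
        (a.coeff i).toAddMonoidHom
          ((fun j l => b.coeff j * c.coeff l - c.coeff l * b.coeff j) j l x) := by
      funext i j l
      simp [P]
    rw [e]
    refine kill (fun i j l => (fun i l => a.coeff i * c.coeff l - c.coeff l * a.coeff i) i l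
      (b.coeff j x)) (fun i j l => (a.coeff i).toAddMonoidHom
          ((fun j l => b.coeff j * c.coeff l - c.coeff l * b.coeff j) j l x))
      (fun j => ?_) (fun i => ?_)
    · funext i l
      rw [ev, hac]
      rfl
    · funext j l
      rw [shiftDiff_iterate_map, ev, hbc]
      simp
  have hQ : shiftDiff₁₃^[r] (shiftDiff₂₃^[r] Q) = fun _ _ _ => 0 := by
    have e : Q = fun i j l =>
        (b.coeff j).toAddMonoidHom
          ((fun i l => a.coeff i * c.coeff l - c.coeff l * a.coeff i) i l x) +
        (fun j l => b.coeff j * c.coeff l - c.coeff l * b.coeff j) j l (a.coeff i x) := by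
      funext i j l
      simp [Q]
    rw [e]
    refine kill (fun i j l => (b.coeff j).toAddMonoidHom
          ((fun i l => a.coeff i * c.coeff l - c.coeff l * a.coeff i) i l x))
      (fun i j l => (fun j l => b.coeff j * c.coeff l - c.coeff l * b.coeff j) j l (a.coeff i x))
      (fun j => ?_) (fun i => ?_)
    · funext i l
      rw [shiftDiff_iterate_map, ev, hac]
      simp
    · funext j l
      rw [ev, hbc]
      rfl
  have fin := (hPQ.shiftDiff₂₃_iterate r).shiftDiff_iterate_residueProd₃ ((N - n).toNat + r) r
    hP hQ n le_rfl
  rw [hPQ.residueProd₃_shiftDiff₂₃_iterate, ← Function.iterate_add_apply] at fin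
  rw [← ev]
  have e : (fun m l => ((a.nprod b n).coeff m * c.coeff l - c.coeff l * (a.nprod b n).coeff m) x) =
      residueProd₃ P Q n := by
    funext m l
    simp only [LinearMap.sub_apply, Module.End.mul_apply, nprod_coeff_apply, residueProd₃, P, Q]
    rw [residueProd_sub (a.residueBdd b (c.coeff l x))
      ((a.residueBdd b x).linearMap (c.coeff l))]
    congr 1
    exact (residueProd_linearMap (c.coeff l) (a.residueBdd b x) n m).symm
  rw [e, fin]
  rfl

/-- The identity field. -/
def one (M : Type*) [AddCommGroup M] [Module ℂ M] : VField M where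
  coeff n := if n = -1 then 1 else 0
  trunc x := ⟨0, fun n hn => by rw [if_neg (by omega)]; rfl⟩

/-- A field is compatible with a translation operator `D` and a vacuum vector `vac`:
`[D, a(z)] = ∂a(z)` and `a(z)vac` has no negative powers of `z`. -/
structure Covariant (D : Module.End ℂ M) (vac : M) (a : VField M) : Prop where
  translation : ∀ n, D * a.coeff n - a.coeff n * D = -n • a.coeff (n - 1)
  creation : ∀ n, 0 ≤ n → a.coeff n vac = 0

variable {D : Module.End ℂ M} {vac : M}

theorem Covariant.nprod {a b : VField M} (ha : a.Covariant D vac) (hb : b.Covariant D vac)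
    (n : ℤ) : (a.nprod b n).Covariant D vac where
  translation m := by
    have ta : ∀ n x, D (a.coeff n x) = a.coeff n (D x) + -n • a.coeff (n - 1) x := fun n x => by
      rw [← LinearMap.smul_apply, ← ha.translation n]
      simp
    have tb : ∀ n x, D (b.coeff n x) = b.coeff n (D x) + -n • b.coeff (n - 1) x := fun n x => by
      rw [← LinearMap.smul_apply, ← hb.translation n]
      simp
    ext x
    simp only [LinearMap.sub_apply, Module.End.mul_apply, LinearMap.smul_apply, nprod_coeff_apply]
    rw [← residueProd_translation (a.residueBdd b x)]
    rw [← residueProd_linearMap D (a.residueBdd b x) n m,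
      ← residueProd_sub ((a.residueBdd b x).linearMap D) (a.residueBdd b (D x))]
    congr 1 <;>
    · funext i j
      simp only [ta, tb, map_add, map_zsmul]
      abel
  creation m hm := by
    rw [nprod_coeff_apply, residueProd]
    have : ∀ i : ℕ, sgnChoose n i • (a.coeff (n - i) (b.coeff (m + i) vac) -
        (n.negOnePow : ℤ) • b.coeff (n + m - i) (a.coeff i vac)) = 0 := fun i => by
      rw [hb.creation (m + i) (by omega), ha.creation i (by omega)]
      simp
    simp only [this, finsum_zero]

theorem Covariant.nprod_vac {a b : VField M} (ha : a.Covariant D vac) (hb : b.Covariant D vac)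
    (n : ℤ) : (a.nprod b n).coeff (-1) vac = a.coeff n (b.coeff (-1) vac) := by
  rw [nprod_coeff_apply, residueProd, finsum_eq_single _ 0]
  · simp [sgnChoose_zero_right, ha.creation 0 le_rfl]
  · intro i hi
    rw [hb.creation (-1 + i) (by omega), ha.creation i (by omega)]
    simp

/-- **Goddard's uniqueness theorem**: two covariant fields which create the same state from the
vacuum and are local with sufficiently many fields are equal. -/
theorem Covariant.ext_of_local {a a' : VField M} (hD : D vac = 0) (ha : a.Covariant D vac)
    (ha' : a'.Covariant D vac) (h : a.coeff (-1) vac = a'.coeff (-1) vac)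
    (hloc : ∀ x : M, ∃ b : ℤ → Module.End ℂ M, LocalModes a.coeff b ∧ LocalModes a'.coeff b ∧
      b (-1) vac = x ∧ ∀ n, 0 ≤ n → b n vac = 0) : a.coeff = a'.coeff := by
  -- translation covariance determines `a(z)vac` from its constant term
  have hvac : ∀ n, a.coeff n vac = a'.coeff n vac := by
    have neg : ∀ k : ℕ, a.coeff (-1 - k) vac = a'.coeff (-1 - k) vac := by
      intro k
      induction k with
      | zero => simpa using h
      | succ k ih =>
        have e1 := LinearMap.congr_fun (ha.translation (-1 - k)) vac
        have e2 := LinearMap.congr_fun (ha'.translation (-1 - k)) vac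
        simp only [LinearMap.sub_apply, Module.End.mul_apply, hD, map_zero, sub_zero,
          LinearMap.smul_apply] at e1 e2
        rw [ih] at e1
        have e3 := e1.symm.trans e2
        rw [← sub_eq_zero, ← smul_sub, ← Int.cast_smul_eq_zsmul ℂ, smul_eq_zero] at e3
        rcases e3 with e3 | e3
        · have : -(-1 - (k : ℤ)) = 0 := by exact_mod_cast e3
          omega
        · rw [sub_eq_zero] at e3
          convert e3 using 3 <;> push_cast <;> ring
    intro n
    by_cases hn : 0 ≤ n
    · rw [ha.creation n hn, ha'.creation n hn]
    · obtain ⟨k, hk⟩ := Int.eq_ofNat_of_zero_le (by omega : 0 ≤ -1 - n)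
      have := neg k
      rwa [← hk, sub_sub_cancel] at this
  funext n
  ext x
  obtain ⟨b, ⟨N, hN⟩, ⟨N', hN'⟩, rfl, hb⟩ := hloc x
  have hN := shiftDiff_iterate_mono (le_max_left N N') hN
  have hN' := shiftDiff_iterate_mono (le_max_right N N') hN'
  set K := max N N'
  -- the coefficients at `w^0` of `(z-w)^K a(z)b(w)vac = (z-w)^K b(w)a(z)vac`
  have ev : ∀ (a : VField M), shiftDiff^[K]
      (fun i j => a.coeff i * b j - b j * a.coeff i) = (fun _ _ => 0) →
      ∀ k, a.coeff k (b (-1) vac) =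
        shiftDiff^[K] (fun i j => b j (a.coeff i vac)) (k - K) (-1) := by
    intro a hN k
    have e := LinearMap.congr_fun (congrFun (congrFun hN (k - K)) (-1)) vac
    have e' := shiftDiff_iterate_map (LinearMap.applyₗ vac).toAddMonoidHom K
      (fun i j => a.coeff i * b j - b j * a.coeff i) (k - K) (-1)
    simp only [LinearMap.toAddMonoidHom_coe, LinearMap.applyₗ_apply_apply] at e'
    rw [e] at e'
    simp only [LinearMap.sub_apply, Module.End.mul_apply] at e'
    rw [shiftDiff_iterate_sub] at e'
    dsimp only at e'
    rw [LinearMap.zero_apply, sub_eq_zero] at e'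
    rw [← e', shiftDiff_iterate_eq_sum, Finset.sum_eq_single 0]
    · simp
    · intro i _ hi
      rw [hb _ (by omega)]
      simp
    · simp
  rw [ev a hN, ev a' hN']
  simp only [hvac]

end VField

end Fields

/-! ### The existence theorem for vertex algebras -/

section Existence
variable {M : Type} [AddCommGroup M] [Module ℂ M]

namespace VField

/-- The sum of two fields. -/
def add (a b : VField M) : VField M where
  coeff n := a.coeff n + b.coeff n
  trunc x := by
    obtain ⟨K, hK⟩ := a.trunc x
    obtain ⟨K', hK'⟩ := b.trunc x
    exact ⟨max K K', fun n hn => by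
      rw [LinearMap.add_apply, hK n (by omega), hK' n (by omega), add_zero]⟩

/-- A scalar multiple of a field. -/
def smul (c : ℂ) (a : VField M) : VField M where
  coeff n := c • a.coeff n
  trunc x := by
    obtain ⟨K, hK⟩ := a.trunc x
    exact ⟨K, fun n hn => by rw [LinearMap.smul_apply, hK n hn, smul_zero]⟩

/-- The derivative of a field. -/
def deriv (a : VField M) : VField M where
  coeff n := -n • a.coeff (n - 1)
  trunc x := by
    obtain ⟨K, hK⟩ := a.trunc x
    exact ⟨K + 1, fun n hn => by rw [LinearMap.smul_apply, hK _ (by omega), smul_zero]⟩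

/-- The fields obtained from given ones and from the identity field by linear combinations and
products. -/
inductive Closure {I : Type*} (G : I → VField M) : VField M → Prop
  | one : Closure G (one M)
  | gen (i) : Closure G (G i)
  | add {a b} : Closure G a → Closure G b → Closure G (a.add b)
  | smul (c) {a} : Closure G a → Closure G (a.smul c)
  | nprod {a b} (n) : Closure G a → Closure G b → Closure G (a.nprod b n)

variable {D : Module.End ℂ M} {vac : M} {I : Type*} {G : I → VField M}

theorem covariant_one : (one M).Covariant D vac where
  translation n := by
    by_cases h : n = 0
    · subst h; simp [one]
    · simp only [one, if_neg (by omega : ¬ n - 1 = -1)]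
      split_ifs <;> simp
  creation n hn := by
    simp only [one, if_neg (by omega : ¬ n = -1)]
    rfl

theorem Closure.covariant (hG : ∀ i, (G i).Covariant D vac) {a : VField M}
    (ha : Closure G a) : a.Covariant D vac := by
  induction ha with
  | one => exact covariant_one
  | gen i => exact hG i
  | @add a b _ _ h1 h2 =>
    refine ⟨fun n => ?_, fun n hn => ?_⟩
    · simp only [VField.add, mul_add, add_mul, smul_add, ← h1.translation, ← h2.translation]
      abel
    · simp [VField.add, h1.creation n hn, h2.creation n hn]
  | @smul c a _ h1 =>
    refine ⟨fun n => ?_, fun n hn => ?_⟩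
    · simp only [VField.smul, mul_smul_comm, smul_mul_assoc, ← smul_sub, h1.translation]
      rw [smul_comm]
    · simp [VField.smul, h1.creation n hn]
  | nprod n _ _ h1 h2 => exact h1.nprod h2 n

theorem localModes_one (b : ℤ → Module.End ℂ M) : LocalModes (one M).coeff b :=
  .of_comm fun i j => by simp only [one]; split_ifs <;> simp

theorem Closure.localModes (hloc : ∀ i j, LocalModes (G i).coeff (G j).coeff) {a b : VField M}
    (ha : Closure G a) (hb : Closure G b) : LocalModes a.coeff b.coeff := by
  have key : ∀ {b : VField M}, (∀ i, LocalModes (G i).coeff b.coeff) →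
      ∀ {a : VField M}, Closure G a → LocalModes a.coeff b.coeff := by
    intro b hb a ha
    -- mutual locality of the factors is needed for Dong's lemma, hence the two-step induction
    have self : ∀ {c d : VField M}, Closure G c → Closure G d →
        (∀ i, LocalModes (G i).coeff d.coeff) → LocalModes c.coeff d.coeff := by
      intro c d hc
      induction hc generalizing d with
      | one => exact fun _ _ => localModes_one _
      | gen i => exact fun _ h => h i
      | add _ _ h1 h2 => exact fun hd h => (h1 hd h).add (h2 hd h)
      | smul c _ h1 => exact fun hd h => (h1 hd h).smul c
      | @nprod a' b' n ha' hb' h1 h2 =>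
        intro hd h
        refine dong (h1 hb' fun i => ?_) (h1 hd h) (h2 hd h) n
        exact (h2 (.gen i) (fun j => hloc j i)).symm
    induction ha with
    | one => exact localModes_one _
    | gen i => exact hb i
    | add _ _ h1 h2 => exact h1.add h2
    | smul c _ h1 => exact h1.smul c
    | @nprod a' b' n ha' hb' h1 h2 =>
      refine dong (self ha' hb' fun i => ?_) h1 h2 n
      exact (self hb' (.gen i) (fun j => hloc j i)).symm
  exact key (fun i => (key (fun j => hloc j i) hb).symm) ha

/-- **The existence theorem for vertex algebras**: mutually local, translation covariant fields
which generate the space from the vacuum vector are the generating fields of a vertex algebra. -/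
theorem exists_vertexAlgebra (hD : D vac = 0) (hG : ∀ i, (G i).Covariant D vac)
    (hloc : ∀ i j, LocalModes (G i).coeff (G j).coeff)
    (span : ∀ N : Submodule ℂ M, vac ∈ N → (∀ i n, ∀ w ∈ N, (G i).coeff n w ∈ N) → N = ⊤) :
    ∃ A : VertexAlgebra M, A.vac = vac ∧ A.D = D ∧
      ∀ i, A.Y ((G i).coeff (-1) vac) = (G i).coeff := by
  have surj : ∀ x, ∃ a : VField M, Closure G a ∧ a.coeff (-1) vac = x := by
    let N : Submodule ℂ M :=
      { carrier := {x | ∃ a : VField M, Closure G a ∧ a.coeff (-1) vac = x}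
        zero_mem' := ⟨_, .smul 0 .one, by simp [VField.smul]⟩
        add_mem' := by
          rintro _ _ ⟨a, ha, rfl⟩ ⟨b, hb, rfl⟩
          exact ⟨_, .add ha hb, rfl⟩
        smul_mem' := by
          rintro c _ ⟨a, ha, rfl⟩
          exact ⟨_, .smul c ha, rfl⟩ }
    have := span N ⟨_, .one, by simp [one]⟩ (by
      rintro i n _ ⟨a, ha, rfl⟩
      exact ⟨_, .nprod n (.gen i) ha, (hG i).nprod_vac (ha.covariant hG) n⟩)
    intro x
    exact (this ▸ Submodule.mem_top : x ∈ N)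
  choose F hF hFx using surj
  have uniq : ∀ {a : VField M}, a.Covariant D vac → (∀ x, LocalModes a.coeff (F x).coeff) →
      a.coeff = (F (a.coeff (-1) vac)).coeff := by
    intro a ha hla
    refine ha.ext_of_local hD ((hF _).covariant hG) (hFx _).symm fun x =>
      ⟨(F x).coeff, hla x, (hF _).localModes hloc (hF x), hFx x,
        ((hF x).covariant hG).creation⟩
  have uniqC : ∀ {a : VField M}, Closure G a → a.coeff = (F (a.coeff (-1) vac)).coeff :=
    fun ha => uniq (ha.covariant hG) fun x => ha.localModes hloc (hF x)
  refine ⟨{ vac := vac, D := D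
            Y := { toFun := fun x => (F x).coeff
                   map_add' := fun x y => ?_
                   map_smul' := fun c x => ?_ }
            truncation := fun a b => (F a).trunc b
            translation := fun a n => ?_
            derivative := fun a n => ?_
            vacuum := fun n => ?_
            replication_nonneg := fun a n hn => ((hF a).covariant hG).creation n hn
            replication := hFx
            locality := fun a b => ?_ }, rfl, rfl, fun i => (uniqC (.gen i)).symm⟩
  · have := uniqC (.add (hF x) (hF y))
    simp only [VField.add, LinearMap.add_apply, hFx] at this
    rw [← this]; rfl
  · have := uniqC (.smul c (hF x))
    simp only [VField.smul, LinearMap.smul_apply, hFx] at this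
    rw [← this]; rfl
  · have := ((hF a).covariant hG).translation n
    ext x
    have := LinearMap.congr_fun this x
    rw [← Int.cast_smul_eq_zsmul ℂ] at this
    simpa using this
  · have cov := (hF a).covariant hG
    have hd : (F a).deriv.Covariant D vac := by
      refine ⟨fun n => ?_, fun n hn => ?_⟩
      · simp only [deriv, mul_smul_comm, smul_mul_assoc, ← smul_sub, cov.translation]
      · simp only [deriv, LinearMap.smul_apply]
        by_cases h : n = 0
        · simp [h]
        · rw [cov.creation _ (by omega), smul_zero]
    have := uniq hd fun x => ((hF a).localModes hloc (hF x)).deriv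
    have e : (F a).deriv.coeff (-1) vac = D a := by
      have := LinearMap.congr_fun (cov.translation (-1)) vac
      simp only [LinearMap.sub_apply, Module.End.mul_apply, hFx, hD, map_zero, sub_zero] at this
      rw [this]
      rfl
    rw [e] at this
    have h2 := congrFun this n
    simp only [deriv] at h2
    rw [← Int.cast_smul_eq_zsmul ℂ] at h2
    simpa using h2.symm
  · have := uniqC .one
    have e : (one M).coeff (-1) vac = vac := by simp [one]
    rw [e] at this
    have h2 := congrFun this n
    simp only [one] at h2
    exact h2.symm
  · obtain ⟨N, hN⟩ := (hF a).localModes hloc (hF b)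
    refine ⟨N, fun n hn k l => ?_⟩
    have := congrFun (congrFun (shiftDiff_iterate_mono hn hN) k) l
    rw [shiftDiff_iterate_eq_sum] at this
    rw [← this]
    refine Finset.sum_congr rfl fun i _ => ?_
    rw [← Int.cast_smul_eq_zsmul ℂ]
    push_cast
    rfl

end VField

end Existence

/-! ### Operator products, generators and homomorphisms -/

namespace VertexAlgebra
open VField
variable {M M' : Type} [AddCommGroup M] [Module ℂ M] [AddCommGroup M'] [Module ℂ M']
variable (A : VertexAlgebra M) (A' : VertexAlgebra M')

theorem D_vac : A.D A.vac = 0 := by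
  have h := A.derivative A.vac (-1)
  rw [A.vacuum] at h
  have := A.replication (A.D A.vac)
  rw [h] at this
  simpa using this.symm

theorem D_eq (a : M) : A.D a = A.Y a (-2) A.vac := by
  have h := A.derivative a (-1)
  have := A.replication (A.D a)
  rw [h] at this
  simpa using this.symm

/-- The field of a state. -/
def field (a : M) : VField M := ⟨A.Y a, A.truncation a⟩

theorem covariant (a : M) : (A.field a).Covariant A.D A.vac where
  translation n := by
    ext x
    have := LinearMap.congr_fun (A.translation a n) x
    rw [← Int.cast_smul_eq_zsmul ℂ]
    simpa [field] using this
  creation n hn := A.replication_nonneg a n hn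

theorem localModes (a b : M) : LocalModes (A.Y a) (A.Y b) := by
  obtain ⟨n₀, h⟩ := A.locality a b
  refine ⟨n₀, ?_⟩
  funext k l
  rw [shiftDiff_iterate_eq_sum, ← h n₀ le_rfl k l]
  refine Finset.sum_congr rfl fun i _ => ?_
  rw [← Int.cast_smul_eq_zsmul ℂ]
  push_cast
  rfl

/-- `Y(a_(n)b, z)` is the `n`-th product of the fields `Y(a,z)` and `Y(b,z)`. -/
theorem Y_Y (a b : M) (n : ℤ) :
    A.Y (A.Y a n b) = ((A.field a).nprod (A.field b) n).coeff := by
  change (A.field (A.Y a n b)).coeff = _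
  have hd : ∀ x, LocalModes ((A.field a).nprod (A.field b) n).coeff (A.field x).coeff := fun x =>
    dong (A.localModes a b) (A.localModes a x) (A.localModes b x) n
  refine (A.covariant (A.Y a n b)).ext_of_local A.D_vac
    ((A.covariant a).nprod (A.covariant b) n) ?_ fun x => ⟨(A.field x).coeff, A.localModes _ _,
      hd x, A.replication x, A.replication_nonneg x⟩
  rw [(A.covariant a).nprod_vac (A.covariant b)]
  simp only [field]
  rw [A.replication, A.replication]

theorem residueBdd (a b x : M) :
    ResidueBdd (fun i j => A.Y a i (A.Y b j x)) (fun i j => A.Y b j (A.Y a i x)) :=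
  (A.field a).residueBdd (A.field b) x

/-- The iterate formula. -/
theorem Y_Y_apply (a b x : M) (n m : ℤ) : A.Y (A.Y a n b) m x =
    residueProd (fun i j => A.Y a i (A.Y b j x)) (fun i j => A.Y b j (A.Y a i x)) n m := by
  rw [Y_Y]
  rfl

/-- The commutator formula. -/
theorem commutator (a b : M) (K : ℕ) (hK : ∀ j : ℕ, K ≤ j → A.Y a j b = 0) (m n : ℤ) (x : M) :
    A.Y a m (A.Y b n x) = A.Y b n (A.Y a m x) +
      ∑ j ∈ Finset.range K, Ring.choose m j • A.Y (A.Y a j b) (m + n - j) x := by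
  rw [← sub_eq_iff_eq_add']
  obtain ⟨N, hN⟩ := A.localModes a b
  have h := eq_sum_of_shiftDiff_iterate_eq_zero (max N K) _
    (shiftDiff_iterate_mono (le_max_left N K) hN) m n
  have h2 := LinearMap.congr_fun h x
  simp only [LinearMap.sub_apply, Module.End.mul_apply, LinearMap.sum_apply,
    LinearMap.smul_apply] at h2
  rw [h2]
  have e : ∀ j : ℕ, (shiftDiff^[j] (fun i j => A.Y a i * A.Y b j - A.Y b j * A.Y a i) 0
      (m + n - j)) x = A.Y (A.Y a j b) (m + n - j) x := by
    intro j
    rw [Y_Y_apply, residueProd_natCast (A.residueBdd a b x)]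
    exact (shiftDiff_iterate_map (LinearMap.applyₗ x).toAddMonoidHom j
      (fun i j => A.Y a i * A.Y b j - A.Y b j * A.Y a i) 0 (m + n - j)).symm
  simp only [e]
  symm
  refine Finset.sum_subset (Finset.range_subset_range.2 (le_max_right N K)) fun j _ hj => ?_
  rw [hK j (by simpa using hj)]
  simp

theorem commutator_of_one {a b : M} (h : ∀ j : ℕ, 1 ≤ j → A.Y a j b = 0) (m n : ℤ) (x : M) :
    A.Y a m (A.Y b n x) = A.Y b n (A.Y a m x) + A.Y (A.Y a 0 b) (m + n) x := by
  rw [A.commutator a b 1 h]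
  simp

theorem commutator_of_two {a b : M} (h : ∀ j : ℕ, 2 ≤ j → A.Y a j b = 0) (m n : ℤ) (x : M) :
    A.Y a m (A.Y b n x) = A.Y b n (A.Y a m x) + A.Y (A.Y a 0 b) (m + n) x +
      m • A.Y (A.Y a 1 b) (m + n - 1) x := by
  rw [A.commutator a b 2 h]
  simp [Finset.sum_range_succ, add_assoc]

/-- Two states commute if all products `a_(n)b` with `n ≥ 0` vanish. -/
def Commuting (a b : M) : Prop := ∀ n : ℤ, 0 ≤ n → A.Y a n b = 0

variable {A}

theorem Commuting.comm {a b : M} (h : A.Commuting a b) (m n : ℤ) (x : M) :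
    A.Y a m (A.Y b n x) = A.Y b n (A.Y a m x) := by
  rw [A.commutator a b 0 (fun j _ => h j (by omega))]
  simp

theorem Commuting.symm {a b : M} (h : A.Commuting a b) : A.Commuting b a := fun n hn => by
  rw [← A.replication a, ← h.comm, A.replication_nonneg b n hn, map_zero]

theorem Commuting.Y {a b c : M} (hb : A.Commuting a b) (hc : A.Commuting a c) (n : ℤ) :
    A.Commuting a (A.Y b n c) := fun m hm => by
  rw [hb.comm, hc m hm, map_zero]

theorem Commuting.add {a b c : M} (hb : A.Commuting a b) (hc : A.Commuting a c) :
    A.Commuting a (b + c) := fun m hm => by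
  rw [map_add, hb m hm, hc m hm, add_zero]

theorem Commuting.sum {a : M} {ι : Type*} {s : Finset ι} {f : ι → M}
    (h : ∀ i ∈ s, A.Commuting a (f i)) : A.Commuting a (∑ i ∈ s, f i) := fun m hm => by
  rw [map_sum, Finset.sum_eq_zero fun i hi => h i hi m hm]

variable (A)

/-- `S` generates the vertex algebra: a subspace that contains the vacuum vector and is closed
under the modes of the elements of `S` is the whole space. -/
def Generates (S : Set M) : Prop :=
  ∀ N : Submodule ℂ M, A.vac ∈ N → (∀ a ∈ S, ∀ n, ∀ w ∈ N, A.Y a n w ∈ N) → N = ⊤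

variable {A A'}

/-- A vertex algebra structure is determined by its vacuum vector and by generating fields. -/
theorem Generates.ext {A A' : VertexAlgebra M} {S : Set M} (hS : A.Generates S)
    (hvac : A.vac = A'.vac) (h : ∀ a ∈ S, A.Y a = A'.Y a) : A = A' := by
  let N : Submodule ℂ M := LinearMap.eqLocus A.Y A'.Y
  have hN : N = ⊤ := by
    refine hS N ?_ fun a ha n w hw => ?_
    · change A.Y A.vac = A'.Y A.vac
      conv_rhs => rw [hvac]
      funext n
      rw [A.vacuum, A'.vacuum]
    · change A.Y _ = A'.Y _
      have hw : A.Y w = A'.Y w := hw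
      have e : A.Y a n w = A'.Y a n w := by rw [h a ha]
      conv_rhs => rw [e]
      funext m
      ext x
      rw [Y_Y_apply, Y_Y_apply, h a ha, hw]
  have hY : A.Y = A'.Y := by
    ext1 w
    exact (hN ▸ Submodule.mem_top : w ∈ N)
  refine VertexAlgebra.ext hvac ?_ hY
  ext w
  rw [A.D_eq, A'.D_eq, hY, hvac]

/-- A linear map that preserves the vacuum vector and intertwines the modes of generators is a
homomorphism. -/
theorem Generates.isHom {S : Set M} (hS : A.Generates S) {φ : M →ₗ[ℂ] M'}
    (hvac : φ A.vac = A'.vac)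
    (h : ∀ a ∈ S, ∀ n b, φ (A.Y a n b) = A'.Y (φ a) n (φ b)) : A.IsHom A' φ := by
  refine ⟨hvac, ?_⟩
  let N : Submodule ℂ M :=
    { carrier := {w | ∀ b n, φ (A.Y w n b) = A'.Y (φ w) n (φ b)}
      zero_mem' := by simp
      add_mem' := by
        intro x y hx hy b n
        simp [hx b n, hy b n]
      smul_mem' := by
        intro c x hx b n
        simp [hx b n] }
  have hN : N = ⊤ := by
    refine hS N ?_ fun a ha n w hw b m => ?_
    · intro b n
      rw [hvac, A.vacuum, A'.vacuum]
      split_ifs <;> simp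
    · rw [Y_Y_apply, ← residueProd_linearMap φ (A.residueBdd a w b), h a ha, Y_Y_apply]
      congr 1 <;>
      · funext i j
        first | rw [h a ha, hw] | rw [hw, h a ha]
  intro a
  exact (hN ▸ Submodule.mem_top : a ∈ N)

/-- Homomorphisms are determined by the images of generators. -/
theorem Generates.hom_ext {S : Set M} (hS : A.Generates S) {φ ψ : M →ₗ[ℂ] M'}
    (hφ : A.IsHom A' φ) (hψ : A.IsHom A' ψ) (h : ∀ a ∈ S, φ a = ψ a) : φ = ψ := by
  have hN : LinearMap.eqLocus φ ψ = ⊤ := by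
    refine hS _ ?_ fun a ha n w hw => ?_
    · rw [LinearMap.mem_eqLocus, hφ.map_vac, hψ.map_vac]
    · rw [LinearMap.mem_eqLocus] at hw ⊢
      rw [hφ.map_Y, hψ.map_Y, h a ha, hw]
  ext w
  exact (hN ▸ Submodule.mem_top : w ∈ LinearMap.eqLocus φ ψ)

theorem IsHom.comp {M'' : Type} [AddCommGroup M''] [Module ℂ M''] {A'' : VertexAlgebra M''}
    {ψ : M' →ₗ[ℂ] M''} {φ : M →ₗ[ℂ] M'} (hψ : A'.IsHom A'' ψ) (hφ : A.IsHom A' φ) :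
    A.IsHom A'' (ψ ∘ₗ φ) where
  map_vac := by simp [hφ.map_vac, hψ.map_vac]
  map_Y a b n := by simp [hφ.map_Y, hψ.map_Y]

theorem IsHom.id : A.IsHom A LinearMap.id := ⟨rfl, fun _ _ _ => rfl⟩

theorem IsHom.symm {e : M ≃ₗ[ℂ] M'} (h : A.IsHom A' e.toLinearMap) :
    A'.IsHom A e.symm.toLinearMap where
  map_vac := by
    have := h.map_vac
    simp only [LinearEquiv.coe_coe] at this ⊢
    rw [← this, e.symm_apply_apply]
  map_Y a b n := by
    have := h.map_Y (e.symm a) (e.symm b) n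
    simp only [LinearEquiv.coe_coe, e.apply_symm_apply] at this ⊢
    rw [← this, e.symm_apply_apply]

end VertexAlgebra

/-! ### Powers of commuting currents -/

section Monomials
variable {A : Type*} {N : ℕ}

/-- The ordered monomial `a_1^{s_1} ⋯ a_N^{s_N}`. -/
def orderedMonomial [Monoid A] (a : Fin N → A) (s : Fin N → ℕ) : A :=
  ((List.finRange N).map fun p => a p ^ s p).prod

theorem orderedMonomial_zero [Monoid A] (a : Fin N → A) : orderedMonomial a 0 = 1 :=
  List.prod_eq_one fun x hx => by
    obtain ⟨p, -, rfl⟩ := List.mem_map.1 hx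
    simp

theorem orderedMonomial_add_single [Monoid A] {a : Fin N → A} (ha : ∀ p q, Commute (a p) (a q))
    (s : Fin N → ℕ) (p : Fin N) :
    orderedMonomial a (s + Pi.single p 1) = a p * orderedMonomial a s := by
  have key : ∀ l : List (Fin N), l.Nodup →
      (l.map fun q => a q ^ (s + Pi.single p 1 : Fin N → ℕ) q).prod =
        if p ∈ l then a p * (l.map fun q => a q ^ s q).prod
        else (l.map fun q => a q ^ s q).prod := by
    intro l
    induction l with
    | nil => simp
    | cons q l ih =>
      intro hl
      rw [List.nodup_cons] at hl
      simp only [List.map_cons, List.prod_cons, ih hl.2, List.mem_cons]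
      by_cases hpq : p = q
      · subst hpq
        rw [if_neg hl.1, if_pos (Or.inl rfl)]
        simp [pow_succ', mul_assoc]
      · have : (Pi.single p 1 : Fin N → ℕ) q = 0 := Pi.single_eq_of_ne (Ne.symm hpq) _
        simp only [Pi.add_apply, this, add_zero, hpq, false_or]
        split_ifs
        · rw [← mul_assoc, ((ha q p).pow_left (s q)).eq, mul_assoc]
        · rfl
  rw [orderedMonomial, key _ (List.nodup_finRange N), if_pos (List.mem_finRange p)]
  rfl

theorem multiIndex_induction {motive : (Fin N → ℕ) → Prop} (zero : motive 0)
    (step : ∀ s p, motive s → motive (s + Pi.single p 1)) (s : Fin N → ℕ) : motive s := by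
  induction h : ∑ p, s p generalizing s with
  | zero =>
    rw [Finset.sum_eq_zero_iff] at h
    obtain rfl : s = 0 := funext fun p => h p (Finset.mem_univ p)
    exact zero
  | succ n ih =>
    obtain ⟨p, -, hp⟩ : ∃ p ∈ Finset.univ, s p ≠ 0 := by
      by_contra! hc
      rw [Finset.sum_eq_zero hc] at h
      omega
    have e : s = (s - Pi.single p 1) + Pi.single p 1 := by
      funext q
      by_cases hq : q = p
      · subst hq; simp; omega
      · simp [Pi.single_eq_of_ne hq]
    rw [e] at h ⊢
    refine step _ p (ih _ ?_)
    simp only [Pi.add_apply, Finset.sum_add_distrib, Finset.sum_pi_single', Finset.mem_univ,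
      if_true] at h
    omega

theorem sub_single_add_single {s : Fin N → ℕ} {p : Fin N} (hp : s p ≠ 0) (q : Fin N) :
    s + Pi.single q 1 - Pi.single p 1 = s - Pi.single p 1 + Pi.single q 1 := by
  funext r
  by_cases hr : r = p
  · subst hr
    simp only [Pi.sub_apply, Pi.add_apply, Pi.single_eq_same]
    omega
  · simp [Pi.single_eq_of_ne hr]

/-- If `[T, a_p] = τ_p` commutes with all the `a_q`, then `T` acts on monomials in the `a_p` like
the derivation `∑_p τ_p ∂/∂a_p`. -/
theorem mul_orderedMonomial [Ring A] {a τ : Fin N → A} (ha : ∀ p q, Commute (a p) (a q)) {T : A}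
    (hT : ∀ p, T * a p = a p * T + τ p) (hτ : ∀ p q, Commute (τ p) (a q)) (s : Fin N → ℕ) :
    T * orderedMonomial a s = orderedMonomial a s * T +
      ∑ p, s p • (τ p * orderedMonomial a (s - Pi.single p 1)) := by
  induction s using multiIndex_induction with
  | zero => simp [orderedMonomial_zero]
  | step s q ih =>
    rw [orderedMonomial_add_single ha, ← mul_assoc, hT, add_mul, mul_assoc, ih, mul_add,
      mul_assoc, add_assoc]
    congr 1
    have e : ∀ p, (s + Pi.single q 1 : Fin N → ℕ) p •
        (τ p * orderedMonomial a (s + Pi.single q 1 - Pi.single p 1)) =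
        s p • (a q * (τ p * orderedMonomial a (s - Pi.single p 1))) +
        if p = q then τ q * orderedMonomial a s else 0 := by
      intro p
      by_cases hp : s p = 0
      · by_cases hpq : p = q
        · subst hpq; simp [hp]
        · simp [hp, hpq]
      · rw [sub_single_add_single hp, orderedMonomial_add_single ha, ← mul_assoc (τ p),
          (hτ p q).eq, mul_assoc (a q)]
        by_cases hpq : p = q
        · subst hpq
          simp only [Pi.add_apply, Pi.single_eq_same, add_smul, one_smul, if_true]
          congr 1
          rw [← mul_assoc, ← (hτ p p).eq, mul_assoc, ← orderedMonomial_add_single ha]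
          congr 2
          funext r
          by_cases hr : r = p
          · subst hr; simp; omega
          · simp [Pi.single_eq_of_ne hr]
        · simp [hpq]
    simp only [e, Finset.sum_add_distrib, Finset.sum_ite_eq', Finset.mem_univ, if_true,
      Finset.mul_sum, mul_smul_comm]

end Monomials

section ExponentialFields
variable {M : Type} [AddCommGroup M] [Module ℂ M] {N : ℕ}

/-- Operators `u_p(n)` which pairwise commute, with `u_p(n)x = 0` for large `n` and `u_p(0) = 0`. -/
structure CommutingCurrents (U : Fin N → ℤ → Module.End ℂ M) : Prop where
  comm : ∀ p q m n x, U p m (U q n x) = U q n (U p m x)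
  trunc : ∀ p x, ∃ n₀ : ℤ, ∀ n, n₀ ≤ n → U p n x = 0
  zero : ∀ p, U p 0 = 0

variable (U : Fin N → ℤ → Module.End ℂ M)

/-- The coefficient at `z^n` of `ū_p(z) = ∑_{j ≠ 0} (1/j) u_p(-j) z^j`. -/
def ubarCoeff (p : Fin N) (n : ℤ) : Module.End ℂ M :=
  if n = 0 then 0 else (n : ℂ)⁻¹ • U p (-n)

/-- `g(z) = ∑_n g_n z^n` is bounded by `J`: it has no terms with `n < -J`, and all coefficients are
killed by `u_p(j)` for `j ≥ J`. -/
def SeriesBdd (J : ℤ) (g : ℤ → M) : Prop :=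
  (∀ n p j, J ≤ j → U p j (g n) = 0) ∧ ∀ n, n < -J → g n = 0

variable {U}

theorem SeriesBdd.mono {J J' : ℤ} {g : ℤ → M} (h : SeriesBdd U J g) (hJ : J ≤ J') :
    SeriesBdd U J' g :=
  ⟨fun n p j hj => h.1 n p j (hJ.trans hj), fun n hn => h.2 n (by omega)⟩

variable (U) in
/-- The series on which the operators `ū_p(z)` are defined. -/
def boundedSeries : Submodule ℂ (ℤ → M) where
  carrier := {g | ∃ J, SeriesBdd U J g}
  zero_mem' := ⟨0, by simp [SeriesBdd]⟩
  add_mem' := by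
    rintro g g' ⟨J, h⟩ ⟨J', h'⟩
    have h := h.mono (le_max_left J J')
    have h' := h'.mono (le_max_right J J')
    refine ⟨max J J', fun n p j hj => ?_, fun n hn => ?_⟩
    · rw [Pi.add_apply, map_add, h.1 n p j hj, h'.1 n p j hj, add_zero]
    · rw [Pi.add_apply, h.2 n hn, h'.2 n hn, add_zero]
  smul_mem' := by
    rintro c g ⟨J, h⟩
    refine ⟨J, fun n p j hj => ?_, fun n hn => ?_⟩
    · rw [Pi.smul_apply, map_smul, h.1 n p j hj, smul_zero]
    · rw [Pi.smul_apply, h.2 n hn, smul_zero]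

theorem actSeries_eq_sum {J : ℤ} {g : ℤ → M} (hg : SeriesBdd U J g) (p : Fin N) (n : ℤ) {a b : ℤ}
    (ha : a ≤ -J) (hb : n + J ≤ b) :
    actSeries (ubarCoeff U p) g n = ∑ m ∈ Finset.Icc a b, ubarCoeff U p m (g (n - m)) := by
  refine finsum_eq_sum_of_support_subset _ fun m hm => ?_
  rw [Finset.coe_Icc, Set.mem_Icc]
  by_contra hc
  refine hm ?_
  dsimp only
  by_cases h : m < a
  · rw [ubarCoeff]
    split_ifs
    · rfl
    · rw [LinearMap.smul_apply, hg.1 _ _ _ (by omega), smul_zero]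
  · rw [hg.2 _ (by omega), map_zero]

namespace CommutingCurrents
variable (hU : CommutingCurrents U)
include hU

theorem ubarCoeff_comm (p q : Fin N) (m n : ℤ) (x : M) :
    ubarCoeff U p m (U q n x) = U q n (ubarCoeff U p m x) := by
  rw [ubarCoeff]
  split_ifs
  · simp
  · simp [hU.comm p q]

theorem ubarCoeff_comm' (p q : Fin N) (m n : ℤ) (x : M) :
    ubarCoeff U p m (ubarCoeff U q n x) = ubarCoeff U q n (ubarCoeff U p m x) := by
  rw [ubarCoeff.eq_1 U q n]
  split_ifs
  · simp
  · rw [LinearMap.smul_apply, map_smul, hU.ubarCoeff_comm, LinearMap.smul_apply]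

theorem actSeries_bdd {J : ℤ} {g : ℤ → M} (hg : SeriesBdd U J g) (p : Fin N) :
    SeriesBdd U (2 * |J|) (actSeries (ubarCoeff U p) g) := by
  have h1 := le_abs_self J
  have h2 := abs_nonneg J
  refine ⟨fun n q j hj => ?_, fun n hn => ?_⟩
  · rw [actSeries_eq_sum hg p n le_rfl le_rfl, map_sum, Finset.sum_eq_zero]
    intro m _
    rw [← hU.ubarCoeff_comm, hg.1 _ _ _ (by omega), map_zero]
  · rw [actSeries_eq_sum hg p n le_rfl le_rfl, Finset.Icc_eq_empty (by omega), Finset.sum_empty]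

/-- The operator of multiplication by `ū_p(z)` on bounded series. -/
def ubarEnd (p : Fin N) : Module.End ℂ (boundedSeries U) where
  toFun g := ⟨actSeries (ubarCoeff U p) g, by
    obtain ⟨J, hJ⟩ := g.2
    exact ⟨_, hU.actSeries_bdd hJ p⟩⟩
  map_add' g g' := by
    obtain ⟨J₀, h₀⟩ := (g + g').2
    obtain ⟨J, h⟩ := g.2
    obtain ⟨J', h'⟩ := g'.2
    have h₀ := h₀.mono (le_max_left J₀ (max J J'))
    have h := h.mono ((le_max_left J J').trans (le_max_right J₀ _))
    have h' := h'.mono ((le_max_right J J').trans (le_max_right J₀ _))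
    ext n
    simp only [Submodule.coe_add, Pi.add_apply]
    rw [actSeries_eq_sum h p n le_rfl le_rfl, actSeries_eq_sum h' p n le_rfl le_rfl,
      ← Finset.sum_add_distrib]
    refine (actSeries_eq_sum h₀ p n le_rfl le_rfl).trans (Finset.sum_congr rfl fun m _ => ?_)
    simp
  map_smul' c g := by
    obtain ⟨J₀, h₀⟩ := (c • g).2
    obtain ⟨J, h⟩ := g.2
    have h₀ := h₀.mono (le_max_left J₀ J)
    have h := h.mono (le_max_right J₀ J)
    ext n
    simp only [RingHom.id_apply, Submodule.coe_smul, Pi.smul_apply]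
    rw [actSeries_eq_sum h p n le_rfl le_rfl, Finset.smul_sum]
    refine (actSeries_eq_sum h₀ p n le_rfl le_rfl).trans (Finset.sum_congr rfl fun m _ => ?_)
    simp

theorem coe_ubarEnd (p : Fin N) (g : boundedSeries U) :
    (hU.ubarEnd p g : ℤ → M) = actSeries (ubarCoeff U p) g := rfl

theorem ubarEnd_commute (p q : Fin N) : Commute (hU.ubarEnd p) (hU.ubarEnd q) := by
  have key : ∀ (p q : Fin N) (J : ℤ) (g : ℤ → M), SeriesBdd U J g → ∀ n b : ℤ,
      n + 2 * |J| + |J| ≤ b →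
      actSeries (ubarCoeff U p) (actSeries (ubarCoeff U q) g) n =
        ∑ m ∈ Finset.Icc (-(2 * |J|)) b, ∑ k ∈ Finset.Icc (-(2 * |J|)) b,
          ubarCoeff U p m (ubarCoeff U q k (g (n - m - k))) := by
    intro p q J g hg n b hb
    have h1 := le_abs_self J
    have h2 := abs_nonneg J
    rw [actSeries_eq_sum (hU.actSeries_bdd hg q) p n (le_refl (-(2 * |J|))) (b := b) (by omega)]
    refine Finset.sum_congr rfl fun m hm => ?_
    rw [Finset.mem_Icc] at hm
    rw [actSeries_eq_sum hg q (n - m) (a := -(2 * |J|)) (b := b) (by omega) (by omega), map_sum]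
  refine LinearMap.ext fun g => Subtype.ext (funext fun n => ?_)
  obtain ⟨J, hJ⟩ := g.2
  change actSeries (ubarCoeff U p) (actSeries (ubarCoeff U q) g) n =
    actSeries (ubarCoeff U q) (actSeries (ubarCoeff U p) g) n
  rw [key p q J g hJ n _ le_rfl, key q p J g hJ n _ le_rfl, Finset.sum_comm]
  refine Finset.sum_congr rfl fun m _ => Finset.sum_congr rfl fun k _ => ?_
  rw [hU.ubarCoeff_comm', sub_right_comm]

theorem single_mem (w : M) : (Pi.single 0 w : ℤ → M) ∈ boundedSeries U := by
  choose n₀ h using fun p => hU.trunc p w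
  refine ⟨∑ p, |n₀ p|, fun n p j hj => ?_, fun n hn => ?_⟩
  · by_cases hn : n = 0
    · subst hn
      rw [Pi.single_eq_same]
      refine h p j ?_
      have := Finset.single_le_sum (f := fun p => |n₀ p|) (fun i _ => abs_nonneg _)
        (Finset.mem_univ p)
      have := le_abs_self (n₀ p)
      omega
    · rw [Pi.single_eq_of_ne hn, map_zero]
  · have : 0 ≤ ∑ p, |n₀ p| := Finset.sum_nonneg fun i _ => abs_nonneg _
    exact Pi.single_eq_of_ne (by omega) _

/-- The constant series `w z^0`. -/
def const : M →ₗ[ℂ] boundedSeries U where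
  toFun w := ⟨Pi.single 0 w, hU.single_mem w⟩
  map_add' x y := by
    ext n
    by_cases h : n = 0
    · subst h; simp
    · simp [Pi.single_eq_of_ne h]
  map_smul' c x := by
    ext n
    by_cases h : n = 0
    · subst h; simp
    · simp [Pi.single_eq_of_ne h]

/-- The coefficient at `z^n` of `ū(z)^s w`. -/
def power (s : Fin N → ℕ) (n : ℤ) : Module.End ℂ M :=
  LinearMap.proj n ∘ₗ (boundedSeries U).subtype ∘ₗ orderedMonomial hU.ubarEnd s ∘ₗ hU.const

theorem foldr_actSeries (s : Fin N → ℕ) (w : M) (n : ℤ) :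
    (List.finRange N).foldr (fun p g => (actSeries (ubarCoeff U p))^[s p] g) (Pi.single 0 w) n =
      hU.power s n w := by
  have it : ∀ (p : Fin N) (k : ℕ) (g : boundedSeries U),
      (actSeries (ubarCoeff U p))^[k] (g : ℤ → M) = ((hU.ubarEnd p ^ k) g : boundedSeries U) := by
    intro p k g
    induction k with
    | zero => rfl
    | succ k ih => rw [Function.iterate_succ_apply', ih, pow_succ', Module.End.mul_apply]; rfl
  have key : ∀ l : List (Fin N),
      l.foldr (fun p g => (actSeries (ubarCoeff U p))^[s p] g) (Pi.single 0 w) =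
        ((l.map fun p => hU.ubarEnd p ^ s p).prod (hU.const w) : boundedSeries U) := by
    intro l
    induction l with
    | nil => rfl
    | cons p l ih =>
      rw [List.foldr_cons, ih, it, List.map_cons, List.prod_cons, Module.End.mul_apply]
  rw [key]
  rfl

/-- An operator `t` whose commutators with the coefficients `ū_{p,m}` are the ones of the operator
`T = t - c d/dz` on series with `[T, ū_p(z)] = z^k σ_p`. -/
structure Derives (U : Fin N → ℤ → Module.End ℂ M) (t : Module.End ℂ M) (c : ℂ) (k : ℤ) (σ : Fin N → Module.End ℂ M) :
    Prop where
  bdd : ∀ J : ℤ, ∃ J' : ℤ, ∀ x, (∀ p j, J ≤ j → U p j x = 0) → ∀ p j, J' ≤ j → U p j (t x) = 0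
  comm : ∀ p q m x, σ p (U q m x) = U q m (σ p x)
  lie : ∀ p m x, t (ubarCoeff U p m x) = ubarCoeff U p m (t x) +
    (c * (m + 1)) • ubarCoeff U p (m + 1) x + if m = k then σ p x else 0

omit hU
namespace Derives
variable {t : Module.End ℂ M} {c : ℂ} {k : ℤ} {σ : Fin N → Module.End ℂ M}
  (ht : Derives U t c k σ)
include ht

/-- The operator `T = t - c d/dz` on bounded series. -/
def seriesEnd : Module.End ℂ (boundedSeries U) where
  toFun g := ⟨fun n => t (g.1 n) - (c * (n + 1)) • g.1 (n + 1), by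
    obtain ⟨J, hJ⟩ := g.2
    obtain ⟨J', hJ'⟩ := ht.bdd J
    refine ⟨max (J + 1) J', fun n p j hj => ?_, fun n hn => ?_⟩
    · rw [map_sub, hJ' _ (hJ.1 n) p j (by omega), map_smul, hJ.1 _ _ _ (by omega), smul_zero,
        sub_zero]
    · dsimp only
      rw [hJ.2 n (by omega), hJ.2 (n + 1) (by omega), map_zero, smul_zero, sub_zero]⟩
  map_add' g g' := by
    ext n
    simp only [Submodule.coe_add, Pi.add_apply, map_add, smul_add]
    abel
  map_smul' r g := by
    ext n
    simp only [Submodule.coe_smul, Pi.smul_apply, map_smul, smul_sub, RingHom.id_apply]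
    rw [smul_comm r]

/-- The operator `z^k σ_p` on bounded series. -/
def shiftEnd (p : Fin N) : Module.End ℂ (boundedSeries U) where
  toFun g := ⟨fun n => σ p (g.1 (n - k)), by
    obtain ⟨J, hJ⟩ := g.2
    refine ⟨max J (J - k), fun n q j hj => ?_, fun n hn => ?_⟩
    · rw [← ht.comm, hJ.1 _ _ _ (by omega), map_zero]
    · dsimp only
      rw [hJ.2 _ (by omega), map_zero]⟩
  map_add' g g' := by
    ext n
    simp
  map_smul' r g := by
    ext n
    simp

theorem shiftEnd_commute (hU : CommutingCurrents U) (p q : Fin N) :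
    Commute (ht.shiftEnd p) (hU.ubarEnd q) := by
  refine LinearMap.ext fun g => Subtype.ext (funext fun n => ?_)
  obtain ⟨J, hJ⟩ := g.2
  have hJ := hJ.mono (le_max_left J (J - k))
  obtain ⟨J', hJ'⟩ := (ht.shiftEnd p g).2
  change σ p (actSeries (ubarCoeff U q) g (n - k)) =
    actSeries (ubarCoeff U q) (ht.shiftEnd p g : ℤ → M) n
  obtain ⟨a, b, h1, h2, h3, h4⟩ : ∃ a b : ℤ, a ≤ -max J (J - k) ∧ n - k + max J (J - k) ≤ b ∧
      a ≤ -J' ∧ n + J' ≤ b :=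
    ⟨min (-max J (J - k)) (-J'), max (n - k + max J (J - k)) (n + J'), by omega, by omega,
      by omega, by omega⟩
  rw [actSeries_eq_sum hJ q (n - k) h1 h2, actSeries_eq_sum hJ' q n h3 h4, map_sum]
  refine Finset.sum_congr rfl fun m _ => ?_
  change _ = ubarCoeff U q m (σ p (g.1 (n - m - k)))
  rw [show n - m - k = n - k - m by ring, ubarCoeff]
  split_ifs
  · simp
  · simp [ht.comm]

theorem seriesEnd_mul_ubarEnd (hU : CommutingCurrents U) (p : Fin N) :
    ht.seriesEnd * hU.ubarEnd p = hU.ubarEnd p * ht.seriesEnd + ht.shiftEnd p := by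
  refine LinearMap.ext fun g => Subtype.ext (funext fun n => ?_)
  obtain ⟨J, hJ⟩ := g.2
  obtain ⟨J', hJ'⟩ := (ht.seriesEnd g).2
  obtain ⟨K, h1, h2, h3⟩ : ∃ K, J + 1 ≤ K ∧ J' ≤ K ∧ |k| ≤ K :=
    ⟨max (J + 1) (max J' |k|), le_max_left _ _, by simp, by simp⟩
  have hJ1 := hJ.mono (by omega : J ≤ K - 1)
  have hJ := hJ.mono (by omega : J ≤ K)
  have hJ' := hJ'.mono h2
  have hk1 := le_abs_self k
  have hk2 := neg_le_abs k
  change t (actSeries (ubarCoeff U p) g n) - (c * (n + 1)) • actSeries (ubarCoeff U p) g (n + 1) =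
    actSeries (ubarCoeff U p) (ht.seriesEnd g : ℤ → M) n + σ p (g.1 (n - k))
  rw [actSeries_eq_sum hJ p n (a := -K) (b := n + K) le_rfl le_rfl,
    actSeries_eq_sum hJ p (n + 1) (a := -K) (b := n + K + 1) le_rfl (by omega),
    actSeries_eq_sum hJ' p n (a := -K) (b := n + K) le_rfl le_rfl]
  have e1 : ∀ m, ubarCoeff U p m ((ht.seriesEnd g : ℤ → M) (n - m)) =
      ubarCoeff U p m (t (g.1 (n - m))) -
        (c * ((n - m : ℤ) + 1)) • ubarCoeff U p m (g.1 (n + 1 - m)) := by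
    intro m
    change ubarCoeff U p m (t (g.1 (n - m)) - (c * ((n - m : ℤ) + 1)) • g.1 (n - m + 1)) = _
    rw [map_sub, map_smul, show n - m + 1 = n + 1 - m by ring]
  have e2 : ∑ m ∈ Finset.Icc (-K) (n + K), (if m = k then σ p (g.1 (n - m)) else 0) =
      σ p (g.1 (n - k)) := by
    by_cases hmem : k ∈ Finset.Icc (-K) (n + K)
    · rw [Finset.sum_ite_eq' _ _ (fun m => σ p (g.1 (n - m))), if_pos hmem]
    · rw [Finset.sum_eq_zero]
      · rw [Finset.mem_Icc] at hmem
        rw [hJ.2 _ (by omega), map_zero]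
      · intro m hm
        rw [if_neg]
        rintro rfl
        exact hmem hm
  -- the terms with `z`-derivatives telescope
  have e3 : ∑ m ∈ Finset.Icc (-K) (n + K), (c * ((m : ℂ) + 1)) •
      ubarCoeff U p (m + 1) (g.1 (n - m)) =
      ∑ m ∈ Finset.Icc (-K) (n + K + 1), (c * (m : ℂ)) • ubarCoeff U p m (g.1 (n + 1 - m)) := by
    have im := Finset.sum_image (s := Finset.Icc (-K) (n + K)) (g := fun m : ℤ => m + 1)
      (f := fun m : ℤ => (c * (m : ℂ)) • ubarCoeff U p m (g.1 (n + 1 - m)))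
      (fun _ _ _ _ h => by simpa using h)
    rw [Finset.image_add_right_Icc] at im
    have sub := Finset.sum_subset (Finset.Icc_subset_Icc (by omega : -K ≤ -K + 1)
      (le_refl (n + K + 1))) (f := fun m : ℤ => (c * (m : ℂ)) • ubarCoeff U p m (g.1 (n + 1 - m)))
      (fun m hm hm' => by
        rw [Finset.mem_Icc] at hm hm'
        rw [ubarCoeff]
        split_ifs
        · simp
        · rw [LinearMap.smul_apply, hJ.1 _ _ _ (by omega)]
          simp)
    rw [← sub, im]
    refine Finset.sum_congr rfl fun m _ => ?_
    rw [show n + 1 - (m + 1) = n - m by ring]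
    push_cast
    rfl
  have e4 : ∑ m ∈ Finset.Icc (-K) (n + K), (c * ((n - m : ℤ) + 1)) •
        ubarCoeff U p m (g.1 (n + 1 - m)) =
      ∑ m ∈ Finset.Icc (-K) (n + K + 1), (c * ((n - m : ℤ) + 1)) •
        ubarCoeff U p m (g.1 (n + 1 - m)) := by
    refine Finset.sum_subset (Finset.Icc_subset_Icc le_rfl (by omega)) fun m hm hm' => ?_
    rw [Finset.mem_Icc] at hm hm'
    rw [hJ1.2 _ (by omega), map_zero, smul_zero]
  simp only [e1, Finset.sum_sub_distrib]
  rw [e4, map_sum]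
  simp only [ht.lie, Finset.sum_add_distrib]
  rw [e2, e3, Finset.smul_sum]
  have : ∑ m ∈ Finset.Icc (-K) (n + K + 1), (c * (m : ℂ)) • ubarCoeff U p m (g.1 (n + 1 - m)) =
    ∑ m ∈ Finset.Icc (-K) (n + K + 1), (c * (n + 1)) • ubarCoeff U p m (g.1 (n + 1 - m)) -
    ∑ m ∈ Finset.Icc (-K) (n + K + 1), (c * ((n - m : ℤ) + 1)) •
        ubarCoeff U p m (g.1 (n + 1 - m)) := by
    rw [← Finset.sum_sub_distrib]
    refine Finset.sum_congr rfl fun m _ => ?_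
    rw [← sub_smul]
    congr 1
    push_cast
    ring
  rw [this]
  abel

theorem seriesEnd_const (hU : CommutingCurrents U) (w : M) :
    ht.seriesEnd (hU.const w) = hU.const (t w) := by
  refine Subtype.ext (funext fun n => ?_)
  change t ((Pi.single 0 w : ℤ → M) n) - (c * (n + 1)) • (Pi.single 0 w : ℤ → M) (n + 1) =
    (Pi.single 0 (t w) : ℤ → M) n
  have h2 : (c * ((n : ℂ) + 1)) • (Pi.single 0 w : ℤ → M) (n + 1) = 0 := by
    by_cases h : n + 1 = 0
    · obtain rfl : n = -1 := by omega
      simp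
    · rw [Pi.single_eq_of_ne h, smul_zero]
  rw [h2, sub_zero]
  by_cases h : n = 0
  · subst h; simp
  · simp [Pi.single_eq_of_ne h]

/-- The commutation relation of `t` with the coefficients of the powers of `ū(z)`. -/
theorem map_power (hU : CommutingCurrents U) (s : Fin N → ℕ) (n : ℤ) (w : M) :
    t (hU.power s n w) = hU.power s n (t w) + (c * (n + 1)) • hU.power s (n + 1) w +
      ∑ p, s p • σ p (hU.power (s - Pi.single p 1) (n - k) w) := by
  have h := mul_orderedMonomial (A := Module.End ℂ (boundedSeries U)) (T := ht.seriesEnd)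
    (τ := ht.shiftEnd) hU.ubarEnd_commute (ht.seriesEnd_mul_ubarEnd hU)
    (ht.shiftEnd_commute hU) s
  have h1 := congrArg (fun g : boundedSeries U => g.1 n) (LinearMap.congr_fun h (hU.const w))
  simp only [Module.End.mul_apply, LinearMap.add_apply, ht.seriesEnd_const, Submodule.coe_add,
    Pi.add_apply, LinearMap.sum_apply, LinearMap.smul_apply, Submodule.coe_sum,
    Finset.sum_apply] at h1
  have h2 : t (hU.power s n w) - (c * (n + 1)) • hU.power s (n + 1) w = hU.power s n (t w) +
    ∑ p, s p • σ p (hU.power (s - Pi.single p 1) (n - k) w) := h1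
  rw [sub_eq_iff_eq_add] at h2
  rw [h2]
  abel

end Derives

section Bound
variable (hU : CommutingCurrents U)

/-- The coefficient of `ū(z)^s w` at `z^n` vanishes for `n < |s| + b`. -/
def PowerBdd (b : ℤ) (w : M) : Prop :=
  ∀ s n, n < (∑ p, s p : ℕ) + b → hU.power s n w = 0

variable {hU}

theorem PowerBdd.mono {b b' : ℤ} {w : M} (h : PowerBdd hU b w) (hb : b' ≤ b) :
    PowerBdd hU b' w := fun s n hn => h s n (by omega)

theorem PowerBdd.add {b : ℤ} {w w' : M} (h : PowerBdd hU b w) (h' : PowerBdd hU b w') :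
    PowerBdd hU b (w + w') := fun s n hn => by rw [map_add, h s n hn, h' s n hn, add_zero]

theorem PowerBdd.smul {b : ℤ} {w : M} (h : PowerBdd hU b w) (c : ℂ) :
    PowerBdd hU b (c • w) := fun s n hn => by rw [map_smul, h s n hn, smul_zero]

/-- On vectors killed by all `u_p(j)`, `j > 0`, only the positive powers of `z` in `ū_p(z)` act. -/
theorem PowerBdd.of_killed {w : M} (hw : ∀ p j, 0 < j → U p j w = 0) : PowerBdd hU 0 w := by
  have key : ∀ s : Fin N → ℕ,
      (∀ n p j, 0 < j → U p j ((orderedMonomial hU.ubarEnd s (hU.const w)).1 n) = 0) ∧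
      ∀ n < ((∑ p, s p : ℕ) : ℤ), (orderedMonomial hU.ubarEnd s (hU.const w)).1 n = 0 := by
    intro s
    induction s using multiIndex_induction with
    | zero =>
      rw [orderedMonomial_zero]
      have e : ∀ n, n ≠ 0 → ((1 : Module.End ℂ (boundedSeries U)) (hU.const w)).1 n = 0 :=
        fun n hn => Pi.single_eq_of_ne hn _
      refine ⟨fun n p j hj => ?_, fun n hn => e n (by simp at hn; omega)⟩
      by_cases hn : n = 0
      · subst hn
        exact hw p j hj
      · rw [e n hn, map_zero]
    | step s q ih =>
      rw [orderedMonomial_add_single hU.ubarEnd_commute, Module.End.mul_apply]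
      set g := orderedMonomial hU.ubarEnd s (hU.const w)
      have hg : SeriesBdd U 1 g.1 :=
        ⟨fun n p j hj => ih.1 n p j (by omega), fun n hn => ih.2 n (by omega)⟩
      rw [coe_ubarEnd]
      refine ⟨fun n p j hj => ?_, fun n hn => ?_⟩
      · rw [actSeries_eq_sum hg q n le_rfl le_rfl, map_sum, Finset.sum_eq_zero]
        intro m _
        rw [← hU.ubarCoeff_comm, ih.1 _ _ _ hj, map_zero]
      · simp only [Pi.add_apply, Finset.sum_add_distrib, Finset.sum_pi_single', Finset.mem_univ,
          if_true] at hn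
        rw [actSeries_eq_sum hg q n le_rfl le_rfl, Finset.sum_eq_zero]
        intro m _
        by_cases hm : m ≤ 0
        · rw [ubarCoeff]
          split_ifs
          · rfl
          · rw [LinearMap.smul_apply, ih.1 _ _ _ (by omega), smul_zero]
        · rw [ih.2 _ (by push_cast at hn ⊢; omega), map_zero]
  intro s n hn
  exact (key s).2 n (by omega)

theorem PowerBdd.derives {t : Module.End ℂ M} {c : ℂ} {k : ℤ} {σ : Fin N → Module.End ℂ M}
    (ht : Derives U t c k σ) {b : ℤ} {w : M} (h : PowerBdd hU b w) :
    PowerBdd hU (min (b - 1) (b - 1 + k)) (t w) := by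
  intro s n hn
  have e := ht.map_power hU s n w
  rw [h s n (by omega), h s (n + 1) (by omega), Finset.sum_eq_zero, map_zero] at e
  · simpa using e.symm
  · intro p _
    by_cases hs : s p = 0
    · rw [hs, zero_smul]
    · have e : ∑ q, s q = ∑ q, (s - Pi.single p 1 : Fin N → ℕ) q + 1 := by
        conv_lhs => rw [show s = s - Pi.single p 1 + Pi.single p 1 by
          funext q
          by_cases hq : q = p
          · subst hq; simp; omega
          · simp [Pi.single_eq_of_ne hq]]
        simp only [Pi.add_apply, Finset.sum_add_distrib, Finset.sum_pi_single', Finset.mem_univ,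
          if_true]
      rw [h _ _ (by omega), map_zero, smul_zero]

end Bound

end CommutingCurrents

end ExponentialFields

/-! ### The exponential field of a function -/

section ExponentialFields
variable {M : Type} [AddCommGroup M] [Module ℂ M] {N : ℕ} {R : Type} [CommRing R] [Algebra ℂ R]
  {U : Fin N → ℤ → Module.End ℂ M} (hU : CommutingCurrents U) (mul : R →ₗ[ℂ] Module.End ℂ M)
  (d : Fin N → Derivation ℂ R R)

/-- The iterated derivative `∂^s = ∂_1^{s_1} ⋯ ∂_N^{s_N}`. -/
def iteratedPartial (s : Fin N → ℕ) : Module.End ℂ R :=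
  orderedMonomial (fun p => (d p).toLinearMap) s

theorem foldr_derivation (s : Fin N → ℕ) (f : R) :
    (List.finRange N).foldr (fun p g => (d p)^[s p] g) f = iteratedPartial d s f := by
  have key : ∀ l : List (Fin N), l.foldr (fun p g => (d p)^[s p] g) f =
      (l.map fun p => (d p).toLinearMap ^ s p).prod f := by
    intro l
    induction l with
    | nil => rfl
    | cons p l ih =>
      rw [List.foldr_cons, ih, List.map_cons, List.prod_cons, Module.End.mul_apply,
        Module.End.pow_apply]
      rfl
  exact key _

theorem iteratedPartial_comm {δ : Module.End ℂ R} (hδ : ∀ p f, δ (d p f) = d p (δ f))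
    (s : Fin N → ℕ) (f : R) : δ (iteratedPartial d s f) = iteratedPartial d s (δ f) := by
  have h : ∀ l : List (Fin N), Commute δ (l.map fun p => (d p).toLinearMap ^ s p).prod := by
    intro l
    refine Commute.list_prod_right _ _ fun x hx => ?_
    obtain ⟨p, -, rfl⟩ := List.mem_map.1 hx
    exact Commute.pow_right (LinearMap.ext fun f => hδ p f) _
  exact LinearMap.congr_fun (h (List.finRange N)).eq f

/-- The coefficient at `z^n` of `∑_s (1/s!) ū(z)^s ∂^s f`, applied to `w`. -/
def expField (f : R) (n : ℤ) (w : M) : M :=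
  ∑ᶠ s : Fin N → ℕ, (∏ p, ((s p).factorial : ℂ))⁻¹ •
    mul (iteratedPartial d s f) (hU.power s n w)

theorem prod_factorial_add_single (s : Fin N → ℕ) (p : Fin N) :
    ∏ q, (((s + Pi.single p 1 : Fin N → ℕ) q).factorial : ℂ) =
      ((s p : ℂ) + 1) * ∏ q, ((s q).factorial : ℂ) := by
  have : ∀ q, (((s + Pi.single p 1 : Fin N → ℕ) q).factorial : ℂ) =
      (if q = p then (s p : ℂ) + 1 else 1) * ((s q).factorial : ℂ) := by
    intro q
    by_cases hq : q = p
    · subst hq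
      simp [Nat.factorial_succ]
    · simp [hq]
  simp only [this, Finset.prod_mul_distrib, Finset.prod_ite_eq', Finset.mem_univ, if_true]

theorem add_single_injective (p : Fin N) :
    Function.Injective fun s : Fin N → ℕ => s + Pi.single p 1 := add_left_injective _

/-- Reindexing a sum over multi-indices `s` with `s_p ≥ 1`. -/
theorem finsum_add_single {G : Type*} [AddCommMonoid G] (p : Fin N) (g : (Fin N → ℕ) → G)
    (hg : ∀ s, s p = 0 → g s = 0) : ∑ᶠ s, g s = ∑ᶠ s : Fin N → ℕ, g (s + Pi.single p 1) := by
  rw [← finsum_mem_range (f := g) (add_single_injective p), ← finsum_mem_univ g]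
  refine finsum_mem_inter_support_eq g _ _ ?_
  ext s
  simp only [Set.mem_inter_iff, Set.mem_univ, true_and, Set.mem_range, Function.mem_support]
  refine ⟨fun h => ⟨⟨s - Pi.single p 1, ?_⟩, h⟩, And.right⟩
  have hs : s p ≠ 0 := fun h0 => h (hg s h0)
  funext q
  by_cases hq : q = p
  · subst hq; simp; omega
  · simp [Pi.single_eq_of_ne hq]

theorem finite_multiIndex (K : ℤ) : {s : Fin N → ℕ | ((∑ p, s p : ℕ) : ℤ) ≤ K}.Finite := by
  refine (Fintype.piFinset fun _ : Fin N => Finset.range (K.toNat + 1)).finite_toSet.subset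
    fun s hs => ?_
  simp only [Finset.mem_coe, Fintype.mem_piFinset, Finset.mem_range]
  intro p
  have := Finset.single_le_sum (f := s) (fun _ _ => Nat.zero_le _) (Finset.mem_univ p)
  simp only [Set.mem_ofPred_eq] at hs
  omega

theorem finite_support_of_bdd {G : Type*} [Zero G] (K : ℤ) (g : (Fin N → ℕ) → G)
    (hg : ∀ s, K < ((∑ p, s p : ℕ) : ℤ) → g s = 0) : g.support.Finite :=
  (finite_multiIndex K).subset fun s hs => by
    by_contra h
    simp only [Set.mem_ofPred_eq, not_le] at h
    exact hs (hg s h)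

variable {hU} {mul d}

theorem expField_support {b : ℤ} {w : M} (hw : CommutingCurrents.PowerBdd hU b w) (f : R) (n : ℤ) :
    (Function.support fun s : Fin N → ℕ => (∏ p, ((s p).factorial : ℂ))⁻¹ •
      mul (iteratedPartial d s f) (hU.power s n w)).Finite :=
  finite_support_of_bdd (n - b) _ fun s hs => by
    rw [hw s n (by omega), map_zero, smul_zero]

theorem expField_add {b b' : ℤ} {w w' : M} (hw : CommutingCurrents.PowerBdd hU b w)
    (hw' : CommutingCurrents.PowerBdd hU b' w') (f : R) (n : ℤ) :
    expField hU mul d f n (w + w') = expField hU mul d f n w + expField hU mul d f n w' := by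
  rw [expField, expField, expField,
    ← finsum_add_distrib (expField_support hw f n) (expField_support hw' f n)]
  refine finsum_congr fun s => ?_
  rw [map_add, map_add, smul_add]

theorem expField_smul {b : ℤ} {w : M} (hw : CommutingCurrents.PowerBdd hU b w) (c : ℂ) (f : R)
    (n : ℤ) : expField hU mul d f n (c • w) = c • expField hU mul d f n w := by
  rw [expField, expField, smul_finsum' c (expField_support hw f n)]
  refine finsum_congr fun s => ?_
  rw [map_smul, map_smul, smul_comm]

theorem expField_eq_zero {b : ℤ} {w : M} (hw : CommutingCurrents.PowerBdd hU b w) (f : R) {n : ℤ}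
    (hn : n < b) : expField hU mul d f n w = 0 := by
  rw [expField]
  refine (finsum_congr fun s => ?_).trans finsum_zero
  rw [hw s n (by omega), map_zero, smul_zero]

theorem expField_zero_of_killed {w : M} (hw : CommutingCurrents.PowerBdd hU 0 w) (f : R) :
    expField hU mul d f 0 w = mul f w := by
  rw [expField, finsum_eq_single _ 0]
  · have : hU.power 0 0 w = w := by
      simp only [CommutingCurrents.power, orderedMonomial_zero]
      change (Pi.single 0 w : ℤ → M) 0 = w
      simp
    simp [this, iteratedPartial, orderedMonomial_zero]
  · intro s hs
    have : 0 < ∑ p, s p := by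
      rw [pos_iff_ne_zero]
      intro h
      rw [Finset.sum_eq_zero_iff] at h
      exact hs (funext fun p => h p (Finset.mem_univ p))
    rw [hw s 0 (by omega), map_zero, smul_zero]

/-- The commutation relation of an operator `t` with the field `∑_s (1/s!) ū(z)^s ∂^s f`: the term
of `[t, ū_p(z)]` produces the derivative `∂_p f`. -/
theorem map_expField (hd : ∀ p q f, d p (d q f) = d q (d p f))
    {t : Module.End ℂ M} {c : ℂ} {k : ℤ} {σ : Fin N → Module.End ℂ M}
    (ht : CommutingCurrents.Derives U t c k σ) {δ : Module.End ℂ R}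
    (hδ : ∀ p f, δ (d p f) = d p (δ f))
    (htm : ∀ r x, t (mul r x) = mul r (t x) + mul (δ r) x)
    (hσm : ∀ p r x, σ p (mul r x) = mul r (σ p x)) {b : ℤ} {w : M}
    (hw : CommutingCurrents.PowerBdd hU b w) (f : R) (n : ℤ) :
    t (expField hU mul d f n w) = expField hU mul d f n (t w) +
      (c * (n + 1)) • expField hU mul d f (n + 1) w +
      ∑ p, σ p (expField hU mul d (d p f) (n - k) w) + expField hU mul d (δ f) n w := by
  let W : (Fin N → ℕ) → ℂ := fun s => (∏ p, ((s p).factorial : ℂ))⁻¹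
  have hC : ∀ p, ∑ᶠ s : Fin N → ℕ, (W s * s p) • σ p (mul (iteratedPartial d s f)
      (hU.power (s - Pi.single p 1) (n - k) w)) = σ p (expField hU mul d (d p f) (n - k) w) := by
    intro p
    rw [finsum_add_single p _ (fun s hs => by simp [hs]), expField,
      map_finsum _ (expField_support hw (d p f) (n - k))]
    refine finsum_congr fun s => ?_
    have hne : ((s p : ℂ) + 1) ≠ 0 := Nat.cast_add_one_ne_zero _
    have e1 : W (s + Pi.single p 1) * ((s + Pi.single p 1 : Fin N → ℕ) p : ℕ) = W s := by
      simp only [W]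
      rw [prod_factorial_add_single, Pi.add_apply, Pi.single_eq_same]
      push_cast
      field_simp
    have e2 : s + Pi.single p 1 - Pi.single p 1 = s := add_tsub_cancel_right _ _
    have e3 : iteratedPartial d (s + Pi.single p 1) f = iteratedPartial d s (d p f) := by
      rw [iteratedPartial, orderedMonomial_add_single, Module.End.mul_apply]
      · exact iteratedPartial_comm d (δ := (d p).toLinearMap) (fun q f => hd p q f) s f
      · exact fun q r => LinearMap.ext fun f => hd q r f
    rw [e1, e2, e3, map_smul]
  have hCs : ∀ p, (Function.support fun s : Fin N → ℕ => (W s * s p) •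
      σ p (mul (iteratedPartial d s f) (hU.power (s - Pi.single p 1) (n - k) w))).Finite := by
    intro p
    refine finite_support_of_bdd (n - k - b + 1) _ fun s hs => ?_
    by_cases hp : s p = 0
    · simp [hp]
    · have e : ∑ q, s q = ∑ q, (s - Pi.single p 1 : Fin N → ℕ) q + 1 := by
        conv_lhs => rw [show s = s - Pi.single p 1 + Pi.single p 1 by
          funext q
          by_cases hq : q = p
          · subst hq; simp; omega
          · simp [Pi.single_eq_of_ne hq]]
        simp only [Pi.add_apply, Finset.sum_add_distrib, Finset.sum_pi_single', Finset.mem_univ,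
          if_true]
      rw [hw _ _ (by omega), map_zero, map_zero, smul_zero]
  have hA := expField_support (mul := mul) (d := d) (hw.derives ht) f n
  have hB := expField_support (mul := mul) (d := d) (hw.smul (c * (n + 1))) f (n + 1)
  have hD := expField_support (mul := mul) (d := d) hw (δ f) n
  have hS : (Function.support fun s : Fin N → ℕ => ∑ p, (W s * s p) •
      σ p (mul (iteratedPartial d s f) (hU.power (s - Pi.single p 1) (n - k) w))).Finite := by
    refine (Set.finite_iUnion hCs).subset fun s hs => ?_
    rw [Set.mem_iUnion]
    by_contra hc
    refine hs (Finset.sum_eq_zero fun p _ => ?_)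
    exact Function.notMem_support.1 (not_exists.1 hc p)
  simp only [← hC]
  rw [← finsum_sum_comm _ _ (fun p _ => hCs p), ← expField_smul hw]
  conv_rhs => rw [expField, expField, expField]
  rw [← finsum_add_distrib hA hB, ← finsum_add_distrib _ hS, ← finsum_add_distrib _ hD, expField,
    map_finsum _ (expField_support hw f n)]
  · refine finsum_congr fun s => ?_
    rw [map_smul, htm, ht.map_power hU s n w, ← iteratedPartial_comm d hδ]
    simp only [map_add, map_smul, smul_add, map_sum, map_nsmul, Finset.smul_sum, hσm]
    congr 2
    refine Finset.sum_congr rfl fun p _ => ?_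
    rw [mul_smul, Nat.cast_smul_eq_nsmul]
  · exact ((hA.union hB).subset (Function.support_add _ _) |>.union hS).subset
      (Function.support_add _ _)
  · exact (hA.union hB).subset (Function.support_add _ _)

end ExponentialFields

/-! ### Highest weight modules of Lie algebras -/

namespace Induced
variable {𝔩 : Type} [LieRing 𝔩] [LieAlgebra ℂ 𝔩] {S : Set 𝔩} {C : 𝔩} {k : ℂ}

theorem act_of_mem {x : 𝔩} (hx : x ∈ S) : act x (vac : Induced 𝔩 S C k) = 0 := by
  refine (Submodule.Quotient.mk_eq_zero _).2 ?_
  dsimp only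
  rw [smul_eq_mul, mul_one]
  exact Ideal.subset_span (Or.inl ⟨x, hx, rfl⟩)

theorem act_central_vac : act C (vac : Induced 𝔩 S C k) = k • vac := by
  refine (Submodule.Quotient.eq _).2 ?_
  dsimp only
  rw [smul_eq_mul, mul_one, ← Algebra.algebraMap_eq_smul_one]
  exact Ideal.subset_span (Or.inr rfl)

theorem act_add (x y : 𝔩) (w : Induced 𝔩 S C k) : act (x + y) w = act x w + act y w := by
  simp [act]

theorem act_smul (r : ℂ) (x : 𝔩) (w : Induced 𝔩 S C k) : act (r • x) w = r • act x w := by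
  simp [act]

/-- The action as a linear map. -/
def actHom : 𝔩 →ₗ[ℂ] Module.End ℂ (Induced 𝔩 S C k) where
  toFun := act
  map_add' x y := LinearMap.ext (act_add x y)
  map_smul' r x := LinearMap.ext (act_smul r x)

@[simp] theorem actHom_apply (x : 𝔩) : actHom x = (act x : Module.End ℂ (Induced 𝔩 S C k)) := rfl

section
attribute [local instance 100] LieRing.ofAssociativeRing

theorem act_lie (x y : 𝔩) (w : Induced 𝔩 S C k) :
    act ⁅x, y⁆ w = act x (act y w) - act y (act x w) := by
  have h := LieHom.map_lie (UniversalEnvelopingAlgebra.ι ℂ) x y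
  rw [LieRing.of_associative_ring_bracket] at h
  simp only [act, Algebra.lsmul_coe, h, sub_smul, mul_smul]

/-- A submodule which is stable under the Lie algebra is stable under its enveloping algebra. -/
theorem smul_mem_of_act_mem (P : Submodule ℂ (Induced 𝔩 S C k)) (h : ∀ x, ∀ w ∈ P, act x w ∈ P)
    (r : UniversalEnvelopingAlgebra ℂ 𝔩) : ∀ w ∈ P, r • w ∈ P := by
  let T : Subalgebra ℂ (UniversalEnvelopingAlgebra ℂ 𝔩) :=
    { carrier := {r | ∀ w ∈ P, r • w ∈ P}
      mul_mem' := fun ha hb w hw => by rw [mul_smul]; exact ha _ (hb _ hw)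
      add_mem' := fun ha hb w hw => by rw [add_smul]; exact P.add_mem (ha _ hw) (hb _ hw)
      algebraMap_mem' := fun r w hw => by
        rw [algebraMap_smul]; exact P.smul_mem _ hw }
  have hT : ∀ x, UniversalEnvelopingAlgebra.ι ℂ x ∈ T := fun x w hw => h x w hw
  let f : 𝔩 →ₗ⁅ℂ⁆ T :=
    { toFun := fun x => ⟨UniversalEnvelopingAlgebra.ι ℂ x, hT x⟩
      map_add' := fun x y => Subtype.ext (map_add _ _ _)
      map_smul' := fun x y => Subtype.ext (map_smul _ _ _)
      map_lie' := fun {x y} => Subtype.ext (LieHom.map_lie _ _ _) }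
  have e : T.val.comp (UniversalEnvelopingAlgebra.lift ℂ f) = AlgHom.id ℂ _ := by
    refine UniversalEnvelopingAlgebra.hom_ext ℂ (LieHom.ext fun x => ?_)
    change ((UniversalEnvelopingAlgebra.lift ℂ f (UniversalEnvelopingAlgebra.ι ℂ x) : T) :
      UniversalEnvelopingAlgebra ℂ 𝔩) = UniversalEnvelopingAlgebra.ι ℂ x
    rw [UniversalEnvelopingAlgebra.lift_ι_apply]
    rfl
  have := congrArg (fun g => g r) e
  simp only [AlgHom.comp_apply, AlgHom.id_apply] at this
  rw [← this]
  exact (UniversalEnvelopingAlgebra.lift ℂ f r).2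

theorem eq_top_of_act_mem (P : Submodule ℂ (Induced 𝔩 S C k)) (hv : vac ∈ P)
    (h : ∀ x, ∀ w ∈ P, act x w ∈ P) : P = ⊤ := by
  refine Submodule.eq_top_iff'.2 fun w => ?_
  obtain ⟨r, rfl⟩ := Submodule.Quotient.mk_surjective _ w
  have := smul_mem_of_act_mem P h r _ hv
  rwa [show r • (vac : Induced 𝔩 S C k) = Submodule.Quotient.mk r by
    rw [vac]; change Submodule.Quotient.mk (r • 1) = _; rw [smul_eq_mul, mul_one]] at this

theorem act_central (hC : ∀ x : 𝔩, ⁅C, x⁆ = 0) (w : Induced 𝔩 S C k) : act C w = k • w := by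
  have : LinearMap.eqLocus (act C) (k • LinearMap.id : Module.End ℂ (Induced 𝔩 S C k)) = ⊤ := by
    refine eq_top_of_act_mem _ act_central_vac fun x w hw => ?_
    have h := act_lie C x w
    simp only [LinearMap.mem_eqLocus, LinearMap.smul_apply, LinearMap.id_apply] at hw ⊢
    rw [hC, hw] at h
    have h0 : act (0 : 𝔩) w = 0 := by simp [act]
    rw [h0, map_smul] at h
    exact (sub_eq_zero.1 h.symm)
  exact LinearMap.congr_fun (LinearMap.eqLocus_eq_top.1 this) w

/-- The universal property: a vector of a representation which satisfies the defining relations of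
the highest weight vector is its image under an equivariant map. -/
theorem exists_lift {P : Type*} [AddCommGroup P] [Module ℂ P] (ρ : 𝔩 →ₗ[ℂ] Module.End ℂ P)
    (hρ : ∀ x y p, ρ ⁅x, y⁆ p = ρ x (ρ y p) - ρ y (ρ x p)) (p : P) (hS : ∀ x ∈ S, ρ x p = 0)
    (hC : ρ C p = k • p) :
    ∃ φ : Induced 𝔩 S C k →ₗ[ℂ] P, φ vac = p ∧ ∀ x w, φ (act x w) = ρ x (φ w) := by
  let f : 𝔩 →ₗ⁅ℂ⁆ Module.End ℂ P :=
    { ρ with map_lie' := fun {x y} => LinearMap.ext fun p => hρ x y p }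
  let F := UniversalEnvelopingAlgebra.lift ℂ f
  have hF : ∀ x, F (UniversalEnvelopingAlgebra.ι ℂ x) = ρ x :=
    fun x => UniversalEnvelopingAlgebra.lift_ι_apply ℂ f x
  let ev : UniversalEnvelopingAlgebra ℂ 𝔩 →ₗ[ℂ] P :=
    (LinearMap.applyₗ p).comp F.toLinearMap
  let I : Ideal (UniversalEnvelopingAlgebra ℂ 𝔩) :=
    Ideal.span (UniversalEnvelopingAlgebra.ι ℂ '' S ∪
      {UniversalEnvelopingAlgebra.ι ℂ C - algebraMap ℂ (UniversalEnvelopingAlgebra ℂ 𝔩) k})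
  have hI : ∀ r ∈ I, ev r = 0 := by
    intro r hr
    induction hr using Submodule.span_induction with
    | mem r hr =>
      rcases hr with ⟨x, hx, rfl⟩ | rfl
      · change F _ p = 0
        rw [hF, hS x hx]
      · change F _ p = 0
        rw [map_sub, hF, AlgHom.commutes, LinearMap.sub_apply, hC]
        simp
    | zero => simp
    | add x y _ _ hx hy => rw [map_add, hx, hy, add_zero]
    | smul a x _ hx =>
      change F (a * x) p = 0
      rw [map_mul, Module.End.mul_apply, show F x p = 0 from hx, map_zero]
  refine ⟨Submodule.liftQ (I.restrictScalars ℂ) ev hI, ?_, ?_⟩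
  · change F 1 p = p
    rw [map_one]; rfl
  · intro x w
    obtain ⟨r, rfl⟩ := Submodule.Quotient.mk_surjective _ w
    change F (UniversalEnvelopingAlgebra.ι ℂ x * r) p = ρ x (F r p)
    rw [map_mul, hF]; rfl

end

theorem hom_ext {P : Type*} [AddCommGroup P] [Module ℂ P] {φ ψ : Induced 𝔩 S C k →ₗ[ℂ] P}
    (ρ : 𝔩 → Module.End ℂ P) (h : φ vac = ψ vac) (hφ : ∀ x w, φ (act x w) = ρ x (φ w))
    (hψ : ∀ x w, ψ (act x w) = ρ x (ψ w)) : φ = ψ := by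
  refine LinearMap.eqLocus_eq_top.1 (eq_top_of_act_mem _ h fun x w hw => ?_)
  rw [LinearMap.mem_eqLocus] at hw ⊢
  rw [hφ, hψ, hw]

/-- A derivation of the Lie algebra which preserves the relations of the highest weight vector acts
on the highest weight module. -/
theorem exists_derivation (δ : 𝔩 →ₗ[ℂ] 𝔩) (hδ : ∀ x y, δ ⁅x, y⁆ = ⁅δ x, y⁆ + ⁅x, δ y⁆)
    (hS : ∀ x ∈ S, act (δ x) (vac : Induced 𝔩 S C k) = 0) (hC : δ C = 0) :
    ∃ D : Module.End ℂ (Induced 𝔩 S C k), D vac = 0 ∧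
      ∀ x w, D (act x w) = act x (D w) + act (δ x) w := by
  let ρ : 𝔩 →ₗ[ℂ] Module.End ℂ (Induced 𝔩 S C k × Induced 𝔩 S C k) :=
    { toFun := fun x => LinearMap.prod ((act x).comp (LinearMap.fst ℂ _ _))
        ((act x).comp (LinearMap.snd ℂ _ _) + (act (δ x)).comp (LinearMap.fst ℂ _ _))
      map_add' := fun x y => LinearMap.ext fun w => Prod.ext (act_add x y w.1) (by
        change act (x + y) w.2 + act (δ (x + y)) w.1 =
          act x w.2 + act (δ x) w.1 + (act y w.2 + act (δ y) w.1)
        rw [map_add, act_add, act_add]; abel)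
      map_smul' := fun r x => LinearMap.ext fun w => Prod.ext (act_smul r x w.1) (by
        change act (r • x) w.2 + act (δ (r • x)) w.1 = r • (act x w.2 + act (δ x) w.1)
        rw [map_smul, act_smul, act_smul, smul_add]) }
  have h0 : act (0 : 𝔩) (vac : Induced 𝔩 S C k) = 0 := by
    rw [← actHom_apply, map_zero, LinearMap.zero_apply]
  obtain ⟨φ, h1, h2⟩ := exists_lift (S := S) (C := C) (k := k) ρ
      (fun x y p => Prod.ext (act_lie x y p.1) (by
        change act ⁅x, y⁆ p.2 + act (δ ⁅x, y⁆) p.1 =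
          act x (act y p.2 + act (δ y) p.1) + act (δ x) (act y p.1) -
          (act y (act x p.2 + act (δ x) p.1) + act (δ y) (act x p.1))
        rw [hδ, act_add, act_lie, act_lie, act_lie, map_add, map_add]; abel)) (vac, 0)
      (fun x hx => Prod.ext (act_of_mem hx) (by
        change act x 0 + act (δ x) vac = 0
        rw [map_zero, hS x hx, add_zero]))
      (Prod.ext act_central_vac (by
        change act C 0 + act (δ C) vac = k • 0
        rw [map_zero, hC, h0, add_zero, smul_zero]))
  have h3 : (LinearMap.fst ℂ _ _).comp φ = LinearMap.id :=
    hom_ext act (congrArg Prod.fst h1) (fun x w => congrArg Prod.fst (h2 x w)) (fun x w => rfl)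
  refine ⟨(LinearMap.snd ℂ _ _).comp φ, congrArg Prod.snd h1, fun x w => ?_⟩
  have h4 : (φ w).1 = w := LinearMap.congr_fun h3 w
  have h5 := congrArg Prod.snd (h2 x w)
  change (φ (act x w)).2 = act x (φ w).2 + act (δ x) (φ w).1 at h5
  rw [h4] at h5
  exact h5

/-- Equivariant maps out of the tensor product of a highest weight module with a vector space. -/
theorem exists_lift_tensor {P Q : Type*} [AddCommGroup P] [Module ℂ P] [AddCommGroup Q]
    [Module ℂ Q] (ρ : 𝔩 →ₗ[ℂ] Module.End ℂ P)
    (hρ : ∀ x y p, ρ ⁅x, y⁆ p = ρ x (ρ y p) - ρ y (ρ x p)) (f : Q →ₗ[ℂ] P)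
    (hS : ∀ x ∈ S, ∀ q, ρ x (f q) = 0) (hC : ∀ q, ρ C (f q) = k • f q) :
    ∃ φ : Induced 𝔩 S C k ⊗[ℂ] Q →ₗ[ℂ] P, (∀ q, φ (vac ⊗ₜ q) = f q) ∧
      ∀ x w, φ (LinearMap.rTensor Q (act x) w) = ρ x (φ w) := by
  let ρ' : 𝔩 →ₗ[ℂ] Module.End ℂ (Q →ₗ[ℂ] P) :=
    { toFun := fun x => LinearMap.llcomp ℂ Q P P (ρ x)
      map_add' := fun x y => by ext; simp
      map_smul' := fun r x => by ext; simp }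
  obtain ⟨φ, h1, h2⟩ := exists_lift (S := S) (C := C) (k := k) ρ'
    (fun x y p => LinearMap.ext fun q => hρ x y (p q)) f
    (fun x hx => LinearMap.ext fun q => hS x hx q) (LinearMap.ext fun q => hC q)
  refine ⟨TensorProduct.lift φ, fun q => by simp [h1], fun x w => ?_⟩
  induction w using TensorProduct.induction_on with
  | zero => simp
  | tmul w q =>
    simp only [LinearMap.rTensor_tmul, TensorProduct.lift.tmul, h2]
    rfl
  | add a b ha hb => simp only [map_add, ha, hb]

theorem span_tensor {Q : Type*} [AddCommGroup Q] [Module ℂ Q]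
    (N : Submodule ℂ (Induced 𝔩 S C k ⊗[ℂ] Q)) (hv : ∀ q, vac ⊗ₜ q ∈ N)
    (h : ∀ x, ∀ w ∈ N, LinearMap.rTensor Q (act x) w ∈ N) : N = ⊤ := by
  refine Submodule.eq_top_iff'.2 fun w => ?_
  induction w using TensorProduct.induction_on with
  | zero => exact N.zero_mem
  | tmul w q =>
    have := eq_top_of_act_mem (N.comap ((TensorProduct.mk ℂ _ Q).flip q)) (hv q)
      (fun x w hw => h x _ hw)
    exact (this.ge (Submodule.mem_top (x := w)) :)
  | add a b ha hb => exact N.add_mem ha hb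

end Induced

namespace Affine
variable {𝔞 : Type} [LieRing 𝔞] [LieAlgebra ℂ 𝔞] (B : InvForm 𝔞)

theorem mode_add (a b : 𝔞) (m : ℤ) : mode B (a + b) m = mode B a m + mode B b m := by
  rw [mode, mode, mode, TensorProduct.tmul_add, ← LieAlgebra.of_add, Prod.mk_add_mk, add_zero]

theorem mode_smul (r : ℂ) (a : 𝔞) (m : ℤ) : mode B (r • a) m = r • mode B a m := by
  rw [mode, mode, TensorProduct.tmul_smul, ← LieAlgebra.of_smul, Prod.smul_mk, smul_zero]

theorem lie_central (x : Affine B) : ⁅central B, x⁆ = 0 := by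
  rw [LieAlgebra.bracket_ofTwoCocycle]
  simp only [central, Equiv.symm_apply_apply, zero_lie, map_zero, LinearMap.zero_apply, zero_add]
  rw [trivial_lie_zero, sub_zero]
  rfl

theorem lie_central' (x : Affine B) : ⁅x, central B⁆ = 0 := by
  rw [← lie_skew, lie_central, neg_zero]

theorem eq_top_of_mode_mem (N : Submodule ℂ (Affine B)) (hc : central B ∈ N)
    (h : ∀ a m, mode B a m ∈ N) : N = ⊤ := by
  refine Submodule.eq_top_iff'.2 fun x => ?_
  obtain ⟨⟨y, z⟩, rfl⟩ := (LieAlgebra.ofProd _).surjective x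
  have hz : LieAlgebra.ofProd _ (0, z) ∈ N := by
    have : (LieAlgebra.ofProd (LieAlgebra.LoopAlgebra.twoCocycleOfBilinear ℂ ℤ 𝔞 (-B).form
      (-B).inv (-B).symm) (0, z)) = (TrivialLieModule.equiv ℂ (LieAlgebra.loopAlgebra ℂ ℤ 𝔞) ℂ z) •
        central B := by
      rw [central, ← LieAlgebra.of_smul, Prod.smul_mk, smul_zero, ← map_smul, smul_eq_mul, mul_one,
        LinearEquiv.symm_apply_apply]
    rw [this]
    exact N.smul_mem _ hc
  let inl : LieAlgebra.loopAlgebra ℂ ℤ 𝔞 →ₗ[ℂ] Affine B :=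
    { toFun := fun y => LieAlgebra.ofProd _ (y, 0)
      map_add' := fun y y' => by rw [← LieAlgebra.of_add, Prod.mk_add_mk, add_zero]
      map_smul' := fun r y => by
        rw [RingHom.id_apply, ← LieAlgebra.of_smul, Prod.smul_mk, smul_zero] }
  have hy : inl y ∈ N := by
    rw [← Submodule.mem_comap]
    induction y using TensorProduct.induction_on with
    | zero => exact Submodule.zero_mem _
    | tmul p a =>
      induction p using AddMonoidAlgebra.induction_linear with
      | zero => rw [TensorProduct.zero_tmul]; exact Submodule.zero_mem _
      | add p q hp hq =>
        rw [TensorProduct.add_tmul]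
        exact Submodule.add_mem _ hp hq
      | single m r =>
        have : AddMonoidAlgebra.single m r = r • AddMonoidAlgebra.single m (1 : ℂ) := by
          rw [AddMonoidAlgebra.smul_single, smul_eq_mul, mul_one]
        rw [this, ← TensorProduct.smul_tmul']
        exact Submodule.smul_mem _ r (h a m : inl _ ∈ N)
    | add p q hp hq => exact Submodule.add_mem _ hp hq
  have e : LieAlgebra.ofProd _ (y, z) = inl y + LieAlgebra.ofProd _ (0, z) := by
    change _ = LieAlgebra.ofProd _ (y, 0) + LieAlgebra.ofProd _ (0, z)
    rw [← LieAlgebra.of_add, Prod.mk_add_mk, add_zero, zero_add]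
  rw [e]
  exact N.add_mem hy hz

/-- Linear maps out of the affine Lie algebra are given by their values on the `a(m)` and `C`. -/
theorem exists_linearMap {P : Type*} [AddCommGroup P] [Module ℂ P] (f : ℤ → 𝔞 →ₗ[ℂ] P) (z : P) :
    ∃ F : Affine B →ₗ[ℂ] P, (∀ a m, F (mode B a m) = f m a) ∧ F (central B) = z := by
  let F₁ : LieAlgebra.loopAlgebra ℂ ℤ 𝔞 →ₗ[ℂ] P :=
    (Finsupp.lsum ℂ f).comp (LieAlgebra.LoopAlgebra.toFinsupp ℂ ℤ 𝔞).toLinearMap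
  let F₂ : TrivialLieModule ℂ (LieAlgebra.loopAlgebra ℂ ℤ 𝔞) ℂ →ₗ[ℂ] P :=
    (LinearMap.toSpanSingleton ℂ P z).comp
      (TrivialLieModule.equiv ℂ (LieAlgebra.loopAlgebra ℂ ℤ 𝔞) ℂ).toLinearMap
  refine ⟨{ toFun := fun x => F₁ ((LieAlgebra.ofProd _).symm x).1 +
              F₂ ((LieAlgebra.ofProd _).symm x).2
            map_add' := fun x y => by
              rw [LieAlgebra.of_symm_add, Prod.fst_add, Prod.snd_add, map_add, map_add]; abel
            map_smul' := fun r x => by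
              rw [LieAlgebra.of_symm_smul, Prod.smul_fst, Prod.smul_snd, map_smul, map_smul,
                smul_add]; rfl }, fun a m => ?_, ?_⟩
  · change F₁ (AddMonoidAlgebra.single m (1 : ℂ) ⊗ₜ[ℂ] a) + F₂ 0 = _
    rw [map_zero, add_zero]
    change Finsupp.lsum ℂ f (LieAlgebra.LoopAlgebra.toFinsupp ℂ ℤ 𝔞
      (AddMonoidAlgebra.single m (1 : ℂ) ⊗ₜ[ℂ] a)) = _
    rw [LieAlgebra.LoopAlgebra.toFinsupp_single_tmul]
    simp
  · change F₁ 0 + F₂ ((TrivialLieModule.equiv ℂ (LieAlgebra.loopAlgebra ℂ ℤ 𝔞) ℂ).symm 1) = z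
    simp [F₂]

end Affine

namespace Vir

theorem eq_top_of_L_mem (N : Submodule ℂ Vir) (hc : central ∈ N) (h : ∀ m, L m ∈ N) : N = ⊤ := by
  refine Submodule.eq_top_iff'.2 fun x => ?_
  have h2 : ∀ f : ℤ →₀ ℂ, (⟨f, 0⟩ : Vir) ∈ N := by
    intro f
    induction f using Finsupp.induction_linear with
    | zero => exact N.zero_mem
    | add f g hf hg =>
      convert N.add_mem hf hg using 1
      ext1 <;> simp
    | single m r =>
      convert N.smul_mem r (h m) using 1
      ext1 <;> simp [L]
  convert N.add_mem (h2 x.coeff) (N.smul_mem x.cen hc) using 1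
  ext1 <;> simp [central]

theorem lie_central (x : Vir) : ⁅central, x⁆ = 0 := by
  ext1 <;> simp [Bracket.bracket, central]

/-- Linear maps out of the Virasoro algebra are given by their values on the `L(m)` and `C`. -/
theorem exists_linearMap {P : Type*} [AddCommGroup P] [Module ℂ P] (f : ℤ → P) (z : P) :
    ∃ F : Vir →ₗ[ℂ] P, (∀ m, F (L m) = f m) ∧ F central = z := by
  refine ⟨{ toFun := fun x => Finsupp.linearCombination ℂ f x.coeff + x.cen • z
            map_add' := fun x y => by simp [add_smul]; abel
            map_smul' := fun r x => by simp [smul_smul] }, fun m => ?_, ?_⟩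
  · simp [L]
  · simp [central]

end Vir

/-! ### The tensor factors of `V` -/

section
variable {M : Type*} [AddCommGroup M] [Module ℂ M] {P : Type*} [AddCommGroup P] [Module ℂ P]

/-- The truncation condition on the coefficients of a field. -/
def Truncated (f : ℤ → Module.End ℂ M) : Prop := ∀ x, ∃ n₀ : ℤ, ∀ n, n₀ ≤ n → f n x = 0

theorem Truncated.rTensor {f : ℤ → Module.End ℂ M} (h : Truncated f) :
    Truncated fun n => LinearMap.rTensor P (f n) := fun x => by
  induction x using TensorProduct.induction_on with
  | zero => exact ⟨0, fun n _ => map_zero _⟩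
  | tmul x y =>
    obtain ⟨n₀, h⟩ := h x
    exact ⟨n₀, fun n hn => by rw [LinearMap.rTensor_tmul, h n hn, TensorProduct.zero_tmul]⟩
  | add x y hx hy =>
    obtain ⟨n, hn⟩ := hx
    obtain ⟨m, hm⟩ := hy
    exact ⟨max n m, fun k hk => by
      rw [map_add, hn k ((le_max_left _ _).trans hk), hm k ((le_max_right _ _).trans hk), add_zero]⟩

theorem Truncated.lTensor {f : ℤ → Module.End ℂ M} (h : Truncated f) :
    Truncated fun n => LinearMap.lTensor P (f n) := fun x => by
  induction x using TensorProduct.induction_on with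
  | zero => exact ⟨0, fun n _ => map_zero _⟩
  | tmul y x =>
    obtain ⟨n₀, h⟩ := h x
    exact ⟨n₀, fun n hn => by rw [LinearMap.lTensor_tmul, h n hn, TensorProduct.tmul_zero]⟩
  | add x y hx hy =>
    obtain ⟨n, hn⟩ := hx
    obtain ⟨m, hm⟩ := hy
    exact ⟨max n m, fun k hk => by
      rw [map_add, hn k ((le_max_left _ _).trans hk), hm k ((le_max_right _ _).trans hk), add_zero]⟩

theorem rTensor_mul_lTensor (a : Module.End ℂ M) (b : Module.End ℂ P) :
    LinearMap.rTensor P a * LinearMap.lTensor M b = LinearMap.lTensor M b * LinearMap.rTensor P a :=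
  TensorProduct.ext' fun _ _ => rfl

/-- The translation operator of a tensor product. -/
def tensorD (D : Module.End ℂ M) (D' : Module.End ℂ P) : Module.End ℂ (M ⊗[ℂ] P) :=
  LinearMap.rTensor P D + LinearMap.lTensor M D'

theorem tensorD_tmul (D : Module.End ℂ M) (D' : Module.End ℂ P) (x : M) (y : P) :
    tensorD D D' (x ⊗ₜ y) = D x ⊗ₜ y + x ⊗ₜ D' y := rfl

theorem tensorD_tmul_eq_zero {D : Module.End ℂ M} {D' : Module.End ℂ P} {x : M} {y : P}
    (hx : D x = 0) (hy : D' y = 0) : tensorD D D' (x ⊗ₜ y) = 0 := by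
  rw [tensorD_tmul, hx, hy, TensorProduct.zero_tmul, TensorProduct.tmul_zero, add_zero]

theorem tensorD_rTensor {D a c : Module.End ℂ M} (D' : Module.End ℂ P) (h : D * a - a * D = c) :
    tensorD D D' * LinearMap.rTensor P a - LinearMap.rTensor P a * tensorD D D' =
      LinearMap.rTensor P c := by
  rw [tensorD, add_mul, mul_add, ← rTensor_mul_lTensor, ← LinearMap.rTensor_mul,
    ← LinearMap.rTensor_mul, ← h, LinearMap.rTensor_sub]
  abel

theorem tensorD_lTensor {D' a c : Module.End ℂ P} (D : Module.End ℂ M) (h : D' * a - a * D' = c) :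
    tensorD D D' * LinearMap.lTensor M a - LinearMap.lTensor M a * tensorD D D' =
      LinearMap.lTensor M c := by
  rw [tensorD, add_mul, mul_add, ← rTensor_mul_lTensor, ← LinearMap.lTensor_mul,
    ← LinearMap.lTensor_mul, ← h, LinearMap.lTensor_sub]
  abel

end

namespace Fock
variable {N : ℕ}

theorem u_pos (p : Fin N) (j : ℕ) (w : Fock N) : u p (Int.ofNat (j + 1)) w =
    ((j : ℂ) + 1) • MvPolynomial.pderiv (Sum.inr (p, j)) w := rfl

theorem u_neg (p : Fin N) (j : ℕ) (w : Fock N) :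
    u p (Int.negSucc j) w = MvPolynomial.X (Sum.inl (p, j)) * w := rfl

theorem u_zero (p : Fin N) (w : Fock N) : u p (Int.ofNat 0) w = 0 := rfl

theorem v_pos (p : Fin N) (j : ℕ) (w : Fock N) : v p (Int.ofNat (j + 1)) w =
    ((j : ℂ) + 1) • MvPolynomial.pderiv (Sum.inl (p, j)) w := rfl

theorem v_neg (p : Fin N) (j : ℕ) (w : Fock N) :
    v p (Int.negSucc j) w = MvPolynomial.X (Sum.inr (p, j)) * w := rfl

theorem v_zero (p : Fin N) (w : Fock N) : v p (Int.ofNat 0) w = 0 := rfl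

theorem pderiv_comm {σ : Type*} (i j : σ) (w : MvPolynomial σ ℂ) :
    MvPolynomial.pderiv i (MvPolynomial.pderiv j w) =
      MvPolynomial.pderiv j (MvPolynomial.pderiv i w) := by
  classical
  have := congrArg (fun D => D w) (show
    ⁅MvPolynomial.pderiv (R := ℂ) i, MvPolynomial.pderiv j⁆ = 0 from
      MvPolynomial.derivation_ext fun k => by
        rw [Derivation.commutator_apply, MvPolynomial.pderiv_X, MvPolynomial.pderiv_X,
          Pi.single_apply, Pi.single_apply]
        split_ifs <;> simp)
  rwa [Derivation.commutator_apply, Derivation.zero_apply, sub_eq_zero] at this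

theorem pderiv_X_mul_of_ne {σ : Type*} {i j : σ} (h : j ≠ i) (w : MvPolynomial σ ℂ) :
    MvPolynomial.pderiv i (MvPolynomial.X j * w) =
      MvPolynomial.X j * MvPolynomial.pderiv i w := by
  rw [MvPolynomial.pderiv_mul, MvPolynomial.pderiv_X_of_ne h, zero_mul, zero_add]

theorem u_comm_u (p q : Fin N) (m s : ℤ) (w : Fock N) : u p m (u q s w) = u q s (u p m w) := by
  rcases m with (_ | m) | m <;> rcases s with (_ | s) | s <;>
    simp only [u_pos, u_neg, u_zero, map_zero, smul_zero, map_smul]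
  · rw [pderiv_comm, smul_comm]
  · rw [pderiv_X_mul_of_ne (by simp)]
  · rw [pderiv_X_mul_of_ne (by simp)]
  · ring

theorem v_comm_v (p q : Fin N) (m s : ℤ) (w : Fock N) : v p m (v q s w) = v q s (v p m w) := by
  rcases m with (_ | m) | m <;> rcases s with (_ | s) | s <;>
    simp only [v_pos, v_neg, v_zero, map_zero, smul_zero, map_smul]
  · rw [pderiv_comm, smul_comm]
  · rw [pderiv_X_mul_of_ne (by simp)]
  · rw [pderiv_X_mul_of_ne (by simp)]
  · ring

theorem u_comm_v (p q : Fin N) (m s : ℤ) (w : Fock N) : u p m (v q s w) = v q s (u p m w) +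
    (if p = q ∧ m = -s then (m : ℂ) else 0) • w := by
  by_cases h : p = q ∧ m = -s
  · obtain ⟨rfl, rfl⟩ := h
    rw [if_pos ⟨rfl, rfl⟩]
    rcases s with (_ | s) | s
    · simp [show u p 0 = 0 from rfl, show v p 0 = 0 from rfl]
    · change u p (Int.negSucc s) _ = v p _ (u p (Int.negSucc s) w) + _
      rw [v_pos, v_pos, u_neg, u_neg, MvPolynomial.pderiv_mul, MvPolynomial.pderiv_X_self, one_mul,
        smul_add, mul_smul_comm, Int.ofNat_eq_natCast]
      push_cast
      module
    · change u p (Int.ofNat (s + 1)) _ = v p _ (u p (Int.ofNat (s + 1)) w) + _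
      rw [u_pos, u_pos, v_neg, v_neg, MvPolynomial.pderiv_mul, MvPolynomial.pderiv_X_self, one_mul,
        smul_add, mul_smul_comm, Int.negSucc_eq]
      push_cast
      module
  · rw [if_neg h, zero_smul, add_zero]
    rcases m with (_ | m) | m <;> rcases s with (_ | s) | s <;>
      simp only [u_pos, u_neg, u_zero, v_pos, v_neg, v_zero, map_zero, smul_zero,
        map_smul]
    · rw [pderiv_comm, smul_comm]
    · have : (Sum.inr (q, s) : Fin N × ℕ ⊕ Fin N × ℕ) ≠ Sum.inr (p, m) := by
        rintro e
        simp only [Sum.inr.injEq, Prod.mk.injEq] at e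
        exact h ⟨e.1.symm, by rw [e.2]; rfl⟩
      rw [pderiv_X_mul_of_ne this]
    · have : (Sum.inl (p, m) : Fin N × ℕ ⊕ Fin N × ℕ) ≠ Sum.inl (q, s) := by
        rintro e
        simp only [Sum.inl.injEq, Prod.mk.injEq] at e
        exact h ⟨e.1, by rw [e.2]; rfl⟩
      rw [pderiv_X_mul_of_ne this]
    · ring

theorem u_truncated (p : Fin N) : Truncated (u p) := fun w => by
  obtain ⟨j₀, hj⟩ : ∃ j₀ : ℕ, ∀ j ≥ j₀, (Sum.inr (p, j) : Fin N × ℕ ⊕ Fin N × ℕ) ∉ w.vars := by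
    obtain ⟨b, hb⟩ := (w.vars.image (Sum.elim (fun x => x.2) (fun x => x.2))).bddAbove
    refine ⟨b + 1, fun j hj h => ?_⟩
    have := hb (Finset.mem_coe.2 (Finset.mem_image_of_mem _ h))
    simp only [Sum.elim_inr] at this
    omega
  refine ⟨j₀ + 1, fun n hn => ?_⟩
  obtain ⟨j, rfl⟩ : ∃ j : ℕ, n = Int.ofNat (j + 1) := ⟨(n - 1).toNat, by
    simp only [Int.ofNat_eq_natCast]; omega⟩
  rw [u_pos, MvPolynomial.pderiv_eq_zero_of_notMem_vars (hj j (by simp at hn; omega)), smul_zero]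

theorem v_truncated (p : Fin N) : Truncated (v p) := fun w => by
  obtain ⟨j₀, hj⟩ : ∃ j₀ : ℕ, ∀ j ≥ j₀, (Sum.inl (p, j) : Fin N × ℕ ⊕ Fin N × ℕ) ∉ w.vars := by
    obtain ⟨b, hb⟩ := (w.vars.image (Sum.elim (fun x => x.2) (fun x => x.2))).bddAbove
    refine ⟨b + 1, fun j hj h => ?_⟩
    have := hb (Finset.mem_coe.2 (Finset.mem_image_of_mem _ h))
    simp only [Sum.elim_inl] at this
    omega
  refine ⟨j₀ + 1, fun n hn => ?_⟩
  obtain ⟨j, rfl⟩ : ∃ j : ℕ, n = Int.ofNat (j + 1) := ⟨(n - 1).toNat, by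
    simp only [Int.ofNat_eq_natCast]; omega⟩
  rw [v_pos, MvPolynomial.pderiv_eq_zero_of_notMem_vars (hj j (by simp at hn; omega)), smul_zero]

theorem u_one (p : Fin N) (n : ℤ) (hn : 0 ≤ n) : u p n 1 = 0 := by
  rcases n with (_ | n) | n
  · rfl
  · simp [u]
  · simp at hn

theorem v_one (p : Fin N) (n : ℤ) (hn : 0 ≤ n) : v p n 1 = 0 := by
  rcases n with (_ | n) | n
  · rfl
  · simp [v]
  · simp at hn

/-- The infinitesimal translation of the Fock space. -/
def translation (N : ℕ) : Derivation ℂ (Fock N) (Fock N) :=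
  MvPolynomial.mkDerivation ℂ (Sum.elim
    (fun x => ((x.2 : ℂ) + 1) • MvPolynomial.X (Sum.inl (x.1, x.2 + 1)))
    (fun x => ((x.2 : ℂ) + 1) • MvPolynomial.X (Sum.inr (x.1, x.2 + 1))))

theorem translation_X_inl (p : Fin N) (j : ℕ) : translation N (MvPolynomial.X (Sum.inl (p, j))) =
    ((j : ℂ) + 1) • MvPolynomial.X (Sum.inl (p, j + 1)) := MvPolynomial.mkDerivation_X _ _ _

theorem translation_X_inr (p : Fin N) (j : ℕ) : translation N (MvPolynomial.X (Sum.inr (p, j))) =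
    ((j : ℂ) + 1) • MvPolynomial.X (Sum.inr (p, j + 1)) := MvPolynomial.mkDerivation_X _ _ _

theorem translation_pderiv_inr (p : Fin N) (j : ℕ) (w : Fock N) :
    translation N (MvPolynomial.pderiv (Sum.inr (p, j)) w) =
      MvPolynomial.pderiv (Sum.inr (p, j)) (translation N w) - u p j w := by
  have key : ⁅translation N, MvPolynomial.pderiv (Sum.inr (p, j))⁆ =
      -(match j with
        | 0 => 0
        | i + 1 => ((i : ℂ) + 1) • MvPolynomial.pderiv (Sum.inr (p, i)) :
        Derivation ℂ (Fock N) (Fock N)) := MvPolynomial.derivation_ext fun k => by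
    rw [Derivation.commutator_apply]
    rcases k with ⟨q, i⟩ | ⟨q, i⟩
    · rw [translation_X_inl, Derivation.map_smul, MvPolynomial.pderiv_X_of_ne (by simp),
        MvPolynomial.pderiv_X_of_ne (by simp)]
      rcases j with _ | j <;> simp
    · rw [translation_X_inr, Derivation.map_smul, MvPolynomial.pderiv_X, MvPolynomial.pderiv_X,
        Pi.single_apply, Pi.single_apply]
      rcases j with _ | j
      · simp; split_ifs <;> simp
      · rw [Derivation.neg_apply, Derivation.smul_apply, MvPolynomial.pderiv_X, Pi.single_apply]
        simp only [Sum.inr.injEq, Prod.mk.injEq, Nat.add_right_cancel_iff]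
        by_cases h : q = p ∧ i = j
        · obtain ⟨rfl, rfl⟩ := h
          simp
        · rw [if_neg h]
          split_ifs <;> simp
  have := congrArg (fun D => D w) key
  simp only [Derivation.commutator_apply, Derivation.neg_apply] at this
  rw [sub_eq_iff_eq_add] at this
  rw [this]
  rcases j with _ | j
  · change -0 + _ = _ - 0
    simp
  · change _ = _ - u p (Int.ofNat (j + 1)) w
    rw [u_pos, Derivation.smul_apply]
    abel

theorem translation_u (p : Fin N) (n : ℤ) (w : Fock N) :
    translation N (u p n w) = u p n (translation N w) - (n : ℂ) • u p (n - 1) w := by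
  rcases n with (_ | n) | n
  · simp [show u p 0 = 0 from rfl]
  · rw [u_pos, u_pos, Derivation.map_smul, translation_pderiv_inr, Int.ofNat_eq_natCast,
      show ((n + 1 : ℕ) : ℤ) - 1 = n by push_cast; ring]
    push_cast
    rw [smul_sub]
  · rw [show Int.negSucc n - 1 = Int.negSucc (n + 1) by simp only [Int.negSucc_eq]; omega,
      u_neg, u_neg, u_neg, Derivation.leibniz, translation_X_inl, Int.negSucc_eq, smul_eq_mul,
      smul_eq_mul, mul_smul_comm, mul_comm w]
    push_cast
    module

theorem translation_pderiv_inl (p : Fin N) (j : ℕ) (w : Fock N) :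
    translation N (MvPolynomial.pderiv (Sum.inl (p, j)) w) =
      MvPolynomial.pderiv (Sum.inl (p, j)) (translation N w) - v p j w := by
  have key : ⁅translation N, MvPolynomial.pderiv (Sum.inl (p, j))⁆ =
      -(match j with
        | 0 => 0
        | i + 1 => ((i : ℂ) + 1) • MvPolynomial.pderiv (Sum.inl (p, i)) :
        Derivation ℂ (Fock N) (Fock N)) := MvPolynomial.derivation_ext fun k => by
    rw [Derivation.commutator_apply]
    rcases k with ⟨q, i⟩ | ⟨q, i⟩
    swap
    · rw [translation_X_inr, Derivation.map_smul, MvPolynomial.pderiv_X_of_ne (by simp),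
        MvPolynomial.pderiv_X_of_ne (by simp)]
      rcases j with _ | j <;> simp
    · rw [translation_X_inl, Derivation.map_smul, MvPolynomial.pderiv_X, MvPolynomial.pderiv_X,
        Pi.single_apply, Pi.single_apply]
      rcases j with _ | j
      · simp; split_ifs <;> simp
      · rw [Derivation.neg_apply, Derivation.smul_apply, MvPolynomial.pderiv_X, Pi.single_apply]
        simp only [Sum.inl.injEq, Prod.mk.injEq, Nat.add_right_cancel_iff]
        by_cases h : q = p ∧ i = j
        · obtain ⟨rfl, rfl⟩ := h
          simp
        · rw [if_neg h]
          split_ifs <;> simp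
  have := congrArg (fun D => D w) key
  simp only [Derivation.commutator_apply, Derivation.neg_apply] at this
  rw [sub_eq_iff_eq_add] at this
  rw [this]
  rcases j with _ | j
  · change -0 + _ = _ - 0
    simp
  · change _ = _ - v p (Int.ofNat (j + 1)) w
    rw [v_pos, Derivation.smul_apply]
    abel

theorem translation_v (p : Fin N) (n : ℤ) (w : Fock N) :
    translation N (v p n w) = v p n (translation N w) - (n : ℂ) • v p (n - 1) w := by
  rcases n with (_ | n) | n
  · simp [show v p 0 = 0 from rfl]
  · rw [v_pos, v_pos, Derivation.map_smul, translation_pderiv_inl, Int.ofNat_eq_natCast,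
      show ((n + 1 : ℕ) : ℤ) - 1 = n by push_cast; ring]
    push_cast
    rw [smul_sub]
  · rw [show Int.negSucc n - 1 = Int.negSucc (n + 1) by simp only [Int.negSucc_eq]; omega,
      v_neg, v_neg, v_neg, Derivation.leibniz, translation_X_inr, Int.negSucc_eq, smul_eq_mul,
      smul_eq_mul, mul_smul_comm, mul_comm w]
    push_cast
    module

end Fock

/-! ### The affine and Virasoro factors -/

section AffineFactor
variable {𝔞 : Type} [LieRing 𝔞] [LieAlgebra ℂ 𝔞] {B : InvForm 𝔞} {k : ℂ}

@[elab_as_elim]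
theorem Affine.induction {p : Affine B → Prop} (x : Affine B) (central : p (Affine.central B))
    (mode : ∀ a m, p (Affine.mode B a m)) (add : ∀ x y, p x → p y → p (x + y))
    (smul : ∀ (r : ℂ) x, p x → p (r • x)) : p x :=
  (Affine.eq_top_of_mode_mem B
    { carrier := {x | p x}
      add_mem' := fun h h' => add _ _ h h'
      zero_mem' := by simpa using smul 0 _ central
      smul_mem' := fun r x h => smul r x h } central mode).ge (Submodule.mem_top (x := x))

@[elab_as_elim]
theorem Vir.induction {p : Vir → Prop} (x : Vir) (central : p Vir.central)
    (L : ∀ m, p (Vir.L m)) (add : ∀ x y, p x → p y → p (x + y))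
    (smul : ∀ (r : ℂ) x, p x → p (r • x)) : p x :=
  (Vir.eq_top_of_L_mem
    { carrier := {x | p x}
      add_mem' := fun h h' => add _ _ h h'
      zero_mem' := by simpa using smul 0 _ central
      smul_mem' := fun r x h => smul r x h } central L).ge (Submodule.mem_top (x := x))

theorem AffineVac.eq_top {Q : Type*} [AddCommGroup Q] [Module ℂ Q]
    (P : Submodule ℂ (AffineVac B k ⊗[ℂ] Q)) (hv : ∀ q, Induced.vac ⊗ₜ q ∈ P)
    (h : ∀ a m, ∀ w ∈ P, LinearMap.rTensor Q (Induced.act (Affine.mode B a m)) w ∈ P) : P = ⊤ := by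
  refine Induced.span_tensor P hv fun x => ?_
  induction x using Affine.induction with
  | central =>
    intro w hw
    have : LinearMap.rTensor Q (Induced.act (Affine.central B) : Module.End ℂ (AffineVac B k)) =
        k • LinearMap.id := by
      refine TensorProduct.ext' fun x y => ?_
      rw [LinearMap.rTensor_tmul, Induced.act_central (Affine.lie_central B)]
      rfl
    rw [this]
    exact P.smul_mem _ hw
  | mode a m => exact h a m
  | add x y hx hy =>
    intro w hw
    have : (Induced.act (x + y) : Module.End ℂ (AffineVac B k)) = Induced.act x + Induced.act y :=
      LinearMap.ext (Induced.act_add x y)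
    rw [this, LinearMap.rTensor_add]
    exact P.add_mem (hx w hw) (hy w hw)
  | smul r x hx =>
    intro w hw
    have : (Induced.act (r • x) : Module.End ℂ (AffineVac B k)) = r • Induced.act x :=
      LinearMap.ext (Induced.act_smul r x)
    rw [this, LinearMap.rTensor_smul]
    exact P.smul_mem r (hx w hw)

theorem VirVac.eq_top (P : Submodule ℂ (VirVac k)) (hv : Induced.vac ∈ P)
    (h : ∀ m, ∀ w ∈ P, Induced.act (Vir.L m) w ∈ P) : P = ⊤ := by
  refine Induced.eq_top_of_act_mem P hv fun x => ?_
  induction x using Vir.induction with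
  | central =>
    intro w hw
    rw [Induced.act_central Vir.lie_central]
    exact P.smul_mem _ hw
  | L m => exact h m
  | add x y hx hy =>
    intro w hw
    rw [Induced.act_add]
    exact P.add_mem (hx w hw) (hy w hw)
  | smul r x hx =>
    intro w hw
    rw [Induced.act_smul]
    exact P.smul_mem r (hx w hw)

theorem AffineVac.mode_comm_mode (a b : 𝔞) (m s : ℤ) (w : AffineVac B k) :
    Induced.act (Affine.mode B a m) (Induced.act (Affine.mode B b s) w) =
      Induced.act (Affine.mode B b s) (Induced.act (Affine.mode B a m) w) +
      Induced.act (Affine.mode B ⁅a, b⁆ (m + s)) w +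
      (if m = -s then (m : ℂ) * B.form a b * k else 0) • w := by
  have h := Induced.act_lie (Affine.mode B a m) (Affine.mode B b s) w
  rw [Affine.lie_mode_mode, Induced.act_add, Induced.act_smul,
    Induced.act_central (Affine.lie_central B), smul_smul, ite_mul, zero_mul] at h
  rw [add_assoc, h]
  abel

theorem VirVac.L_comm_L (m s : ℤ) (w : VirVac k) :
    Induced.act (Vir.L m) (Induced.act (Vir.L s) w) =
      Induced.act (Vir.L s) (Induced.act (Vir.L m) w) +
      ((m : ℂ) - s) • Induced.act (Vir.L (m + s)) w +
      (if m = -s then ((m : ℂ) ^ 3 - m) / 12 * k else 0) • w := by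
  have h := Induced.act_lie (Vir.L m) (Vir.L s) w
  rw [Vir.lie_L_L, Induced.act_add, Induced.act_smul, Induced.act_smul,
    Induced.act_central Vir.lie_central, smul_smul, ite_mul, zero_mul] at h
  rw [add_assoc, h]
  abel

theorem AffineVac.truncated (a : 𝔞) :
    Truncated fun n => (Induced.act (Affine.mode B a n) : Module.End ℂ (AffineVac B k)) := by
  let P : Submodule ℂ (AffineVac B k) :=
    { carrier := {w | ∀ a : 𝔞, ∃ n₀ : ℤ, ∀ n, n₀ ≤ n → Induced.act (Affine.mode B a n) w = 0}
      add_mem' := fun {x y} hx hy a => by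
        obtain ⟨n, hn⟩ := hx a
        obtain ⟨m, hm⟩ := hy a
        exact ⟨max n m, fun k hk => by rw [map_add, hn k ((le_max_left _ _).trans hk),
          hm k ((le_max_right _ _).trans hk), add_zero]⟩
      zero_mem' := fun a => ⟨0, fun n _ => map_zero _⟩
      smul_mem' := fun r x hx a => by
        obtain ⟨n, hn⟩ := hx a
        exact ⟨n, fun k hk => by rw [map_smul, hn k hk, smul_zero]⟩ }
  have hP : P = ⊤ := by
    refine Induced.eq_top_of_act_mem P (fun a => ⟨0, fun n hn => Induced.act_of_mem ⟨a, n, hn, rfl⟩⟩)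
      fun x => ?_
    induction x using Affine.induction with
    | central =>
      intro w hw
      rw [Induced.act_central (Affine.lie_central B)]
      exact P.smul_mem _ hw
    | mode b s =>
      intro w hw a
      obtain ⟨n₁, h₁⟩ := hw a
      obtain ⟨n₂, h₂⟩ := hw ⁅a, b⁆
      refine ⟨max n₁ (max (n₂ - s) (1 - s)), fun n hn => ?_⟩
      simp only [max_le_iff] at hn
      rw [AffineVac.mode_comm_mode, h₁ n hn.1, h₂ _ (by omega), if_neg (by omega), map_zero,
        zero_smul, add_zero, add_zero]
    | add x y hx hy =>
      intro w hw
      rw [Induced.act_add]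
      exact P.add_mem (hx w hw) (hy w hw)
    | smul r x hx =>
      intro w hw
      rw [Induced.act_smul]
      exact P.smul_mem r (hx w hw)
  exact fun w => (hP.ge (Submodule.mem_top (x := w)) : w ∈ P) a

theorem VirVac.truncated :
    Truncated fun n => (Induced.act (Vir.L (n - 1)) : Module.End ℂ (VirVac k)) := by
  let P : Submodule ℂ (VirVac k) :=
    { carrier := {w | ∃ n₀ : ℤ, ∀ n, n₀ ≤ n → Induced.act (Vir.L (n - 1)) w = 0}
      add_mem' := fun {x y} hx hy => by
        obtain ⟨n, hn⟩ := hx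
        obtain ⟨m, hm⟩ := hy
        exact ⟨max n m, fun k hk => by rw [map_add, hn k ((le_max_left _ _).trans hk),
          hm k ((le_max_right _ _).trans hk), add_zero]⟩
      zero_mem' := ⟨0, fun n _ => map_zero _⟩
      smul_mem' := fun r x hx => by
        obtain ⟨n, hn⟩ := hx
        exact ⟨n, fun k hk => by rw [map_smul, hn k hk, smul_zero]⟩ }
  have hP : P = ⊤ := by
    refine VirVac.eq_top P ⟨0, fun n hn => Induced.act_of_mem ⟨n - 1, by omega, rfl⟩⟩
      fun s w hw => ?_
    obtain ⟨n₁, h₁⟩ := hw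
    refine ⟨max n₁ (max (n₁ - s) (2 - s)), fun n hn => ?_⟩
    simp only [max_le_iff] at hn
    rw [VirVac.L_comm_L, h₁ n hn.1, show n - 1 + s = n + s - 1 by ring, h₁ _ (by omega),
      if_neg (by omega), map_zero, smul_zero, zero_smul, add_zero, add_zero]
  exact fun w => (hP.ge (Submodule.mem_top (x := w)) : w ∈ P)

theorem derivation_lie_of_smul {L : Type*} [LieRing L] [LieAlgebra ℂ L] (δ : L →ₗ[ℂ] L)
    {x y x' y' u u' z : L} {m s c c₁ c₂ : ℂ} (hx : δ x = -m • x') (hy : δ y = -s • y')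
    (h : ⁅x, y⁆ = u + c • z) (h₁ : ⁅x', y⁆ = u' + c₁ • z) (h₂ : ⁅x, y'⁆ = u' + c₂ • z)
    (hu : δ u = -(m + s) • u') (hz : δ z = 0) (hc : m * c₁ + s * c₂ = 0) :
    δ ⁅x, y⁆ = ⁅δ x, y⁆ + ⁅x, δ y⁆ := by
  rw [h, hx, hy, smul_lie, lie_smul, h₁, h₂, map_add, map_smul, hz, hu]
  have : -m • (u' + c₁ • z) + -s • (u' + c₂ • z) =
      -(m + s) • u' - (m * c₁ + s * c₂) • z := by module
  rw [this, hc]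
  simp

/-- The derivation `-d/dt` of the affine Lie algebra. -/
theorem Affine.exists_derivation (B : InvForm 𝔞) : ∃ δ : Affine B →ₗ[ℂ] Affine B,
    (∀ a m, δ (mode B a m) = -(m : ℂ) • mode B a (m - 1)) ∧ δ (central B) = 0 ∧
    ∀ x y, δ ⁅x, y⁆ = ⁅δ x, y⁆ + ⁅x, δ y⁆ := by
  obtain ⟨δ, hδ, hδC⟩ := Affine.exists_linearMap B (P := Affine B) (fun m => -(m : ℂ) •
    { toFun := fun a => mode B a (m - 1)
      map_add' := fun a b => mode_add B a b _
      map_smul' := fun r a => mode_smul B r a _ }) 0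
  have hδ' : ∀ a m, δ (mode B a m) = -(m : ℂ) • mode B a (m - 1) := hδ
  clear hδ
  refine ⟨δ, hδ', hδC, fun x y => ?_⟩
  induction x using Affine.induction with
  | central => rw [Affine.lie_central, hδC, zero_lie, Affine.lie_central, map_zero, add_zero]
  | add x x' hx hx' => rw [add_lie, map_add, hx, hx', map_add, add_lie, add_lie]; abel
  | smul r x hx => rw [smul_lie, map_smul, hx, map_smul, smul_lie, smul_lie, smul_add]
  | mode a m =>
    induction y using Affine.induction with
    | central =>
      rw [Affine.lie_central', hδC, lie_zero, Affine.lie_central', map_zero, add_zero]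
    | add x x' hx hx' => rw [lie_add, map_add, hx, hx', map_add, lie_add, lie_add]; abel
    | smul r x hx => rw [lie_smul, map_smul, hx, map_smul, lie_smul, lie_smul, smul_add]
    | mode b s =>
      refine derivation_lie_of_smul δ (hδ' a m) (hδ' b s) (lie_mode_mode B a b m s)
        ((lie_mode_mode B a b (m - 1) s).trans (by rw [show m - 1 + s = m + s - 1 by ring]))
        ((lie_mode_mode B a b m (s - 1)).trans (by rw [show m + (s - 1) = m + s - 1 by ring]))
        ((hδ' ⁅a, b⁆ (m + s)).trans (by push_cast; rfl)) hδC ?_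
      by_cases h : m + s = 1
      · obtain rfl : s = 1 - m := by omega
        rw [if_pos (by omega), if_pos (by omega)]
        push_cast
        ring
      · rw [if_neg (by omega), if_neg (by omega)]
        ring

/-- The derivation `-d/dt` of the affine Lie algebra induces the infinitesimal translation. -/
theorem AffineVac.exists_translation (B : InvForm 𝔞) (k : ℂ) :
    ∃ D : Module.End ℂ (AffineVac B k), D Induced.vac = 0 ∧ ∀ a (n : ℤ),
      D * Induced.act (Affine.mode B a n) - Induced.act (Affine.mode B a n) * D =
        -(n : ℂ) • Induced.act (Affine.mode B a (n - 1)) := by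
  obtain ⟨δ, hδ, hδC, hδ'⟩ := Affine.exists_derivation B
  obtain ⟨D, hD, hDx⟩ := Induced.exists_derivation (C := Affine.central B) (k := k)
    (S := {x | ∃ (a : 𝔞) (m : ℤ), 0 ≤ m ∧ x = Affine.mode B a m}) δ hδ' (by
      rintro x ⟨a, m, hm, rfl⟩
      rw [hδ a m, Induced.act_smul]
      rcases hm.eq_or_lt with rfl | hm
      · simp
      · rw [Induced.act_of_mem (Set.mem_ofPred_eq ▸ ⟨a, m - 1, by omega, rfl⟩), smul_zero]) hδC
  refine ⟨D, hD, fun a n => LinearMap.ext fun w => ?_⟩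
  rw [LinearMap.sub_apply, Module.End.mul_apply, Module.End.mul_apply, hDx, hδ a n,
    Induced.act_smul, add_sub_cancel_left, LinearMap.smul_apply]

/-- The operator `L(-1)` is the infinitesimal translation. -/
theorem VirVac.translation (n : ℤ) :
    (Induced.act (Vir.L (-1)) * Induced.act (Vir.L (n - 1)) -
      Induced.act (Vir.L (n - 1)) * Induced.act (Vir.L (-1)) : Module.End ℂ (VirVac k)) =
        -(n : ℂ) • Induced.act (Vir.L (n - 1 - 1)) := by
  refine LinearMap.ext fun w => ?_
  rw [LinearMap.sub_apply, Module.End.mul_apply, Module.End.mul_apply, VirVac.L_comm_L,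
    LinearMap.smul_apply, show -1 + (n - 1) = n - 1 - 1 by ring]
  have : (if (-1 : ℤ) = -(n - 1) then (((-1 : ℤ) : ℂ) ^ 3 - (-1 : ℤ)) / 12 * k else 0) = 0 := by
    split_ifs <;> norm_num
  rw [this, zero_smul, add_zero, add_sub_cancel_left]
  congr 1
  push_cast
  ring

end AffineFactor

/-! ### The fields of the tensor product `V` -/

section
attribute [local instance 100] LieRing.ofAssociativeRing

theorem single_lie_single {N : ℕ} (a b c d : Fin N) :
    ⁅(Matrix.single a b 1 : Matrix (Fin N) (Fin N) ℂ), (Matrix.single c d 1 : Matrix (Fin N) (Fin N) ℂ)⁆ =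
      (if b = c then Matrix.single a d 1 else 0) - (if d = a then Matrix.single c b 1 else 0) := by
  rw [LieRing.of_associative_ring_bracket]
  congr 1
  · split_ifs with h
    · subst h; simp
    · simp [h]
  · split_ifs with h
    · subst h; simp
    · simp [h]

theorem traceForm_single {N : ℕ} (a b c d : Fin N) :
    (traceForm N).form (Matrix.single a b 1) (Matrix.single c d 1) =
      if b = c ∧ a = d then 1 else 0 := by
  change (Matrix.single a b (1 : ℂ) * Matrix.single c d 1).trace = _
  by_cases h : b = c
  · subst h
    by_cases h' : a = d
    · subst h'; simp
    · simp [h', Matrix.trace_single_eq_of_ne]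
  · simp [h]

theorem GlVac.E_comm_E {N : ℕ} (a b c d : Fin N) (m s : ℤ) (w : GlVac N) :
    GlVac.E a b m (GlVac.E c d s w) = GlVac.E c d s (GlVac.E a b m w) +
      ((if b = c then GlVac.E a d (m + s) w else 0) -
        (if d = a then GlVac.E c b (m + s) w else 0)) +
      (if b = c ∧ a = d ∧ m = -s then (m : ℂ) else 0) • w := by
  refine (AffineVac.mode_comm_mode _ _ m s w).trans ?_
  rw [single_lie_single, traceForm_single, mul_one]
  congr 2
  · have : ∀ x y : Matrix (Fin N) (Fin N) ℂ,
        Induced.act (Affine.mode (traceForm N) (x - y) (m + s)) w =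
        Induced.act (Affine.mode (traceForm N) x (m + s)) w -
          Induced.act (Affine.mode (traceForm N) y (m + s)) w := fun x y => by
      rw [eq_sub_iff_add_eq, ← Induced.act_add, ← Affine.mode_add, sub_add_cancel]
    have h0 : Induced.act (Affine.mode (traceForm N) 0 (m + s)) w = 0 := by
      simpa using this 0 0
    rw [this]
    congr 1
    · split_ifs
      · rfl
      · exact h0
    · split_ifs
      · rfl
      · exact h0
  · by_cases h1 : b = c <;> by_cases h2 : a = d <;> by_cases h3 : m = -s <;> simp [h1, h2, h3]

theorem GlVac.E_truncated {N : ℕ} (a b : Fin N) : Truncated (GlVac.E a b) :=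
  AffineVac.truncated _

end

/-- The infinitesimal translation of the universal affine vertex algebra. -/
def AffineVac.translation {𝔞 : Type} [LieRing 𝔞] [LieAlgebra ℂ 𝔞] (B : InvForm 𝔞) (k : ℂ) :
    Module.End ℂ (AffineVac B k) := (AffineVac.exists_translation B k).choose

theorem rTensor_commutator {M P : Type*} [AddCommGroup M] [Module ℂ M] [AddCommGroup P] [Module ℂ P]
    {x y z : Module.End ℂ M} {r : ℂ} (h : ∀ w, x (y w) = y (x w) + z w + r • w) (w : M ⊗[ℂ] P) :
    LinearMap.rTensor P x (LinearMap.rTensor P y w) =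
      LinearMap.rTensor P y (LinearMap.rTensor P x w) + LinearMap.rTensor P z w + r • w := by
  induction w using TensorProduct.induction_on with
  | zero => simp
  | add a b ha hb => simp only [map_add, ha, hb, smul_add]; abel
  | tmul a b =>
    simp only [LinearMap.rTensor_tmul, h, TensorProduct.add_tmul, TensorProduct.smul_tmul']

theorem lTensor_commutator {M P : Type*} [AddCommGroup M] [Module ℂ M] [AddCommGroup P] [Module ℂ P]
    {x y z : Module.End ℂ M} {r : ℂ} (h : ∀ w, x (y w) = y (x w) + z w + r • w) (w : P ⊗[ℂ] M) :
    LinearMap.lTensor P x (LinearMap.lTensor P y w) =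
      LinearMap.lTensor P y (LinearMap.lTensor P x w) + LinearMap.lTensor P z w + r • w := by
  induction w using TensorProduct.induction_on with
  | zero => simp
  | add a b ha hb => simp only [map_add, ha, hb, smul_add]; abel
  | tmul a b =>
    simp only [LinearMap.lTensor_tmul, h, TensorProduct.tmul_add, TensorProduct.tmul_smul]

namespace VSpace
variable {𝔤 : Type} [LieRing 𝔤] [LieAlgebra ℂ 𝔤] {N : ℕ} {B : InvForm 𝔤} {c k : ℂ}

section
attribute [local instance 100] LieRing.ofAssociativeRing

variable (N B c k) in
/-- The infinitesimal translation of `V`. -/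
def translation : Module.End ℂ (VSpace N B c k) :=
  tensorD (Fock.translation N).toLinearMap (tensorD (AffineVac.translation (traceForm N) 1)
    (tensorD (AffineVac.translation B c) (Induced.act (Vir.L (-1)))))

theorem translation_vac : translation N B c k vac = 0 := by
  have h : ∀ {𝔞 : Type} [LieRing 𝔞] [LieAlgebra ℂ 𝔞] (B : InvForm 𝔞) (k : ℂ),
    AffineVac.translation B k Induced.vac = 0 :=
    fun B k => (AffineVac.exists_translation B k).choose_spec.1
  have h' : Induced.act (Vir.L (-1)) (Induced.vac : VirVac k) = 0 :=
    Induced.act_of_mem ⟨-1, le_rfl, rfl⟩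
  have h1 : (Fock.translation N).toLinearMap (1 : Fock N) = 0 := Derivation.map_one_eq_zero _
  exact tensorD_tmul_eq_zero h1 (tensorD_tmul_eq_zero (h _ _) (tensorD_tmul_eq_zero (h _ _) h'))

theorem translation_mode (a : Gen N 𝔤) (n : ℤ) :
    translation N B c k * mode a n - mode a n * translation N B c k =
      -(n : ℂ) • mode a (n - 1) := by
  have h : ∀ {𝔞 : Type} [LieRing 𝔞] [LieAlgebra ℂ 𝔞] (B : InvForm 𝔞) (k : ℂ) (a : 𝔞) (n : ℤ),
      AffineVac.translation B k * Induced.act (Affine.mode B a n) -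
        Induced.act (Affine.mode B a n) * AffineVac.translation B k =
        -(n : ℂ) • Induced.act (Affine.mode B a (n - 1)) :=
    fun B k => (AffineVac.exists_translation B k).choose_spec.2
  cases a with
  | u p =>
    refine (tensorD_rTensor _ (c := -(n : ℂ) • Fock.u p (n - 1)) (LinearMap.ext fun w => ?_)).trans
      (LinearMap.rTensor_smul _ _ _)
    change Fock.translation N (Fock.u p n w) - Fock.u p n (Fock.translation N w) =
      -(n : ℂ) • Fock.u p (n - 1) w
    rw [Fock.translation_u]
    module
  | v p =>
    refine (tensorD_rTensor _ (c := -(n : ℂ) • Fock.v p (n - 1)) (LinearMap.ext fun w => ?_)).trans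
      (LinearMap.rTensor_smul _ _ _)
    change Fock.translation N (Fock.v p n w) - Fock.v p n (Fock.translation N w) =
      -(n : ℂ) • Fock.v p (n - 1) w
    rw [Fock.translation_v]
    module
  | E a b =>
    refine (tensorD_lTensor _ (tensorD_rTensor _ (h _ _ _ n))).trans ?_
    rw [LinearMap.rTensor_smul, LinearMap.lTensor_smul]
    rfl
  | g x =>
    refine (tensorD_lTensor _ (tensorD_lTensor _ (tensorD_rTensor _ (h _ _ _ n)))).trans ?_
    rw [LinearMap.rTensor_smul, LinearMap.lTensor_smul, LinearMap.lTensor_smul]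
    rfl
  | vir =>
    refine (tensorD_lTensor _ (tensorD_lTensor _ (tensorD_lTensor _
      (VirVac.translation n)))).trans ?_
    rw [LinearMap.lTensor_smul, LinearMap.lTensor_smul, LinearMap.lTensor_smul]
    rfl

theorem mode_truncated (a : Gen N 𝔤) :
    Truncated (mode a : ℤ → Module.End ℂ (VSpace N B c k)) := by
  cases a with
  | u p => exact (Fock.u_truncated p).rTensor
  | v p => exact (Fock.v_truncated p).rTensor
  | E a b => exact (GlVac.E_truncated a b).rTensor.lTensor
  | g x => exact (AffineVac.truncated x).rTensor.lTensor.lTensor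
  | vir => exact VirVac.truncated.lTensor.lTensor.lTensor

theorem mode_vac (a : Gen N 𝔤) {n : ℤ} (hn : 0 ≤ n) :
    mode a n (vac : VSpace N B c k) = 0 := by
  cases a with
  | u p => simp [mode, vac, Fock.u_one p n hn]
  | v p => simp [mode, vac, Fock.v_one p n hn]
  | E a b =>
    have : GlVac.E a b n Induced.vac = 0 := Induced.act_of_mem ⟨_, n, hn, rfl⟩
    simp [mode, vac, this]
  | g x =>
    have : Induced.act (Affine.mode B x n) (Induced.vac : AffineVac B c) = 0 :=
      Induced.act_of_mem ⟨_, n, hn, rfl⟩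
    simp only [mode, vac, LinearMap.lTensor_tmul, LinearMap.rTensor_tmul, this,
      TensorProduct.zero_tmul, TensorProduct.tmul_zero]
  | vir =>
    have : Induced.act (Vir.L (n - 1)) (Induced.vac : VirVac k) = 0 :=
      Induced.act_of_mem ⟨n - 1, by omega, rfl⟩
    simp only [mode, vac, LinearMap.lTensor_tmul, this, TensorProduct.tmul_zero]

theorem eq_top (P : Submodule ℂ (VSpace N B c k)) (hv : vac ∈ P)
    (h : ∀ a n, ∀ w ∈ P, mode a n w ∈ P) : P = ⊤ := by
  have h1 : ∀ w : VirVac k, (1 : Fock N) ⊗ₜ[ℂ] ((Induced.vac : GlVac N) ⊗ₜ[ℂ]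
      ((Induced.vac : AffineVac B c) ⊗ₜ[ℂ] w)) ∈ P := by
    have := VirVac.eq_top (P.comap ((TensorProduct.mk ℂ (Fock N) _ 1).comp
      ((TensorProduct.mk ℂ (GlVac N) _ Induced.vac).comp
        (TensorProduct.mk ℂ (AffineVac B c) (VirVac k) Induced.vac)))) hv
      (fun m w hw => by simpa [mode] using h .vir (m + 1) _ hw)
    exact fun w => this.ge (Submodule.mem_top (x := w))
  have h2 : ∀ w : AffineVac B c ⊗[ℂ] VirVac k, (1 : Fock N) ⊗ₜ[ℂ]
      ((Induced.vac : GlVac N) ⊗ₜ[ℂ] w) ∈ P := by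
    have := AffineVac.eq_top (P.comap ((TensorProduct.mk ℂ (Fock N) _ 1).comp
      (TensorProduct.mk ℂ (GlVac N) (AffineVac B c ⊗[ℂ] VirVac k) Induced.vac))) h1
      (fun a m w hw => h (.g a) m _ hw)
    exact fun w => this.ge (Submodule.mem_top (x := w))
  have h3 : ∀ w : GlVac N ⊗[ℂ] (AffineVac B c ⊗[ℂ] VirVac k), (1 : Fock N) ⊗ₜ[ℂ] w ∈ P := by
    have := AffineVac.eq_top (P.comap (TensorProduct.mk ℂ (Fock N)
      (GlVac N ⊗[ℂ] (AffineVac B c ⊗[ℂ] VirVac k)) 1)) h2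
      (fun x m => by
        have key : ∀ x : Matrix (Fin N) (Fin N) ℂ, ∀ w ∈ P.comap (TensorProduct.mk ℂ (Fock N)
            (GlVac N ⊗[ℂ] (AffineVac B c ⊗[ℂ] VirVac k)) 1),
            LinearMap.rTensor _ (Induced.actHom (Affine.mode (traceForm N) x m)) w ∈
              P.comap (TensorProduct.mk ℂ (Fock N)
                (GlVac N ⊗[ℂ] (AffineVac B c ⊗[ℂ] VirVac k)) 1) := by
          intro x w hw
          induction x using Matrix.induction_on' with
          | h_zero =>
            rw [show Affine.mode (traceForm N) 0 m = 0 by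
              simpa using Affine.mode_smul (traceForm N) 0 0 m, map_zero, LinearMap.rTensor_zero]
            exact Submodule.zero_mem _
          | h_add x y hx hy =>
            rw [Affine.mode_add, map_add, LinearMap.rTensor_add]
            exact Submodule.add_mem _ hx hy
          | h_std_basis a b r =>
            rw [show Matrix.single a b r = r • Matrix.single a b (1 : ℂ) by simp, Affine.mode_smul,
              map_smul, LinearMap.rTensor_smul]
            exact Submodule.smul_mem _ r (h (.E a b) m _ hw)
        exact key x)
    exact fun w => this.ge (Submodule.mem_top (x := w))
  refine Submodule.eq_top_iff'.2 fun w => ?_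
  induction w using TensorProduct.induction_on with
  | zero => exact P.zero_mem
  | add x y hx hy => exact P.add_mem hx hy
  | tmul f w =>
    induction f using MvPolynomial.induction_on with
    | C r =>
      rw [MvPolynomial.C_eq_smul_one, ← TensorProduct.smul_tmul']
      exact P.smul_mem r (h3 w)
    | add f g hf hg =>
      rw [TensorProduct.add_tmul]
      exact P.add_mem hf hg
    | mul_X f i hf =>
      rw [mul_comm]
      rcases i with ⟨p, j⟩ | ⟨p, j⟩
      · exact h (.u p) (Int.negSucc j) _ hf
      · exact h (.v p) (Int.negSucc j) _ hf

/-- The number of the tensor factor in which a generator acts. -/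
def factor : Gen N 𝔤 → ℕ
  | .u _ => 0
  | .v _ => 0
  | .E _ _ => 1
  | .g _ => 2
  | .vir => 3

theorem lTensor_commute {P Q : Type*} [AddCommGroup P] [Module ℂ P] [AddCommGroup Q] [Module ℂ Q]
    {x y : Module.End ℂ P} (e : x * y = y * x) : LinearMap.lTensor Q x * LinearMap.lTensor Q y =
      LinearMap.lTensor Q y * LinearMap.lTensor Q x := by
  rw [← LinearMap.lTensor_mul, ← LinearMap.lTensor_mul, e]

theorem mode_comm_of_lt {a b : Gen N 𝔤} (h : factor a < factor b) (m n : ℤ) :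
    (mode a m * mode b n : Module.End ℂ (VSpace N B c k)) = mode b n * mode a m := by
  cases a with
  | u p => cases b with
    | u q | v q => exact absurd h (lt_irrefl 0)
    | E _ _ | g _ | vir => exact rTensor_mul_lTensor _ _
  | v p => cases b with
    | u q | v q => exact absurd h (lt_irrefl 0)
    | E _ _ | g _ | vir => exact rTensor_mul_lTensor _ _
  | E _ _ => cases b with
    | u q | v q => exact absurd h (Nat.not_lt_zero _)
    | E _ _ => exact absurd h (lt_irrefl _)
    | g _ | vir => exact lTensor_commute (rTensor_mul_lTensor _ _)
  | g x => cases b with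
    | u q | v q => exact absurd h (Nat.not_lt_zero _)
    | E _ _ => exact absurd h (by simp [factor])
    | g _ => exact absurd h (lt_irrefl _)
    | vir => exact lTensor_commute (lTensor_commute (rTensor_mul_lTensor _ _))
  | vir => cases b <;> exact absurd h (by simp [factor])

theorem mode_comm_of_ne {a b : Gen N 𝔤} (h : factor a ≠ factor b) (m n : ℤ)
    (w : VSpace N B c k) : mode a m (mode b n w) = mode b n (mode a m w) := by
  rcases h.lt_or_gt with h | h
  · exact LinearMap.congr_fun (mode_comm_of_lt h m n) w
  · exact (LinearMap.congr_fun (mode_comm_of_lt h n m) w).symm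

theorem mode_u_comm_u (p q : Fin N) (m s : ℤ) (w : VSpace N B c k) :
    mode (.u p) m (mode (.u q) s w) = mode (.u q) s (mode (.u p) m w) := by
  refine LinearMap.congr_fun (f := mode (.u p) m * mode (.u q) s)
    (g := mode (.u q) s * mode (.u p) m) (TensorProduct.ext' fun x y => ?_) w
  simp [mode, Fock.u_comm_u p q m s x]

theorem mode_v_comm_v (p q : Fin N) (m s : ℤ) (w : VSpace N B c k) :
    mode (.v p) m (mode (.v q) s w) = mode (.v q) s (mode (.v p) m w) := by
  refine LinearMap.congr_fun (f := mode (.v p) m * mode (.v q) s)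
    (g := mode (.v q) s * mode (.v p) m) (TensorProduct.ext' fun x y => ?_) w
  simp [mode, Fock.v_comm_v p q m s x]

theorem mode_u_comm_v (p q : Fin N) (m s : ℤ) (w : VSpace N B c k) :
    mode (.u p) m (mode (.v q) s w) = mode (.v q) s (mode (.u p) m w) +
      (if p = q ∧ m = -s then (m : ℂ) else 0) • w := by
  refine LinearMap.congr_fun (f := mode (.u p) m * mode (.v q) s)
    (g := mode (.v q) s * mode (.u p) m + (if p = q ∧ m = -s then (m : ℂ) else 0) • LinearMap.id)
    (TensorProduct.ext' fun x y => ?_) w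
  simp only [mode, Module.End.mul_apply, LinearMap.rTensor_tmul, LinearMap.add_apply,
    LinearMap.smul_apply, LinearMap.id_apply, Fock.u_comm_v p q m s x, TensorProduct.add_tmul,
    TensorProduct.smul_tmul']

theorem mode_E_comm_E (a b e d : Fin N) (m s : ℤ) (w : VSpace N B c k) :
    mode (.E a b) m (mode (.E e d) s w) = mode (.E e d) s (mode (.E a b) m w) +
      ((if b = e then mode (.E a d) (m + s) w else 0) -
        (if d = a then mode (.E e b) (m + s) w else 0)) +
      (if b = e ∧ a = d ∧ m = -s then (m : ℂ) else 0) • w := by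
  have h := lTensor_commutator (P := Fock N) (rTensor_commutator (P := AffineVac B c ⊗[ℂ] VirVac k)
    (x := GlVac.E a b m) (y := GlVac.E e d s)
    (z := (if b = e then GlVac.E a d (m + s) else 0) - (if d = a then GlVac.E e b (m + s) else 0))
    (r := if b = e ∧ a = d ∧ m = -s then (m : ℂ) else 0) fun w => by
      refine (GlVac.E_comm_E a b e d m s w).trans ?_
      rw [LinearMap.sub_apply]
      congr 3 <;> split_ifs <;> rfl) w
  refine h.trans ?_
  rw [LinearMap.rTensor_sub, LinearMap.lTensor_sub, LinearMap.sub_apply]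
  congr 3
  · split_ifs
    · rfl
    · rw [LinearMap.rTensor_zero, LinearMap.lTensor_zero, LinearMap.zero_apply]
  · split_ifs
    · rfl
    · rw [LinearMap.rTensor_zero, LinearMap.lTensor_zero, LinearMap.zero_apply]

theorem mode_g_comm_g (x y : 𝔤) (m s : ℤ) (w : VSpace N B c k) :
    mode (.g x) m (mode (.g y) s w) = mode (.g y) s (mode (.g x) m w) +
      mode (.g ⁅x, y⁆) (m + s) w + (if m = -s then (m : ℂ) * B.form x y * c else 0) • w :=
  lTensor_commutator (P := Fock N) (lTensor_commutator (P := GlVac N) (rTensor_commutator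
    (P := VirVac k) fun w => AffineVac.mode_comm_mode x y m s w)) w

theorem mode_vir_comm_vir (m n : ℤ) (w : VSpace N B c k) :
    mode .vir m (mode .vir n w) = mode .vir n (mode .vir m w) +
      ((m : ℂ) - n) • mode .vir (m + n - 1) w +
      (if m + n = 2 then (m : ℂ) * (m - 1) * (m - 2) / 12 * k else 0) • w := by
  refine (lTensor_commutator (P := Fock N) (lTensor_commutator (P := GlVac N) (lTensor_commutator
    (P := AffineVac B c) (x := Induced.act (Vir.L (m - 1))) (y := Induced.act (Vir.L (n - 1)))
    (z := ((m : ℂ) - n) • Induced.act (Vir.L (m + n - 1 - 1)))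
    (r := if m + n = 2 then (m : ℂ) * (m - 1) * (m - 2) / 12 * k else 0) fun w => ?_)) w).trans ?_
  · refine (VirVac.L_comm_L (m - 1) (n - 1) w).trans ?_
    rw [show m - 1 + (n - 1) = m + n - 1 - 1 by ring, LinearMap.smul_apply]
    congr 2
    · congr 1; push_cast; ring
    · by_cases h : m + n = 2
      · rw [if_pos h, if_pos (by omega)]; push_cast; ring
      · rw [if_neg h, if_neg (by omega)]
  · congr 2
    refine (LinearMap.congr_fun ((congrArg (LinearMap.lTensor _) ((congrArg (LinearMap.lTensor _)
      (LinearMap.lTensor_smul _ _ _)).trans (LinearMap.lTensor_smul _ _ _))).trans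
        (LinearMap.lTensor_smul _ _ _)) w).trans ?_
    rfl

end

end VSpace

/-! ### The vertex algebra `V ⊗ R` of a ring with commuting derivations -/

theorem CommutingCurrents.Derives.of_comm {M : Type} [AddCommGroup M] [Module ℂ M] {N : ℕ}
    {U : Fin N → ℤ → Module.End ℂ M} {t : Module.End ℂ M}
    (h : ∀ p m x, t (U p m x) = U p m (t x)) : CommutingCurrents.Derives U t 0 0 0 where
  bdd J := ⟨J, fun x hx p j hj => by rw [← h, hx p j hj, map_zero]⟩
  comm p q m x := by simp
  lie p m x := by
    have : (if m = 0 then (0 : Fin N → Module.End ℂ M) p x else 0) = 0 := by split_ifs <;> simp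
    rw [this, zero_mul, zero_smul, add_zero, add_zero, ubarCoeff]
    split_ifs with hm
    · simp
    · rw [LinearMap.smul_apply, LinearMap.smul_apply, map_smul, h]

/-- The commutation relations of the generating fields of `V`, for operators on a vector space. -/
structure GenRelations {N : ℕ} {𝔤 : Type} [LieRing 𝔤] [LieAlgebra ℂ 𝔤] (B : InvForm 𝔤) (c k : ℂ)
    {M : Type} [AddCommGroup M] [Module ℂ M] (mode : Gen N 𝔤 → ℤ → Module.End ℂ M) : Prop where
  mode_comm_of_ne : ∀ {a b : Gen N 𝔤}, VSpace.factor a ≠ VSpace.factor b → ∀ (m n : ℤ) (w : M),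
    mode a m (mode b n w) = mode b n (mode a m w)
  mode_u_comm_u : ∀ p q m s w,
    mode (.u p) m (mode (.u q) s w) = mode (.u q) s (mode (.u p) m w)
  mode_v_comm_v : ∀ p q m s w,
    mode (.v p) m (mode (.v q) s w) = mode (.v q) s (mode (.v p) m w)
  mode_u_comm_v : ∀ p q m s w, mode (.u p) m (mode (.v q) s w) =
    mode (.v q) s (mode (.u p) m w) + (if p = q ∧ m = -s then (m : ℂ) else 0) • w
  mode_E_comm_E : ∀ a b e d m s w, mode (.E a b) m (mode (.E e d) s w) =
    mode (.E e d) s (mode (.E a b) m w) +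
      ((if b = e then mode (.E a d) (m + s) w else 0) -
        (if d = a then mode (.E e b) (m + s) w else 0)) +
      (if b = e ∧ a = d ∧ m = -s then (m : ℂ) else 0) • w
  mode_g_comm_g : ∀ x y m s w, mode (.g x) m (mode (.g y) s w) =
    mode (.g y) s (mode (.g x) m w) + mode (.g ⁅x, y⁆) (m + s) w +
      (if m = -s then (m : ℂ) * B.form x y * c else 0) • w
  mode_vir_comm_vir : ∀ m n w, mode .vir m (mode .vir n w) = mode .vir n (mode .vir m w) +
      ((m : ℂ) - n) • mode .vir (m + n - 1) w +
      (if m + n = 2 then (m : ℂ) * (m - 1) * (m - 2) / 12 * k else 0) • w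

/-- The data of the vertex algebra `V` on a vector space: the vacuum vector, the infinitesimal
translation and the generating fields, together with the properties of them which determine the
structure. -/
structure FreeFields (N : ℕ) {𝔤 : Type} [LieRing 𝔤] [LieAlgebra ℂ 𝔤] (B : InvForm 𝔤) (c k : ℂ)
    (V : Type) [AddCommGroup V] [Module ℂ V] where
  vac : V
  translation : Module.End ℂ V
  mode : Gen N 𝔤 → ℤ → Module.End ℂ V
  rel : GenRelations B c k mode
  translation_vac : translation vac = 0
  translation_mode : ∀ a n, translation * mode a n - mode a n * translation =
    -(n : ℂ) • mode a (n - 1)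
  mode_truncated : ∀ a, Truncated (mode a)
  mode_vac : ∀ a {n : ℤ}, 0 ≤ n → mode a n vac = 0
  u_zero : ∀ p, mode (.u p) 0 = 0
  v_zero : ∀ p, mode (.v p) 0 = 0
  eq_top : ∀ P : Submodule ℂ V, vac ∈ P → (∀ a n, ∀ w ∈ P, mode a n w ∈ P) → P = ⊤

/-- The fields of the tensor product vertex algebra. -/
def VSpace.freeFields (N : ℕ) {𝔤 : Type} [LieRing 𝔤] [LieAlgebra ℂ 𝔤] (B : InvForm 𝔤) (c k : ℂ) :
    FreeFields N B c k (VSpace N B c k) where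
  vac := VSpace.vac
  translation := VSpace.translation N B c k
  mode := VSpace.mode
  rel :=
    { mode_comm_of_ne := VSpace.mode_comm_of_ne
      mode_u_comm_u := VSpace.mode_u_comm_u
      mode_v_comm_v := VSpace.mode_v_comm_v
      mode_u_comm_v := VSpace.mode_u_comm_v
      mode_E_comm_E := VSpace.mode_E_comm_E
      mode_g_comm_g := VSpace.mode_g_comm_g
      mode_vir_comm_vir := VSpace.mode_vir_comm_vir }
  translation_vac := VSpace.translation_vac
  translation_mode := VSpace.translation_mode
  mode_truncated := VSpace.mode_truncated
  mode_vac := VSpace.mode_vac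
  u_zero _ := LinearMap.rTensor_zero _
  v_zero _ := LinearMap.rTensor_zero _
  eq_top := VSpace.eq_top

namespace LocalModel
variable {𝔤 : Type} [LieRing 𝔤] [LieAlgebra ℂ 𝔤] {N : ℕ} {B : InvForm 𝔤} {c k : ℂ}
  {V : Type} [AddCommGroup V] [Module ℂ V] (𝓥 : FreeFields N B c k V)
  {R : Type} [CommRing R] [Algebra ℂ R]

variable (R) in
/-- The operators `u_p(n)` on `V ⊗ R`. -/
def current (p : Fin N) (n : ℤ) : Module.End ℂ (V ⊗[ℂ] R) :=
  LinearMap.rTensor R (𝓥.mode (.u p) n)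

variable (R) in
theorem commutingCurrents : CommutingCurrents (current 𝓥 R) where
  comm p q m n x := by
    refine LinearMap.congr_fun (f := current 𝓥 R p m * current 𝓥 R q n)
      (g := current 𝓥 R q n * current 𝓥 R p m) (TensorProduct.ext' fun x y => ?_) x
    exact congrArg (· ⊗ₜ y) (𝓥.rel.mode_u_comm_u p q m n x)
  trunc p := (𝓥.mode_truncated (.u p)).rTensor
  zero p := by
    rw [current, 𝓥.u_zero, LinearMap.rTensor_zero]

variable (V R) in
/-- Multiplication by functions on `V ⊗ R`. -/
def mulOp : R →ₗ[ℂ] Module.End ℂ (V ⊗[ℂ] R) :=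
  (LinearMap.lTensorHom _).comp (LinearMap.mul ℂ R)

theorem mulOp_mul (f g : R) (w : V ⊗[ℂ] R) :
    mulOp V R (f * g) w = mulOp V R f (mulOp V R g w) := by
  refine LinearMap.congr_fun (f := mulOp V R (f * g))
    (g := mulOp V R f * mulOp V R g) (TensorProduct.ext' fun x y => ?_) w
  exact congrArg (x ⊗ₜ ·) (mul_assoc f g y)

theorem rTensor_comm_mulOp (a : Module.End ℂ V) (f : R)
    (w : V ⊗[ℂ] R) :
    LinearMap.rTensor R a (mulOp V R f w) = mulOp V R f (LinearMap.rTensor R a w) :=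
  LinearMap.congr_fun (rTensor_mul_lTensor a (LinearMap.mulLeft ℂ f)) w

theorem rTensor_comm_lTensor (a : Module.End ℂ V) (b : Module.End ℂ R)
    (w : V ⊗[ℂ] R) :
    LinearMap.rTensor R a (LinearMap.lTensor _ b w) =
      LinearMap.lTensor _ b (LinearMap.rTensor R a w) :=
  LinearMap.congr_fun (rTensor_mul_lTensor a b) w

theorem rTensor_comm_rTensor {a b : Module.End ℂ V} (h : ∀ v, a (b v) = b (a v))
    (w : V ⊗[ℂ] R) :
    LinearMap.rTensor R a (LinearMap.rTensor R b w) =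
      LinearMap.rTensor R b (LinearMap.rTensor R a w) := by
  refine LinearMap.congr_fun (f := LinearMap.rTensor R a * LinearMap.rTensor R b)
    (g := LinearMap.rTensor R b * LinearMap.rTensor R a) (TensorProduct.ext' fun x y => ?_) w
  exact congrArg (· ⊗ₜ y) (h x)

/-- For `n ≠ 0` the commutator of `v_q(n)` with `ū_p(z)` is `δ_{pq} z^n`. -/
theorem derives_v (q : Fin N) {n : ℤ} (hn : n ≠ 0) :
    CommutingCurrents.Derives (current 𝓥 R) (LinearMap.rTensor R (𝓥.mode (.v q) n)) 0 n
      (Pi.single q LinearMap.id) := by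
  have h : ∀ p m (x : V ⊗[ℂ] R),
      LinearMap.rTensor R (𝓥.mode (.v q) n) (current 𝓥 R p m x) =
      current 𝓥 R p m (LinearMap.rTensor R (𝓥.mode (.v q) n) x) +
        (if p = q ∧ m = -n then -(m : ℂ) else 0) • x := fun p m x => by
    have := rTensor_commutator (P := R) (x := 𝓥.mode (.u p) m) (y := 𝓥.mode (.v q) n) (z := 0)
      (r := if p = q ∧ m = -n then (m : ℂ) else 0) (fun w => by
        rw [LinearMap.zero_apply, add_zero]; exact 𝓥.rel.mode_u_comm_v p q m n w) x
    rw [LinearMap.rTensor_zero, LinearMap.zero_apply, add_zero] at this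
    rw [current, this, add_assoc, ← add_smul]
    split_ifs <;> simp
  refine ⟨fun J => ⟨max J (1 - n), fun x hx p j hj => ?_⟩, fun p q' m x => ?_, fun p m x => ?_⟩
  · have := h p j x
    rw [if_neg (fun h => by have := h.2; omega), zero_smul, add_zero, hx p j (by omega), map_zero]
      at this
    exact this.symm
  · by_cases hp : p = q
    · subst hp; simp
    · simp [Pi.single_eq_of_ne hp]
  · rw [zero_mul, zero_smul, add_zero, ubarCoeff]
    by_cases hm : m = 0
    · subst hm; simp [hn.symm]
    · rw [if_neg hm, LinearMap.smul_apply, LinearMap.smul_apply, map_smul, h, smul_add, smul_smul]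
      congr 1
      by_cases hp : p = q
      · subst hp
        by_cases hmn : m = n
        · subst hmn
          have : (m : ℂ) ≠ 0 := by exact_mod_cast hm
          simp [this]
        · simp [hmn]
      · simp [hp]

/-- The fields of functions are defined on all vectors: this holds for the vacuum vector, and the
condition is preserved by the generating fields. -/
theorem exists_powerBdd (w : V ⊗[ℂ] R) :
    ∃ b : ℤ, CommutingCurrents.PowerBdd (commutingCurrents 𝓥 R) b w := by
  let P : Submodule ℂ (V ⊗[ℂ] R) :=
    { carrier := {w | ∃ b : ℤ, CommutingCurrents.PowerBdd (commutingCurrents 𝓥 R) b w}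
      add_mem' := fun ⟨b, hb⟩ ⟨b', hb'⟩ =>
        ⟨min b b', (hb.mono (min_le_left _ _)).add (hb'.mono (min_le_right _ _))⟩
      zero_mem' := ⟨0, fun s n _ => map_zero _⟩
      smul_mem' := fun r w ⟨b, hb⟩ => ⟨b, hb.smul r⟩ }
  have hP : ∀ (t : Module.End ℂ _) {c' : ℂ} {k' : ℤ} {σ : Fin N → Module.End ℂ _},
      CommutingCurrents.Derives (current 𝓥 R) t c' k' σ → ∀ w ∈ P, t w ∈ P :=
    fun t _ _ _ ht w ⟨b, hb⟩ => ⟨_, hb.derives ht⟩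
  have h1 : ∀ (r : R), P.comap ((TensorProduct.mk ℂ V R).flip r) = ⊤ := by
    intro r
    refine 𝓥.eq_top _ ⟨0, .of_killed fun p j hj => ?_⟩ fun a n w hw => ?_
    · change 𝓥.mode (.u p) j 𝓥.vac ⊗ₜ[ℂ] r = 0
      rw [𝓥.mode_vac _ hj.le, TensorProduct.zero_tmul]
    · change LinearMap.rTensor R (𝓥.mode a n) (w ⊗ₜ r) ∈ P
      have comm : (∀ p m (x : V), 𝓥.mode a n (𝓥.mode (.u p) m x) =
          𝓥.mode (.u p) m (𝓥.mode a n x)) →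
          LinearMap.rTensor R (𝓥.mode a n) (w ⊗ₜ r) ∈ P := fun h =>
        hP _ (.of_comm fun p m x => rTensor_comm_rTensor (h p m) x) _ hw
      cases a with
      | u p => exact comm fun q m x => 𝓥.rel.mode_u_comm_u p q n m x
      | v q =>
        by_cases hn : n = 0
        · subst hn
          rw [𝓥.v_zero, LinearMap.rTensor_zero]
          exact P.zero_mem
        · exact hP _ (derives_v 𝓥 q hn) _ hw
      | E a b => exact comm fun q m x => 𝓥.rel.mode_comm_of_ne (by simp [VSpace.factor]) _ _ _
      | g x => exact comm fun q m x => 𝓥.rel.mode_comm_of_ne (by simp [VSpace.factor]) _ _ _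
      | vir => exact comm fun q m x => 𝓥.rel.mode_comm_of_ne (by simp [VSpace.factor]) _ _ _
  suffices w ∈ P from this
  induction w using TensorProduct.induction_on with
  | zero => exact P.zero_mem
  | add x y hx hy => exact P.add_mem hx hy
  | tmul v r => exact (h1 r).ge (Submodule.mem_top (x := v))

variable (d : Fin N → Derivation ℂ R R)

/-- The generating fields on `V ⊗ R`: the operators of `V` act in the first factor, except that
`v_p(0) = d_p`. -/
def mode : Gen N 𝔤 → ℤ → Module.End ℂ (V ⊗[ℂ] R)
  | .v p, n => if n = 0 then LinearMap.lTensor _ (d p).toLinearMap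
      else LinearMap.rTensor _ (𝓥.mode (.v p) n)
  | a, n => LinearMap.rTensor _ (𝓥.mode a n)

/-- The coefficients `f_(n)` of the field `Y(1 ⊗ f, z)` of a function. -/
def functionMode (f : R) (n : ℤ) : Module.End ℂ (V ⊗[ℂ] R) where
  toFun := expField (commutingCurrents 𝓥 R) (mulOp V R) d f (-n - 1)
  map_add' w w' := by
    obtain ⟨b, hb⟩ := exists_powerBdd 𝓥 w
    obtain ⟨b', hb'⟩ := exists_powerBdd 𝓥 w'
    exact expField_add hb hb' f _
  map_smul' r w := by
    obtain ⟨b, hb⟩ := exists_powerBdd 𝓥 w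
    exact expField_smul hb r f _

theorem functionMode_apply (f : R) (n : ℤ) (w : V ⊗[ℂ] R) : functionMode 𝓥 d f n w =
    expField (commutingCurrents 𝓥 R) (mulOp V R) d f (-n - 1) w := rfl

theorem mode_of_ne_v {a : Gen N 𝔤} (h : ∀ p, a ≠ .v p) (n : ℤ) :
    (mode 𝓥 d a n : Module.End ℂ (V ⊗[ℂ] R)) = LinearMap.rTensor R (𝓥.mode a n) := by
  cases a with
  | v p => exact absurd rfl (h p)
  | _ => rfl

theorem mode_v_zero (p : Fin N) : (mode 𝓥 d (.v p) 0 : Module.End ℂ (V ⊗[ℂ] R)) =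
    LinearMap.lTensor _ (d p).toLinearMap := by
  rw [mode, if_pos rfl]

theorem mode_v_of_ne (p : Fin N) {n : ℤ} (hn : n ≠ 0) :
    (mode 𝓥 d (.v p) n : Module.End ℂ (V ⊗[ℂ] R)) =
      LinearMap.rTensor _ (𝓥.mode (.v p) n) := by
  rw [mode, if_neg hn]

/-- A generating field of `V ⊗ R` is the one of `V`, plus `d_p` in the case of `v_p(0)`. -/
theorem mode_eq_add (a : Gen N 𝔤) (n : ℤ) : ∃ e : Module.End ℂ R,
    (e = 0 ∨ (n = 0 ∧ ∃ p, a = .v p ∧ e = (d p).toLinearMap)) ∧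
    (mode 𝓥 d a n : Module.End ℂ (V ⊗[ℂ] R)) =
      LinearMap.rTensor R (𝓥.mode a n) + LinearMap.lTensor _ e := by
  cases a with
  | v p =>
    by_cases hn : n = 0
    · subst hn
      refine ⟨(d p).toLinearMap, Or.inr ⟨rfl, p, rfl, rfl⟩, ?_⟩
      rw [mode_v_zero, 𝓥.v_zero, LinearMap.rTensor_zero, zero_add]
    · exact ⟨0, Or.inl rfl, by rw [mode_v_of_ne 𝓥 d p hn, LinearMap.lTensor_zero, add_zero]⟩
  | _ => exact ⟨0, Or.inl rfl, by rw [LinearMap.lTensor_zero, add_zero]; rfl⟩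

variable {𝓥 d}

/-- Commutators of the generating fields of `V ⊗ R` are the ones of `V`. -/
theorem mode_commutator (hd : ∀ p q f, d p (d q f) = d q (d p f)) {a b : Gen N 𝔤} {m n : ℤ}
    {z : Module.End ℂ V} {r : ℂ}
    (h : ∀ v, 𝓥.mode a m (𝓥.mode b n v) = 𝓥.mode b n (𝓥.mode a m v) + z v + r • v)
    (w : V ⊗[ℂ] R) :
    mode 𝓥 d a m (mode 𝓥 d b n w) = mode 𝓥 d b n (mode 𝓥 d a m w) + LinearMap.rTensor R z w + r • w := by
  obtain ⟨e, he, ha⟩ := mode_eq_add 𝓥 d a m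
  obtain ⟨e', he', hb⟩ := mode_eq_add 𝓥 d b n
  have hee : e * e' = e' * e := by
    rcases he with rfl | ⟨-, p, -, rfl⟩
    · simp
    · rcases he' with rfl | ⟨-, q, -, rfl⟩
      · simp
      · exact LinearMap.ext fun f => hd p q f
  have hee' := LinearMap.congr_fun (VSpace.lTensor_commute (Q := V) hee) w
  simp only [Module.End.mul_apply] at hee'
  rw [ha, hb]
  simp only [LinearMap.add_apply, map_add, rTensor_commutator h, rTensor_comm_lTensor, hee']
  abel

theorem mode_comm_of_ne (hd : ∀ p q f, d p (d q f) = d q (d p f)) {a b : Gen N 𝔤}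
    (h : VSpace.factor a ≠ VSpace.factor b) (m n : ℤ) (w : V ⊗[ℂ] R) :
    mode 𝓥 d a m (mode 𝓥 d b n w) = mode 𝓥 d b n (mode 𝓥 d a m w) := by
  have := mode_commutator hd (z := 0) (r := 0) (fun v => by
    rw [𝓥.rel.mode_comm_of_ne h m n v]; simp) w
  simpa using this

theorem mode_u_comm_u (p q : Fin N) (m n : ℤ) (w : V ⊗[ℂ] R) :
    mode 𝓥 d (.u p) m (mode 𝓥 d (.u q) n w) = mode 𝓥 d (.u q) n (mode 𝓥 d (.u p) m w) :=
  (commutingCurrents 𝓥 R).comm p q m n w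

theorem mode_v_comm_v (hd : ∀ p q f, d p (d q f) = d q (d p f)) (p q : Fin N) (m n : ℤ)
    (w : V ⊗[ℂ] R) :
    mode 𝓥 d (.v p) m (mode 𝓥 d (.v q) n w) = mode 𝓥 d (.v q) n (mode 𝓥 d (.v p) m w) := by
  have := mode_commutator hd (z := 0) (r := 0) (fun v => by
    rw [𝓥.rel.mode_v_comm_v p q m n v]; simp) w
  simpa using this

theorem mode_u_comm_v (hd : ∀ p q f, d p (d q f) = d q (d p f)) (p q : Fin N) (m n : ℤ)
    (w : V ⊗[ℂ] R) :
    mode 𝓥 d (.u p) m (mode 𝓥 d (.v q) n w) = mode 𝓥 d (.v q) n (mode 𝓥 d (.u p) m w) +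
      (if p = q ∧ m = -n then (m : ℂ) else 0) • w := by
  have := mode_commutator hd (z := 0) (r := if p = q ∧ m = -n then (m : ℂ) else 0) (fun v => by
    rw [𝓥.rel.mode_u_comm_v p q m n v, LinearMap.zero_apply, add_zero]) w
  simpa using this

theorem mode_E_comm_E (hd : ∀ p q f, d p (d q f) = d q (d p f)) (a b e f : Fin N) (m n : ℤ)
    (w : V ⊗[ℂ] R) :
    mode 𝓥 d (.E a b) m (mode 𝓥 d (.E e f) n w) = mode 𝓥 d (.E e f) n (mode 𝓥 d (.E a b) m w) +
      ((if b = e then mode 𝓥 d (.E a f) (m + n) w else 0) -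
        (if f = a then mode 𝓥 d (.E e b) (m + n) w else 0)) +
      (if b = e ∧ a = f ∧ m = -n then (m : ℂ) else 0) • w := by
  refine (mode_commutator hd (z := (if b = e then 𝓥.mode (.E a f) (m + n) else 0) -
    (if f = a then 𝓥.mode (.E e b) (m + n) else 0))
    (r := if b = e ∧ a = f ∧ m = -n then (m : ℂ) else 0) (fun v => ?_) w).trans ?_
  · rw [𝓥.rel.mode_E_comm_E, LinearMap.sub_apply]
    congr 3 <;> split_ifs <;> rfl
  · rw [LinearMap.rTensor_sub, LinearMap.sub_apply]
    congr 3
    · split_ifs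
      · rfl
      · rw [LinearMap.rTensor_zero, LinearMap.zero_apply]
    · split_ifs
      · rfl
      · rw [LinearMap.rTensor_zero, LinearMap.zero_apply]

theorem mode_g_comm_g (hd : ∀ p q f, d p (d q f) = d q (d p f)) (x y : 𝔤) (m n : ℤ)
    (w : V ⊗[ℂ] R) :
    mode 𝓥 d (.g x) m (mode 𝓥 d (.g y) n w) = mode 𝓥 d (.g y) n (mode 𝓥 d (.g x) m w) +
      mode 𝓥 d (.g ⁅x, y⁆) (m + n) w + (if m = -n then (m : ℂ) * B.form x y * c else 0) • w :=
  mode_commutator hd (fun v => 𝓥.rel.mode_g_comm_g x y m n v) w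

theorem mode_vir_comm_vir (hd : ∀ p q f, d p (d q f) = d q (d p f)) (m n : ℤ)
    (w : V ⊗[ℂ] R) :
    mode 𝓥 d .vir m (mode 𝓥 d .vir n w) = mode 𝓥 d .vir n (mode 𝓥 d .vir m w) +
      ((m : ℂ) - n) • mode 𝓥 d .vir (m + n - 1) w +
      (if m + n = 2 then (m : ℂ) * (m - 1) * (m - 2) / 12 * k else 0) • w := by
  refine (mode_commutator hd (z := ((m : ℂ) - n) • 𝓥.mode .vir (m + n - 1))
    (fun v => 𝓥.rel.mode_vir_comm_vir m n v) w).trans ?_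
  rw [LinearMap.rTensor_smul]
  rfl

/-- Operators which commute with the currents and are derivations over functions. -/
theorem map_functionMode (hd : ∀ p q f, d p (d q f) = d q (d p f))
    {t : Module.End ℂ (V ⊗[ℂ] R)}
    (ht : ∀ p m x, t (current 𝓥 R p m x) = current 𝓥 R p m (t x)) {δ : Module.End ℂ R}
    (hδ : ∀ p f, δ (d p f) = d p (δ f))
    (htm : ∀ r x, t (mulOp V R r x) = mulOp V R r (t x) + mulOp V R (δ r) x)
    (f : R) (n : ℤ) (w : V ⊗[ℂ] R) :
    t (functionMode 𝓥 d f n w) = functionMode 𝓥 d f n (t w) + functionMode 𝓥 d (δ f) n w := by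
  obtain ⟨b, hb⟩ := exists_powerBdd 𝓥 w
  have := map_expField hd (.of_comm ht) hδ htm (fun p r x => by simp) hb f (-n - 1)
  rw [zero_mul, zero_smul, add_zero, Finset.sum_eq_zero (fun p _ => by simp), add_zero] at this
  exact this

theorem functionMode_comm (hd : ∀ p q f, d p (d q f) = d q (d p f))
    {t : Module.End ℂ (V ⊗[ℂ] R)}
    (ht : ∀ p m x, t (current 𝓥 R p m x) = current 𝓥 R p m (t x))
    (htm : ∀ r x, t (mulOp V R r x) = mulOp V R r (t x))
    (f : R) (n : ℤ) (w : V ⊗[ℂ] R) :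
    t (functionMode 𝓥 d f n w) = functionMode 𝓥 d f n (t w) := by
  have h0 : ∀ x, functionMode 𝓥 d (0 : R) n x = 0 := fun x => by
    rw [functionMode_apply, expField]
    simp
  have := map_functionMode hd ht (δ := 0) (fun p f => by simp) (fun r x => by simp [htm]) f n w
  rwa [LinearMap.zero_apply, h0, add_zero] at this

theorem mode_comm_functionMode (hd : ∀ p q f, d p (d q f) = d q (d p f)) {a : Gen N 𝔤}
    (h : ∀ q, a ≠ .v q) (m : ℤ) (f : R) (n : ℤ) (w : V ⊗[ℂ] R) :
    mode 𝓥 d a m (functionMode 𝓥 d f n w) = functionMode 𝓥 d f n (mode 𝓥 d a m w) := by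
  rw [mode_of_ne_v 𝓥 d h]
  refine functionMode_comm hd (fun p m' x => rTensor_comm_rTensor (fun v => ?_) x)
    (fun r x => rTensor_comm_mulOp _ r x) f n w
  cases a with
  | u q => exact 𝓥.rel.mode_u_comm_u _ _ _ _ _
  | v q => exact absurd rfl (h q)
  | _ => exact 𝓥.rel.mode_comm_of_ne (by simp [VSpace.factor]) _ _ _

/-- The commutator of `v_p(m)` and `f_(n)` is `(d_p f)_(m+n)`. For `m ≠ 0` it comes from the
exponential, for `m = 0` from the derivation `d_p`. -/
theorem mode_v_comm_functionMode (hd : ∀ p q f, d p (d q f) = d q (d p f)) (q : Fin N) (m : ℤ)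
    (f : R) (n : ℤ) (w : V ⊗[ℂ] R) :
    mode 𝓥 d (.v q) m (functionMode 𝓥 d f n w) = functionMode 𝓥 d f n (mode 𝓥 d (.v q) m w) +
      functionMode 𝓥 d (d q f) (m + n) w := by
  by_cases hm : m = 0
  · subst hm
    rw [mode_v_zero, zero_add]
    refine map_functionMode hd (fun p m x => (rTensor_comm_lTensor _ _ x).symm)
      (fun p f => hd q p f) (fun r x => ?_) f n w
    refine LinearMap.congr_fun (f := LinearMap.lTensor _ (d q).toLinearMap * mulOp V R r)
      (g := mulOp V R r * LinearMap.lTensor _ (d q).toLinearMap + mulOp V R (d q r))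
      (TensorProduct.ext' fun v y => ?_) x
    change v ⊗ₜ d q (r * y) = v ⊗ₜ (r * d q y) + v ⊗ₜ (d q r * y)
    rw [← TensorProduct.tmul_add, Derivation.leibniz, smul_eq_mul, smul_eq_mul, mul_comm y]
  · rw [mode_v_of_ne 𝓥 d q hm]
    obtain ⟨b, hb⟩ := exists_powerBdd 𝓥 w
    have h0 : ∀ x n, functionMode 𝓥 d (0 : R) n x = 0 := fun x n => by
      rw [functionMode_apply, expField]
      simp
    have := map_expField (mul := mulOp V R) hd (derives_v 𝓥 q hm) (δ := 0) (fun p f => by simp)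
      (fun r x => by
        rw [LinearMap.zero_apply, map_zero, LinearMap.zero_apply, add_zero]
        exact rTensor_comm_mulOp _ r x)
      (fun p r x => by
        by_cases hp : p = q
        · subst hp; simp
        · simp [Pi.single_eq_of_ne hp]) hb f (-n - 1)
    rw [zero_mul, zero_smul, add_zero, Finset.sum_eq_single q, Pi.single_eq_same,
      LinearMap.id_apply, LinearMap.zero_apply] at this
    · rw [functionMode_apply, this, ← functionMode_apply, functionMode_apply 𝓥 d (d q f),
        show -(m + n) - 1 = -n - 1 - m by ring]
      have e := h0 w n
      rw [functionMode_apply] at e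
      rw [e, add_zero]
    · intro p _ hp
      simp [Pi.single_eq_of_ne hp]
    · simp

theorem functionMode_comm_functionMode (hd : ∀ p q f, d p (d q f) = d q (d p f)) (f g : R)
    (m n : ℤ) (w : V ⊗[ℂ] R) :
    functionMode 𝓥 d f m (functionMode 𝓥 d g n w) = functionMode 𝓥 d g n (functionMode 𝓥 d f m w) :=
  functionMode_comm hd (fun p m' x => (mode_comm_functionMode hd (a := .u p) (by simp) m' f m x).symm)
    (fun r x => (functionMode_comm hd (fun p m x => (rTensor_comm_mulOp _ _ x).symm)
      (fun r' x => by rw [← mulOp_mul, ← mulOp_mul, mul_comm]) f m x).symm) g n w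

variable (𝓥 d) in
/-- The infinitesimal translation of `V ⊗ R`. -/
def translation : Module.End ℂ (V ⊗[ℂ] R) :=
  LinearMap.rTensor R (𝓥.translation) +
    ∑ p, LinearMap.rTensor R (𝓥.mode (.u p) (-1)) * LinearMap.lTensor _ (d p).toLinearMap

theorem translation_tmul (v : V) (f : R) : translation 𝓥 d (v ⊗ₜ f) =
    𝓥.translation v ⊗ₜ f + ∑ p, 𝓥.mode (.u p) (-1) v ⊗ₜ d p f := by
  rw [translation, LinearMap.add_apply, LinearMap.sum_apply]
  rfl

/-- The commutator of `D - d/dz` with `ū_p(z)` is `-u_p(-1)`, because `ū_p(z)` has no constant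
term. -/
theorem derives_translation :
    CommutingCurrents.Derives (current 𝓥 R)
      (LinearMap.rTensor R (𝓥.translation)) 1 0 (fun p => -current 𝓥 R p (-1)) := by
  have h : ∀ p m (x : V ⊗[ℂ] R),
      LinearMap.rTensor R (𝓥.translation) (current 𝓥 R p m x) =
      current 𝓥 R p m (LinearMap.rTensor R (𝓥.translation) x) -
        (m : ℂ) • current 𝓥 R p (m - 1) x := fun p m x => by
    have := LinearMap.congr_fun (congrArg (LinearMap.rTensor R)
      (𝓥.translation_mode (.u p) m)) x
    rw [LinearMap.rTensor_sub, LinearMap.rTensor_mul, LinearMap.rTensor_mul, LinearMap.rTensor_smul,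
      LinearMap.sub_apply, sub_eq_iff_eq_add] at this
    refine this.trans ?_
    rw [LinearMap.smul_apply, neg_smul, neg_add_eq_sub]
    rfl
  refine ⟨fun J => ⟨J + 1, fun x hx p j hj => ?_⟩, fun p q' m x => ?_, fun p m x => ?_⟩
  · have := h p j x
    rw [hx p j (by omega), hx p (j - 1) (by omega), map_zero, smul_zero, sub_zero] at this
    exact this.symm
  · rw [LinearMap.neg_apply, LinearMap.neg_apply, map_neg, (commutingCurrents 𝓥 R).comm]
  · rw [one_mul]
    by_cases hm : m = 0
    · subst hm
      simp [ubarCoeff]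
    · have hm' : (m : ℂ) ≠ 0 := by exact_mod_cast hm
      rw [if_neg hm, add_zero, ubarCoeff, if_neg hm, LinearMap.smul_apply, LinearMap.smul_apply,
        map_smul, h, smul_sub, sub_eq_add_neg]
      congr 1
      by_cases hm1 : m + 1 = 0
      · have : -m - 1 = 0 := by omega
        rw [this, (commutingCurrents 𝓥 R).zero]
        simp [ubarCoeff, hm1]
      · have hm1' : (m : ℂ) + 1 ≠ 0 := by exact_mod_cast hm1
        rw [ubarCoeff, if_neg hm1, LinearMap.smul_apply, smul_smul, smul_smul,
          show -(m + 1) = -m - 1 by ring]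
        push_cast
        rw [mul_inv_cancel₀ hm1', ← neg_smul]
        congr 1
        field_simp

theorem translation_functionMode (hd : ∀ p q f, d p (d q f) = d q (d p f)) (f : R) (n : ℤ)
    (w : V ⊗[ℂ] R) : translation 𝓥 d (functionMode 𝓥 d f n w) =
      functionMode 𝓥 d f n (translation 𝓥 d w) - (n : ℂ) • functionMode 𝓥 d f (n - 1) w := by
  obtain ⟨b, hb⟩ := exists_powerBdd 𝓥 w
  have h0 : ∀ x n, functionMode 𝓥 d (0 : R) n x = 0 := fun x n => by
    rw [functionMode_apply, expField]
    simp
  have h1 := map_expField (mul := mulOp V R) hd (derives_translation (𝓥 := 𝓥)) (δ := 0) (fun p f => by simp)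
      (fun r x => by
        rw [LinearMap.zero_apply, map_zero, LinearMap.zero_apply, add_zero]
        exact rTensor_comm_mulOp _ r x)
      (fun p r x => by
        rw [LinearMap.neg_apply, LinearMap.neg_apply, map_neg]
        exact congrArg _ (rTensor_comm_mulOp _ r x)) hb f (-n - 1)
  have h2 : ∀ p, current 𝓥 R p (-1) (LinearMap.lTensor _ (d p).toLinearMap
      (functionMode 𝓥 d f n w)) = functionMode 𝓥 d f n (current 𝓥 R p (-1)
        (LinearMap.lTensor _ (d p).toLinearMap w)) +
        current 𝓥 R p (-1) (functionMode 𝓥 d (d p f) n w) := fun p => by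
    have := mode_v_comm_functionMode (𝓥 := 𝓥) hd p 0 f n w
    rw [mode_v_zero, zero_add] at this
    rw [this, map_add]
    congr 1
    exact mode_comm_functionMode hd (𝓥 := 𝓥) (a := .u p) (by simp) (-1) f n _
  have e := h0 w n
  rw [functionMode_apply] at e
  rw [LinearMap.zero_apply, e, add_zero, show -n - 1 + 1 = -(n - 1) - 1 by ring,
    ← functionMode_apply, ← functionMode_apply, ← functionMode_apply] at h1
  rw [translation, LinearMap.add_apply, LinearMap.sum_apply, h1, LinearMap.add_apply,
    LinearMap.sum_apply, map_add, map_sum]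
  have h3 : ∀ p, (LinearMap.rTensor R (𝓥.mode (.u p) (-1)) *
      LinearMap.lTensor V (d p).toLinearMap) (functionMode 𝓥 d f n w) = _ := h2
  rw [Finset.sum_congr rfl fun p _ => h3 p, Finset.sum_add_distrib]
  have h4 : ∑ p, (-current 𝓥 R p (-1)) (expField (commutingCurrents 𝓥 R)
      (mulOp V R) d (d p f) (-n - 1 - 0) w) =
      -∑ p, current 𝓥 R p (-1) (functionMode 𝓥 d (d p f) n w) := by
    rw [← Finset.sum_neg_distrib]
    refine Finset.sum_congr rfl fun p _ => ?_
    rw [sub_zero]; rfl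
  rw [h4]
  have h5 : (1 * (((-n - 1 : ℤ) : ℂ) + 1)) = -(n : ℂ) := by push_cast; ring
  rw [h5, neg_smul]
  have h6 : ∑ p, functionMode 𝓥 d f n ((LinearMap.rTensor R (𝓥.mode (.u p) (-1)) *
      LinearMap.lTensor V (d p).toLinearMap) w) =
      ∑ p, functionMode 𝓥 d f n (current 𝓥 R p (-1)
        (LinearMap.lTensor _ (d p).toLinearMap w)) := rfl
  rw [h6]
  abel

end LocalModel

/-! ### The vertex algebras `V` and `V ⊗ R` -/

section
variable {𝔤 : Type} [LieRing 𝔤] [LieAlgebra ℂ 𝔤] {N : ℕ} {B : InvForm 𝔤} {c k : ℂ}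

/-- Fields with the commutation relations of `V` are mutually local. -/
theorem GenRelations.localModes {M : Type} [AddCommGroup M] [Module ℂ M]
    {mode : Gen N 𝔤 → ℤ → Module.End ℂ M} (h : GenRelations B c k mode) (a b : Gen N 𝔤) :
    VField.LocalModes (mode a) (mode b) := by
  have comm : ∀ a b : Gen N 𝔤, (∀ m n w, mode a m (mode b n w) = mode b n (mode a m w)) →
      VField.LocalModes (mode a) (mode b) := fun a b e =>
    .of_comm fun i j => LinearMap.ext fun w => e i j w
  have uv : ∀ p q, VField.LocalModes (mode (.u p)) (mode (.v q)) := fun p q => by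
    refine .of_sum 2 (fun j n => if j = 1 ∧ p = q ∧ n = 0 then 1 else 0) fun m n =>
      LinearMap.ext fun w => ?_
    rw [LinearMap.sub_apply, Module.End.mul_apply, Module.End.mul_apply, h.mode_u_comm_v,
      add_sub_cancel_left, Finset.sum_range_succ, Finset.sum_range_one]
    simp only [zero_ne_one, false_and, if_false, true_and, smul_zero, zero_add,
      Ring.choose_one_right, LinearMap.smul_apply, add_eq_zero_iff_eq_neg]
    split_ifs
    · exact Int.cast_smul_eq_zsmul ℂ m w
    · simp
  by_cases hab : VSpace.factor a ≠ VSpace.factor b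
  · exact comm a b (h.mode_comm_of_ne hab)
  rw [not_not] at hab
  cases a with
  | u p => cases b with
    | u q => exact comm _ _ (h.mode_u_comm_u p q)
    | v q => exact uv p q
    | _ => simp [VSpace.factor] at hab
  | v p => cases b with
    | u q => exact (uv q p).symm
    | v q => exact comm _ _ (h.mode_v_comm_v p q)
    | _ => simp [VSpace.factor] at hab
  | E a b => cases ‹Gen N 𝔤› with
    | E e d =>
      refine .of_sum 2 (fun j n => if j = 0 then (if b = e then mode (.E a d) n else 0) -
        (if d = a then mode (.E e b) n else 0) else if b = e ∧ a = d ∧ n = 0 then 1 else 0) fun m n =>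
        LinearMap.ext fun w => ?_
      rw [LinearMap.sub_apply, Module.End.mul_apply, Module.End.mul_apply, h.mode_E_comm_E,
        add_assoc, add_sub_cancel_left, Finset.sum_range_succ, Finset.sum_range_one]
      simp only [if_true, one_ne_zero, if_false, Ring.choose_one_right, Ring.choose_zero_right,
        one_smul, LinearMap.add_apply, LinearMap.sub_apply, LinearMap.smul_apply,
        add_eq_zero_iff_eq_neg]
      congr 1
      · congr 1 <;> split_ifs <;> rfl
      · split_ifs
        · exact Int.cast_smul_eq_zsmul ℂ m w
        · simp
    | _ => simp [VSpace.factor] at hab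
  | g x => cases b with
    | g y =>
      refine .of_sum 2 (fun j n => if j = 0 then mode (.g ⁅x, y⁆) n else
        if n = 0 then (B.form x y * c) • 1 else 0) fun m n => LinearMap.ext fun w => ?_
      rw [LinearMap.sub_apply, Module.End.mul_apply, Module.End.mul_apply, h.mode_g_comm_g,
        add_assoc, add_sub_cancel_left, Finset.sum_range_succ, Finset.sum_range_one]
      simp only [if_true, one_ne_zero, if_false, Ring.choose_one_right, Ring.choose_zero_right,
        one_smul, LinearMap.add_apply, LinearMap.smul_apply, add_eq_zero_iff_eq_neg]
      congr 1
      split_ifs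
      · rw [LinearMap.smul_apply, Module.End.one_apply, ← Int.cast_smul_eq_zsmul ℂ, smul_smul,
          mul_assoc]
      · simp
    | _ => simp [VSpace.factor] at hab
  | vir => cases b with
    | vir =>
      refine .of_sum 4 (fun j n => if j = 0 then -(n : ℂ) • mode .vir (n - 1) else
        if j = 1 then (2 : ℂ) • mode .vir (n - 1) else
        if j = 2 then 0 else if n = 2 then (k / 2) • 1 else 0) fun m n => LinearMap.ext fun w => ?_
      have h3 : ((Ring.choose m 3 : ℤ) : ℂ) = (m : ℂ) * (m - 1) * (m - 2) / 6 := by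
        have e1 := choose_mul_succ m 2
        have e2 := choose_mul_succ m 1
        rw [Ring.choose_one_right] at e2
        have e1' : ((((2 : ℕ) : ℤ) : ℂ) + 1) * ((Ring.choose m 3 : ℤ) : ℂ) =
            ((m : ℂ) - 2) * ((Ring.choose m 2 : ℤ) : ℂ) := by exact_mod_cast e1
        have e2' : ((((1 : ℕ) : ℤ) : ℂ) + 1) * ((Ring.choose m 2 : ℤ) : ℂ) =
            ((m : ℂ) - 1) * (m : ℂ) := by exact_mod_cast e2
        push_cast at e1' e2'
        linear_combination (1 / 3 : ℂ) * e1' + ((m : ℂ) - 2) / 6 * e2'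
      rw [LinearMap.sub_apply, Module.End.mul_apply, Module.End.mul_apply, h.mode_vir_comm_vir,
        add_assoc, add_sub_cancel_left, Finset.sum_range_succ, Finset.sum_range_succ,
        Finset.sum_range_succ, Finset.sum_range_one]
      simp only [if_true, one_ne_zero, if_false, Ring.choose_one_right, Ring.choose_zero_right,
        LinearMap.add_apply, LinearMap.smul_apply, OfNat.ofNat_ne_zero,
        OfNat.ofNat_ne_one, smul_zero, add_zero,
        show (3 : ℕ) ≠ 2 by decide, ← Int.cast_smul_eq_zsmul ℂ, h3, smul_smul]
      rw [← add_smul]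
      congr 1
      · congr 1; push_cast; ring
      · split_ifs
        · rw [LinearMap.smul_apply, Module.End.one_apply, smul_smul]; congr 1; ring
        · simp
    | _ => simp [VSpace.factor] at hab

namespace FreeFields
variable {V : Type} [AddCommGroup V] [Module ℂ V] (𝓥 : FreeFields N B c k V)

/-- The generator with a given label. -/
def state (a : Gen N 𝔤) : V := 𝓥.mode a (-1) 𝓥.vac

/-- The existence of the vertex algebra `V`. -/
theorem exists_vertexAlgebra : ∃ A : VertexAlgebra V, A.vac = 𝓥.vac ∧ A.D = 𝓥.translation ∧
    ∀ a, A.Y (𝓥.state a) = 𝓥.mode a := by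
  refine VField.exists_vertexAlgebra (D := 𝓥.translation) (vac := 𝓥.vac)
    (G := fun a : Gen N 𝔤 => ⟨𝓥.mode a, 𝓥.mode_truncated a⟩) 𝓥.translation_vac
    (fun a => ⟨fun n => ?_, fun n hn => 𝓥.mode_vac a hn⟩) (fun a b => 𝓥.rel.localModes a b)
    (fun P hv h => 𝓥.eq_top P hv h)
  refine (𝓥.translation_mode a n).trans (LinearMap.ext fun w => ?_)
  rw [LinearMap.smul_apply, LinearMap.smul_apply, neg_smul, neg_smul, Int.cast_smul_eq_zsmul]

end FreeFields

namespace LocalModel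
variable {V : Type} [AddCommGroup V] [Module ℂ V] {𝓥 : FreeFields N B c k V}
  {R : Type} [CommRing R] [Algebra ℂ R] {d : Fin N → Derivation ℂ R R}

theorem genRelations (hd : ∀ p q f, d p (d q f) = d q (d p f)) :
    GenRelations B c k (mode 𝓥 d) where
  mode_comm_of_ne := mode_comm_of_ne hd
  mode_u_comm_u := mode_u_comm_u
  mode_v_comm_v := mode_v_comm_v hd
  mode_u_comm_v := mode_u_comm_v hd
  mode_E_comm_E := mode_E_comm_E hd
  mode_g_comm_g := mode_g_comm_g hd
  mode_vir_comm_vir := mode_vir_comm_vir hd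

theorem translation_mode (hd : ∀ p q f, d p (d q f) = d q (d p f)) (a : Gen N 𝔤) (n : ℤ)
    (w : V ⊗[ℂ] R) : translation 𝓥 d (mode 𝓥 d a n w) =
      mode 𝓥 d a n (translation 𝓥 d w) - (n : ℂ) • mode 𝓥 d a (n - 1) w := by
  have hr := genRelations (𝓥 := 𝓥) hd
  have hT : ∀ w, translation 𝓥 d w = LinearMap.rTensor R 𝓥.translation w +
      ∑ p, mode 𝓥 d (.u p) (-1) (mode 𝓥 d (.v p) 0 w) := fun w => by
    rw [translation, LinearMap.add_apply, LinearMap.sum_apply]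
    simp only [mode_v_zero]
    rfl
  obtain ⟨e, he, ha⟩ := mode_eq_add 𝓥 d a n
  have h1 : LinearMap.rTensor R 𝓥.translation (mode 𝓥 d a n w) =
      mode 𝓥 d a n (LinearMap.rTensor R 𝓥.translation w) -
        (n : ℂ) • LinearMap.rTensor R (𝓥.mode a (n - 1)) w := by
    have := LinearMap.congr_fun (congrArg (LinearMap.rTensor R) (𝓥.translation_mode a n)) w
    rw [LinearMap.rTensor_sub, LinearMap.rTensor_mul, LinearMap.rTensor_mul, LinearMap.rTensor_smul,
      LinearMap.sub_apply, sub_eq_iff_eq_add, Module.End.mul_apply, Module.End.mul_apply,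
      LinearMap.smul_apply, neg_smul] at this
    rw [ha, LinearMap.add_apply, LinearMap.add_apply, map_add, this, rTensor_comm_lTensor]
    abel
  have h2 : ∀ p, mode 𝓥 d (.v p) 0 (mode 𝓥 d a n w) = mode 𝓥 d a n (mode 𝓥 d (.v p) 0 w) := by
    intro p
    cases a with
    | u q =>
      have := hr.mode_u_comm_v q p n 0 w
      rw [this]
      split_ifs with h
      · rw [h.2]; simp
      · simp
    | v q => exact hr.mode_v_comm_v _ _ _ _ _
    | _ => exact hr.mode_comm_of_ne (by simp [VSpace.factor]) _ _ _
  by_cases hv : ∃ q, a = .v q ∧ n = 1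
  · obtain ⟨q, rfl, rfl⟩ := hv
    have h3 : ∀ p x, mode 𝓥 d (.u p) (-1) (mode 𝓥 d (.v q) 1 x) =
        mode 𝓥 d (.v q) 1 (mode 𝓥 d (.u p) (-1) x) + if p = q then -x else 0 := by
      intro p x
      rw [hr.mode_u_comm_v]
      by_cases hp : p = q <;> simp [hp]
    rw [hT, hT, h1, map_add, map_sum]
    simp only [h2, h3]
    rw [Finset.sum_add_distrib, Finset.sum_ite_eq' Finset.univ q, if_pos (Finset.mem_univ _),
      sub_self, 𝓥.v_zero, LinearMap.rTensor_zero, LinearMap.zero_apply, smul_zero, sub_zero,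
      Int.cast_one, one_smul]
    abel
  · have h3 : ∀ p x, mode 𝓥 d (.u p) (-1) (mode 𝓥 d a n x) =
        mode 𝓥 d a n (mode 𝓥 d (.u p) (-1) x) := by
      intro p x
      cases a with
      | u q => exact hr.mode_u_comm_u _ _ _ _ _
      | v q =>
        rw [hr.mode_u_comm_v, if_neg (fun h => hv ⟨q, rfl, by omega⟩), zero_smul, add_zero]
      | _ => exact hr.mode_comm_of_ne (by simp [VSpace.factor]) _ _ _
    have h4 : LinearMap.rTensor R (𝓥.mode a (n - 1)) = mode 𝓥 d a (n - 1) := by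
      cases a with
      | v q => rw [mode_v_of_ne 𝓥 d q (fun h => hv ⟨q, rfl, by omega⟩)]
      | _ => rfl
    rw [hT, hT, h1, map_add, map_sum, h4]
    simp only [h2, h3]
    abel

theorem mode_truncated (a : Gen N 𝔤) : Truncated (mode 𝓥 d a) := fun w => by
  obtain ⟨n₀, h⟩ := (𝓥.mode_truncated a).rTensor (P := R) w
  refine ⟨max n₀ 1, fun n hn => ?_⟩
  rw [max_le_iff] at hn
  cases a with
  | v p => rw [mode_v_of_ne 𝓥 d p (by omega)]; exact h n hn.1
  | _ => exact h n hn.1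

theorem mode_vac (a : Gen N 𝔤) {n : ℤ} (hn : 0 ≤ n) (f : R) :
    mode 𝓥 d a n (𝓥.vac ⊗ₜ f) = if n = 0 then match a with
      | .v p => 𝓥.vac ⊗ₜ d p f
      | _ => 0 else 0 := by
  have h0 : LinearMap.rTensor R (𝓥.mode a n) (𝓥.vac ⊗ₜ f) = 0 := by
    rw [LinearMap.rTensor_tmul, 𝓥.mode_vac a hn, TensorProduct.zero_tmul]
  cases a with
  | v p =>
    by_cases h : n = 0
    · subst h; rw [mode_v_zero, if_pos rfl]; rfl
    · rw [mode_v_of_ne 𝓥 d p h, if_neg h, h0]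
  | _ => rw [ite_self]; exact h0

theorem mode_neg_one_vac (a : Gen N 𝔤) (f : R) :
    mode 𝓥 d a (-1) (𝓥.vac ⊗ₜ f) = 𝓥.state a ⊗ₜ f := by
  cases a with
  | v p => rw [mode_v_of_ne 𝓥 d p (by norm_num)]; rfl
  | _ => rfl

theorem powerBdd_vac (f : R) : CommutingCurrents.PowerBdd (commutingCurrents 𝓥 R) 0 (𝓥.vac ⊗ₜ f) :=
  .of_killed fun p j hj => by
    change 𝓥.mode (.u p) j 𝓥.vac ⊗ₜ[ℂ] f = 0
    rw [𝓥.mode_vac _ hj.le, TensorProduct.zero_tmul]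

theorem functionMode_truncated (f : R) : Truncated (functionMode 𝓥 d f) := fun w => by
  obtain ⟨b, hb⟩ := exists_powerBdd 𝓥 w
  exact ⟨-b, fun n hn => expField_eq_zero hb f (by omega)⟩

theorem functionMode_vac {n : ℤ} (hn : 0 ≤ n) (f g : R) :
    functionMode 𝓥 d f n (𝓥.vac ⊗ₜ g) = 0 := expField_eq_zero (powerBdd_vac g) f (by omega)

theorem functionMode_neg_one_vac (f g : R) :
    functionMode 𝓥 d f (-1) (𝓥.vac ⊗ₜ g) = 𝓥.vac ⊗ₜ (f * g) := by
  rw [functionMode_apply, show (-(-1 : ℤ) - 1) = 0 by norm_num]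
  exact expField_zero_of_killed (powerBdd_vac g) f

theorem eq_top (P : Submodule ℂ (V ⊗[ℂ] R)) (hv : ∀ f, 𝓥.vac ⊗ₜ f ∈ P)
    (h : ∀ a n, ∀ w ∈ P, mode 𝓥 d a n w ∈ P) : P = ⊤ := by
  refine Submodule.eq_top_iff'.2 fun w => ?_
  induction w using TensorProduct.induction_on with
  | zero => exact P.zero_mem
  | add x y hx hy => exact P.add_mem hx hy
  | tmul v f =>
    have := 𝓥.eq_top (P.comap ((TensorProduct.mk ℂ V R).flip f)) (hv f) (fun a n w hw => by
      cases a with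
      | v p =>
        by_cases hn : n = 0
        · subst hn
          rw [𝓥.v_zero]
          exact Submodule.zero_mem _
        · have := h (.v p) n _ hw
          rw [mode_v_of_ne 𝓥 d p hn] at this
          exact this
      | u p => exact h (.u p) n _ hw
      | E a b => exact h (.E a b) n _ hw
      | g x => exact h (.g x) n _ hw
      | vir => exact h .vir n _ hw)
    exact this.ge (Submodule.mem_top (x := v))

variable (𝓥) in
/-- The existence of the vertex algebra `V ⊗ R`. -/
theorem exists_vertexAlgebra (hd : ∀ p q f, d p (d q f) = d q (d p f)) :
    ∃ A : VertexAlgebra (V ⊗[ℂ] R), A.vac = 𝓥.vac ⊗ₜ 1 ∧ A.D = translation 𝓥 d ∧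
      (∀ a, A.Y (𝓥.state a ⊗ₜ 1) = mode 𝓥 d a) ∧
      ∀ f, A.Y (𝓥.vac ⊗ₜ f) = functionMode 𝓥 d f := by
  have zs : ∀ (n : ℤ) (w : V ⊗[ℂ] R), -n • w = -((n : ℂ) • w) := fun n w => by
    rw [neg_smul, Int.cast_smul_eq_zsmul]
  let G : Gen N 𝔤 ⊕ R → VField (V ⊗[ℂ] R) :=
    Sum.elim (fun a => ⟨mode 𝓥 d a, mode_truncated a⟩)
      (fun f => ⟨functionMode 𝓥 d f, functionMode_truncated f⟩)
  suffices h : ∃ A : VertexAlgebra (V ⊗[ℂ] R), A.vac = 𝓥.vac ⊗ₜ 1 ∧ A.D = translation 𝓥 d ∧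
      ∀ i, A.Y ((G i).coeff (-1) (𝓥.vac ⊗ₜ 1)) = (G i).coeff by
    obtain ⟨A, h1, h2, h3⟩ := h
    refine ⟨A, h1, h2, fun a => ?_, fun f => ?_⟩
    · have := h3 (Sum.inl a)
      simp only [G, Sum.elim_inl, mode_neg_one_vac] at this
      exact this
    · have := h3 (Sum.inr f)
      simp only [G, Sum.elim_inr, functionMode_neg_one_vac, mul_one] at this
      exact this
  refine VField.exists_vertexAlgebra ?_ ?_ ?_ ?_
  · rw [translation_tmul, 𝓥.translation_vac, TensorProduct.zero_tmul, zero_add]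
    simp
  · rintro (a | f)
    · refine ⟨fun n => LinearMap.ext fun w => ?_, fun n hn => ?_⟩
      · refine (sub_eq_iff_eq_add.2 ((translation_mode hd a n w).trans ?_))
        rw [LinearMap.smul_apply, zs]
        exact (neg_add_eq_sub _ _).symm
      · refine (mode_vac a hn 1).trans ?_
        cases a <;> simp
    · refine ⟨fun n => LinearMap.ext fun w => ?_, fun n hn => functionMode_vac hn f 1⟩
      refine (sub_eq_iff_eq_add.2 ((translation_functionMode hd f n w).trans ?_))
      rw [LinearMap.smul_apply, zs]
      exact (neg_add_eq_sub _ _).symm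
  · have hvf : ∀ a f, VField.LocalModes (mode 𝓥 d a) (functionMode 𝓥 d f) := fun a f => by
      by_cases ha : ∃ p, a = .v p
      · obtain ⟨p, rfl⟩ := ha
        refine .of_sum 1 (fun _ n => functionMode 𝓥 d (d p f) n) fun m n =>
          LinearMap.ext fun w => ?_
        rw [Finset.sum_range_one, Ring.choose_zero_right, one_smul, LinearMap.sub_apply,
          Module.End.mul_apply, Module.End.mul_apply, mode_v_comm_functionMode hd,
          add_sub_cancel_left]
      · exact .of_comm fun i j => LinearMap.ext fun w =>
          mode_comm_functionMode hd (not_exists.1 ha) i f j w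
    rintro (a | f) (b | g)
    · exact (genRelations hd).localModes a b
    · exact hvf a g
    · exact (hvf b f).symm
    · exact .of_comm fun i j => LinearMap.ext fun w => functionMode_comm_functionMode hd f g i j w
  · intro P hv h
    refine eq_top (𝓥 := 𝓥) (d := d) P (fun f => ?_) (fun a n w hw => h (Sum.inl a) n w hw)
    have := h (Sum.inr f) (-1) _ hv
    simp only [G, Sum.elim_inr, functionMode_neg_one_vac, mul_one] at this
    exact this

end LocalModel

end

/-! ### Realizations of the generators -/

section
variable {𝔤 : Type} {N : ℕ} {R : Type} [CommRing R] [Algebra ℂ R] {M : Type} [AddCommGroup M]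
  [Module ℂ M]

namespace VertexAlgebra

/-- The modes of `a_(-1)b`, on a vector which is annihilated by `a_(i)` and `b_(i)` for `i ≥ L`. -/
theorem Y_neg_one_apply (A : VertexAlgebra M) {a b x : M} {L : ℕ} {n : ℤ} (hn : 0 ≤ n)
    (ha : ∀ i : ℤ, L ≤ i → A.Y a i x = 0) (hb : ∀ i : ℤ, L ≤ i → A.Y b i x = 0) :
    A.Y (A.Y a (-1) b) n x = ∑ i ∈ Finset.range L,
      (A.Y a (-1 - i) (A.Y b (n + i) x) + A.Y b (n - 1 - i) (A.Y a i x)) := by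
  rw [Y_Y_apply, residueProd_eq_sum (K := L) (fun j hj i => ⟨?_, ?_⟩) _ _ L le_rfl (by omega)]
  · refine Finset.sum_congr rfl fun i _ => ?_
    rw [sgnChoose_neg_one]
    simp [Int.negOnePow_neg, Int.negOnePow_one, add_comm n, sub_eq_add_neg, add_assoc]
  · rw [hb j hj, map_zero]
  · rw [ha j hj, map_zero]

end VertexAlgebra

namespace Realization
variable {A : VertexAlgebra M} {F : R →ₗ[ℂ] M} {s : Gen N 𝔤 → M}

section
variable (A F s)

/-- `∑ u_p(-1) ω_p`, for a one-form `ω = ∑ ω_p dx_p`. -/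
def uForm (ω : Fin N → R) : M := ∑ p, A.Y (s (.u p)) (-1) (F (ω p))

/-- `∑ v_p(-1) τ_p`, for a vector field `τ = ∑ τ_p ∂_p`. -/
def vField (τ : Fin N → R) : M := ∑ p, A.Y (s (.v p)) (-1) (F (τ p))

/-- `∑ E_{ab}(-1) X_{ab}`, for a matrix of functions. -/
def eMatrix (X : Fin N → Fin N → R) : M := ∑ a, ∑ b, A.Y (s (.E a b)) (-1) (F (X a b))

end

theorem uForm_add (ω ω' : Fin N → R) :
    uForm A F s ω + uForm A F s ω' = uForm A F s (fun p => ω p + ω' p) := by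
  simp [uForm, Finset.sum_add_distrib]

theorem vField_add (ω ω' : Fin N → R) :
    vField A F s ω + vField A F s ω' = vField A F s (fun p => ω p + ω' p) := by
  simp [vField, Finset.sum_add_distrib]

theorem eMatrix_add (X X' : Fin N → Fin N → R) :
    eMatrix A F s X + eMatrix A F s X' = eMatrix A F s (fun a b => X a b + X' a b) := by
  simp [eMatrix, Finset.sum_add_distrib]

theorem uForm_neg (ω : Fin N → R) : -uForm A F s ω = uForm A F s (fun p => -ω p) := by
  simp [uForm]

theorem vField_neg (ω : Fin N → R) : -vField A F s ω = vField A F s (fun p => -ω p) := by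
  simp [vField]

theorem eMatrix_neg (X : Fin N → Fin N → R) :
    -eMatrix A F s X = eMatrix A F s (fun a b => -X a b) := by
  simp [eMatrix]

theorem uForm_sum {κ : Type*} (t : Finset κ) (ω : κ → Fin N → R) :
    ∑ i ∈ t, uForm A F s (ω i) = uForm A F s (fun p => ∑ i ∈ t, ω i p) := by
  simp only [uForm, map_sum]
  exact Finset.sum_comm

theorem vField_sum {κ : Type*} (t : Finset κ) (ω : κ → Fin N → R) :
    ∑ i ∈ t, vField A F s (ω i) = vField A F s (fun p => ∑ i ∈ t, ω i p) := by
  simp only [vField, map_sum]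
  exact Finset.sum_comm

theorem eMatrix_sum {κ : Type*} (t : Finset κ) (X : κ → Fin N → Fin N → R) :
    ∑ i ∈ t, eMatrix A F s (X i) = eMatrix A F s (fun a b => ∑ i ∈ t, X i a b) := by
  simp only [eMatrix, map_sum]
  rw [Finset.sum_comm]
  exact Finset.sum_congr rfl fun _ _ => Finset.sum_comm

end Realization

variable [LieRing 𝔤] [LieAlgebra ℂ 𝔤] {B : InvForm 𝔤} {c k : ℂ}

variable (B c k) in
/-- Functions `F f`, `f ∈ R`, and states `s a` in a vertex algebra with the operator products of the
elements `1 ⊗ f` and of the generators of `V ⊗ R`, where `v_p(0) = d_p` on functions. -/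
structure Realization (d : Fin N → Derivation ℂ R R) (A : VertexAlgebra M) (F : R →ₗ[ℂ] M)
    (s : Gen N 𝔤 → M) : Prop where
  rel : GenRelations B c k fun a => A.Y (s a)
  g_linear : ∃ G : 𝔤 →ₗ[ℂ] M, ∀ x, s (.g x) = G x
  one : F 1 = A.vac
  mul : ∀ f g, A.Y (F f) (-1) (F g) = F (f * g)
  commuting : ∀ f g, A.Commuting (F f) (F g)
  commuting_gen : ∀ a, (∀ p, a ≠ .v p) → ∀ f, A.Commuting (s a) (F f)
  v_zero : ∀ p f, A.Y (s (.v p)) 0 (F f) = F (d p f)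
  v_pos : ∀ p f (n : ℤ), 0 < n → A.Y (s (.v p)) n (F f) = 0
  D_function : ∀ f, A.D (F f) = ∑ p, A.Y (s (.u p)) (-1) (F (d p f))

namespace Realization
variable {d : Fin N → Derivation ℂ R R} {A : VertexAlgebra M} {F : R →ₗ[ℂ] M}
  {s : Gen N 𝔤 → M}
variable (h : Realization B c k d A F s)
include h

theorem v_comm (p : Fin N) (m : ℤ) (f : R) (n : ℤ) (x : M) :
    A.Y (s (.v p)) m (A.Y (F f) n x) =
      A.Y (F f) n (A.Y (s (.v p)) m x) + A.Y (F (d p f)) (m + n) x := by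
  rw [A.commutator_of_one (fun j hj => h.v_pos p f j (by omega)), h.v_zero]

theorem function_neg_two (f g : R) :
    A.Y (F f) (-2) (F g) = uForm A F s (fun r => g * d r f) := by
  rw [← A.replication (F g), (h.commuting f g).comm, ← A.D_eq, h.D_function, map_sum]
  refine Finset.sum_congr rfl fun p _ => ?_
  rw [← (h.commuting_gen _ (by simp) _).comm, h.mul]

theorem function_commuting_uForm (f : R) (ω : Fin N → R) : A.Commuting (F f) (uForm A F s ω) :=
  .sum fun _ _ => (h.commuting_gen _ (by simp) f).symm.Y (h.commuting f _) _

theorem function_commuting_eMatrix (f : R) (X : Fin N → Fin N → R) :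
    A.Commuting (F f) (eMatrix A F s X) :=
  .sum fun _ _ => .sum fun _ _ => (h.commuting_gen _ (by simp) f).symm.Y (h.commuting f _) _

theorem function_neg_one_uForm (f : R) (ω : Fin N → R) :
    A.Y (F f) (-1) (uForm A F s ω) = uForm A F s (fun p => f * ω p) := by
  rw [uForm, map_sum]
  refine Finset.sum_congr rfl fun p _ => ?_
  rw [← (h.commuting_gen _ (by simp) _).comm, h.mul]

theorem function_neg_one_eMatrix (f : R) (X : Fin N → Fin N → R) :
    A.Y (F f) (-1) (eMatrix A F s X) = eMatrix A F s (fun a b => f * X a b) := by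
  rw [eMatrix, map_sum]
  refine Finset.sum_congr rfl fun a _ => ?_
  rw [map_sum]
  refine Finset.sum_congr rfl fun b _ => ?_
  rw [← (h.commuting_gen _ (by simp) _).comm, h.mul]

theorem function_vField (f : R) (n : ℤ) (τ : Fin N → R) :
    A.Y (F f) n (vField A F s τ) = ∑ q, (A.Y (s (.v q)) (-1) (A.Y (F f) n (F (τ q))) -
      A.Y (F (d q f)) (n - 1) (F (τ q))) := by
  rw [vField, map_sum]
  refine Finset.sum_congr rfl fun q _ => ?_
  rw [h.v_comm, show -1 + n = n - 1 by ring, add_sub_cancel_right]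

theorem function_neg_one_vField (f : R) (τ : Fin N → R) :
    A.Y (F f) (-1) (vField A F s τ) = vField A F s (fun p => f * τ p) -
      uForm A F s (fun r => ∑ q, τ q * d r (d q f)) := by
  rw [h.function_vField, Finset.sum_sub_distrib, ← uForm_sum]
  congr 1
  · exact Finset.sum_congr rfl fun q _ => by rw [h.mul]
  · exact Finset.sum_congr rfl fun q _ => h.function_neg_two _ _

theorem function_zero_vField (f : R) (τ : Fin N → R) :
    A.Y (F f) 0 (vField A F s τ) = -F (∑ q, τ q * d q f) := by
  rw [h.function_vField, map_sum, ← Finset.sum_neg_distrib]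
  refine Finset.sum_congr rfl fun q _ => ?_
  rw [h.commuting f _ 0 le_rfl, map_zero, zero_sub, zero_sub, h.mul, mul_comm]

theorem function_pos_vField (f : R) {n : ℤ} (hn : 1 ≤ n) (τ : Fin N → R) :
    A.Y (F f) n (vField A F s τ) = 0 := by
  rw [h.function_vField]
  refine Finset.sum_eq_zero fun q _ => ?_
  rw [h.commuting f _ n (by omega), h.commuting _ _ _ (by omega), map_zero, sub_zero]

theorem u_commuting_uForm (p : Fin N) (ω : Fin N → R) :
    A.Commuting (s (.u p)) (uForm A F s ω) :=
  .sum fun q _ n hn => by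
    have := h.rel.mode_u_comm_u p q n (-1) (F (ω q))
    rw [this, h.commuting_gen _ (by simp) _ n hn, map_zero]

/-- Generators of different tensor factors commute. -/
theorem gen_commuting {a b : Gen N 𝔤} (hab : VSpace.factor a ≠ VSpace.factor b) :
    A.Commuting (s a) (s b) := fun n hn => by
  have := h.rel.mode_comm_of_ne hab n (-1) A.vac
  rw [A.replication, A.replication_nonneg _ n hn, map_zero] at this
  exact this

theorem gen_commuting_eMatrix {a : Gen N 𝔤} (ha : VSpace.factor a ≠ 1) (hv : ∀ p, a ≠ .v p)
    (X : Fin N → Fin N → R) : A.Commuting (s a) (eMatrix A F s X) :=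
  .sum fun _ _ => .sum fun _ _ => (h.gen_commuting ha).Y (h.commuting_gen _ hv _) _

theorem gen_commuting_uForm {a : Gen N 𝔤} (ha : VSpace.factor a ≠ 0)
    (ω : Fin N → R) : A.Commuting (s a) (uForm A F s ω) :=
  .sum fun _ _ => (h.gen_commuting ha).Y (h.commuting_gen _ (fun p hp => ha (by rw [hp]; rfl)) _) _

theorem gen_commuting_vField {a : Gen N 𝔤} (ha : VSpace.factor a ≠ 0)
    (ω : Fin N → R) : A.Commuting (s a) (vField A F s ω) :=
  .sum fun _ _ => (h.gen_commuting ha).Y (h.commuting_gen _ (fun p hp => ha (by rw [hp]; rfl)) _) _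

theorem v_uForm (q : Fin N) {m : ℤ} (ω : Fin N → R) :
    A.Y (s (.v q)) m (uForm A F s ω) = ∑ p, (A.Y (s (.u p)) (-1) (A.Y (s (.v q)) m (F (ω p))) +
      if p = q ∧ m = 1 then F (ω p) else 0) := by
  rw [uForm, map_sum]
  refine Finset.sum_congr rfl fun p _ => ?_
  have := h.rel.mode_u_comm_v p q (-1) m (F (ω p))
  rw [this, add_assoc, left_eq_add]
  by_cases hp : p = q ∧ m = 1
  · rw [if_pos hp, if_pos ⟨hp.1, by omega⟩]; simp
  · rw [if_neg hp, if_neg (fun h => hp ⟨h.1, by omega⟩)]; simp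

theorem v_zero_uForm (q : Fin N) (ω : Fin N → R) :
    A.Y (s (.v q)) 0 (uForm A F s ω) = uForm A F s (fun p => d q (ω p)) := by
  rw [h.v_uForm]
  refine Finset.sum_congr rfl fun p _ => ?_
  rw [if_neg (by simp), add_zero, h.v_zero]

theorem v_one_uForm (q : Fin N) (ω : Fin N → R) :
    A.Y (s (.v q)) 1 (uForm A F s ω) = F (ω q) := by
  rw [h.v_uForm, Finset.sum_eq_single q]
  · rw [h.v_pos _ _ _ one_pos, map_zero, if_pos ⟨rfl, rfl⟩, zero_add]
  · intro p _ hp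
    rw [h.v_pos _ _ _ one_pos, map_zero, if_neg (fun h => hp h.1), zero_add]
  · simp

theorem v_pos_uForm (q : Fin N) {m : ℤ} (hm : 2 ≤ m) (ω : Fin N → R) :
    A.Y (s (.v q)) m (uForm A F s ω) = 0 := by
  rw [h.v_uForm]
  refine Finset.sum_eq_zero fun p _ => ?_
  rw [h.v_pos _ _ _ (by omega), map_zero, if_neg (fun h => by omega), zero_add]

theorem v_zero_vField (q : Fin N) (τ : Fin N → R) :
    A.Y (s (.v q)) 0 (vField A F s τ) = vField A F s (fun p => d q (τ p)) := by
  rw [vField, map_sum]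
  refine Finset.sum_congr rfl fun p _ => ?_
  have := h.rel.mode_v_comm_v q p 0 (-1) (F (τ p))
  rw [this, h.v_zero]

theorem v_pos_vField (q : Fin N) {m : ℤ} (hm : 1 ≤ m) (τ : Fin N → R) :
    A.Y (s (.v q)) m (vField A F s τ) = 0 := by
  rw [vField, map_sum]
  refine Finset.sum_eq_zero fun p _ => ?_
  have := h.rel.mode_v_comm_v q p m (-1) (F (τ p))
  rw [this, h.v_pos _ _ _ (by omega), map_zero]

theorem v_zero_eMatrix (q : Fin N) (X : Fin N → Fin N → R) :
    A.Y (s (.v q)) 0 (eMatrix A F s X) = eMatrix A F s (fun a b => d q (X a b)) := by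
  rw [eMatrix, map_sum]
  refine Finset.sum_congr rfl fun a _ => ?_
  rw [map_sum]
  refine Finset.sum_congr rfl fun b _ => ?_
  rw [(h.gen_commuting (a := .v q) (b := .E a b) (by simp [VSpace.factor])).comm, h.v_zero]

theorem v_pos_eMatrix (q : Fin N) {m : ℤ} (hm : 1 ≤ m) (X : Fin N → Fin N → R) :
    A.Y (s (.v q)) m (eMatrix A F s X) = 0 := by
  rw [eMatrix, map_sum]
  refine Finset.sum_eq_zero fun a _ => ?_
  rw [map_sum]
  refine Finset.sum_eq_zero fun b _ => ?_
  rw [(h.gen_commuting (a := .v q) (b := .E a b) (by simp [VSpace.factor])).comm,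
    h.v_pos _ _ _ (by omega), map_zero]

theorem E_eMatrix (a b : Fin N) {m : ℤ} (hm : 0 ≤ m) (X : Fin N → Fin N → R) :
    A.Y (s (.E a b)) m (eMatrix A F s X) = ∑ e, ∑ f,
      (((if b = e then A.Y (s (.E a f)) (m - 1) (F (X e f)) else 0) -
        (if f = a then A.Y (s (.E e b)) (m - 1) (F (X e f)) else 0)) +
      if b = e ∧ a = f ∧ m = 1 then F (X e f) else 0) := by
  rw [eMatrix, map_sum]
  refine Finset.sum_congr rfl fun e _ => ?_
  rw [map_sum]
  refine Finset.sum_congr rfl fun f _ => ?_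
  have := h.rel.mode_E_comm_E a b e f m (-1) (F (X e f))
  rw [this, h.commuting_gen _ (by simp) _ m hm, map_zero, zero_add, ← sub_eq_add_neg]
  congr 1
  by_cases hp : b = e ∧ a = f ∧ m = 1
  · rw [if_pos hp, if_pos ⟨hp.1, hp.2.1, by omega⟩, hp.2.2]; simp
  · rw [if_neg hp, if_neg (fun h => hp ⟨h.1, h.2.1, by omega⟩)]; simp

theorem E_zero_eMatrix (a b : Fin N) (X : Fin N → Fin N → R) :
    A.Y (s (.E a b)) 0 (eMatrix A F s X) = ∑ f, A.Y (s (.E a f)) (-1) (F (X b f)) -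
      ∑ e, A.Y (s (.E e b)) (-1) (F (X e a)) := by
  rw [h.E_eMatrix a b le_rfl]
  simp only [zero_sub, zero_ne_one, and_false, if_false, add_zero, Finset.sum_sub_distrib]
  congr 1
  · rw [Finset.sum_comm]
    exact Finset.sum_congr rfl fun f _ => by rw [Finset.sum_ite_eq, if_pos (Finset.mem_univ _)]
  · exact Finset.sum_congr rfl fun f _ => by rw [Finset.sum_ite_eq', if_pos (Finset.mem_univ _)]

theorem E_one_eMatrix (a b : Fin N) (X : Fin N → Fin N → R) :
    A.Y (s (.E a b)) 1 (eMatrix A F s X) = F (X b a) := by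
  rw [h.E_eMatrix a b zero_le_one]
  simp only [sub_self, h.commuting_gen (.E _ _) (by simp) _ 0 le_rfl, ite_self, zero_add, and_true]
  rw [Finset.sum_eq_single b (by
    intro e _ he
    exact Finset.sum_eq_zero fun f _ => if_neg fun h => he h.1.symm) (by simp),
    Finset.sum_eq_single a (by
      intro f _ hf
      exact if_neg fun h => hf h.2.symm) (by simp)]
  rw [if_pos ⟨rfl, rfl⟩]

theorem E_pos_eMatrix (a b : Fin N) {m : ℤ} (hm : 2 ≤ m) (X : Fin N → Fin N → R) :
    A.Y (s (.E a b)) m (eMatrix A F s X) = 0 := by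
  rw [h.E_eMatrix a b (by omega)]
  refine Finset.sum_eq_zero fun e _ => Finset.sum_eq_zero fun f _ => ?_
  simp only [h.commuting_gen (.E _ _) (by simp) _ (m - 1) (by omega), ite_self, zero_add, sub_self]
  exact if_neg fun h => by omega

end Realization
end

section
variable {𝔤 : Type} [LieRing 𝔤] [LieAlgebra ℂ 𝔤] {N : ℕ} {B : InvForm 𝔤} {c k : ℂ}
  {R : Type} [CommRing R] [Algebra ℂ R] {M : Type} [AddCommGroup M] [Module ℂ M]

namespace Realization
variable {d : Fin N → Derivation ℂ R R} {A : VertexAlgebra M} {F : R →ₗ[ℂ] M}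
  {s : Gen N 𝔤 → M} (h : Realization B c k d A F s)
include h

/-! Products of `a_(-1)f`, where `f` is a function, with states `b` of weight at most one: the
hypothesis on `b` is that `a_(n)b` and `f_(n)b` vanish for large `n`. -/

omit h in
theorem product_zero {a b : M} {f : R} (ha : ∀ i : ℤ, 2 ≤ i → A.Y a i b = 0)
    (hf : ∀ i : ℤ, 1 ≤ i → A.Y (F f) i b = 0) :
    A.Y (A.Y a (-1) (F f)) 0 b = A.Y a (-1) (A.Y (F f) 0 b) + A.Y (F f) (-1) (A.Y a 0 b) +
      A.Y (F f) (-2) (A.Y a 1 b) := by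
  rw [A.Y_neg_one_apply (L := 2) le_rfl (fun i hi => ha i (by exact_mod_cast hi))
    (fun i hi => hf i (by omega)), Finset.sum_range_succ, Finset.sum_range_one]
  have := hf 1 le_rfl
  simp [this]

omit h in
theorem product_one {a b : M} {f : R} (ha : ∀ i : ℤ, 2 ≤ i → A.Y a i b = 0)
    (hf : ∀ i : ℤ, 1 ≤ i → A.Y (F f) i b = 0) :
    A.Y (A.Y a (-1) (F f)) 1 b = A.Y (F f) 0 (A.Y a 0 b) + A.Y (F f) (-1) (A.Y a 1 b) := by
  rw [A.Y_neg_one_apply (L := 2) zero_le_one (fun i hi => ha i (by exact_mod_cast hi))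
    (fun i hi => hf i (by omega)), Finset.sum_range_succ, Finset.sum_range_one]
  have := hf 1 le_rfl
  have := hf 2 (by norm_num)
  simp [*]

theorem product_pos {a b : M} {f : R} (ha : ∀ i : ℤ, 2 ≤ i → A.Y a i b = 0)
    (hf : ∀ i : ℤ, 1 ≤ i → A.Y (F f) i b = 0)
    (h0 : ∀ i : ℤ, 1 ≤ i → A.Y (F f) i (A.Y a 0 b) = 0) (h1 : ∃ g, A.Y a 1 b = F g)
    {n : ℤ} (hn : 2 ≤ n) : A.Y (A.Y a (-1) (F f)) n b = 0 := by
  obtain ⟨g, hg⟩ := h1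
  rw [A.Y_neg_one_apply (L := 2) (by omega) (fun i hi => ha i (by exact_mod_cast hi))
    (fun i hi => hf i (by omega)), Finset.sum_range_succ, Finset.sum_range_one]
  push_cast
  rw [hg, hf _ (by omega), hf _ (by omega), h0 _ (by omega), h.commuting f g _ (by omega)]
  simp

theorem function_pos_uForm {f : R} {n : ℤ} (hn : 1 ≤ n) (ω : Fin N → R) :
    A.Y (F f) n (uForm A F s ω) = 0 := h.function_commuting_uForm f ω n (by omega)

theorem function_pos_eMatrix {f : R} {n : ℤ} (hn : 1 ≤ n) (X : Fin N → Fin N → R) :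
    A.Y (F f) n (eMatrix A F s X) = 0 := h.function_commuting_eMatrix f X n (by omega)

/-! Products of a vector field with functions, forms, vector fields and matrices. -/

theorem vField_zero_function (τ : Fin N → R) (f : R) :
    A.Y (vField A F s τ) 0 (F f) = F (∑ q, τ q * d q f) := by
  rw [vField, map_sum, Finset.sum_apply, LinearMap.sum_apply, map_sum]
  refine Finset.sum_congr rfl fun q _ => ?_
  rw [product_zero (fun i hi => h.v_pos _ _ _ (by omega)) (fun i hi => h.commuting _ _ _ (by omega)),
    h.commuting _ _ _ le_rfl, h.v_zero, h.v_pos _ _ _ one_pos, map_zero, map_zero, h.mul, zero_add,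
    add_zero]

theorem vField_pos_function (τ : Fin N → R) (f : R) {n : ℤ} (hn : 1 ≤ n) :
    A.Y (vField A F s τ) n (F f) = 0 := by
  rw [vField, map_sum, Finset.sum_apply, LinearMap.sum_apply]
  refine Finset.sum_eq_zero fun q _ => ?_
  rw [A.Y_neg_one_apply (L := 1) (by omega) (fun i hi => h.v_pos _ _ _ (by omega))
    (fun i hi => h.commuting _ _ _ (by omega)), Finset.sum_range_one,
    h.commuting _ _ _ (by omega), Nat.cast_zero, h.v_zero, h.commuting _ _ _ (by omega), map_zero,
    add_zero]

theorem vField_zero_uForm (τ ω : Fin N → R) : A.Y (vField A F s τ) 0 (uForm A F s ω) =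
    uForm A F s (fun r => ∑ q, (τ q * d q (ω r) + ω q * d r (τ q))) := by
  rw [vField, map_sum, Finset.sum_apply, LinearMap.sum_apply, ← uForm_sum]
  refine Finset.sum_congr rfl fun q _ => ?_
  rw [product_zero (fun i hi => h.v_pos_uForm _ hi _) (fun i hi => h.function_pos_uForm hi _),
    h.function_commuting_uForm _ _ _ le_rfl, h.v_zero_uForm, h.v_one_uForm,
    h.function_neg_one_uForm, h.function_neg_two, map_zero, zero_add, uForm_add]

theorem vField_one_uForm (τ ω : Fin N → R) : A.Y (vField A F s τ) 1 (uForm A F s ω) =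
    F (∑ q, τ q * ω q) := by
  rw [vField, map_sum, Finset.sum_apply, LinearMap.sum_apply, map_sum]
  refine Finset.sum_congr rfl fun q _ => ?_
  rw [product_one (fun i hi => h.v_pos_uForm _ hi _) (fun i hi => h.function_pos_uForm hi _),
    h.v_zero_uForm, h.v_one_uForm, h.function_commuting_uForm _ _ _ le_rfl, h.mul, zero_add]

theorem vField_pos_uForm (τ ω : Fin N → R) {n : ℤ} (hn : 2 ≤ n) :
    A.Y (vField A F s τ) n (uForm A F s ω) = 0 := by
  rw [vField, map_sum, Finset.sum_apply, LinearMap.sum_apply]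
  refine Finset.sum_eq_zero fun q _ => ?_
  refine h.product_pos (fun i hi => h.v_pos_uForm _ hi _) (fun i hi => h.function_pos_uForm hi _)
    (fun i hi => ?_) ⟨_, h.v_one_uForm _ _⟩ hn
  rw [h.v_zero_uForm, h.function_pos_uForm hi]

theorem vField_zero_eMatrix (τ : Fin N → R) (X : Fin N → Fin N → R) :
    A.Y (vField A F s τ) 0 (eMatrix A F s X) =
      eMatrix A F s (fun a b => ∑ q, τ q * d q (X a b)) := by
  rw [vField, map_sum, Finset.sum_apply, LinearMap.sum_apply, ← eMatrix_sum]
  refine Finset.sum_congr rfl fun q _ => ?_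
  rw [product_zero (fun i hi => h.v_pos_eMatrix _ (by omega) _)
    (fun i hi => h.function_pos_eMatrix hi _),
    h.function_commuting_eMatrix _ _ _ le_rfl, h.v_zero_eMatrix, h.v_pos_eMatrix _ le_rfl,
    h.function_neg_one_eMatrix, map_zero, map_zero, zero_add, add_zero]

theorem vField_pos_eMatrix (τ : Fin N → R) (X : Fin N → Fin N → R) {n : ℤ} (hn : 1 ≤ n) :
    A.Y (vField A F s τ) n (eMatrix A F s X) = 0 := by
  rw [vField, map_sum, Finset.sum_apply, LinearMap.sum_apply]
  refine Finset.sum_eq_zero fun q _ => ?_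
  rw [A.Y_neg_one_apply (L := 1) (by omega) (fun i hi => h.v_pos_eMatrix _ (by omega) _)
    (fun i hi => h.function_pos_eMatrix (by omega) _), Finset.sum_range_one,
    h.function_pos_eMatrix (by omega), Nat.cast_zero, h.v_zero_eMatrix,
    h.function_commuting_eMatrix _ _ _ (by omega), map_zero, add_zero]

theorem vField_zero_vField (τ σ : Fin N → R) : A.Y (vField A F s τ) 0 (vField A F s σ) =
    vField A F s (fun p => ∑ q, (τ q * d q (σ p) - σ q * d q (τ p))) -
      uForm A F s (fun r => ∑ q, ∑ p, d q (σ p) * d r (d p (τ q))) := by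
  have key : ∀ q, A.Y (A.Y (s (.v q)) (-1) (F (τ q))) 0 (vField A F s σ) =
      -A.Y (s (.v q)) (-1) (F (∑ p, σ p * d p (τ q))) +
        (vField A F s (fun p => τ q * d q (σ p)) -
          uForm A F s (fun r => ∑ p, d q (σ p) * d r (d p (τ q)))) := fun q => by
    rw [product_zero (fun i hi => h.v_pos_vField _ (by omega) _)
      (fun i hi => h.function_pos_vField _ hi _), h.function_zero_vField, h.v_zero_vField,
      h.v_pos_vField _ le_rfl, h.function_neg_one_vField, map_neg, map_zero, add_zero]
  rw [vField, map_sum, Finset.sum_apply, LinearMap.sum_apply, Finset.sum_congr rfl fun q _ => key q,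
    Finset.sum_add_distrib, Finset.sum_sub_distrib, vField_sum, uForm_sum, Finset.sum_neg_distrib,
    ← add_sub_assoc]
  congr 1
  change -vField A F s (fun q => ∑ p, σ p * d p (τ q)) + _ = _
  rw [vField_neg, vField_add]
  congr 1
  funext p
  rw [Finset.sum_sub_distrib]
  ring

theorem vField_one_vField (τ σ : Fin N → R) : A.Y (vField A F s τ) 1 (vField A F s σ) =
    -F (∑ q, ∑ p, d q (σ p) * d p (τ q)) := by
  rw [vField, map_sum, Finset.sum_apply, LinearMap.sum_apply, map_sum, ← Finset.sum_neg_distrib]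
  refine Finset.sum_congr rfl fun q _ => ?_
  rw [product_one (fun i hi => h.v_pos_vField _ (by omega) _)
    (fun i hi => h.function_pos_vField _ hi _), h.v_zero_vField, h.v_pos_vField _ le_rfl,
    h.function_zero_vField, map_zero, add_zero]

theorem vField_pos_vField (τ σ : Fin N → R) {n : ℤ} (hn : 2 ≤ n) :
    A.Y (vField A F s τ) n (vField A F s σ) = 0 := by
  rw [vField, map_sum, Finset.sum_apply, LinearMap.sum_apply]
  refine Finset.sum_eq_zero fun q _ => ?_
  refine h.product_pos (fun i hi => h.v_pos_vField _ (by omega) _)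
    (fun i hi => h.function_pos_vField _ hi _)
    (fun i hi => ?_) ⟨0, by rw [h.v_pos_vField _ le_rfl, map_zero]⟩ hn
  rw [h.v_zero_vField, h.function_pos_vField _ hi]

/-! Products of matrices of functions. -/

theorem function_commuting_E (a b : Fin N) (f g : R) :
    A.Commuting (F g) (A.Y (s (.E a b)) (-1) (F f)) :=
  (h.commuting_gen _ (by simp) g).symm.Y (h.commuting g f) _

theorem eMatrix_zero_eMatrix (X Y : Fin N → Fin N → R) :
    A.Y (eMatrix A F s X) 0 (eMatrix A F s Y) =
      eMatrix A F s (fun a b => ∑ e, (X a e * Y e b - Y a e * X e b)) +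
      uForm A F s (fun r => ∑ a, ∑ b, Y b a * d r (X a b)) := by
  have key : ∀ a b, A.Y (A.Y (s (.E a b)) (-1) (F (X a b))) 0 (eMatrix A F s Y) =
      (∑ f, A.Y (s (.E a f)) (-1) (F (X a b * Y b f)) -
        ∑ e, A.Y (s (.E e b)) (-1) (F (X a b * Y e a))) +
        uForm A F s (fun r => Y b a * d r (X a b)) := fun a b => by
    rw [product_zero (fun i hi => h.E_pos_eMatrix _ _ (by omega) _)
      (fun i hi => h.function_pos_eMatrix hi _), h.function_commuting_eMatrix _ _ _ le_rfl,
      h.E_zero_eMatrix, h.E_one_eMatrix, h.function_neg_two, map_zero, zero_add, map_sub, map_sum,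
      map_sum]
    congr 2 <;> refine Finset.sum_congr rfl fun f _ => ?_ <;>
    rw [← (h.commuting_gen _ (by simp) _).comm, h.mul]
  rw [eMatrix, map_sum, Finset.sum_apply, LinearMap.sum_apply]
  simp only [map_sum, Finset.sum_apply, LinearMap.sum_apply, key, Finset.sum_add_distrib,
    uForm_sum, Finset.sum_sub_distrib]
  congr 1
  rw [eMatrix]
  simp only [map_sub, map_sum, Finset.sum_sub_distrib]
  congr 1
  · exact Finset.sum_congr rfl fun a _ => Finset.sum_comm
  · rw [Finset.sum_comm]
    rw [Finset.sum_congr rfl fun b _ => Finset.sum_comm, Finset.sum_comm]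
    refine Finset.sum_congr rfl fun a _ => Finset.sum_congr rfl fun b _ =>
      Finset.sum_congr rfl fun e _ => ?_
    rw [mul_comm]

theorem eMatrix_one_eMatrix (X Y : Fin N → Fin N → R) :
    A.Y (eMatrix A F s X) 1 (eMatrix A F s Y) = F (∑ a, ∑ b, X a b * Y b a) := by
  rw [eMatrix, map_sum, Finset.sum_apply, LinearMap.sum_apply, map_sum]
  refine Finset.sum_congr rfl fun a _ => ?_
  rw [map_sum, Finset.sum_apply, LinearMap.sum_apply, map_sum]
  refine Finset.sum_congr rfl fun b _ => ?_
  rw [product_one (fun i hi => h.E_pos_eMatrix _ _ (by omega) _)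
      (fun i hi => h.function_pos_eMatrix hi _), h.E_zero_eMatrix, h.E_one_eMatrix, h.mul,
    map_sub, map_sum, map_sum, Finset.sum_eq_zero fun _ _ => h.function_commuting_E _ _ _ _ _ le_rfl,
    Finset.sum_eq_zero fun _ _ => h.function_commuting_E _ _ _ _ _ le_rfl, sub_self, zero_add]

theorem eMatrix_pos_eMatrix (X Y : Fin N → Fin N → R) {n : ℤ} (hn : 2 ≤ n) :
    A.Y (eMatrix A F s X) n (eMatrix A F s Y) = 0 := by
  rw [eMatrix, map_sum, Finset.sum_apply, LinearMap.sum_apply]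
  refine Finset.sum_eq_zero fun a _ => ?_
  rw [map_sum, Finset.sum_apply, LinearMap.sum_apply]
  refine Finset.sum_eq_zero fun b _ => ?_
  refine h.product_pos (fun i hi => h.E_pos_eMatrix _ _ (by omega) _)
      (fun i hi => h.function_pos_eMatrix hi _) (fun i hi => ?_) ⟨_, h.E_one_eMatrix _ _ _⟩ hn
  rw [h.E_zero_eMatrix, map_sub, map_sum, map_sum,
    Finset.sum_eq_zero fun _ _ => h.function_commuting_E _ _ _ _ _ (by omega),
    Finset.sum_eq_zero fun _ _ => h.function_commuting_E _ _ _ _ _ (by omega), sub_self]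

theorem eMatrix_commuting_function (X : Fin N → Fin N → R) (f : R) :
    A.Commuting (eMatrix A F s X) (F f) := (h.function_commuting_eMatrix f X).symm

theorem uForm_commuting_function (ω : Fin N → R) (f : R) :
    A.Commuting (uForm A F s ω) (F f) := (h.function_commuting_uForm f ω).symm

theorem uForm_commuting_uForm (ω ω' : Fin N → R) :
    A.Commuting (uForm A F s ω) (uForm A F s ω') :=
  .sum fun p _ => (h.u_commuting_uForm p ω).symm.Y (h.uForm_commuting_function _ _) _

theorem uForm_commuting_eMatrix (ω : Fin N → R) (X : Fin N → Fin N → R) :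
    A.Commuting (uForm A F s ω) (eMatrix A F s X) :=
  .sum fun a _ => .sum fun b _ => (h.gen_commuting_uForm (a := .E a b) (by simp [VSpace.factor])
    ω).symm.Y (h.uForm_commuting_function _ _) _

theorem eMatrix_zero_vField (X : Fin N → Fin N → R) (τ : Fin N → R) :
    A.Y (eMatrix A F s X) 0 (vField A F s τ) =
      -eMatrix A F s (fun a b => ∑ q, τ q * d q (X a b)) := by
  rw [eMatrix, map_sum, Finset.sum_apply, LinearMap.sum_apply, eMatrix, ← Finset.sum_neg_distrib]
  refine Finset.sum_congr rfl fun a _ => ?_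
  rw [map_sum, Finset.sum_apply, LinearMap.sum_apply, ← Finset.sum_neg_distrib]
  refine Finset.sum_congr rfl fun b _ => ?_
  have hE := h.gen_commuting_vField (a := .E a b) (by simp [VSpace.factor]) τ
  rw [product_zero (fun i hi => hE i (by omega)) (fun i hi => h.function_pos_vField _ hi _),
    hE 0 le_rfl, hE 1 zero_le_one, h.function_zero_vField, map_zero, map_zero, add_zero, add_zero,
    map_neg]

theorem eMatrix_pos_vField (X : Fin N → Fin N → R) (τ : Fin N → R) {n : ℤ} (hn : 1 ≤ n) :
    A.Y (eMatrix A F s X) n (vField A F s τ) = 0 := by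
  rw [eMatrix, map_sum, Finset.sum_apply, LinearMap.sum_apply]
  refine Finset.sum_eq_zero fun a _ => ?_
  rw [map_sum, Finset.sum_apply, LinearMap.sum_apply]
  refine Finset.sum_eq_zero fun b _ => ?_
  have hE := h.gen_commuting_vField (a := .E a b) (by simp [VSpace.factor]) τ
  rw [A.Y_neg_one_apply (L := 1) (by omega) (fun i hi => hE i (by omega))
    (fun i hi => h.function_pos_vField _ (by omega) _), Finset.sum_range_one,
    h.function_pos_vField _ (by omega), hE _ (by omega), map_zero, map_zero, add_zero]

end Realization
end

/-! ### The change of coordinates -/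

section
variable {𝔤 : Type} [LieRing 𝔤] [LieAlgebra ℂ 𝔤] {N : ℕ} {B : InvForm 𝔤} {c k : ℂ}
  {R : Type} [CommRing R] [Algebra ℂ R] {M : Type} [AddCommGroup M] [Module ℂ M]

/-- Two systems of commuting derivations `d`, `d'` of a ring are the partial derivatives with
respect to two systems of parameters `x`, `y`. -/
structure CoordinateChange (d d' : Fin N → Derivation ℂ R R) (x y : Fin N → R) : Prop where
  comm : ∀ p q f, d p (d q f) = d q (d p f)
  comm' : ∀ p q f, d' p (d' q f) = d' q (d' p f)
  chain : ∀ p f, d p f = ∑ a, d p (y a) * d' a f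
  chain' : ∀ a f, d' a f = ∑ p, d' a (x p) * d p f
  param : ∀ a b, d' a (y b) = if a = b then 1 else 0

theorem VertexAlgebra.Y_add (A : VertexAlgebra M) (a b w : M) (n : ℤ) :
    A.Y (a + b) n w = A.Y a n w + A.Y b n w := by
  rw [map_add]
  rfl

namespace Realization
variable {d : Fin N → Derivation ℂ R R} {A : VertexAlgebra M} {F : R →ₗ[ℂ] M}
  {s : Gen N 𝔤 → M} {x : Fin N → R}

section
variable (d A F s x)

/-- The state `∑ v_p(-1) τ_p + ∑ E_{sp}(-1) ∂_s τ_p` of a vector field `T = ∑ τ_p ∂_p`. -/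
def fieldState (T : Derivation ℂ R R) : M :=
  vField A F s (fun p => T (x p)) + eMatrix A F s (fun a p => d a (T (x p)))

/-- The state `∑ E_{sp}(-1) α_s τ_p + ∑ u_s(-1) T(α_s)` of a one-form `α = ∑ α_s dx_s` and a vector
field `T = ∑ τ_p ∂_p`. -/
def tensorState (α : Fin N → R) (T : Derivation ℂ R R) : M :=
  eMatrix A F s (fun a p => α a * T (x p)) + uForm A F s (fun r => T (α r))

end

variable (h : Realization B c k d A F s)
include h

theorem fieldState_zero_function {T : Derivation ℂ R R} (hT : ∀ f, T f = ∑ q, T (x q) * d q f)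
    (f : R) : A.Y (fieldState d A F s x T) 0 (F f) = F (T f) := by
  rw [fieldState, A.Y_add, h.vField_zero_function,
    h.eMatrix_commuting_function _ _ _ le_rfl, add_zero, ← hT]

theorem fieldState_pos_function (T : Derivation ℂ R R) (f : R) {n : ℤ} (hn : 1 ≤ n) :
    A.Y (fieldState d A F s x T) n (F f) = 0 := by
  rw [fieldState, A.Y_add, h.vField_pos_function _ _ hn,
    h.eMatrix_commuting_function _ _ _ (by omega), add_zero]

/-- The states of commuting vector fields commute: this is where the level `1` of `gl_N` enters. -/
theorem fieldState_commuting (hd : ∀ p q f, d p (d q f) = d q (d p f)) {T S : Derivation ℂ R R}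
    (hT : ∀ f, T f = ∑ q, T (x q) * d q f) (hS : ∀ f, S f = ∑ q, S (x q) * d q f)
    (hTS : ∀ f, T (S f) = S (T f)) :
    A.Commuting (fieldState d A F s x T) (fieldState d A F s x S) := by
  intro n hn
  have tr : ∀ r, ∑ q, ∑ p, d q (S (x p)) * d r (d p (T (x q))) =
      ∑ a, ∑ b, d b (S (x a)) * d r (d a (T (x b))) := fun r => Finset.sum_comm
  rw [fieldState, fieldState, A.Y_add, map_add, map_add]
  rcases (by omega : n = 0 ∨ n = 1 ∨ 2 ≤ n) with rfl | rfl | hn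
  · rw [h.vField_zero_vField, h.vField_zero_eMatrix, h.eMatrix_zero_vField, h.eMatrix_zero_eMatrix]
    have e1 : vField A F s (fun p => ∑ q, (T (x q) * d q (S (x p)) - S (x q) * d q (T (x p)))) =
        0 := by
      simp only [Finset.sum_sub_distrib, ← hT, ← hS, hTS, sub_self]
      simp [vField]
    have e2 : eMatrix A F s (fun a b => ∑ q, T (x q) * d q (d a (S (x b)))) +
        (-eMatrix A F s (fun a b => ∑ q, S (x q) * d q (d a (T (x b)))) +
        eMatrix A F s fun a b => ∑ e, (d a (T (x e)) * d e (S (x b)) -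
          d a (S (x e)) * d e (T (x b)))) = 0 := by
      rw [eMatrix_neg, eMatrix_add, eMatrix_add]
      have : ∀ a b, ∑ q, T (x q) * d q (d a (S (x b))) +
          (-∑ q, S (x q) * d q (d a (T (x b))) + ∑ e, (d a (T (x e)) * d e (S (x b)) -
          d a (S (x e)) * d e (T (x b)))) = 0 := fun a b => by
        have e := congrArg (d a) (hTS (x b))
        rw [hT (S (x b)), hS (T (x b)), map_sum, map_sum] at e
        simp only [Derivation.leibniz, smul_eq_mul, Finset.sum_add_distrib, hd a] at e
        simp only [Finset.sum_sub_distrib, mul_comm (d a _) (d _ _)]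
        linear_combination e
      simp only [this]
      simp [eMatrix]
    rw [e1, zero_sub]
    simp only [tr]
    rw [← e2]
    abel
  · rw [h.vField_one_vField, h.vField_pos_eMatrix _ _ le_rfl, h.eMatrix_pos_vField _ _ le_rfl,
      h.eMatrix_one_eMatrix, add_zero, zero_add, neg_add_eq_zero, Finset.sum_comm]
    congr 1
    exact Finset.sum_congr rfl fun a _ => Finset.sum_congr rfl fun b _ => mul_comm _ _
  · rw [h.vField_pos_vField _ _ hn, h.vField_pos_eMatrix _ _ (by omega),
      h.eMatrix_pos_vField _ _ (by omega), h.eMatrix_pos_eMatrix _ _ hn]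
    simp

/-- The state of a vector field `T` commutes with the state of `α` and `S` if `α` and `S` are
invariant under `T` and the function `α(T)` is annihilated by `S`. -/
theorem fieldState_commuting_of_invariant (hd : ∀ p q f, d p (d q f) = d q (d p f))
    {T S : Derivation ℂ R R}
    (hT : ∀ f, T f = ∑ q, T (x q) * d q f) (hS : ∀ f, S f = ∑ q, S (x q) * d q f)
    (hTS : ∀ f, T (S f) = S (T f)) {α : Fin N → R}
    (hα : ∀ r, T (α r) + ∑ q, α q * d r (T (x q)) = 0) (hα' : S (∑ q, α q * T (x q)) = 0) :
    A.Commuting (fieldState d A F s x T) (tensorState A F s x α S) := by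
  intro n hn
  rw [fieldState, tensorState, A.Y_add, map_add, map_add,
    (h.uForm_commuting_eMatrix _ _).symm n hn]
  rcases (by omega : n = 0 ∨ n = 1 ∨ 2 ≤ n) with rfl | rfl | hn
  · rw [h.vField_zero_eMatrix, h.vField_zero_uForm, h.eMatrix_zero_eMatrix]
    have e1 : eMatrix A F s (fun a b => ∑ q, T (x q) * d q (α a * S (x b))) +
        eMatrix A F s (fun a b => ∑ e, (d a (T (x e)) * (α e * S (x b)) -
          α a * S (x e) * d e (T (x b)))) = 0 := by
      rw [eMatrix_add]
      have : ∀ a b, ∑ q, T (x q) * d q (α a * S (x b)) +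
          ∑ e, (d a (T (x e)) * (α e * S (x b)) - α a * S (x e) * d e (T (x b))) = 0 :=
        fun a b => by
          have h1 := hTS (x b)
          rw [hS (T (x b))] at h1
          have h2 : ∑ e, d a (T (x e)) * (α e * S (x b)) =
              (∑ q, α q * d a (T (x q))) * S (x b) := by
            rw [Finset.sum_mul]
            exact Finset.sum_congr rfl fun _ _ => by ring
          have h3 : ∑ e, α a * S (x e) * d e (T (x b)) = α a * ∑ q, S (x q) * d q (T (x b)) := by
            rw [Finset.mul_sum]
            exact Finset.sum_congr rfl fun _ _ => by ring
          rw [← hT, Finset.sum_sub_distrib, Derivation.leibniz, h2, h3, smul_eq_mul, smul_eq_mul]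
          linear_combination α a * h1 + S (x b) * hα a
      simp only [this]
      simp [eMatrix]
    have e2 : uForm A F s (fun r => ∑ q, (T (x q) * d q (S (α r)) + S (α q) * d r (T (x q)))) +
        uForm A F s (fun r => ∑ a, ∑ b, α b * S (x a) * d r (d a (T (x b)))) = 0 := by
      rw [uForm_add]
      have : ∀ r, ∑ q, (T (x q) * d q (S (α r)) + S (α q) * d r (T (x q))) +
          ∑ a, ∑ b, α b * S (x a) * d r (d a (T (x b))) = 0 := fun r => by
        have h1 := congrArg S (hα r)
        rw [map_add, map_sum, map_zero] at h1
        simp only [Derivation.leibniz, smul_eq_mul, Finset.sum_add_distrib] at h1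
        have h2 : ∑ a, ∑ b, α b * S (x a) * d r (d a (T (x b))) =
            ∑ b, α b * S (d r (T (x b))) := by
          rw [Finset.sum_comm]
          refine Finset.sum_congr rfl fun b _ => ?_
          rw [hS (d r _), Finset.mul_sum]
          refine Finset.sum_congr rfl fun a _ => ?_
          rw [hd r a]
          ring
        rw [Finset.sum_add_distrib, ← hT, h2, hTS, ← h1]
        simp only [mul_comm (S (α _))]
        ring
      simp only [this]
      simp [uForm]
    have e := congrArg₂ (· + ·) e1 e2
    rw [add_zero] at e
    refine Eq.trans ?_ e
    abel
  · rw [h.vField_pos_eMatrix _ _ le_rfl, h.vField_one_uForm, h.eMatrix_one_eMatrix, zero_add,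
      add_zero, ← map_add]
    have : ∑ q, T (x q) * S (α q) + ∑ a, ∑ b, d a (T (x b)) * (α b * S (x a)) = 0 := by
      rw [← hα', map_sum, Finset.sum_comm, ← Finset.sum_add_distrib]
      refine Finset.sum_congr rfl fun q _ => ?_
      rw [Derivation.leibniz, hS (T (x q)), smul_eq_mul, smul_eq_mul, Finset.mul_sum, add_comm]
      congr 1
      exact Finset.sum_congr rfl fun a _ => by ring
    rw [this, map_zero]
  · rw [h.vField_pos_eMatrix _ _ (by omega), h.vField_pos_uForm _ _ hn,
      h.eMatrix_pos_eMatrix _ _ hn]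
    simp

/-- For closed one-forms `α`, `β` and constant `β(T)` the states of `(α, T)` and `(β, S)` have the
commutation relations of matrices. -/
theorem tensorState_zero_tensorState {T S : Derivation ℂ R R} {α β : Fin N → R}
    (hT : ∀ f, T f = ∑ q, T (x q) * d q f) (hS : ∀ f, S f = ∑ q, S (x q) * d q f)
    (hα : ∀ p q, d p (α q) = d q (α p)) (hβ : ∀ p q, d p (β q) = d q (β p)) {K L : R}
    (hK : ∑ q, β q * T (x q) = K) (hL : ∑ q, α q * S (x q) = L) (hKd : ∀ p, d p K = 0) :
    A.Y (tensorState A F s x α T) 0 (tensorState A F s x β S) =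
      A.Y (F K) (-1) (tensorState A F s x α S) - A.Y (F L) (-1) (tensorState A F s x β T) := by
  rw [tensorState, tensorState, tensorState, tensorState, A.Y_add, map_add, map_add, map_add, map_add,
    h.uForm_commuting_eMatrix _ _ _ le_rfl, h.uForm_commuting_uForm _ _ _ le_rfl,
    (h.uForm_commuting_eMatrix _ _).symm _ le_rfl, h.eMatrix_zero_eMatrix,
    h.function_neg_one_eMatrix, h.function_neg_one_eMatrix, h.function_neg_one_uForm,
    h.function_neg_one_uForm, add_zero, add_zero, add_zero, add_sub_add_comm, sub_eq_add_neg,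
    sub_eq_add_neg, eMatrix_neg, eMatrix_add, uForm_neg, uForm_add]
  congr 2
  · funext a b
    rw [← hK, ← hL, Finset.sum_sub_distrib, Finset.sum_mul, Finset.sum_mul, sub_eq_add_neg]
    refine congrArg₂ (· + ·) (Finset.sum_congr rfl fun _ _ => by ring)
      (congrArg Neg.neg (Finset.sum_congr rfl fun _ _ => by ring))
  · funext r
    have h1 : ∑ q, β q * d r (T (x q)) = -T (β r) := by
      have := hKd r
      rw [← hK, map_sum] at this
      simp only [Derivation.leibniz, smul_eq_mul, Finset.sum_add_distrib] at this
      rw [hT (β r), eq_neg_iff_add_eq_zero, ← this]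
      congr 1
      exact Finset.sum_congr rfl fun q _ => by rw [hβ r q]
    have h2 : ∑ a, ∑ b, β b * S (x a) * d r (α a * T (x b)) =
        (∑ a, α a * S (x a)) * (∑ b, β b * d r (T (x b))) +
        (∑ b, β b * T (x b)) * ∑ a, S (x a) * d a (α r) := by
      rw [Finset.sum_mul_sum, Finset.sum_mul_sum, Finset.sum_comm (γ := Fin N) (s := Finset.univ)
        (f := fun b a => β b * T (x b) * (S (x a) * d a (α r))), ← Finset.sum_add_distrib]
      refine Finset.sum_congr rfl fun a _ => ?_
      rw [← Finset.sum_add_distrib]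
      refine Finset.sum_congr rfl fun b _ => ?_
      rw [Derivation.leibniz, smul_eq_mul, smul_eq_mul, hα r a]
      ring
    rw [h2, h1, hK, hL, ← hS]
    ring

theorem tensorState_one_tensorState {T S : Derivation ℂ R R} {α β : Fin N → R} :
    A.Y (tensorState A F s x α T) 1 (tensorState A F s x β S) =
      F ((∑ q, β q * T (x q)) * ∑ q, α q * S (x q)) := by
  rw [tensorState, tensorState, A.Y_add, map_add, map_add,
    h.uForm_commuting_eMatrix _ _ _ zero_le_one, h.uForm_commuting_uForm _ _ _ zero_le_one,
    (h.uForm_commuting_eMatrix _ _).symm _ zero_le_one, h.eMatrix_one_eMatrix, add_zero, add_zero,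
    add_zero, mul_comm, Finset.sum_mul_sum]
  congr 1
  exact Finset.sum_congr rfl fun a _ => Finset.sum_congr rfl fun b _ => by ring

theorem tensorState_pos_tensorState {T S : Derivation ℂ R R} {α β : Fin N → R} {n : ℤ}
    (hn : 2 ≤ n) : A.Y (tensorState A F s x α T) n (tensorState A F s x β S) = 0 := by
  rw [tensorState, tensorState, A.Y_add, map_add, map_add,
    h.uForm_commuting_eMatrix _ _ _ (by omega), h.uForm_commuting_uForm _ _ _ (by omega),
    (h.uForm_commuting_eMatrix _ _).symm _ (by omega), h.eMatrix_pos_eMatrix _ _ hn]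
  simp

omit h in
variable (d A F s x) in
/-- The generators in the parameters `y`, in terms of the ones in the parameters `x`. -/
def newState (d' : Fin N → Derivation ℂ R R) (y : Fin N → R) : Gen N 𝔤 → M
  | .u a => uForm A F s fun p => d p (y a)
  | .v a => fieldState d A F s x (d' a)
  | .E a b => tensorState A F s x (fun p => d p (y a)) (d' b)
  | .g z => s (.g z)
  | .vir => s .vir

variable {d' : Fin N → Derivation ℂ R R} {y : Fin N → R}

theorem newState_u (a : Fin N) : newState d A F s x d' y (.u a) = A.D (F (y a)) :=
  (h.D_function (y a)).symm

variable (hc : CoordinateChange d d' x y)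
include hc

theorem fieldState_comm_function (a : Fin N) (m : ℤ) (f : R) (n : ℤ) (w : M) :
    A.Y (fieldState d A F s x (d' a)) m (A.Y (F f) n w) =
      A.Y (F f) n (A.Y (fieldState d A F s x (d' a)) m w) + A.Y (F (d' a f)) (m + n) w := by
  rw [A.commutator_of_one (fun j hj => h.fieldState_pos_function _ f (by omega)),
    h.fieldState_zero_function (hc.chain' a)]

theorem fieldState_commuting_tensorState (a e b : Fin N) :
    A.Commuting (fieldState d A F s x (d' a))
      (tensorState A F s x (fun p => d p (y e)) (d' b)) := by
  have key : ∑ q, d q (y e) * d' a (x q) = if a = e then 1 else 0 := by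
    rw [← hc.param, hc.chain' a (y e)]
    exact Finset.sum_congr rfl fun _ _ => mul_comm _ _
  refine h.fieldState_commuting_of_invariant hc.comm (hc.chain' a) (hc.chain' b) (hc.comm' a b)
    (fun r => ?_) ?_
  · have h1 := congrArg (d r) key
    rw [map_sum] at h1
    simp only [Derivation.leibniz, smul_eq_mul, Finset.sum_add_distrib] at h1
    rw [hc.chain' a (d r (y e)), add_comm]
    have h2 : d r (if a = e then 1 else 0 : R) = 0 := by split_ifs <;> simp
    rw [← h2, ← h1]
    congr 1
    exact Finset.sum_congr rfl fun q _ => by rw [hc.comm q r]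
  · rw [key]
    split_ifs <;> simp

/-- Generators of different tensor factors commute in the new coordinates. -/
theorem newState_commuting {a b : Gen N 𝔤} (hab : VSpace.factor a ≠ VSpace.factor b) :
    A.Commuting (newState d A F s x d' y a) (newState d A F s x d' y b) := by
  have hs : ∀ a : Gen N 𝔤, VSpace.factor a ≠ 0 → VSpace.factor a ≠ 1 → ∀ b,
      VSpace.factor b ≠ VSpace.factor a → A.Commuting (s a) (newState d A F s x d' y b) := by
    intro a h0 h1 b hb
    have hv : ∀ p, a ≠ .v p := by rintro p rfl; exact h0 rfl
    cases b with
    | u p => exact h.gen_commuting_uForm h0 _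
    | v p => exact (h.gen_commuting_vField h0 _).add (h.gen_commuting_eMatrix h1 hv _)
    | E e f => exact (h.gen_commuting_eMatrix h1 hv _).add (h.gen_commuting_uForm h0 _)
    | g z => exact h.gen_commuting hb.symm
    | vir => exact h.gen_commuting hb.symm
  have uE : ∀ p e f, A.Commuting (newState d A F s x d' y (.u p))
      (newState d A F s x d' y (.E e f)) := fun p e f =>
    (h.uForm_commuting_eMatrix _ _).add (h.uForm_commuting_uForm _ _)
  have vE : ∀ p e f, A.Commuting (newState d A F s x d' y (.v p))
      (newState d A F s x d' y (.E e f)) := fun p e f => h.fieldState_commuting_tensorState hc p e f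
  cases a with
  | g z => exact hs (.g z) (by simp [VSpace.factor]) (by simp [VSpace.factor]) b hab.symm
  | vir => exact hs .vir (by simp [VSpace.factor]) (by simp [VSpace.factor]) b hab.symm
  | u p => cases b with
    | g z => exact (hs (.g z) (by simp [VSpace.factor]) (by simp [VSpace.factor]) _ hab).symm
    | vir => exact (hs .vir (by simp [VSpace.factor]) (by simp [VSpace.factor]) _ hab).symm
    | E e f => exact uE p e f
    | _ => exact absurd rfl hab
  | v p => cases b with
    | g z => exact (hs (.g z) (by simp [VSpace.factor]) (by simp [VSpace.factor]) _ hab).symm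
    | vir => exact (hs .vir (by simp [VSpace.factor]) (by simp [VSpace.factor]) _ hab).symm
    | E e f => exact vE p e f
    | _ => exact absurd rfl hab
  | E e f => cases b with
    | g z => exact (hs (.g z) (by simp [VSpace.factor]) (by simp [VSpace.factor]) _ hab).symm
    | vir => exact (hs .vir (by simp [VSpace.factor]) (by simp [VSpace.factor]) _ hab).symm
    | u p => exact (uE p e f).symm
    | v p => exact (vE p e f).symm
    | _ => exact absurd rfl hab

theorem newState_E_comm_E (a b e f : Fin N) (m n : ℤ) (w : M) :
    A.Y (newState d A F s x d' y (.E a b)) m (A.Y (newState d A F s x d' y (.E e f)) n w) =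
      A.Y (newState d A F s x d' y (.E e f)) n (A.Y (newState d A F s x d' y (.E a b)) m w) +
      ((if b = e then A.Y (newState d A F s x d' y (.E a f)) (m + n) w else 0) -
        (if f = a then A.Y (newState d A F s x d' y (.E e b)) (m + n) w else 0)) +
      (if b = e ∧ a = f ∧ m = -n then (m : ℂ) else 0) • w := by
  have key : ∀ b e, ∑ q, d q (y e) * d' b (x q) = if b = e then 1 else 0 := fun b e => by
    rw [← hc.param, hc.chain' b (y e)]
    exact Finset.sum_congr rfl fun _ _ => mul_comm _ _
  have h1 : ∀ P : Prop, [Decidable P] → ∀ z : M, A.Y (F (if P then 1 else 0)) (-1) z =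
      if P then z else 0 := fun P _ z => by
    split_ifs
    · rw [h.one, A.vacuum, if_pos rfl, LinearMap.id_apply]
    · simp
  simp only [newState]
  rw [A.commutator_of_two (fun j hj => h.tensorState_pos_tensorState (by omega)),
    h.tensorState_zero_tensorState (hc.chain' b) (hc.chain' f) (fun p q => hc.comm p q _)
    (fun p q => hc.comm p q _) (key b e) (key f a) (fun p => by split_ifs <;> simp),
    h.tensorState_one_tensorState, key, key, h1, h1, map_sub, Pi.sub_apply, LinearMap.sub_apply]
  congr 1
  · congr 2 <;> split_ifs <;> simp
  · by_cases h2 : b = e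
    · by_cases h3 : a = f
      · rw [if_pos h2, if_pos h3.symm, one_mul, h.one, A.vacuum]
        by_cases h4 : m = -n
        · rw [if_pos (by omega), if_pos ⟨h2, h3, h4⟩, Int.cast_smul_eq_zsmul]; rfl
        · rw [if_neg (by omega), if_neg (fun h => h4 h.2.2)]; simp
      · rw [if_neg (fun h : f = a => h3 h.symm), if_neg (fun h : _ ∧ _ => h3 h.2.1)]; simp
    · rw [if_neg h2, if_neg (fun h : _ ∧ _ => h2 h.1)]; simp

/-- **Change of coordinates**: the new generators satisfy the relations of the generators of the
vertex algebra in the new coordinates. -/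
theorem changeCoordinates : Realization B c k d' A F (newState d A F s x d' y) where
  rel :=
    { mode_comm_of_ne := fun hab m n w => (h.newState_commuting hc hab).comm m n w
      mode_u_comm_u := fun p q m n w => (h.uForm_commuting_uForm _ _).comm m n w
      mode_v_comm_v := fun p q m n w => (h.fieldState_commuting hc.comm (hc.chain' p) (hc.chain' q)
        (hc.comm' p q)).comm m n w
      mode_u_comm_v := fun p q m n w => by
        have := h.fieldState_comm_function hc q n (y p) (m - 1) w
        rw [hc.param] at this
        rw [h.newState_u, A.derivative, LinearMap.smul_apply, LinearMap.smul_apply, map_smul]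
        change -(m : ℂ) • _ = -(m : ℂ) • (A.Y (fieldState d A F s x (d' q)) n _) + _
        rw [this, smul_add, add_assoc]
        refine left_eq_add.2 ?_
        by_cases hpq : q = p
        · rw [if_pos hpq, h.one, A.vacuum]
          by_cases hm : m = -n
          · rw [if_pos (by omega), if_pos ⟨hpq.symm, hm⟩, LinearMap.id_apply, ← add_smul]
            simp
          · rw [if_neg (by omega), if_neg (fun h => hm h.2)]; simp
        · rw [if_neg hpq, if_neg (fun h => hpq h.1.symm)]; simp
      mode_E_comm_E := h.newState_E_comm_E hc
      mode_g_comm_g := h.rel.mode_g_comm_g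
      mode_vir_comm_vir := h.rel.mode_vir_comm_vir }
  g_linear := h.g_linear
  one := h.one
  mul := h.mul
  commuting := h.commuting
  commuting_gen a ha f := by
    cases a with
    | u p => exact h.uForm_commuting_function _ _
    | v p => exact absurd rfl (ha p)
    | E e b => exact ((h.eMatrix_commuting_function _ f).symm.add
        (h.uForm_commuting_function _ f).symm).symm
    | g z => exact h.commuting_gen _ (by simp) f
    | vir => exact h.commuting_gen _ (by simp) f
  v_zero p f := h.fieldState_zero_function (hc.chain' p) f
  v_pos p f n hn := h.fieldState_pos_function _ f (by omega)
  D_function f := by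
    have : ∀ a, A.Y (newState d A F s x d' y (.u a)) (-1) (F (d' a f)) =
        uForm A F s (fun r => d' a f * d r (y a)) := fun a => by
      rw [h.newState_u, A.derivative, ← h.function_neg_two]
      simp
    simp only [this, uForm_sum]
    rw [h.D_function, uForm]
    refine Finset.sum_congr rfl fun p _ => ?_
    rw [hc.chain p f]
    simp only [mul_comm]

end Realization
end

/-! ### The universal property of `V` -/

section
variable {P Q : Type} [AddCommGroup P] [Module ℂ P] [AddCommGroup Q] [Module ℂ Q]

/-- The universal property of `V ⊗ Q`, for a highest weight module `V` over a Lie algebra that is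
spanned by `G`. -/
theorem Induced.exists_lift_of_span {𝔩 : Type} [LieRing 𝔩] [LieAlgebra ℂ 𝔩] {S : Set 𝔩} {C : 𝔩}
    {k : ℂ} (G : Set 𝔩) (hG : ∀ N : Submodule ℂ 𝔩, (∀ x ∈ G, x ∈ N) → N = ⊤)
    (ρ : 𝔩 →ₗ[ℂ] Module.End ℂ P)
    (hρ : ∀ x ∈ G, ∀ y ∈ G, ∀ p, ρ ⁅x, y⁆ p = ρ x (ρ y p) - ρ y (ρ x p)) (f : Q →ₗ[ℂ] P)
    (hS : ∀ x ∈ S, ∀ q, ρ x (f q) = 0) (hC : ∀ q, ρ C (f q) = k • f q) :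
    ∃ φ : Induced 𝔩 S C k ⊗[ℂ] Q →ₗ[ℂ] P, (∀ q, φ (vac ⊗ₜ q) = f q) ∧
      (∀ x w, φ (LinearMap.rTensor Q (act x) w) = ρ x (φ w)) ∧
      ∀ (T : Module.End ℂ Q) (T' : Module.End ℂ P), (∀ q, f (T q) = T' (f q)) →
        (∀ x ∈ G, ∀ p, T' (ρ x p) = ρ x (T' p)) →
        ∀ w, φ (LinearMap.lTensor _ T w) = T' (φ w) := by
  have top : ∀ N : Submodule ℂ 𝔩, (∀ x ∈ G, x ∈ N) → ∀ x, x ∈ N := fun N h x =>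
    (hG N h).ge Submodule.mem_top
  have h1 : ∀ x ∈ G, ∀ y p, ρ ⁅x, y⁆ p = ρ x (ρ y p) - ρ y (ρ x p) := fun x hx =>
    top { carrier := {y | ∀ p, ρ ⁅x, y⁆ p = ρ x (ρ y p) - ρ y (ρ x p)}
          add_mem' := fun ha hb p => by
            rw [lie_add, map_add, LinearMap.add_apply, ha, hb, map_add, LinearMap.add_apply,
              LinearMap.add_apply, map_add]
            abel
          zero_mem' := fun p => by simp
          smul_mem' := fun r a ha p => by
            rw [lie_smul, map_smul, LinearMap.smul_apply, ha, map_smul, LinearMap.smul_apply,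
              LinearMap.smul_apply, map_smul, smul_sub] } (hρ x hx)
  have h2 : ∀ x y p, ρ ⁅x, y⁆ p = ρ x (ρ y p) - ρ y (ρ x p) :=
    top { carrier := {x | ∀ y p, ρ ⁅x, y⁆ p = ρ x (ρ y p) - ρ y (ρ x p)}
          add_mem' := fun ha hb y p => by
            rw [add_lie, map_add, LinearMap.add_apply, ha, hb, map_add, LinearMap.add_apply,
              LinearMap.add_apply, map_add]
            abel
          zero_mem' := fun y p => by simp
          smul_mem' := fun r a ha y p => by
            rw [smul_lie, map_smul, LinearMap.smul_apply, ha, map_smul, LinearMap.smul_apply,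
              LinearMap.smul_apply, map_smul, smul_sub] } h1
  obtain ⟨φ, hv, hx⟩ := exists_lift_tensor ρ h2 f hS hC
  refine ⟨φ, hv, hx, fun T T' hT hT' w => ?_⟩
  have h3 : ∀ x p, T' (ρ x p) = ρ x (T' p) :=
    top { carrier := {x | ∀ p, T' (ρ x p) = ρ x (T' p)}
          add_mem' := fun ha hb p => by
            rw [map_add, LinearMap.add_apply, map_add, ha, hb, LinearMap.add_apply]
          zero_mem' := fun p => by simp
          smul_mem' := fun r a ha p => by
            rw [map_smul, LinearMap.smul_apply, map_smul, ha, LinearMap.smul_apply] } hT'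
  have : LinearMap.eqLocus (φ ∘ₗ LinearMap.lTensor _ T) (T' ∘ₗ φ) = ⊤ := by
    refine span_tensor _ (fun q => ?_) fun x w hw => ?_
    · rw [LinearMap.mem_eqLocus, LinearMap.comp_apply, LinearMap.comp_apply,
        LinearMap.lTensor_tmul, hv, hv, hT]
    · rw [LinearMap.mem_eqLocus, LinearMap.comp_apply, LinearMap.comp_apply] at hw ⊢
      have e : LinearMap.lTensor _ T (LinearMap.rTensor Q (act x) w) =
          LinearMap.rTensor Q (act x) (LinearMap.lTensor _ T w) :=
        (LinearMap.congr_fun (rTensor_mul_lTensor (act x) T) w).symm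
      rw [e, hx, hx, hw, h3]
  exact LinearMap.congr_fun (LinearMap.eqLocus_eq_top.1 this) w

theorem bracket_of_relation {L : Type} [LieRing L] [LieAlgebra ℂ L] {ρ : L →ₗ[ℂ] Module.End ℂ P}
    {x y u z : L} {r : ℂ} (h : ⁅x, y⁆ = u + r • z) {p t : P} (ht : ρ x (ρ y p) = ρ y (ρ x p) + t)
    (hu : ρ u p + r • ρ z p = t) : ρ ⁅x, y⁆ p = ρ x (ρ y p) - ρ y (ρ x p) := by
  rw [h, map_add, map_smul, LinearMap.add_apply, LinearMap.smul_apply, hu, ht, add_sub_cancel_left]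

theorem bracket_of_central {L : Type} [LieRing L] [LieAlgebra ℂ L] {ρ : L →ₗ[ℂ] Module.End ℂ P}
    {z : L} {k : ℂ} (hz : ∀ x : L, ⁅z, x⁆ = 0) (hρ : ∀ p, ρ z p = k • p) (x : L) (p : P) :
    ρ ⁅z, x⁆ p = ρ z (ρ x p) - ρ x (ρ z p) ∧ ρ ⁅x, z⁆ p = ρ x (ρ z p) - ρ z (ρ x p) := by
  rw [← lie_skew x z, hz, hρ, hρ]
  simp

theorem AffineVac.exists_lift {𝔞 : Type} [LieRing 𝔞] [LieAlgebra ℂ 𝔞] {B : InvForm 𝔞} {k : ℂ}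
    (op : ℤ → 𝔞 →ₗ[ℂ] Module.End ℂ P)
    (rel : ∀ a b m s p, op m a (op s b p) = op s b (op m a p) + op (m + s) ⁅a, b⁆ p +
      (if m = -s then (m : ℂ) * B.form a b * k else 0) • p)
    (f : Q →ₗ[ℂ] P) (hf : ∀ a m, 0 ≤ m → ∀ q, op m a (f q) = 0) :
    ∃ φ : AffineVac B k ⊗[ℂ] Q →ₗ[ℂ] P, (∀ q, φ (Induced.vac ⊗ₜ q) = f q) ∧
      (∀ a m w, φ (LinearMap.rTensor Q (Induced.act (Affine.mode B a m)) w) = op m a (φ w)) ∧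
      ∀ (T : Module.End ℂ Q) (T' : Module.End ℂ P), (∀ q, f (T q) = T' (f q)) →
        (∀ a m p, T' (op m a p) = op m a (T' p)) →
        ∀ w, φ (LinearMap.lTensor _ T w) = T' (φ w) := by
  obtain ⟨ρ, hρ, hC⟩ := Affine.exists_linearMap B op (k • LinearMap.id)
  have hC' : ∀ p, ρ (Affine.central B) p = k • p := fun p => LinearMap.congr_fun hC p
  have hρ' : ∀ a m p, ρ (Affine.mode B a m) p = op m a p := fun a m p =>
    LinearMap.congr_fun (hρ a m) p
  have hlie : ∀ a m b s p, ρ ⁅Affine.mode B a m, Affine.mode B b s⁆ p =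
      ρ (Affine.mode B a m) (ρ (Affine.mode B b s) p) -
        ρ (Affine.mode B b s) (ρ (Affine.mode B a m) p) := fun a m b s p => by
    refine bracket_of_relation (Affine.lie_mode_mode B a b m s)
      (t := op (m + s) ⁅a, b⁆ p + (if m = -s then (m : ℂ) * B.form a b * k else 0) • p) ?_ ?_
    · simp only [hρ']
      rw [rel, add_assoc]
    · simp only [hρ', hC', smul_smul, ite_mul, zero_mul]
  obtain ⟨φ, h1, h2, h3⟩ := Induced.exists_lift_of_span (C := Affine.central B) (k := k)
    (S := {x | ∃ (a : 𝔞) (m : ℤ), 0 ≤ m ∧ x = Affine.mode B a m})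
    ({x | ∃ (a : 𝔞) (m : ℤ), x = Affine.mode B a m} ∪ {Affine.central B})
    (fun N hN => Affine.eq_top_of_mode_mem B N (hN _ (Or.inr rfl))
      fun a m => hN _ (Or.inl ⟨a, m, rfl⟩)) ρ (by
      rintro x (⟨a, m, rfl⟩ | rfl) y (⟨b, s, rfl⟩ | rfl) p
      · exact hlie a m b s p
      · exact (bracket_of_central (Affine.lie_central B) hC' _ p).2
      · exact (bracket_of_central (Affine.lie_central B) hC' _ p).1
      · exact (bracket_of_central (Affine.lie_central B) hC' _ p).1) f (by
      rintro x ⟨a, m, hm, rfl⟩ q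
      exact (hρ' a m _).trans (hf a m hm q)) (fun q => hC' _)
  refine ⟨φ, h1, fun a m w => (h2 _ w).trans (hρ' a m _), fun T T' hT hT' => h3 T T' hT ?_⟩
  rintro x (⟨a, m, rfl⟩ | rfl) p
  · simp only [hρ', hT']
  · simp only [hC', map_smul]

theorem VirVac.exists_lift {k : ℂ} (op : ℤ → Module.End ℂ P)
    (rel : ∀ m s p, op m (op s p) = op s (op m p) + ((m : ℂ) - s) • op (m + s) p +
      (if m = -s then ((m : ℂ) ^ 3 - m) / 12 * k else 0) • p)
    (p : P) (hp : ∀ m, -1 ≤ m → op m p = 0) :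
    ∃ φ : VirVac k →ₗ[ℂ] P, φ Induced.vac = p ∧
      (∀ m w, φ (Induced.act (Vir.L m) w) = op m (φ w)) ∧
      ∀ T' : Module.End ℂ P, T' p = 0 → (∀ m p, T' (op m p) = op m (T' p)) →
        ∀ w, T' (φ w) = 0 := by
  obtain ⟨ρ, hρ, hC⟩ := Vir.exists_linearMap op (k • LinearMap.id)
  have hC' : ∀ p, ρ Vir.central p = k • p := fun p => LinearMap.congr_fun hC p
  have hρ' : ∀ m p, ρ (Vir.L m) p = op m p := fun m p => LinearMap.congr_fun (hρ m) p
  have hlie : ∀ m s p, ρ ⁅Vir.L m, Vir.L s⁆ p =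
      ρ (Vir.L m) (ρ (Vir.L s) p) - ρ (Vir.L s) (ρ (Vir.L m) p) := fun m s p => by
    refine bracket_of_relation (Vir.lie_L_L m s) (t := ((m : ℂ) - s) • op (m + s) p +
      (if m = -s then ((m : ℂ) ^ 3 - m) / 12 * k else 0) • p) ?_ ?_
    · simp only [hρ']
      rw [rel, add_assoc]
    · simp only [hρ', hC', smul_smul, ite_mul, zero_mul, map_smul, LinearMap.smul_apply]
  obtain ⟨φ, h1, h2, h3⟩ := Induced.exists_lift_of_span (C := Vir.central) (k := k)
    (S := {x | ∃ m : ℤ, -1 ≤ m ∧ x = Vir.L m}) ({x | ∃ m : ℤ, x = Vir.L m} ∪ {Vir.central})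
    (fun N hN => Vir.eq_top_of_L_mem N (hN _ (Or.inr rfl)) fun m => hN _ (Or.inl ⟨m, rfl⟩)) ρ (by
      rintro x (⟨m, rfl⟩ | rfl) y (⟨s, rfl⟩ | rfl) p
      · exact hlie m s p
      · exact (bracket_of_central Vir.lie_central hC' _ p).2
      · exact (bracket_of_central Vir.lie_central hC' _ p).1
      · exact (bracket_of_central Vir.lie_central hC' _ p).1)
    (LinearMap.toSpanSingleton ℂ P p) (by
      rintro x ⟨m, hm, rfl⟩ q
      rw [LinearMap.toSpanSingleton_apply, map_smul, hρ', hp m hm, smul_zero]) (fun q => hC' _)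
  refine ⟨φ ∘ₗ (TensorProduct.mk ℂ _ ℂ).flip 1, (h1 1).trans (one_smul _ _),
    fun m w => (h2 (Vir.L m) (w ⊗ₜ 1)).trans (hρ' m _), fun T' hT hT' w => ?_⟩
  refine (h3 0 T' (fun q => ?_) ?_ (w ⊗ₜ 1)).symm.trans ?_
  · simp [hT]
  · rintro x (⟨m, rfl⟩ | rfl) p
    · simp only [hρ', hT']
    · simp only [hC', map_smul]
  · rw [LinearMap.lTensor_zero, LinearMap.zero_apply, map_zero]

/-- The universal property of a polynomial ring for commuting operators `cr i`: creation operators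
and their commutators with other operators. -/
theorem exists_lift_polynomial {σ : Type} (cr : σ → Module.End ℂ P)
    (comm : ∀ i j p, cr i (cr j p) = cr j (cr i p)) (f : Q →ₗ[ℂ] P) :
    ∃ φ : MvPolynomial σ ℂ ⊗[ℂ] Q →ₗ[ℂ] P, (∀ q, φ (1 ⊗ₜ q) = f q) ∧
      (∀ i w, φ (LinearMap.rTensor Q (LinearMap.mulLeft ℂ (MvPolynomial.X i)) w) = cr i (φ w)) ∧
      ∀ (δ : Derivation ℂ (MvPolynomial σ ℂ) (MvPolynomial σ ℂ)) (r : σ → ℂ)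
        (T : Module.End ℂ Q) (T' : Module.End ℂ P),
        (∀ i, δ (MvPolynomial.X i) = MvPolynomial.C (r i)) → (∀ q, f (T q) = T' (f q)) →
        (∀ i p, T' (cr i p) = cr i (T' p) + r i • p) →
        ∀ w, φ (LinearMap.rTensor Q δ.toLinearMap w + LinearMap.lTensor _ T w) = T' (φ w) := by
  have hcomm : IsMulCommutative (Algebra.adjoin ℂ (Set.range cr)) :=
    Algebra.isMulCommutative_adjoin ℂ (by
      rintro _ ⟨i, rfl⟩ _ ⟨j, rfl⟩
      exact LinearMap.ext fun p => comm i j p)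
  let _ : CommRing (Algebra.adjoin ℂ (Set.range cr)) :=
    { (inferInstance : Ring (Algebra.adjoin ℂ (Set.range cr))) with
      mul_comm := hcomm.is_comm.comm }
  let ev : MvPolynomial σ ℂ →ₐ[ℂ] Module.End ℂ P := (Subalgebra.val _).comp
    (MvPolynomial.aeval fun i => (⟨cr i, Algebra.subset_adjoin ⟨i, rfl⟩⟩ :
      Algebra.adjoin ℂ (Set.range cr)))
  have hev : ∀ i, ev (MvPolynomial.X i) = cr i := fun i => by simp [ev]
  let φ : MvPolynomial σ ℂ ⊗[ℂ] Q →ₗ[ℂ] P := TensorProduct.lift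
    ((LinearMap.lcomp ℂ P f).comp ev.toLinearMap)
  have hφ : ∀ x q, φ (x ⊗ₜ q) = ev x (f q) := fun x q => rfl
  refine ⟨φ, fun q => ?_, fun i w => ?_, fun δ r T T' hδ hT hT' w => ?_⟩
  · rw [hφ, map_one, Module.End.one_apply]
  · refine LinearMap.congr_fun (f := φ ∘ₗ LinearMap.rTensor Q
      (LinearMap.mulLeft ℂ (MvPolynomial.X i))) (g := cr i ∘ₗ φ) (TensorProduct.ext' fun x q => ?_) w
    rw [LinearMap.comp_apply, LinearMap.comp_apply, LinearMap.rTensor_tmul,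
      LinearMap.mulLeft_apply, hφ, hφ, map_mul, hev, Module.End.mul_apply]
  · refine LinearMap.congr_fun (f := φ ∘ₗ (LinearMap.rTensor Q δ.toLinearMap +
      LinearMap.lTensor _ T)) (g := T' ∘ₗ φ) (TensorProduct.ext' fun x q => ?_) w
    rw [LinearMap.comp_apply, LinearMap.comp_apply, LinearMap.add_apply, LinearMap.rTensor_tmul,
      LinearMap.lTensor_tmul, map_add, hφ, hφ, hφ, hT]
    change ev (δ x) (f q) + ev x (T' (f q)) = T' (ev x (f q))
    induction x using MvPolynomial.induction_on with
    | C a =>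
      rw [← MvPolynomial.algebraMap_eq, Derivation.map_algebraMap, AlgHom.commutes]
      simp
    | add x y hx hy =>
      rw [map_add, map_add, map_add, LinearMap.add_apply, LinearMap.add_apply, LinearMap.add_apply,
        map_add, ← hx, ← hy]
      abel
    | mul_X x i hx =>
      rw [Derivation.leibniz, hδ, mul_comm x, map_mul, hev, Module.End.mul_apply,
        Module.End.mul_apply, hT', ← hx, MvPolynomial.C_eq_smul_one, smul_eq_mul, smul_eq_mul,
        mul_smul_comm, mul_one, map_add, map_mul, map_smul, hev, LinearMap.add_apply,
        LinearMap.smul_apply, Module.End.mul_apply, map_add]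
      abel

end

section
variable {P Q : Type} [AddCommGroup P] [Module ℂ P] [AddCommGroup Q] [Module ℂ Q]

theorem Fock.exists_lift {N : ℕ} {u v : Fin N → ℤ → Module.End ℂ P}
    (uu : ∀ p q m s x, u p m (u q s x) = u q s (u p m x))
    (vv : ∀ p q m s x, v p m (v q s x) = v q s (v p m x))
    (uv : ∀ p q m s x, u p m (v q s x) = v q s (u p m x) +
      (if p = q ∧ m = -s then (m : ℂ) else 0) • x) (f : Q →ₗ[ℂ] P)
    (hu : ∀ p n, 0 ≤ n → ∀ q, u p n (f q) = 0) (hv : ∀ p n, 0 < n → ∀ q, v p n (f q) = 0) :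
    ∃ φ : Fock N ⊗[ℂ] Q →ₗ[ℂ] P, (∀ q, φ (1 ⊗ₜ q) = f q) ∧
      (∀ p n w, φ (LinearMap.rTensor Q (Fock.u p n) w) = u p n (φ w)) ∧
      (∀ p n w, n ≠ 0 → φ (LinearMap.rTensor Q (Fock.v p n) w) = v p n (φ w)) ∧
      ∀ (T : Module.End ℂ Q) (T' : Module.End ℂ P), (∀ q, f (T q) = T' (f q)) →
        (∀ p m x, T' (u p m x) = u p m (T' x)) → (∀ p m x, T' (v p m x) = v p m (T' x)) →
        ∀ w, φ (LinearMap.lTensor _ T w) = T' (φ w) := by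
  have vu : ∀ p q m s x, v p m (u q s x) = u q s (v p m x) +
      (if p = q ∧ m = -s then (m : ℂ) else 0) • x := fun p q m s x => by
    rw [uv, add_assoc, ← add_smul, left_eq_add]
    by_cases h : p = q ∧ m = -s
    · rw [if_pos h, if_pos ⟨h.1.symm, by omega⟩, h.2]; simp
    · rw [if_neg h, if_neg fun h' => h ⟨h'.1.symm, by omega⟩]; simp
  obtain ⟨φ, h1, h2, h3⟩ := exists_lift_polynomial (σ := Fin N × ℕ ⊕ Fin N × ℕ)
    (Sum.elim (fun i => u i.1 (Int.negSucc i.2)) (fun i => v i.1 (Int.negSucc i.2))) (by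
      rintro (⟨p, i⟩ | ⟨p, i⟩) (⟨q, j⟩ | ⟨q, j⟩) x
      · exact uu _ _ _ _ _
      · simp only [Sum.elim_inl, Sum.elim_inr]
        rw [uv, if_neg fun h => by have := h.2; omega, zero_smul, add_zero]
      · simp only [Sum.elim_inl, Sum.elim_inr]
        rw [vu, if_neg fun h => by have := h.2; omega, zero_smul, add_zero]
      · exact vv _ _ _ _ _) f
  -- the annihilation operators act as derivations
  have key : ∀ (i : Fin N × ℕ ⊕ Fin N × ℕ) (j : ℕ) (T' : Module.End ℂ P), (∀ q, T' (f q) = 0) →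
      (∀ q m x, T' (u q m x) = u q m (T' x) +
        (if i = .inl (q, j) ∧ m = Int.negSucc j then (j : ℂ) + 1 else 0) • x) →
      (∀ q m x, T' (v q m x) = v q m (T' x) +
        (if i = .inr (q, j) ∧ m = Int.negSucc j then (j : ℂ) + 1 else 0) • x) →
      (∃ q, i = .inl (q, j) ∨ i = .inr (q, j)) →
      ∀ w, φ (LinearMap.rTensor Q (((j : ℂ) + 1) • (MvPolynomial.pderiv i).toLinearMap) w) =
        T' (φ w) := by
    intro i j T' hf hu' hv' hi w
    have := h3 (((j : ℂ) + 1) • MvPolynomial.pderiv i) (fun l => if l = i then (j : ℂ) + 1 else 0)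
      0 T' (fun l => ?_) (fun q => by rw [hf, LinearMap.zero_apply, map_zero]) ?_ w
    · rw [LinearMap.lTensor_zero, LinearMap.zero_apply, add_zero] at this
      exact this
    · rw [Derivation.smul_apply]
      by_cases hl : l = i
      · subst hl
        rw [MvPolynomial.pderiv_X_self, if_pos rfl, MvPolynomial.smul_eq_C_mul, mul_one]
      · rw [MvPolynomial.pderiv_X_of_ne (by exact hl), if_neg hl, smul_zero, map_zero]
    · rintro (⟨q, l⟩ | ⟨q, l⟩) x
      · simp only [Sum.elim_inl]
        rw [hu']
        congr 2
        refine if_congr ?_ rfl rfl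
        obtain ⟨q', rfl | rfl⟩ := hi
        · simp only [Sum.inl.injEq, Prod.mk.injEq, Int.negSucc.injEq]
          constructor
          · rintro ⟨⟨rfl, -⟩, rfl⟩; exact ⟨rfl, rfl⟩
          · rintro ⟨rfl, rfl⟩; exact ⟨⟨rfl, trivial⟩, rfl⟩
        · simp
      · simp only [Sum.elim_inr]
        rw [hv']
        congr 2
        refine if_congr ?_ rfl rfl
        obtain ⟨q', rfl | rfl⟩ := hi
        · simp
        · simp only [Sum.inr.injEq, Prod.mk.injEq, Int.negSucc.injEq]
          constructor
          · rintro ⟨⟨rfl, -⟩, rfl⟩; exact ⟨rfl, rfl⟩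
          · rintro ⟨rfl, rfl⟩; exact ⟨⟨rfl, trivial⟩, rfl⟩
  have hT : ∀ (T : Module.End ℂ Q) (T' : Module.End ℂ P), (∀ q, f (T q) = T' (f q)) →
      (∀ p m x, T' (u p m x) = u p m (T' x)) → (∀ p m x, T' (v p m x) = v p m (T' x)) →
      ∀ w, φ (LinearMap.lTensor _ T w) = T' (φ w) := by
    intro T T' hf hu' hv' w
    have := h3 0 0 T T' (fun i => by simp) hf ?_ w
    · have e : (LinearMap.rTensor Q (0 : Derivation ℂ (Fock N) (Fock N)).toLinearMap) w = 0 :=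
        LinearMap.congr_fun (LinearMap.rTensor_zero Q) w
      rw [e, zero_add] at this
      exact this
    · rintro (⟨q, l⟩ | ⟨q, l⟩) x
      · simp [hu']
      · simp [hv']
  refine ⟨φ, h1, fun p n w => ?_, fun p n w hn => ?_, hT⟩
  · rcases n with (_ | j) | j
    · have := hT 0 (u p 0) (fun q => by simp [hu p 0 le_rfl]) (fun q m x => uu _ _ _ _ _)
        (fun q m x => by
          rw [uv]
          split_ifs <;> simp) w
      rw [LinearMap.lTensor_zero, LinearMap.zero_apply, map_zero] at this
      exact (congrArg φ (LinearMap.congr_fun (LinearMap.rTensor_zero Q) w)).trans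
        ((map_zero φ).trans this)
    · refine key (.inr (p, j)) j (u p (Int.ofNat (j + 1))) (hu p _ (Int.natCast_nonneg _))
        (fun q m x => ?_) (fun q m x => ?_) ⟨p, Or.inr rfl⟩ w
      · rw [uu, if_neg (by simp), zero_smul, add_zero]
      · rw [uv]
        congr 2
        simp only [Sum.inr.injEq, Prod.mk.injEq, and_true, Int.negSucc_eq, Int.ofNat_eq_natCast]
        push_cast
        refine if_congr (and_congr_right fun _ => ?_) rfl rfl
        omega
    · exact h2 (.inl (p, j)) w
  · rcases n with (_ | j) | j
    · exact absurd rfl hn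
    · refine key (.inl (p, j)) j (v p (Int.ofNat (j + 1))) (hv p _ (by simp))
        (fun q m x => ?_) (fun q m x => ?_) ⟨p, Or.inl rfl⟩ w
      · rw [vu]
        congr 2
        simp only [Sum.inl.injEq, Prod.mk.injEq, and_true, Int.negSucc_eq, Int.ofNat_eq_natCast]
        push_cast
        refine if_congr (and_congr_right fun _ => ?_) rfl rfl
        omega
      · rw [vv, if_neg (by simp), zero_smul, add_zero]
    · exact h2 (.inr (p, j)) w

section
attribute [local instance 100] LieRing.ofAssociativeRing

theorem GlVac.exists_lift {N : ℕ} {E : Fin N → Fin N → ℤ → Module.End ℂ P}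
    (rel : ∀ a b e d m s w, E a b m (E e d s w) = E e d s (E a b m w) +
      ((if b = e then E a d (m + s) w else 0) - (if d = a then E e b (m + s) w else 0)) +
      (if b = e ∧ a = d ∧ m = -s then (m : ℂ) else 0) • w)
    (f : Q →ₗ[ℂ] P) (hf : ∀ a b m, 0 ≤ m → ∀ q, E a b m (f q) = 0) :
    ∃ φ : GlVac N ⊗[ℂ] Q →ₗ[ℂ] P, (∀ q, φ (Induced.vac ⊗ₜ q) = f q) ∧
      (∀ a b m w, φ (LinearMap.rTensor Q (GlVac.E a b m) w) = E a b m (φ w)) ∧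
      ∀ (T : Module.End ℂ Q) (T' : Module.End ℂ P), (∀ q, f (T q) = T' (f q)) →
        (∀ a b m p, T' (E a b m p) = E a b m (T' p)) →
        ∀ w, φ (LinearMap.lTensor _ T w) = T' (φ w) := by
  have span : ∀ (S : Submodule ℂ (Matrix (Fin N) (Fin N) ℂ)),
      (∀ a b, Matrix.single a b 1 ∈ S) → ∀ X, X ∈ S := fun S hS X => by
    rw [Matrix.matrix_eq_sum_single X]
    refine S.sum_mem fun a _ => S.sum_mem fun b _ => ?_
    have : Matrix.single a b (X a b) = X a b • Matrix.single a b (1 : ℂ) := by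
      rw [Matrix.smul_single, smul_eq_mul, mul_one]
    rw [this]
    exact S.smul_mem _ (hS a b)
  let op : ℤ → Matrix (Fin N) (Fin N) ℂ →ₗ[ℂ] Module.End ℂ P := fun m =>
    ∑ a, ∑ b, (LinearMap.toSpanSingleton ℂ (Module.End ℂ P) (E a b m)).comp
      (Matrix.entryLinearMap ℂ ℂ a b)
  have hop : ∀ a b m p, op m (Matrix.single a b 1) p = E a b m p := fun a b m p => by
    have : op m (Matrix.single a b 1) = E a b m := by
      simp only [op, LinearMap.sum_apply, LinearMap.comp_apply, Matrix.entryLinearMap_apply,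
        LinearMap.toSpanSingleton_apply]
      rw [Finset.sum_eq_single a, Finset.sum_eq_single b]
      · simp
      · intro b' _ hb; rw [Matrix.single_apply_of_ne _ _ _ _ _ (fun h => hb h.2.symm), zero_smul]
      · simp
      · intro a' _ ha
        refine Finset.sum_eq_zero fun b' _ => ?_
        rw [Matrix.single_apply_of_ne _ _ _ _ _ (fun h => ha h.1.symm), zero_smul]
      · simp
    rw [this]
  obtain ⟨φ, h1, h2, h3⟩ := AffineVac.exists_lift (B := traceForm N) (k := 1) op (by
    intro X Y m s p
    refine span
      { carrier := {X | ∀ p, op m X (op s Y p) = op s Y (op m X p) + op (m + s) ⁅X, Y⁆ p +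
          (if m = -s then (m : ℂ) * (traceForm N).form X Y * 1 else 0) • p}
        add_mem' := ?_
        zero_mem' := ?_
        smul_mem' := ?_ } (fun a b => ?_) X p
    · intro X X' h h' p
      have h := h p
      have h' := h' p
      simp only [map_add, LinearMap.add_apply, add_lie] at h h' ⊢
      rw [h, h']
      split_ifs <;> module
    · intro p
      simp
    · intro r X h p
      have h := h p
      simp only [map_smul, LinearMap.smul_apply, smul_lie, smul_eq_mul] at h ⊢
      rw [h]
      split_ifs <;> module
    · refine span
        { carrier := {Y | ∀ p, op m (Matrix.single a b (1 : ℂ)) (op s Y p) =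
            op s Y (op m (Matrix.single a b 1) p) +
            op (m + s) ⁅Matrix.single a b (1 : ℂ), Y⁆ p +
            (if m = -s then (m : ℂ) * (traceForm N).form (Matrix.single a b 1) Y * 1 else 0) • p}
          add_mem' := ?_
          zero_mem' := ?_
          smul_mem' := ?_ } (fun e d => ?_) Y
      · intro X X' h h' p
        have h := h p
        have h' := h' p
        simp only [map_add, LinearMap.add_apply, lie_add] at h h' ⊢
        rw [h, h']
        split_ifs <;> module
      · intro p
        simp
      · intro r X h p
        have h := h p
        simp only [map_smul, LinearMap.smul_apply, lie_smul, smul_eq_mul] at h ⊢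
        rw [h]
        split_ifs <;> module
      · intro p
        rw [single_lie_single, traceForm_single, hop, hop, hop, hop, rel, map_sub,
          LinearMap.sub_apply]
        congr 2
        · congr 2
          · split_ifs
            · rw [hop]
            · simp
          · split_ifs
            · rw [hop]
            · simp
        · split_ifs <;> simp_all) f (by
    intro X m hm q
    refine span (LinearMap.ker ((op m).flip (f q))) (fun a b => ?_) X
    rw [LinearMap.mem_ker, LinearMap.flip_apply, hop, hf a b m hm])
  refine ⟨φ, h1, fun a b m w => (h2 _ _ _).trans (hop a b m _), fun T T' hT hT' => h3 T T' hT ?_⟩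
  intro X m p
  refine span (LinearMap.eqLocus (T' ∘ₗ (op m).flip p) ((op m).flip (T' p))) (fun a b => ?_) X
  rw [LinearMap.mem_eqLocus, LinearMap.comp_apply, LinearMap.flip_apply, LinearMap.flip_apply, hop,
    hop, hT']

end

/-- **The universal property of `V`.** -/
theorem VSpace.exists_lift {N : ℕ} {𝔤 : Type} [LieRing 𝔤] [LieAlgebra ℂ 𝔤] {B : InvForm 𝔤}
    {c k : ℂ} {mode : Gen N 𝔤 → ℤ → Module.End ℂ P} (rel : GenRelations B c k mode)
    (lin : ∀ n, ∃ G : 𝔤 →ₗ[ℂ] Module.End ℂ P, ∀ x, G x = mode (.g x) n) (p : P)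
    (hp : ∀ a n, 0 ≤ n → (n = 0 → ∀ q, a ≠ .v q) → mode a n p = 0) :
    ∃ φ : VSpace N B c k →ₗ[ℂ] P, φ VSpace.vac = p ∧
      ∀ a n, (n = 0 → ∀ q, a ≠ .v q) → ∀ w, φ (VSpace.mode a n w) = mode a n (φ w) := by
  obtain ⟨φ₁, h1, h1', h1T⟩ := VirVac.exists_lift (k := k) (fun m => mode .vir (m + 1)) (by
    intro m s p
    rw [rel.mode_vir_comm_vir, show m + 1 + (s + 1) - 1 = m + s + 1 by ring]
    push_cast
    congr 2
    · congr 1; ring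
    · by_cases h : m = -s
      · rw [if_pos h, if_pos (by omega)]; ring
      · rw [if_neg h, if_neg (by omega)]) p (fun m hm => hp _ _ (by omega) (by simp))
  choose G hG using lin
  obtain ⟨φ₂, h2, h2', h2T⟩ := AffineVac.exists_lift (B := B) (k := c) G (by
    intro a b m s p
    rw [hG, hG, hG, rel.mode_g_comm_g]) φ₁ (by
    intro x m hm w
    rw [hG]
    refine h1T _ (hp _ _ hm (by simp)) (fun n p => ?_) w
    exact rel.mode_comm_of_ne (by simp [VSpace.factor]) _ _ _)
  -- operators which commute with the modes of `𝔤` and `Vir` and annihilate `p`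
  have zero₂ : ∀ a n, 0 ≤ n → (n = 0 → ∀ q, a ≠ .v q) → VSpace.factor a ≤ 1 →
      ∀ w, mode a n (φ₂ w) = 0 := fun a n hn ha hf w => by
    rw [← h2T 0 (mode a n) (fun q => ?_) (fun x m p => ?_), LinearMap.lTensor_zero,
      LinearMap.zero_apply, map_zero]
    · rw [LinearMap.zero_apply, map_zero, h1T _ (hp a n hn ha) fun m p => ?_]
      exact rel.mode_comm_of_ne (fun h => absurd (h ▸ hf) (by simp [VSpace.factor])) _ _ _
    · rw [hG]
      exact rel.mode_comm_of_ne (fun h => absurd (h ▸ hf) (by simp [VSpace.factor])) _ _ _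
  have vir₂ : ∀ n w, φ₂ (LinearMap.lTensor _ (Induced.act (Vir.L (n - 1))) w) =
      mode .vir n (φ₂ w) := fun n w => by
    refine h2T _ (mode .vir n) (fun q => ?_) (fun x m p => ?_) w
    · rw [h1', sub_add_cancel]
    · rw [hG]
      exact rel.mode_comm_of_ne (by simp [VSpace.factor]) _ _ _
  obtain ⟨φ₃, h3, h3', h3T⟩ := GlVac.exists_lift (E := fun a b => mode (.E a b))
    rel.mode_E_comm_E φ₂ (fun a b m hm w => zero₂ _ _ hm (by simp) (by simp [VSpace.factor]) w)
  have zero₃ : ∀ a n, 0 ≤ n → (n = 0 → ∀ q, a ≠ .v q) → VSpace.factor a = 0 →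
      ∀ w, mode a n (φ₃ w) = 0 := fun a n hn ha hf w => by
    rw [← h3T 0 (mode a n) (fun q => ?_) (fun e b m p => ?_), LinearMap.lTensor_zero,
      LinearMap.zero_apply, map_zero]
    · rw [LinearMap.zero_apply, map_zero, zero₂ a n hn ha (by omega)]
    · exact rel.mode_comm_of_ne (fun h => absurd (h ▸ hf) (by simp [VSpace.factor])) _ _ _
  obtain ⟨φ₄, h4, hu, hv, h4T⟩ := Fock.exists_lift (u := fun p => mode (.u p))
    (v := fun p => mode (.v p)) rel.mode_u_comm_u rel.mode_v_comm_v rel.mode_u_comm_v φ₃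
    (fun p n hn w => zero₃ _ _ hn (by simp) rfl w)
    (fun p n hn w => zero₃ _ _ hn.le (fun h => absurd h hn.ne') rfl w)
  have last : ∀ a n (T : Module.End ℂ _), VSpace.factor a ≠ 0 →
      (∀ w, φ₃ (T w) = mode a n (φ₃ w)) → ∀ w, φ₄ (LinearMap.lTensor _ T w) = mode a n (φ₄ w) :=
    fun a n T ha hT w => h4T T (mode a n) hT (fun p m x => rel.mode_comm_of_ne ha _ _ _)
      (fun p m x => rel.mode_comm_of_ne ha _ _ _) w
  refine ⟨φ₄, ?_, fun a n ha w => ?_⟩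
  · rw [VSpace.vac, h4, h3, h2, h1]
  · cases a with
    | u q => exact hu q n w
    | v q => exact hv q n w fun h => ha h q rfl
    | E e b => exact last (.E e b) n _ (by simp [VSpace.factor]) (fun w => h3' e b n w) w
    | g x =>
      refine last (.g x) n _ (by simp [VSpace.factor]) (fun w => ?_) w
      refine h3T _ (mode (.g x) n) (fun q => ?_) (fun e b m p => ?_) w
      · rw [h2', hG]
      · exact rel.mode_comm_of_ne (by simp [VSpace.factor]) _ _ _
    | vir =>
      refine last .vir n _ (by simp [VSpace.factor]) (fun w => ?_) w
      refine h3T _ (mode .vir n) (fun q => vir₂ n q) (fun e b m p => ?_) w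
      exact rel.mode_comm_of_ne (by simp [VSpace.factor]) _ _ _

end

/-! ### The universal property of `V ⊗ R` -/

section
variable {𝔤 : Type} [LieRing 𝔤] [LieAlgebra ℂ 𝔤] {N : ℕ} {B : InvForm 𝔤} {c k : ℂ}
  {R : Type} [CommRing R] [Algebra ℂ R] {M : Type} [AddCommGroup M] [Module ℂ M]
  {V : Type} [AddCommGroup V] [Module ℂ V]

/-- `V` is freely generated by its vacuum vector, subject to the commutation relations and to the
annihilation of the vacuum vector. Nothing is required of the operators `v_p(0)`. -/
structure FreeFields.IsUniversal (𝓥 : FreeFields N B c k V) : Prop where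
  g_linear : ∃ G : 𝔤 →ₗ[ℂ] V, ∀ x, 𝓥.state (.g x) = G x
  exists_lift : ∀ (P : Type) [AddCommGroup P] [Module ℂ P] (mode : Gen N 𝔤 → ℤ → Module.End ℂ P),
    GenRelations B c k mode →
    (∀ n, ∃ G : 𝔤 →ₗ[ℂ] Module.End ℂ P, ∀ x, G x = mode (.g x) n) → ∀ p : P,
    (∀ a n, 0 ≤ n → (n = 0 → ∀ q, a ≠ .v q) → mode a n p = 0) →
    ∃ φ : V →ₗ[ℂ] P, φ 𝓥.vac = p ∧
      ∀ a n, (n = 0 → ∀ q, a ≠ .v q) → ∀ w, φ (𝓥.mode a n w) = mode a n (φ w)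

theorem VSpace.isUniversal (N : ℕ) (B : InvForm 𝔤) (c k : ℂ) :
    (VSpace.freeFields N B c k).IsUniversal where
  g_linear := by
    let G : 𝔤 →ₗ[ℂ] AffineVac B c :=
      { toFun := fun x => Induced.actHom (Affine.mode B x (-1)) Induced.vac
        map_add' := fun x y => by rw [Affine.mode_add, map_add, LinearMap.add_apply]
        map_smul' := fun r x => by
          rw [Affine.mode_smul, map_smul, LinearMap.smul_apply, RingHom.id_apply] }
    exact ⟨(TensorProduct.mk ℂ (Fock N) _ 1).comp ((TensorProduct.mk ℂ (GlVac N) _ Induced.vac).comp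
      (((TensorProduct.mk ℂ (AffineVac B c) (VirVac k)).flip Induced.vac).comp G)), fun x => rfl⟩
  exists_lift _ _ _ _ rel lin p hp := VSpace.exists_lift rel lin p hp

theorem GenRelations.v_zero_comm {mode : Gen N 𝔤 → ℤ → Module.End ℂ M}
    (rel : GenRelations B c k mode) (p : Fin N) (a : Gen N 𝔤) (n : ℤ) (w : M) :
    mode (.v p) 0 (mode a n w) = mode a n (mode (.v p) 0 w) := by
  cases a with
  | u q =>
    rw [rel.mode_u_comm_v]
    have : (if q = p ∧ n = -0 then (n : ℂ) else 0) = 0 := by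
      split_ifs with h
      · rw [h.2]; simp
      · rfl
    rw [this, zero_smul, add_zero]
  | v q => exact rel.mode_v_comm_v _ _ _ _ _
  | _ => exact rel.mode_comm_of_ne (by simp [VSpace.factor]) _ _ _

/-- Composition of linear maps with an operator on the target. -/
def postcomp : Module.End ℂ M →ₗ[ℂ] Module.End ℂ (R →ₗ[ℂ] M) where
  toFun T :=
    { toFun := fun φ => T ∘ₗ φ
      map_add' := fun _ _ => LinearMap.comp_add _ _ _
      map_smul' := fun _ _ => LinearMap.comp_smul _ _ _ }
  map_add' _ _ := rfl
  map_smul' _ _ := rfl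

theorem GenRelations.postcomp {mode : Gen N 𝔤 → ℤ → Module.End ℂ M}
    (rel : GenRelations B c k mode) :
    GenRelations B c k (fun a n => VOASheaf.postcomp (R := R) (mode a n)) where
  mode_comm_of_ne h m n w := LinearMap.ext fun r => rel.mode_comm_of_ne h m n (w r)
  mode_u_comm_u p q m n w := LinearMap.ext fun r => rel.mode_u_comm_u p q m n (w r)
  mode_v_comm_v p q m n w := LinearMap.ext fun r => rel.mode_v_comm_v p q m n (w r)
  mode_u_comm_v p q m n w := LinearMap.ext fun r => rel.mode_u_comm_v p q m n (w r)
  mode_E_comm_E a b e d m n w := LinearMap.ext fun r => by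
    refine (rel.mode_E_comm_E a b e d m n (w r)).trans ?_
    simp only [LinearMap.add_apply, LinearMap.sub_apply]
    congr 3 <;> split_ifs <;> rfl
  mode_g_comm_g x y m n w := LinearMap.ext fun r => rel.mode_g_comm_g x y m n (w r)
  mode_vir_comm_vir m n w := LinearMap.ext fun r => rel.mode_vir_comm_vir m n (w r)

namespace Realization
variable {d : Fin N → Derivation ℂ R R} {A : VertexAlgebra M} {F : R →ₗ[ℂ] M} {s : Gen N 𝔤 → M}

/-- A realization can be pulled back along a homomorphism which intertwines the derivations. -/
theorem comp (h : Realization B c k d A F s) {S : Type} [CommRing S] [Algebra ℂ S]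
    {e : Fin N → Derivation ℂ S S} (ρ : S →ₐ[ℂ] R) (hρ : ∀ p f, ρ (e p f) = d p (ρ f)) :
    Realization B c k e A (F ∘ₗ ρ.toLinearMap) s where
  rel := h.rel
  g_linear := h.g_linear
  one := by simp [h.one]
  mul f g := by simp [h.mul]
  commuting f g := h.commuting _ _
  commuting_gen a ha f := h.commuting_gen a ha _
  v_zero p f := by simp [h.v_zero, hρ]
  v_pos p f n hn := h.v_pos p _ n hn
  D_function f := by simp [h.D_function, hρ]

/-- The universal property of `V ⊗ R`, for linear maps. -/
theorem exists_linearMap (h : Realization B c k d A F s) {𝓥 : FreeFields N B c k V}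
    (hU : 𝓥.IsUniversal) : ∃ φ : V ⊗[ℂ] R →ₗ[ℂ] M, (∀ f, φ (𝓥.vac ⊗ₜ f) = F f) ∧
      ∀ a n w, φ (LocalModel.mode 𝓥 d a n w) = A.Y (s a) n (φ w) := by
  obtain ⟨G, hG⟩ := h.g_linear
  obtain ⟨φ, h1, h2⟩ := hU.exists_lift (R →ₗ[ℂ] M)
    (fun a n => postcomp (A.Y (s a) n)) h.rel.postcomp
    (fun n => ⟨postcomp.comp ((LinearMap.proj n).comp (A.Y.comp G)), fun x => by
      rw [hG]; rfl⟩) F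
    (fun a n hn ha => LinearMap.ext fun f => by
      change A.Y (s a) n (F f) = 0
      by_cases hv : ∃ p, a = .v p
      · obtain ⟨p, rfl⟩ := hv
        exact h.v_pos p f n (lt_of_le_of_ne hn fun h0 => ha h0.symm p rfl)
      · exact h.commuting_gen a (not_exists.1 hv) f n hn)
  have h2' : ∀ a n, (n = 0 → ∀ q, a ≠ .v q) → ∀ w f,
      φ (𝓥.mode a n w) f = A.Y (s a) n (φ w f) := fun a n ha w f =>
    LinearMap.congr_fun (h2 a n ha w) f
  -- the operator `v_p(0)` acts by `d_p` on the factor `R`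
  have h3 : ∀ p v f, φ v (d p f) = A.Y (s (.v p)) 0 (φ v f) := by
    intro p v
    let P : Submodule ℂ V :=
      { carrier := {v | ∀ f, φ v (d p f) = A.Y (s (.v p)) 0 (φ v f)}
        zero_mem' := fun f => by simp
        add_mem' := fun {x y} hx hy f => by
          rw [map_add, LinearMap.add_apply, LinearMap.add_apply, map_add, hx, hy]
        smul_mem' := fun r x hx f => by
          rw [map_smul, LinearMap.smul_apply, LinearMap.smul_apply, map_smul, hx] }
    have hP : P = ⊤ := by
      refine 𝓥.eq_top P (fun f => ?_) fun a n w hw => ?_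
      · rw [h1, h.v_zero]
      · by_cases ha : n = 0 → ∀ q, a ≠ .v q
        · intro f
          have hw : φ w (d p f) = _ := hw f
          rw [h2' a n ha, h2' a n ha, hw]
          exact (h.rel.v_zero_comm p a n _).symm
        · push Not at ha
          obtain ⟨rfl, q, rfl⟩ := ha
          rw [𝓥.v_zero]
          exact P.zero_mem
    exact (hP ▸ Submodule.mem_top : v ∈ P)
  refine ⟨TensorProduct.lift φ, fun f => by rw [TensorProduct.lift.tmul, h1], fun a n w => ?_⟩
  induction w using TensorProduct.induction_on with
  | zero => simp
  | add x y hx hy => rw [map_add, map_add, map_add, map_add, hx, hy]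
  | tmul v f =>
    rw [TensorProduct.lift.tmul]
    by_cases ha : n = 0 → ∀ q, a ≠ .v q
    · rw [← h2' a n ha, ← TensorProduct.lift.tmul (f' := φ)]
      congr 1
      cases a with
      | v p =>
        rw [LocalModel.mode_v_of_ne 𝓥 d p fun h0 => ha h0 p rfl]
        rfl
      | _ => rfl
    · push Not at ha
      obtain ⟨rfl, q, rfl⟩ := ha
      rw [LocalModel.mode_v_zero, ← h3]
      rfl

section
variable {M₀ : Type} [AddCommGroup M₀] [Module ℂ M₀] {A₀ : VertexAlgebra M₀} {F₀ : R →ₗ[ℂ] M₀}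
  {s₀ : Gen N 𝔤 → M₀}

/-- A linear map which intertwines the generating fields and the functions of two realizations is
a homomorphism: the fields of the functions are determined by the infinitesimal translation and the
commutators with the generating fields. -/
theorem isHom (h₀ : Realization B c k d A₀ F₀ s₀) (h : Realization B c k d A F s)
    (top : ∀ P : Submodule ℂ M₀, (∀ f, F₀ f ∈ P) → (∀ a n, ∀ w ∈ P, A₀.Y (s₀ a) n w ∈ P) → P = ⊤)
    {φ : M₀ →ₗ[ℂ] M} (hF : ∀ f, φ (F₀ f) = F f)
    (hs : ∀ a n w, φ (A₀.Y (s₀ a) n w) = A.Y (s a) n (φ w)) : A₀.IsHom A φ := by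
  have tr : ∀ {M : Type} [AddCommGroup M] [Module ℂ M] (A : VertexAlgebra M) (a w : M) (n : ℤ),
      A.D (A.Y a n w) = A.Y a n (A.D w) - (n : ℂ) • A.Y a (n - 1) w := fun A a w n => by
    have := LinearMap.congr_fun (A.translation a n) w
    rw [LinearMap.sub_apply, LinearMap.comp_apply, LinearMap.comp_apply, LinearMap.smul_apply,
      sub_eq_iff_eq_add] at this
    rw [this, neg_smul]
    abel
  have hD : ∀ w, φ (A₀.D w) = A.D (φ w) := by
    have : LinearMap.eqLocus (φ ∘ₗ A₀.D) (A.D ∘ₗ φ) = ⊤ := by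
      refine top _ (fun f => ?_) fun a n w hw => ?_
      · rw [LinearMap.mem_eqLocus, LinearMap.comp_apply, LinearMap.comp_apply, h₀.D_function, hF,
          h.D_function, map_sum]
        exact Finset.sum_congr rfl fun p _ => by rw [hs, hF]
      · rw [LinearMap.mem_eqLocus, LinearMap.comp_apply, LinearMap.comp_apply] at hw ⊢
        rw [tr, map_sub, map_smul, hs, hs, hs, tr, hw]
    exact fun w => (this ▸ Submodule.mem_top : w ∈ LinearMap.eqLocus (φ ∘ₗ A₀.D) (A.D ∘ₗ φ))
  have hff : ∀ (j : ℕ) (f g : R), φ (A₀.Y (F₀ f) (-j - 1) (F₀ g)) =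
      A.Y (F f) (-j - 1) (F g) := by
    intro j
    induction j with
    | zero =>
      intro f g
      simp only [Nat.cast_zero, neg_zero, zero_sub]
      rw [h₀.mul, h.mul, hF]
    | succ j ih =>
      intro f g
      have rec₀ := tr A₀ (F₀ f) (F₀ g) (-j - 1)
      have rec₁ := tr A (F f) (F g) (-j - 1)
      have hr : φ (A₀.Y (F₀ f) (-j - 1) (A₀.D (F₀ g))) =
          A.Y (F f) (-j - 1) (A.D (F g)) := by
        rw [h₀.D_function, h.D_function, map_sum, map_sum, map_sum]
        refine Finset.sum_congr rfl fun p _ => ?_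
        rw [← (h₀.commuting_gen _ (by simp) f).comm, hs, ih,
          (h.commuting_gen _ (by simp) f).comm]
      rw [eq_sub_iff_add_eq, ← eq_sub_iff_add_eq'] at rec₀ rec₁
      have e := congrArg φ rec₀
      rw [map_smul, map_sub, hr, hD, ih, ← rec₁] at e
      have hne : ((-j - 1 : ℤ) : ℂ) ≠ 0 := by
        rw [Int.cast_ne_zero]; omega
      rw [show (-((j + 1 : ℕ) : ℤ) - 1) = -j - 1 - 1 by push_cast; ring]
      exact smul_right_injective M hne e
  have hf : ∀ w f n, φ (A₀.Y (F₀ f) n w) = A.Y (F f) n (φ w) := by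
    intro w
    let P : Submodule ℂ M₀ :=
      { carrier := {w | ∀ f n, φ (A₀.Y (F₀ f) n w) = A.Y (F f) n (φ w)}
        zero_mem' := fun f n => by simp
        add_mem' := fun {x y} hx hy f n => by
          rw [map_add, map_add, map_add, map_add, hx, hy]
        smul_mem' := fun r x hx f n => by
          rw [map_smul, map_smul, map_smul, map_smul, hx] }
    have hP : P = ⊤ := by
      refine top P (fun g f n => ?_) fun a m w hw f n => ?_
      · rcases le_or_gt 0 n with hn | hn
        · rw [h₀.commuting f g n hn, hF, h.commuting f g n hn, map_zero]
        · obtain ⟨j, rfl⟩ : ∃ j : ℕ, n = -j - 1 := ⟨(-n - 1).toNat, by omega⟩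
          rw [hff, hF]
      · have hw : ∀ f n, φ (A₀.Y (F₀ f) n w) = A.Y (F f) n (φ w) := hw
        by_cases hv : ∃ p, a = .v p
        · obtain ⟨p, rfl⟩ := hv
          have e₀ := h₀.v_comm p m f n w
          have e := h.v_comm p m f n (φ w)
          rw [← sub_eq_iff_eq_add] at e₀ e
          rw [← e₀, map_sub, hs, hs, hw, hw, e]
        · rw [← (h₀.commuting_gen a (not_exists.1 hv) f).comm, hs, hs, hw,
            (h.commuting_gen a (not_exists.1 hv) f).comm]
    exact (hP ▸ Submodule.mem_top : w ∈ P)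
  have hvac : φ A₀.vac = A.vac := by rw [← h₀.one, hF, h.one]
  have gen : A₀.Generates (Set.range F₀ ∪ Set.range s₀) := fun P hv hP =>
    top P (fun f => by
      rw [← A₀.replication (F₀ f)]
      exact hP _ (Or.inl ⟨f, rfl⟩) _ _ hv) (fun a n w hw => hP _ (Or.inr ⟨a, rfl⟩) n w hw)
  refine gen.isHom hvac ?_
  rintro _ (⟨f, rfl⟩ | ⟨a, rfl⟩) n b
  · rw [hf, hF]
  · have : φ (s₀ a) = s a := by
      rw [← A₀.replication (s₀ a), hs, hvac, A.replication]
    rw [hs, this]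

end
end Realization

namespace LocalModel
variable {𝓥 : FreeFields N B c k V} {d : Fin N → Derivation ℂ R R}
  {A : VertexAlgebra (V ⊗[ℂ] R)}

/-- The vertex algebra `V ⊗ R` is a realization of its generators. -/
theorem realization (hU : 𝓥.IsUniversal) (hd : ∀ p q f, d p (d q f) = d q (d p f))
    (hvac : A.vac = 𝓥.vac ⊗ₜ 1) (hD : A.D = translation 𝓥 d)
    (hgen : ∀ a, A.Y (𝓥.state a ⊗ₜ 1) = mode 𝓥 d a)
    (hfun : ∀ f, A.Y (𝓥.vac ⊗ₜ f) = functionMode 𝓥 d f) :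
    Realization B c k d A (TensorProduct.mk ℂ V R 𝓥.vac) fun a => 𝓥.state a ⊗ₜ 1 where
  rel := by
    simp only [hgen]
    exact genRelations hd
  g_linear := by
    obtain ⟨G, hG⟩ := hU.g_linear
    exact ⟨((TensorProduct.mk ℂ V R).flip 1).comp G, fun x => by rw [hG]; rfl⟩
  one := hvac.symm
  mul f g := by
    rw [TensorProduct.mk_apply, hfun]
    exact functionMode_neg_one_vac f g
  commuting f g n hn := by
    rw [TensorProduct.mk_apply, hfun]
    exact functionMode_vac hn f g
  commuting_gen a ha f n hn := by
    rw [hgen, TensorProduct.mk_apply, mode_vac a hn]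
    cases a with
    | v p => exact absurd rfl (ha p)
    | _ => exact ite_self _
  v_zero p f := by
    rw [hgen, TensorProduct.mk_apply, mode_vac _ le_rfl, if_pos rfl]
    rfl
  v_pos p f n hn := by
    rw [hgen, TensorProduct.mk_apply, mode_vac _ hn.le, if_neg hn.ne']
  D_function f := by
    rw [hD, TensorProduct.mk_apply, translation_tmul, 𝓥.translation_vac, TensorProduct.zero_tmul,
      zero_add]
    exact Finset.sum_congr rfl fun p _ => by rw [hgen]; rfl

theorem generates (hgen : ∀ a, A.Y (𝓥.state a ⊗ₜ 1) = mode 𝓥 d a) :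
    A.Generates (Set.range (fun f : R => 𝓥.vac ⊗ₜ[ℂ] f) ∪
      Set.range fun a => 𝓥.state a ⊗ₜ[ℂ] (1 : R)) := fun P hv hP =>
  eq_top (𝓥 := 𝓥) (d := d) P (fun f => by
    rw [← A.replication (𝓥.vac ⊗ₜ f)]
    exact hP _ (Or.inl ⟨f, rfl⟩) _ _ hv) (fun a n w hw => by
    rw [← hgen]
    exact hP _ (Or.inr ⟨a, rfl⟩) n w hw)

end LocalModel

/-- **The universal property of `V ⊗ R`**: a realization in a vertex algebra extends to a
homomorphism. -/
theorem Realization.exists_hom {d : Fin N → Derivation ℂ R R} {A : VertexAlgebra M}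
    {F : R →ₗ[ℂ] M} {s : Gen N 𝔤 → M} (h : Realization B c k d A F s)
    {𝓥 : FreeFields N B c k V} (hU : 𝓥.IsUniversal)
    {A₀ : VertexAlgebra (V ⊗[ℂ] R)}
    (h₀ : Realization B c k d A₀ (TensorProduct.mk ℂ V R 𝓥.vac) fun a => 𝓥.state a ⊗ₜ 1)
    (hgen : ∀ a, A₀.Y (𝓥.state a ⊗ₜ 1) = LocalModel.mode 𝓥 d a) :
    ∃ φ : V ⊗[ℂ] R →ₗ[ℂ] M, A₀.IsHom A φ ∧ (∀ f, φ (𝓥.vac ⊗ₜ f) = F f) ∧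
      ∀ a, φ (𝓥.state a ⊗ₜ 1) = s a := by
  obtain ⟨φ, h1, h2⟩ := h.exists_linearMap hU
  have hom : A₀.IsHom A φ := h₀.isHom h
    (fun P hf ha => LocalModel.eq_top (𝓥 := 𝓥) (d := d) P hf fun a n w hw => by
      rw [← hgen]
      exact ha a n w hw) h1 (fun a n w => by rw [hgen, h2])
  refine ⟨φ, hom, h1, fun a => ?_⟩
  rw [← LocalModel.mode_neg_one_vac (d := d), h2, h1, h.one, A.replication]

end

/-! ### Normally ordered products and the embedding of `V` -/

section
variable {M : Type} [AddCommGroup M] [Module ℂ M]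

theorem sgnChoose_neg (j i : ℕ) : sgnChoose (-j - 1) i = ((i + j).choose j : ℤ) := by
  rw [sgnChoose, show (-j - 1 : ℤ) = -(j + 1) by ring, Ring.choose_neg,
    show (j : ℤ) + 1 + i - 1 = ((i + j : ℕ) : ℤ) by push_cast; ring, Ring.choose_natCast,
    Nat.choose_symm_add]
  simp [Int.negOnePow_def, ← mul_assoc, ← mul_pow, Units.smul_def]

/-- The field of `a_(-j-1)b` is a normally ordered product. -/
theorem VertexAlgebra.Y_Y_eq_normalOrder (A : VertexAlgebra M) (a b x : M) (j : ℕ) (n : ℤ) :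
    A.Y (A.Y a (-j - 1) b) n x = normalOrder (dividedDeriv j (A.Y a)) (A.Y b) n x := by
  obtain ⟨Ka, ha⟩ := A.truncation a x
  obtain ⟨Kb, hb⟩ := A.truncation b x
  obtain ⟨L, hL1, hL2⟩ : ∃ L : ℕ, max Ka Kb ≤ L ∧ max Ka Kb ≤ n + L :=
    ⟨(max Ka Kb).toNat + (max Ka Kb - n).toNat, by omega, by omega⟩
  have hsg : ∀ i : ℕ, (-1 : ℂ) ^ j * ((Ring.choose (-i - 1 : ℤ) j : ℤ) : ℂ) =
      ((i + j).choose j : ℂ) := fun i => by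
    have := sgnChoose_neg i j
    rw [sgnChoose, add_comm, Nat.choose_symm_add] at this
    exact_mod_cast this
  rw [Y_Y_apply, residueProd_eq_sum (K := max Ka Kb) (fun i hi l => ⟨?_, ?_⟩) _ _ L hL1 hL2]
  rotate_left
  · rw [hb i (by omega), map_zero]
  · rw [ha i (by omega), map_zero]
  have h1 : ∀ k : ℕ, dividedDeriv j (A.Y a) (-k - 1) (A.Y b (n + k) x) =
      sgnChoose (-j - 1) k • A.Y a (-j - 1 - k) (A.Y b (n + k) x) := fun k => by
    rw [dividedDeriv, LinearMap.smul_apply, hsg, sgnChoose_neg,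
      show (-k - 1 - j : ℤ) = -j - 1 - k by ring, natCast_zsmul, Nat.cast_smul_eq_nsmul]
  have h2 : ∀ i : ℕ, A.Y b (n - (i + j : ℕ) - 1) (dividedDeriv j (A.Y a) (i + j : ℕ) x) =
      -(sgnChoose (-j - 1) i • ((Int.negOnePow (-j - 1) : ℤˣ) : ℤ) •
        A.Y b (-j - 1 + n - i) (A.Y a i x)) := fun i => by
    have : (-(((Int.negOnePow (-j - 1) : ℤˣ) : ℤ)) : ℤ) = (-1) ^ j := by
      rw [Int.negOnePow_sub, Int.negOnePow_one, Int.negOnePow_neg, Int.negOnePow_def]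
      simp
    rw [dividedDeriv, LinearMap.smul_apply, map_smul, sgnChoose_neg, ← smul_neg, ← neg_smul, this,
      Ring.choose_natCast, show (n - (i + j : ℕ) - 1 : ℤ) = -j - 1 + n - i by push_cast; ring,
      show (((i + j : ℕ) : ℤ) - j : ℤ) = i by push_cast; ring, mul_comm, mul_smul]
    rw [Int.cast_natCast, Nat.cast_smul_eq_nsmul, natCast_zsmul]
    congr 1
    rcases Nat.even_or_odd j with h | h <;> simp [h.neg_one_pow]
  have h3 : ∀ k : ℕ, k < j → A.Y b (n - k - 1) (dividedDeriv j (A.Y a) k x) = 0 := fun k hk => by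
    rw [dividedDeriv, Ring.choose_natCast, Nat.choose_eq_zero_of_lt hk]
    simp
  rw [normalOrder, finsum_eq_sum_of_support_subset (s := Finset.range (L + j)) _ ?_,
    Finset.sum_add_distrib]
  · have e1 : ∑ k ∈ Finset.range (L + j), dividedDeriv j (A.Y a) (-k - 1) (A.Y b (n + k) x) =
        ∑ k ∈ Finset.range L, sgnChoose (-j - 1) k • A.Y a (-j - 1 - k) (A.Y b (n + k) x) := by
      rw [Finset.sum_range_add, Finset.sum_congr rfl fun k _ => h1 k,
        Finset.sum_eq_zero (s := Finset.range j) fun k _ => ?_, add_zero]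
      rw [hb _ (by omega), map_zero]
    have e2 : ∑ k ∈ Finset.range (L + j), A.Y b (n - k - 1) (dividedDeriv j (A.Y a) k x) =
        ∑ i ∈ Finset.range L, -(sgnChoose (-j - 1) i • ((Int.negOnePow (-j - 1) : ℤˣ) : ℤ) •
          A.Y b (-j - 1 + n - i) (A.Y a i x)) := by
      rw [add_comm L j, Finset.sum_range_add, Finset.sum_eq_zero fun k hk =>
        h3 k (Finset.mem_range.1 hk), zero_add]
      refine Finset.sum_congr rfl fun i _ => ?_
      rw [← h2, add_comm j i]
    rw [e1, e2, ← Finset.sum_add_distrib]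
    exact Finset.sum_congr rfl fun i _ => by rw [smul_sub, sub_eq_add_neg]
  · intro k hk
    rw [Finset.coe_range, Set.mem_Iio]
    by_contra hkL
    refine hk ?_
    dsimp only
    rw [hb _ (by omega), map_zero, zero_add, dividedDeriv, LinearMap.smul_apply, ha _ (by omega),
      smul_zero, map_zero]

end

namespace LocalModel
variable {𝔤 : Type} [LieRing 𝔤] [LieAlgebra ℂ 𝔤] {N : ℕ} {B : InvForm 𝔤} {c k : ℂ}
  {V : Type} [AddCommGroup V] [Module ℂ V] {𝓥 : FreeFields N B c k V}
  {R : Type} [CommRing R] [Algebra ℂ R]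
  {d : Fin N → Derivation ℂ R R}

/-- The map `ν ↦ ν ⊗ 1` is a homomorphism: it intertwines the generating fields because `v_p(0)`
vanishes on `V` and `d_p 1 = 0`. -/
theorem isHom_tmul_one {AV : VertexAlgebra V} {A : VertexAlgebra (V ⊗[ℂ] R)}
    (hv : AV.vac = 𝓥.vac) (hg : ∀ a, AV.Y (𝓥.state a) = 𝓥.mode a)
    (hvac : A.vac = 𝓥.vac ⊗ₜ 1) (hgen : ∀ a, A.Y (𝓥.state a ⊗ₜ 1) = mode 𝓥 d a) :
    AV.IsHom A ((TensorProduct.mk ℂ V R).flip 1) := by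
  have gen : AV.Generates (Set.range 𝓥.state) := fun P hP h =>
    𝓥.eq_top P (hv ▸ hP) fun a n w hw => by
      rw [← hg]
      exact h _ ⟨a, rfl⟩ n w hw
  refine gen.isHom (by rw [hv, hvac]; rfl) ?_
  rintro _ ⟨a, rfl⟩ n b
  rw [LinearMap.flip_apply, LinearMap.flip_apply, LinearMap.flip_apply, TensorProduct.mk_apply,
    TensorProduct.mk_apply, TensorProduct.mk_apply, hg, hgen]
  cases a with
  | v p =>
    by_cases hn : n = 0
    · subst hn
      rw [mode_v_zero, 𝓥.v_zero, LinearMap.lTensor_tmul]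
      simp
    · rw [mode_v_of_ne 𝓥 d p hn]
      rfl
  | _ => rfl

end LocalModel

section
variable {X : Scheme.{0}} {π : X ⟶ Spec (.of ℂ)} {N : ℕ}
  {𝔤 : Type} [LieRing 𝔤] [LieAlgebra ℂ 𝔤] {B : InvForm 𝔤} {c k : ℂ}
  (κ : Chart π N) {W : X.Opens} (hW : W ≤ κ.U)

theorem Loc.mode_eq (a : Gen N 𝔤) :
    (Loc.mode κ hW a : ℤ → Module.End ℂ (Loc π N B c k W)) =
      LocalModel.mode (VSpace.freeFields N B c k) (κ.pd hW) a := by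
  cases a <;> rfl

theorem Loc.functionField_eq (f : Reg π W) (n : ℤ) (w : Loc π N B c k W) :
    Loc.functionField κ hW f n w =
      LocalModel.functionMode (VSpace.freeFields N B c k) (κ.pd hW) f (-n - 1) w := by
  rw [LocalModel.functionMode_apply, show -(-n - 1) - 1 = n by ring, Loc.functionField, expField]
  refine finsum_congr fun s => ?_
  have h1 : Loc.ubarPow κ hW s w n =
      (LocalModel.commutingCurrents (VSpace.freeFields N B c k) (Reg π W)).power s n w :=
    CommutingCurrents.foldr_actSeries _ s w n
  have h2 : κ.pdPow hW s f = iteratedPartial (κ.pd hW) s f := foldr_derivation _ s f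
  rw [h1, h2]
  rfl

end

/-! ### Partial derivatives with respect to local parameters -/

section
variable {X : Scheme.{0}} {π : X ⟶ Spec (.of ℂ)} {N : ℕ}

theorem Reg.res_self {W : X.Opens} (f : Reg π W) : Reg.res π (le_refl W) f = f := by
  have key : ∀ f : Γ(X, W), (X.presheaf.map (homOfLE (le_refl W)).op).hom f = f := fun f => by
    rw [Subsingleton.elim (homOfLE (le_refl W)) (𝟙 W), op_id, X.presheaf.map_id]
    rfl
  exact key f

namespace Chart

section
variable (κ : Chart π N) {W : X.Opens} (hW : W ≤ κ.U)

/-- The coefficients of `df` in the basis `dx_1, …, dx_N` are the partial derivatives. -/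
theorem pd_eq_of_differential (f : Reg π W) (g : Fin N → Reg π W)
    (h : ∀ (A : X.Opens) (_ : IsAffineOpen A) (hAW : A ≤ W),
      KaehlerDifferential.D ℂ (Reg π A) (Reg.res π hAW f) =
        ∑ p, Reg.res π hAW (g p) • KaehlerDifferential.D ℂ (Reg π A) (κ.param (hAW.trans hW) p))
    (p : Fin N) : κ.pd hW p f = g p := by
  refine Reg.ext_affine π fun A hA hAW => ?_
  obtain ⟨b, hb⟩ := κ.exists_basis hA (hAW.trans hW)
  have e := (κ.pd_spec hW f A hA hAW).symm.trans (h A hA hAW)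
  simp only [← hb] at e
  have := congrArg (fun z => b.repr z p) e
  simpa [Finsupp.single_apply] using this

theorem res_pd {W' : X.Opens} (h : W' ≤ W) (p : Fin N) (f : Reg π W) :
    Reg.res π h (κ.pd hW p f) = κ.pd (h.trans hW) p (Reg.res π h f) := by
  refine (κ.pd_eq_of_differential (h.trans hW) _ (fun q => Reg.res π h (κ.pd hW q f))
    (fun A hA hAW => ?_) p).symm
  rw [Reg.res_res, κ.pd_spec hW f A hA (hAW.trans h)]
  exact Finset.sum_congr rfl fun q _ => by rw [Reg.res_res]

theorem res_param {W' : X.Opens} (h : W' ≤ W) (p : Fin N) :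
    Reg.res π h (κ.param hW p) = κ.param (h.trans hW) p := Reg.res_res _ _ _ _

theorem pd_param (p q : Fin N) : κ.pd hW p (κ.param hW q) = if p = q then 1 else 0 := by
  refine κ.pd_eq_of_differential hW _ (fun p => if p = q then 1 else 0) (fun A hA hAW => ?_) p
  rw [κ.res_param]
  simp only [apply_ite (Reg.res π hAW), map_one, map_zero, ite_smul, one_smul, zero_smul]
  rw [Finset.sum_ite_eq' Finset.univ q, if_pos (Finset.mem_univ _)]

/-- On an affine open subset, a derivation is determined by its values on the parameters. -/
theorem derivation_eq_sum (hA : IsAffineOpen W) (δ : Derivation ℂ (Reg π W) (Reg π W))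
    (f : Reg π W) : δ f = ∑ p, δ (κ.param hW p) * κ.pd hW p f := by
  have := congrArg δ.liftKaehlerDifferential (κ.pd_spec hW f W hA le_rfl)
  rw [Derivation.liftKaehlerDifferential_comp_D, Reg.res_self, map_sum] at this
  rw [this]
  refine Finset.sum_congr rfl fun p _ => ?_
  rw [map_smul, Derivation.liftKaehlerDifferential_comp_D, Reg.res_self, smul_eq_mul, mul_comm]

theorem pd_comm (p q : Fin N) (f : Reg π W) :
    κ.pd hW p (κ.pd hW q f) = κ.pd hW q (κ.pd hW p f) := by
  refine Reg.ext_affine π fun A hA hAW => ?_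
  simp only [res_pd]
  have h : ∀ g, ⁅κ.pd (hAW.trans hW) p, κ.pd (hAW.trans hW) q⁆ g = 0 := fun g => by
    rw [κ.derivation_eq_sum (hAW.trans hW) hA]
    refine Finset.sum_eq_zero fun r _ => ?_
    rw [Derivation.commutator_apply, pd_param, pd_param]
    split_ifs <;> simp
  have := h (Reg.res π hAW f)
  rwa [Derivation.commutator_apply, sub_eq_zero] at this

end

variable (κ κ' : Chart π N) {W : X.Opens} (h : W ≤ κ.U) (h' : W ≤ κ'.U)

/-- The chain rule. -/
theorem pd_chain (p : Fin N) (f : Reg π W) :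
    κ.pd h p f = ∑ a, κ.pd h p (κ'.param h' a) * κ'.pd h' a f := by
  refine Reg.ext_affine π fun A hA hAW => ?_
  rw [res_pd, κ'.derivation_eq_sum (hAW.trans h') hA, map_sum]
  exact Finset.sum_congr rfl fun a _ => by rw [map_mul, res_pd, res_pd, res_param]

/-- The partial derivatives with respect to the parameters of two charts on a common open subset. -/
theorem coordinateChange :
    CoordinateChange (κ.pd h) (κ'.pd h') (κ.param h) (κ'.param h') where
  comm := κ.pd_comm h
  comm' := κ'.pd_comm h'
  chain := κ.pd_chain κ' h h'
  chain' := κ'.pd_chain κ h' h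
  param := κ'.pd_param h'

end Chart
end

/-! ### The gluing maps -/

section
variable {𝔤 : Type} [LieRing 𝔤] [LieAlgebra ℂ 𝔤] {N : ℕ} {B : InvForm 𝔤} {c k : ℂ}
  {V : Type} [AddCommGroup V] [Module ℂ V]

namespace LocalModel
variable {𝓥 : FreeFields N B c k V} {R : Type} [CommRing R] [Algebra ℂ R]
  {d : Fin N → Derivation ℂ R R}

/-- `A` is the vertex algebra structure on `V ⊗ R` with `v_p(0) = d_p`. -/
structure IsModel (𝓥 : FreeFields N B c k V) (d : Fin N → Derivation ℂ R R)
    (A : VertexAlgebra (V ⊗[ℂ] R)) : Prop where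
  vac : A.vac = 𝓥.vac ⊗ₜ 1
  gen : ∀ a, A.Y (𝓥.state a ⊗ₜ 1) = mode 𝓥 d a
  function : ∀ f, A.Y (𝓥.vac ⊗ₜ f) = functionMode 𝓥 d f

theorem IsModel.ext {A A' : VertexAlgebra (V ⊗[ℂ] R)} (h : IsModel 𝓥 d A)
    (h' : IsModel 𝓥 d A') : A' = A := by
  refine (generates h'.gen).ext (h'.vac.trans h.vac.symm) ?_
  rintro _ (⟨f, rfl⟩ | ⟨a, rfl⟩)
  · exact (h'.function f).trans (h.function f).symm
  · exact (h'.gen a).trans (h.gen a).symm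

theorem IsModel.D_eq {A : VertexAlgebra (V ⊗[ℂ] R)} (h : IsModel 𝓥 d A)
    (hd : ∀ p q f, d p (d q f) = d q (d p f)) : A.D = translation 𝓥 d := by
  obtain ⟨A', h1, h2, h3, h4⟩ := LocalModel.exists_vertexAlgebra 𝓥 hd
  rw [← h.ext ⟨h1, h3, h4⟩, h2]

theorem IsModel.D_tmul {A : VertexAlgebra (V ⊗[ℂ] R)} (h : IsModel 𝓥 d A)
    (hd : ∀ p q f, d p (d q f) = d q (d p f)) {D : Module.End ℂ V} (hD : D = 𝓥.translation) (v : V)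
    (f : R) : A.D (v ⊗ₜ f) = D v ⊗ₜ f + ∑ p, 𝓥.mode (.u p) (-1) v ⊗ₜ d p f := by
  rw [h.D_eq hd, hD, translation_tmul]

theorem IsModel.realization {A : VertexAlgebra (V ⊗[ℂ] R)} (h : IsModel 𝓥 d A)
    (hU : 𝓥.IsUniversal) (hd : ∀ p q f, d p (d q f) = d q (d p f)) :
    Realization B c k d A (TensorProduct.mk ℂ V R 𝓥.vac) fun a => 𝓥.state a ⊗ₜ 1 :=
  LocalModel.realization hU hd h.vac (h.D_eq hd) h.gen h.function

theorem IsModel.Y_state_tmul {A : VertexAlgebra (V ⊗[ℂ] R)} (h : IsModel 𝓥 d A) (a : Gen N 𝔤)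
    (f : R) : A.Y (𝓥.state a ⊗ₜ 1) (-1) (𝓥.vac ⊗ₜ f) = 𝓥.state a ⊗ₜ f := by
  rw [h.gen, mode_neg_one_vac]

/-- Homomorphisms from `V ⊗ R` are determined by the images of the functions and the generators. -/
theorem IsModel.hom_ext {A : VertexAlgebra (V ⊗[ℂ] R)} (h : IsModel 𝓥 d A) {M : Type}
    [AddCommGroup M] [Module ℂ M] {A' : VertexAlgebra M} {φ ψ : V ⊗[ℂ] R →ₗ[ℂ] M}
    (hφ : A.IsHom A' φ) (hψ : A.IsHom A' ψ) (hf : ∀ f, φ (𝓥.vac ⊗ₜ f) = ψ (𝓥.vac ⊗ₜ f))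
    (hs : ∀ a, φ (𝓥.state a ⊗ₜ 1) = ψ (𝓥.state a ⊗ₜ 1)) : φ = ψ := by
  refine (generates h.gen).hom_ext hφ hψ ?_
  rintro _ (⟨f, rfl⟩ | ⟨a, rfl⟩)
  · exact hf f
  · exact hs a

variable {S : Type} [CommRing S] [Algebra ℂ S] {e : Fin N → Derivation ℂ S S}

/-- Homomorphisms `ρ : R → S` which intertwine the derivations induce homomorphisms
`V ⊗ R → V ⊗ S`. -/
theorem IsModel.isHom_lTensor {A : VertexAlgebra (V ⊗[ℂ] R)} {A' : VertexAlgebra (V ⊗[ℂ] S)}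
    (h : IsModel 𝓥 d A) (h' : IsModel 𝓥 e A') (hU : 𝓥.IsUniversal)
    (hd : ∀ p q f, d p (d q f) = d q (d p f)) (he : ∀ p q f, e p (e q f) = e q (e p f))
    (ρ : R →ₐ[ℂ] S) (hρ : ∀ p f, ρ (d p f) = e p (ρ f)) :
    A.IsHom A' (LinearMap.lTensor V ρ.toLinearMap) := by
  refine (h.realization hU hd).isHom ((h'.realization hU he).comp ρ hρ)
    (fun P hf ha => eq_top (𝓥 := 𝓥) (d := d) P hf fun a n w hw => by
      rw [← h.gen]
      exact ha a n w hw) (fun f => rfl) (fun a n w => ?_)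
  rw [h.gen, h'.gen]
  have comm : ∀ T : Module.End ℂ V, LinearMap.lTensor V ρ.toLinearMap (LinearMap.rTensor R T w) =
      LinearMap.rTensor S T (LinearMap.lTensor V ρ.toLinearMap w) := fun T => by
    rw [← LinearMap.comp_apply, ← LinearMap.comp_apply, LinearMap.lTensor_comp_rTensor,
      LinearMap.rTensor_comp_lTensor]
  cases a with
  | v p =>
    by_cases hn : n = 0
    · subst hn
      rw [mode_v_zero, mode_v_zero, ← LinearMap.comp_apply, ← LinearMap.comp_apply,
        ← LinearMap.lTensor_comp, ← LinearMap.lTensor_comp]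
      congr 2
      exact LinearMap.ext fun f => hρ p f
    · rw [mode_v_of_ne 𝓥 d p hn, mode_v_of_ne 𝓥 e p hn, comm]
  | _ => exact comm _

/-- The state of `V ⊗ R` which corresponds to a generator in the parameters `y`. -/
def newState (𝓥 : FreeFields N B c k V) (d d' : Fin N → Derivation ℂ R R) (x y : Fin N → R) :
    Gen N 𝔤 → V ⊗[ℂ] R
  | .u a => ∑ p, 𝓥.state (.u p) ⊗ₜ d p (y a)
  | .v a => ∑ p, 𝓥.state (.v p) ⊗ₜ d' a (x p) +
      ∑ s, ∑ p, 𝓥.state (.E s p) ⊗ₜ d s (d' a (x p))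
  | .E a b => ∑ s, ∑ p, 𝓥.state (.E s p) ⊗ₜ (d s (y a) * d' b (x p)) +
      ∑ s, 𝓥.state (.u s) ⊗ₜ d' b (d s (y a))
  | .g z => 𝓥.state (.g z) ⊗ₜ 1
  | .vir => 𝓥.state .vir ⊗ₜ 1

variable {d' : Fin N → Derivation ℂ R R} {x y : Fin N → R}

theorem IsModel.newState_eq {A : VertexAlgebra (V ⊗[ℂ] R)} (h : IsModel 𝓥 d A) :
    Realization.newState d A (TensorProduct.mk ℂ V R 𝓥.vac) (fun a => 𝓥.state a ⊗ₜ 1) x d' y =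
      newState 𝓥 d d' x y := by
  funext a
  cases a <;> simp only [Realization.newState, newState, Realization.uForm, Realization.fieldState,
    Realization.tensorState, Realization.eMatrix, Realization.vField, TensorProduct.mk_apply,
    h.Y_state_tmul]

/-- The gluing map: a homomorphism from `V ⊗ R` in the parameters `y` to `V ⊗ R` in the parameters
`x`. -/
theorem IsModel.exists_gluing {A A' : VertexAlgebra (V ⊗[ℂ] R)} (h : IsModel 𝓥 d A)
    (h' : IsModel 𝓥 d' A') (hU : 𝓥.IsUniversal) (hc : CoordinateChange d d' x y) :
    ∃ φ : V ⊗[ℂ] R →ₗ[ℂ] V ⊗[ℂ] R, A'.IsHom A φ ∧ (∀ f, φ (𝓥.vac ⊗ₜ f) = 𝓥.vac ⊗ₜ f) ∧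
      ∀ a, φ (𝓥.state a ⊗ₜ 1) = newState 𝓥 d d' x y a := by
  have := (h.realization hU hc.comm).changeCoordinates hc
  rw [h.newState_eq] at this
  exact this.exists_hom hU (h'.realization hU hc.comm') h'.gen

end LocalModel
end

/-! ### Transitivity of the change of coordinates -/

section
variable {𝔤 : Type} [LieRing 𝔤] [LieAlgebra ℂ 𝔤] {N : ℕ} {B : InvForm 𝔤} {c k : ℂ}
  {R : Type} [CommRing R] [Algebra ℂ R] {M : Type} [AddCommGroup M] [Module ℂ M]

theorem VertexAlgebra.Y_neg_one_neg_one (A : VertexAlgebra M) {a b x : M}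
    (ha : ∀ i : ℤ, 1 ≤ i → A.Y a i x = 0) (hb : A.Commuting b x) :
    A.Y (A.Y a (-1) b) (-1) x = A.Y a (-1) (A.Y b (-1) x) + A.Y b (-2) (A.Y a 0 x) := by
  rw [Y_Y_apply, residueProd_eq_sum (K := 1) (fun j hj i => ⟨?_, ?_⟩) _ _ 2 (by norm_num)
    (by norm_num), Finset.sum_range_succ, Finset.sum_range_one, sgnChoose_neg_one,
    sgnChoose_neg_one]
  · simp [Int.negOnePow_neg, Int.negOnePow_one, hb 0 le_rfl, ha 1 le_rfl]
  · rw [hb j (by omega), map_zero]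
  · rw [ha j hj, map_zero]

namespace Realization

omit [LieRing 𝔤] [LieAlgebra ℂ 𝔤] in
theorem map_newState {M₀ : Type} [AddCommGroup M₀] [Module ℂ M₀] {A₀ : VertexAlgebra M₀}
    {F₀ : R →ₗ[ℂ] M₀} {s₀ : Gen N 𝔤 → M₀} {A : VertexAlgebra M} {φ : M₀ →ₗ[ℂ] M}
    (hφ : A₀.IsHom A φ) (d d' : Fin N → Derivation ℂ R R) (x y : Fin N → R) (a : Gen N 𝔤) :
    φ (newState d A₀ F₀ s₀ x d' y a) =
      newState d A (φ ∘ₗ F₀) (fun a => φ (s₀ a)) x d' y a := by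
  cases a <;> simp only [newState, uForm, fieldState, tensorState, eMatrix, vField, map_add, map_sum,
    hφ.map_Y, LinearMap.comp_apply]

variable {d : Fin N → Derivation ℂ R R} {A : VertexAlgebra M} {F : R →ₗ[ℂ] M} {s : Gen N 𝔤 → M}
  {x : Fin N → R}

theorem newState_self (h : Realization B c k d A F s)
    (hx : ∀ p q, d p (x q) = if p = q then 1 else 0) : newState d A F s x d x = s := by
  have hF : ∀ a b : Fin N, F (if a = b then 1 else 0) = if a = b then A.vac else 0 := fun a b => by
    split_ifs
    · exact h.one
    · exact map_zero F
  have hd : ∀ r a b : Fin N, d r (if a = b then 1 else 0) = 0 := fun r a b => by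
    split_ifs <;> simp
  have hY : ∀ (a : M) (P : Prop) [Decidable P], A.Y a (-1) (if P then A.vac else 0) =
      if P then a else 0 := fun a P _ => by
    split_ifs
    · exact A.replication a
    · exact map_zero _
  funext a
  cases a with
  | u a =>
    simp only [newState, uForm, hx, hF, hY]
    rw [Finset.sum_ite_eq', if_pos (Finset.mem_univ a)]
  | v a =>
    simp only [newState, fieldState, vField, eMatrix, hx, hd, hF, hY, map_zero,
      Finset.sum_const_zero, add_zero]
    rw [Finset.sum_ite_eq, if_pos (Finset.mem_univ a)]
  | E a b =>
    have : ∀ r p : Fin N, (if r = a then (1 : R) else 0) * (if b = p then 1 else 0) =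
        if r = a then (if b = p then 1 else 0) else 0 := fun r p => by split_ifs <;> simp
    simp only [newState, tensorState, uForm, eMatrix, hx, hd, map_zero,
      Finset.sum_const_zero, add_zero, this]
    rw [Finset.sum_eq_single a, Finset.sum_eq_single b]
    · rw [if_pos rfl, if_pos rfl, h.one, A.replication]
    · intro p _ hp
      rw [if_pos rfl, if_neg hp.symm, map_zero, map_zero]
    · simp
    · intro r _ hr
      simp only [if_neg hr, map_zero, Finset.sum_const_zero]
    · simp
  | _ => rfl

variable (h : Realization B c k d A F s)
include h

theorem uForm_neg_one_function (ω : Fin N → R) (f : R) :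
    A.Y (uForm A F s ω) (-1) (F f) = uForm A F s (fun r => f * ω r) := by
  rw [← A.replication (F f), (h.function_commuting_uForm f ω).symm.comm, A.replication,
    h.function_neg_one_uForm]

theorem eMatrix_neg_one_function (X : Fin N → Fin N → R) (f : R) :
    A.Y (eMatrix A F s X) (-1) (F f) = eMatrix A F s (fun a b => f * X a b) := by
  rw [← A.replication (F f), (h.function_commuting_eMatrix f X).symm.comm, A.replication,
    h.function_neg_one_eMatrix]

theorem vField_neg_one_function (τ : Fin N → R) (f : R) :
    A.Y (vField A F s τ) (-1) (F f) = vField A F s (fun p => f * τ p) +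
      uForm A F s (fun r => ∑ p, d p f * d r (τ p)) := by
  have : ∀ p, A.Y (A.Y (s (.v p)) (-1) (F (τ p))) (-1) (F f) =
      A.Y (s (.v p)) (-1) (F (f * τ p)) + uForm A F s (fun r => d p f * d r (τ p)) := fun p => by
    rw [A.Y_neg_one_neg_one (fun i hi => h.v_pos p f i (by omega)) (h.commuting _ _), h.mul,
      h.v_zero, h.function_neg_two, mul_comm]
  have hsum : A.Y (vField A F s τ) (-1) (F f) =
      ∑ p, A.Y (A.Y (s (.v p)) (-1) (F (τ p))) (-1) (F f) := by
    rw [vField, map_sum, Finset.sum_apply, LinearMap.sum_apply]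
  rw [hsum]
  simp only [this, Finset.sum_add_distrib, uForm_sum]
  rfl

theorem tensorState_neg_one_function (α : Fin N → R) (T : Derivation ℂ R R) (f : R) :
    A.Y (tensorState A F s x α T) (-1) (F f) =
      eMatrix A F s (fun a p => f * (α a * T (x p))) + uForm A F s (fun r => f * T (α r)) := by
  rw [tensorState, A.Y_add, h.eMatrix_neg_one_function, h.uForm_neg_one_function]

theorem fieldState_neg_one_function (T : Derivation ℂ R R) (f : R) :
    A.Y (fieldState d A F s x T) (-1) (F f) = vField A F s (fun p => f * T (x p)) +
      uForm A F s (fun r => ∑ p, d p f * d r (T (x p))) +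
      eMatrix A F s (fun a p => f * d a (T (x p))) := by
  rw [fieldState, A.Y_add, h.vField_neg_one_function, h.eMatrix_neg_one_function]

variable {d' : Fin N → Derivation ℂ R R} {y : Fin N → R} (hc : CoordinateChange d d' x y)
include hc

/-- The state of a vector field does not depend on the coordinates. -/
theorem fieldState_newState {T : Derivation ℂ R R} (hT : ∀ f, T f = ∑ q, T (y q) * d' q f) :
    fieldState d' A F (newState d A F s x d' y) y T = fieldState d A F s x T := by
  have e1 : vField A F (newState d A F s x d' y) (fun p => T (y p)) =
      ∑ b, (vField A F s (fun p => T (y b) * d' b (x p)) +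
      uForm A F s (fun r => ∑ p, d p (T (y b)) * d r (d' b (x p))) +
      eMatrix A F s (fun a p => T (y b) * d a (d' b (x p)))) :=
    Finset.sum_congr rfl fun b _ => h.fieldState_neg_one_function _ _
  have e2 : eMatrix A F (newState d A F s x d' y) (fun a p => d' a (T (y p))) =
      ∑ a, ∑ b, (eMatrix A F s (fun r p => d' a (T (y b)) * (d r (y a) * d' b (x p))) +
        uForm A F s (fun r => d' a (T (y b)) * d' b (d r (y a)))) :=
    Finset.sum_congr rfl fun a _ => Finset.sum_congr rfl fun b _ =>
      h.tensorState_neg_one_function _ _ _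
  -- the derivative of the relation between the Jacobian matrices
  have jac : ∀ a b r, d' b (d r (y a)) = -∑ p, d r (d' b (x p)) * d p (y a) := by
    intro a b r
    have e := congrArg (d r) (hc.chain' b (y a))
    have h0 : d r (d' b (y a)) = 0 := by
      rw [hc.param]; split_ifs <;> simp
    rw [h0, map_sum] at e
    simp only [Derivation.leibniz, smul_eq_mul, Finset.sum_add_distrib] at e
    rw [hc.chain' b, eq_neg_iff_add_eq_zero, e]
    congr 1
    · exact Finset.sum_congr rfl fun p _ => by rw [hc.comm]
    · exact Finset.sum_congr rfl fun p _ => mul_comm _ _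
  rw [fieldState, fieldState, e1, e2]
  simp only [Finset.sum_add_distrib, uForm_sum, vField_sum, eMatrix_sum]
  have hv : (fun p => ∑ b, T (y b) * d' b (x p)) = fun p => T (x p) := funext fun p => (hT _).symm
  have hE : ∀ a p, ∑ b, T (y b) * d a (d' b (x p)) +
      ∑ i, ∑ b, d' i (T (y b)) * (d a (y i) * d' b (x p)) = d a (T (x p)) := fun a p => by
    rw [hT (x p), map_sum, Finset.sum_comm, ← Finset.sum_add_distrib]
    refine Finset.sum_congr rfl fun b _ => ?_
    rw [Derivation.leibniz, smul_eq_mul, smul_eq_mul, hc.chain a (T (y b)), Finset.mul_sum]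
    congr 1
    exact Finset.sum_congr rfl fun i _ => by ring
  have hu : ∀ r, ∑ b, ∑ p, d p (T (y b)) * d r (d' b (x p)) +
      ∑ i, ∑ b, d' i (T (y b)) * d' b (d r (y i)) = 0 := fun r => by
    rw [Finset.sum_comm (γ := Fin N) (s := Finset.univ) (t := Finset.univ)
      (f := fun i b => d' i (T (y b)) * d' b (d r (y i))), ← Finset.sum_add_distrib]
    refine Finset.sum_eq_zero fun b _ => ?_
    simp only [jac, mul_neg, Finset.sum_neg_distrib, Finset.mul_sum]
    rw [Finset.sum_comm, ← sub_eq_add_neg, ← Finset.sum_sub_distrib]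
    refine Finset.sum_eq_zero fun p _ => ?_
    rw [hc.chain p, Finset.sum_mul, ← Finset.sum_sub_distrib]
    exact Finset.sum_eq_zero fun a _ => by ring
  rw [hv]
  have hE' : (fun a p => d a (T (x p))) = fun a p => ∑ b, T (y b) * d a (d' b (x p)) +
      ∑ i, ∑ b, d' i (T (y b)) * (d a (y i) * d' b (x p)) :=
    funext fun a => funext fun p => (hE a p).symm
  have hu' : uForm A F s (fun r => ∑ b, ∑ p, d p (T (y b)) * d r (d' b (x p))) +
      uForm A F s (fun r => ∑ i, ∑ b, d' i (T (y b)) * d' b (d r (y i))) = 0 := by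
    rw [uForm_add]
    simp only [hu, uForm, map_zero, Finset.sum_const_zero]
  rw [hE', ← eMatrix_add]
  rw [eq_neg_of_add_eq_zero_left hu']
  abel

theorem tensorState_newState {T : Derivation ℂ R R} (hT : ∀ f, T f = ∑ q, T (y q) * d' q f)
    (f : R) : tensorState A F (newState d A F s x d' y) y (fun p => d' p f) T =
      tensorState A F s x (fun p => d p f) T := by
  have e1 : eMatrix A F (newState d A F s x d' y) (fun a p => d' a f * T (y p)) =
      ∑ a, ∑ b, (eMatrix A F s (fun r p => (d' a f * T (y b)) * (d r (y a) * d' b (x p))) +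
        uForm A F s (fun r => (d' a f * T (y b)) * d' b (d r (y a)))) :=
    Finset.sum_congr rfl fun a _ => Finset.sum_congr rfl fun b _ =>
      h.tensorState_neg_one_function _ _ _
  have e2 : uForm A F (newState d A F s x d' y) (fun r => T (d' r f)) =
      ∑ a, uForm A F s (fun r => T (d' a f) * d r (y a)) :=
    Finset.sum_congr rfl fun a _ => h.uForm_neg_one_function _ _
  rw [tensorState, tensorState, e1, e2]
  simp only [Finset.sum_add_distrib, uForm_sum, eMatrix_sum]
  rw [add_assoc, uForm_add]
  congr 2
  · funext r p
    rw [hT (x p), hc.chain r f, Finset.sum_mul_sum]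
    exact Finset.sum_congr rfl fun a _ => Finset.sum_congr rfl fun b _ => by ring
  · funext r
    rw [hc.chain r f, map_sum, ← Finset.sum_add_distrib]
    refine Finset.sum_congr rfl fun a _ => ?_
    rw [Derivation.leibniz, smul_eq_mul, smul_eq_mul, hT (d r (y a)), add_comm, Finset.mul_sum,
      mul_comm (T (d' a f))]
    congr 1
    exact Finset.sum_congr rfl fun b _ => by ring

/-- **Transitivity of the change of coordinates.** -/
theorem newState_newState {d'' : Fin N → Derivation ℂ R R} {z : Fin N → R}
    (hc' : CoordinateChange d' d'' y z) :
    newState d' A F (newState d A F s x d' y) y d'' z = newState d A F s x d'' z := by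
  funext a
  cases a with
  | u a => rw [(h.changeCoordinates hc).newState_u, h.newState_u]
  | v a => exact h.fieldState_newState hc (hc'.chain' a)
  | E a b => exact h.tensorState_newState hc (hc'.chain' b) (z a)
  | _ => rfl

end Realization
end

/-! ### The local vertex algebras and their gluing maps -/

section
variable {𝔤 : Type} [LieRing 𝔤] [LieAlgebra ℂ 𝔤] {N : ℕ} {B : InvForm 𝔤} {c k : ℂ}
  {V : Type} [AddCommGroup V] [Module ℂ V]

namespace LocalModel
variable {𝓥 : FreeFields N B c k V} {R : Type} [CommRing R] [Algebra ℂ R]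
  {d d' d'' : Fin N → Derivation ℂ R R} {x y z : Fin N → R}

/-- The composition of gluing maps has the formulas of a gluing map. -/
theorem IsModel.gluing_comp {A A' : VertexAlgebra (V ⊗[ℂ] R)} (h : IsModel 𝓥 d A)
    (h' : IsModel 𝓥 d' A') (hU : 𝓥.IsUniversal)
    (hc : CoordinateChange d d' x y) (hc' : CoordinateChange d' d'' y z)
    {φ ψ : V ⊗[ℂ] R →ₗ[ℂ] V ⊗[ℂ] R} (hφ : A'.IsHom A φ)
    (hφf : ∀ f, φ (𝓥.vac ⊗ₜ f) = 𝓥.vac ⊗ₜ f)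
    (hφs : ∀ a, φ (𝓥.state a ⊗ₜ 1) = newState 𝓥 d d' x y a)
    (hψs : ∀ a, ψ (𝓥.state a ⊗ₜ 1) = newState 𝓥 d' d'' y z a) (a : Gen N 𝔤) :
    φ (ψ (𝓥.state a ⊗ₜ 1)) = newState 𝓥 d d'' x z a := by
  rw [hψs, ← h'.newState_eq, Realization.map_newState hφ, ← h.newState_eq,
    ← (h.realization hU hc.comm).newState_newState hc hc']
  congr 1
  · exact LinearMap.ext hφf
  · exact (funext hφs).trans h.newState_eq.symm

theorem IsModel.newState_self {A : VertexAlgebra (V ⊗[ℂ] R)} (h : IsModel 𝓥 d A)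
    (hU : 𝓥.IsUniversal) (hd : ∀ p q f, d p (d q f) = d q (d p f))
    (hx : ∀ p q, d p (x q) = if p = q then 1 else 0) (a : Gen N 𝔤) :
    newState 𝓥 d d x x a = 𝓥.state a ⊗ₜ 1 := by
  rw [← h.newState_eq, (h.realization hU hd).newState_self hx]

/-- The gluing map is an isomorphism, the inverse is the gluing map in the other direction. -/
theorem IsModel.exists_gluing_equiv {A A' : VertexAlgebra (V ⊗[ℂ] R)} (h : IsModel 𝓥 d A)
    (h' : IsModel 𝓥 d' A') (hU : 𝓥.IsUniversal) (hc : CoordinateChange d d' x y)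
    (hc' : CoordinateChange d' d y x) :
    ∃ Φ : V ⊗[ℂ] R ≃ₗ[ℂ] V ⊗[ℂ] R, A'.IsHom A Φ.toLinearMap ∧
      (∀ f, Φ (𝓥.vac ⊗ₜ f) = 𝓥.vac ⊗ₜ f) ∧
      ∀ a, Φ (𝓥.state a ⊗ₜ 1) = newState 𝓥 d d' x y a := by
  obtain ⟨φ, h1, h2, h3⟩ := h.exists_gluing h' hU hc
  obtain ⟨ψ, h1', h2', h3'⟩ := h'.exists_gluing h hU hc'
  have e1 : φ ∘ₗ ψ = LinearMap.id := h.hom_ext (h1.comp h1') .id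
    (fun f => by rw [LinearMap.comp_apply, h2', h2, LinearMap.id_apply]) fun a => by
      rw [LinearMap.comp_apply, h.gluing_comp h' hU hc hc' h1 h2 h3 h3',
        h.newState_self hU hc.comm hc'.param, LinearMap.id_apply]
  have e2 : ψ ∘ₗ φ = LinearMap.id := h'.hom_ext (h1'.comp h1) .id
    (fun f => by rw [LinearMap.comp_apply, h2, h2', LinearMap.id_apply]) fun a => by
      rw [LinearMap.comp_apply, h'.gluing_comp h hU hc' hc h1' h2' h3' h3,
        h'.newState_self hU hc.comm' hc.param, LinearMap.id_apply]
  exact ⟨LinearEquiv.ofLinearMap φ ψ e1 e2, h1, h2, h3⟩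

theorem lTensor_newState {S : Type} [CommRing S] [Algebra ℂ S] {e e' : Fin N → Derivation ℂ S S}
    (ρ : R →ₐ[ℂ] S) (hρ : ∀ p f, ρ (d p f) = e p (ρ f)) (hρ' : ∀ p f, ρ (d' p f) = e' p (ρ f))
    (a : Gen N 𝔤) : LinearMap.lTensor V ρ.toLinearMap (newState 𝓥 d d' x y a) =
      newState 𝓥 e e' (fun p => ρ (x p)) (fun p => ρ (y p)) a := by
  cases a <;> simp [newState, hρ, hρ']

end LocalModel
end

section
variable {X : Scheme.{0}} {π : X ⟶ Spec (.of ℂ)} {N : ℕ}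
  {𝔤 : Type} [LieRing 𝔤] [LieAlgebra ℂ 𝔤] {B : InvForm 𝔤} {c k : ℂ}

/-- The vertex algebra structures in the local parameters of a chart, in terms of the general
construction. -/
theorem isLocalStructure_iff (κ : Chart π N) {W : X.Opens} (hW : W ≤ κ.U)
    {A : VertexAlgebra (Loc π N B c k W)} : IsLocalStructure κ hW A ↔
      LocalModel.IsModel (VSpace.freeFields N B c k) (κ.pd hW) A := by
  have e : ∀ n : ℤ, -(-n - 1) - 1 = n := fun n => by ring
  refine ⟨fun h => ⟨h.vac, fun a => funext fun n => ?_, fun f => funext fun n =>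
    LinearMap.ext fun w => ?_⟩, fun h => ⟨h.vac, fun a n => ?_, fun f n w => ?_⟩⟩
  · exact (h.gen a n).trans (congrFun (Loc.mode_eq κ hW a) n)
  · refine (h.function f n w).trans ?_
    rw [Loc.functionField_eq, e]
  · exact (congrFun (h.gen a) n).trans (congrFun (Loc.mode_eq κ hW a) n).symm
  · rw [Loc.functionField_eq, e]
    exact LinearMap.congr_fun (congrFun (h.function f) n) w

theorem isGluing_iff (κ κ' : Chart π N) {W : X.Opens} (h : W ≤ κ.U) (h' : W ≤ κ'.U)
    (Φ : Loc π N B c k W →ₗ[ℂ] Loc π N B c k W) : IsGluing κ κ' h h' Φ ↔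
      (∀ f : Reg π W, Φ (VSpace.vac ⊗ₜ f) = VSpace.vac ⊗ₜ f) ∧
      ∀ a : Gen N 𝔤, Φ (VSpace.state a ⊗ₜ 1) = LocalModel.newState (VSpace.freeFields N B c k)
        (κ.pd h) (κ'.pd h') (κ.param h) (κ'.param h') a := by
  refine ⟨fun H => ⟨H.function, fun a => ?_⟩, fun H => ⟨H.1, fun a => H.2 (.u a),
    fun a => H.2 (.v a), fun a b => H.2 (.E a b), fun x => H.2 (.g x), H.2 .vir⟩⟩
  cases a with
  | u a => exact H.u a
  | v a => exact H.v a
  | E a b => exact H.E a b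
  | g x => exact H.g x
  | vir => exact H.vir

variable (π B c k) in
/-- The local vertex algebras and the gluing maps between them. -/
theorem exists_local_structures {ι : Type} (κ : ι → Chart π N) :
    ∃ (A : ∀ (i : ι) (W : X.Opens), W ≤ (κ i).U → VertexAlgebra (Loc π N B c k W))
      (Φ : ∀ (i j : ι) (W : X.Opens), W ≤ (κ i).U → W ≤ (κ j).U →
        (Loc π N B c k W ≃ₗ[ℂ] Loc π N B c k W)),
      (∀ i W (hW : W ≤ (κ i).U), IsLocalStructure (κ i) hW (A i W hW)) ∧
      (∀ i W W' (hW : W ≤ (κ i).U) (hW' : W' ≤ W),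
        (A i W hW).IsHom (A i W' (hW'.trans hW)) (Loc.res hW')) ∧
      (∀ i j W (hi : W ≤ (κ i).U) (hj : W ≤ (κ j).U),
        (A j W hj).IsHom (A i W hi) (Φ i j W hi hj).toLinearMap ∧
        IsGluing (κ i) (κ j) hi hj (Φ i j W hi hj).toLinearMap ∧
        (∀ φ : Loc π N B c k W →ₗ[ℂ] Loc π N B c k W, (A j W hj).IsHom (A i W hi) φ →
          IsGluing (κ i) (κ j) hi hj φ → φ = (Φ i j W hi hj).toLinearMap)) ∧
      (∀ i j W W' (hi : W ≤ (κ i).U) (hj : W ≤ (κ j).U) (hW' : W' ≤ W) (a : Loc π N B c k W),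
        Φ i j W' (hW'.trans hi) (hW'.trans hj) (Loc.res hW' a) =
          Loc.res hW' (Φ i j W hi hj a)) ∧
      (∀ i j l W (hi : W ≤ (κ i).U) (hj : W ≤ (κ j).U) (hl : W ≤ (κ l).U) (a : Loc π N B c k W),
        Φ i j W hi hj (Φ j l W hj hl a) = Φ i l W hi hl a) := by
  have hU := VSpace.isUniversal N B c k
  choose A hA using fun (i : ι) (W : X.Opens) (hW : W ≤ (κ i).U) =>
    LocalModel.exists_vertexAlgebra (VSpace.freeFields N B c k) ((κ i).pd_comm hW)
  have hM : ∀ i W (hW : W ≤ (κ i).U),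
      LocalModel.IsModel (VSpace.freeFields N B c k) ((κ i).pd hW) (A i W hW) := fun i W hW =>
    ⟨(hA i W hW).1, (hA i W hW).2.2.1, (hA i W hW).2.2.2⟩
  choose Φ hΦ using fun (i j : ι) (W : X.Opens) (hi : W ≤ (κ i).U) (hj : W ≤ (κ j).U) =>
    (hM i W hi).exists_gluing_equiv (hM j W hj) hU ((κ i).coordinateChange (κ j) hi hj)
      ((κ j).coordinateChange (κ i) hj hi)
  have hR : ∀ i W W' (hW : W ≤ (κ i).U) (hW' : W' ≤ W),
      (A i W hW).IsHom (A i W' (hW'.trans hW)) (Loc.res hW') := fun i W W' hW hW' =>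
    (hM i W hW).isHom_lTensor (hM i W' (hW'.trans hW)) hU ((κ i).pd_comm hW) ((κ i).pd_comm _)
      (Reg.res π hW') ((κ i).res_pd hW hW')
  refine ⟨A, Φ, fun i W hW => (isLocalStructure_iff _ _).2 (hM i W hW), hR,
    fun i j W hi hj => ⟨(hΦ i j W hi hj).1, (isGluing_iff _ _ _ _ _).2 (hΦ i j W hi hj).2,
      fun φ hφ hg => ?_⟩, fun i j W W' hi hj hW' a => ?_, fun i j l W hi hj hl a => ?_⟩
  · obtain ⟨hf, hs⟩ := (isGluing_iff _ _ _ _ _).1 hg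
    exact (hM j W hj).hom_ext hφ (hΦ i j W hi hj).1
      (fun f => (hf f).trans ((hΦ i j W hi hj).2.1 f).symm)
      (fun a => (hs a).trans ((hΦ i j W hi hj).2.2 a).symm)
  · obtain ⟨h1, h2, h3⟩ := hΦ i j W hi hj
    obtain ⟨h1', h2', h3'⟩ := hΦ i j W' (hW'.trans hi) (hW'.trans hj)
    have := (hM j W hj).hom_ext (h1'.comp (hR j W W' hj hW')) ((hR i W W' hi hW').comp h1)
      (fun f => ?_) (fun a => ?_)
    · exact LinearMap.congr_fun this a
    · exact (h2' _).trans (congrArg (Loc.res hW') (h2 f)).symm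
    · refine Eq.trans ?_ (congrArg (Loc.res hW') (h3 a)).symm
      have e : Loc.res hW' ((VSpace.freeFields N B c k).state a ⊗ₜ[ℂ] (1 : Reg π W)) =
          (VSpace.freeFields N B c k).state a ⊗ₜ[ℂ] (1 : Reg π W') :=
        congrArg (_ ⊗ₜ[ℂ] ·) (map_one (Reg.res π hW'))
      refine (congrArg _ e).trans ((h3' a).trans ?_)
      refine Eq.symm ((LocalModel.lTensor_newState (Reg.res π hW') ((κ i).res_pd hi hW')
        ((κ j).res_pd hj hW') a).trans ?_)
      congr 1
      · exact funext fun p => (κ i).res_param hi hW' p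
      · exact funext fun p => (κ j).res_param hj hW' p
  · obtain ⟨h1, h2, h3⟩ := hΦ i j W hi hj
    obtain ⟨h1', h2', h3'⟩ := hΦ j l W hj hl
    obtain ⟨h1'', h2'', h3''⟩ := hΦ i l W hi hl
    have := (hM l W hl).hom_ext (h1.comp h1') h1''
      (fun f => (congrArg _ (h2' f)).trans ((h2 f).trans (h2'' f).symm))
      (fun a => ((hM i W hi).gluing_comp (hM j W hj) hU
        ((κ i).coordinateChange (κ j) hi hj) ((κ j).coordinateChange (κ l) hj hl) h1 h2 h3 h3'
        a).trans (h3'' a).symm)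
    exact LinearMap.congr_fun this a

end

/-! ### Products and subalgebras of vertex algebras -/

namespace VertexAlgebra

/-- The product of finitely many vertex algebras. -/
def pi {ι : Type} [Finite ι] {L : ι → Type} [∀ i, AddCommGroup (L i)] [∀ i, Module ℂ (L i)]
    (A : ∀ i, VertexAlgebra (L i)) : VertexAlgebra (∀ i, L i) where
  vac i := (A i).vac
  D := LinearMap.pi fun i => (A i).D ∘ₗ LinearMap.proj i
  Y :=
    { toFun := fun a n => LinearMap.pi fun i => (A i).Y (a i) n ∘ₗ LinearMap.proj i
      map_add' := fun a b => by
        funext n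
        refine LinearMap.ext fun w => funext fun i => ?_
        exact (A i).Y_add (a i) (b i) (w i) n
      map_smul' := fun r a => by
        funext n
        refine LinearMap.ext fun w => funext fun i => ?_
        change (A i).Y (r • a i) n (w i) = _
        rw [map_smul]
        rfl }
  truncation a b := by
    choose n hn using fun i => (A i).truncation (a i) (b i)
    obtain ⟨K, hK⟩ := Set.Finite.bddAbove (Set.finite_range n)
    exact ⟨K, fun m hm => funext fun i => hn i m ((hK ⟨i, rfl⟩).trans hm)⟩
  translation a n := LinearMap.ext fun w => funext fun i =>
    LinearMap.congr_fun ((A i).translation (a i) n) (w i)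
  derivative a n := LinearMap.ext fun w => funext fun i =>
    LinearMap.congr_fun ((A i).derivative (a i) n) (w i)
  vacuum n := LinearMap.ext fun w => funext fun i => by
    refine (LinearMap.congr_fun ((A i).vacuum n) (w i)).trans ?_
    split_ifs <;> rfl
  replication_nonneg a n hn := funext fun i => (A i).replication_nonneg (a i) n hn
  replication a := funext fun i => (A i).replication (a i)
  locality a b := by
    choose n hn using fun i => (A i).locality (a i) (b i)
    obtain ⟨K, hK⟩ := Set.Finite.bddAbove (Set.finite_range n)
    refine ⟨K, fun m hm k l => LinearMap.ext fun w => funext fun i => ?_⟩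
    refine Eq.trans ?_ (LinearMap.congr_fun (hn i m ((hK ⟨i, rfl⟩).trans hm) k l) (w i))
    rw [LinearMap.sum_apply, LinearMap.sum_apply, Finset.sum_apply]
    rfl

/-- A subspace which contains the vacuum vector and is closed under all products is a vertex
algebra. -/
def restrict {M : Type} [AddCommGroup M] [Module ℂ M] (A : VertexAlgebra M) (S : Submodule ℂ M)
    (hvac : A.vac ∈ S) (hY : ∀ a ∈ S, ∀ n, ∀ b ∈ S, A.Y a n b ∈ S) : VertexAlgebra S where
  vac := ⟨A.vac, hvac⟩
  D := A.D.restrict fun a ha => by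
    rw [A.D_eq]
    exact hY a ha _ _ hvac
  Y :=
    { toFun := fun a n => (A.Y a n).restrict (hY a a.2 n)
      map_add' := fun a b => by
        funext n
        exact LinearMap.ext fun w => Subtype.ext (A.Y_add a b w n)
      map_smul' := fun r a => by
        funext n
        refine LinearMap.ext fun w => Subtype.ext ?_
        change A.Y (r • (a : M)) n w = _
        rw [map_smul]
        rfl }
  truncation a b := by
    obtain ⟨K, hK⟩ := A.truncation a b
    exact ⟨K, fun n hn => Subtype.ext (hK n hn)⟩
  translation a n := LinearMap.ext fun w => Subtype.ext
    (LinearMap.congr_fun (A.translation a n) w)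
  derivative a n := LinearMap.ext fun w => Subtype.ext
    (LinearMap.congr_fun (A.derivative a n) w)
  vacuum n := LinearMap.ext fun w => Subtype.ext (by
    refine (LinearMap.congr_fun (A.vacuum n) (w : M)).trans ?_
    split_ifs <;> rfl)
  replication_nonneg a n hn := Subtype.ext (A.replication_nonneg a n hn)
  replication a := Subtype.ext (A.replication (a : M))
  locality a b := by
    obtain ⟨K, hK⟩ := A.locality (a : M) b
    refine ⟨K, fun m hm k l => LinearMap.ext fun w => Subtype.ext ?_⟩
    refine Eq.trans ?_ (LinearMap.congr_fun (hK m hm k l) (w : M))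
    rw [LinearMap.sum_apply, LinearMap.sum_apply, Submodule.coe_sum]
    rfl

end VertexAlgebra

/-! ### The sheaf property of `V ⊗ 𝒪` -/

section
variable {X : Scheme.{0}} {π : X ⟶ Spec (.of ℂ)} {N : ℕ}
  {𝔤 : Type} [LieRing 𝔤] [LieAlgebra ℂ 𝔤] {B : InvForm 𝔤} {c k : ℂ}

theorem Reg.ext_cover {I : Type} {W : X.Opens} (U : I → X.Opens) (hU : ∀ i, U i ≤ W)
    (hW : W ≤ ⨆ i, U i) {s t : Reg π W} (h : ∀ i, Reg.res π (hU i) s = Reg.res π (hU i) t) :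
    s = t :=
  X.sheaf.eq_of_locally_eq' U W (fun i => homOfLE (hU i)) hW s t h

theorem Reg.glue {I : Type} {W : X.Opens} (U : I → X.Opens) (hU : ∀ i, U i ≤ W)
    (hW : W ≤ ⨆ i, U i) (s : ∀ i, Reg π (U i)) (h : ∀ i j,
      Reg.res π (inf_le_left : U i ⊓ U j ≤ U i) (s i) =
        Reg.res π (inf_le_right : U i ⊓ U j ≤ U j) (s j)) :
    ∃ t : Reg π W, ∀ i, Reg.res π (hU i) t = s i := by
  obtain ⟨t, ht, -⟩ := X.sheaf.existsUnique_gluing' U W (fun i => homOfLE (hU i)) hW s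
    (fun i j => h i j)
  exact ⟨t, ht⟩

/-- The coordinates of the elements of `V ⊗ R`, with respect to a basis of `V`, are natural in `R`. -/
theorem equivFinsuppOfBasisLeft_lTensor {V R S I : Type} [AddCommGroup V] [Module ℂ V]
    [AddCommGroup R] [Module ℂ R] [AddCommGroup S] [Module ℂ S] [DecidableEq I]
    (b : Module.Basis I ℂ V) (ρ : R →ₗ[ℂ] S) (w : V ⊗[ℂ] R) (l : I) :
    TensorProduct.equivFinsuppOfBasisLeft b (LinearMap.lTensor V ρ w) l =
      ρ (TensorProduct.equivFinsuppOfBasisLeft b w l) := by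
  induction w using TensorProduct.induction_on with
  | zero => simp
  | add x y hx hy => simp only [map_add, Finsupp.add_apply, hx, hy]
  | tmul v f => simp

/-- Elements of `V ⊗ 𝒪(W)` are determined locally, as their coordinates with respect to a basis of
`V` are. -/
theorem tensorReg_ext {V : Type} [AddCommGroup V] [Module ℂ V] {I : Type} {W : X.Opens}
    (U : I → X.Opens) (hU : ∀ i, U i ≤ W) (hW : W ≤ ⨆ i, U i) {s t : V ⊗[ℂ] Reg π W}
    (h : ∀ i, LinearMap.lTensor V (Reg.res π (hU i)).toLinearMap s =
      LinearMap.lTensor V (Reg.res π (hU i)).toLinearMap t) : s = t := by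
  classical
  let b := Module.Basis.ofVectorSpace ℂ V
  refine (TensorProduct.equivFinsuppOfBasisLeft b).injective (Finsupp.ext fun l => ?_)
  refine Reg.ext_cover U hU hW fun i => ?_
  have := DFunLike.congr_fun (congrArg (TensorProduct.equivFinsuppOfBasisLeft b) (h i)) l
  rwa [equivFinsuppOfBasisLeft_lTensor, equivFinsuppOfBasisLeft_lTensor] at this

/-- Compatible elements of `V ⊗ 𝒪` glue, as their coordinates with respect to a basis of `V` do.
Only finitely many of the glued coordinates are nonzero because open subsets are quasi-compact. -/
theorem tensorReg_glue [NoetherianSpace X] {V : Type} [AddCommGroup V] [Module ℂ V] {I : Type}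
    {W : X.Opens} (U : I → X.Opens) (hU : ∀ i, U i ≤ W) (hW : W ≤ ⨆ i, U i)
    (s : ∀ i, V ⊗[ℂ] Reg π (U i)) (h : ∀ i j,
      LinearMap.lTensor V (Reg.res π (inf_le_left : U i ⊓ U j ≤ U i)).toLinearMap (s i) =
        LinearMap.lTensor V (Reg.res π (inf_le_right : U i ⊓ U j ≤ U j)).toLinearMap (s j)) :
    ∃ t : V ⊗[ℂ] Reg π W, ∀ i, LinearMap.lTensor V (Reg.res π (hU i)).toLinearMap t = s i := by
  classical
  let b := Module.Basis.ofVectorSpace ℂ V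
  choose t ht using fun l => Reg.glue (π := π) U hU hW
    (fun i => TensorProduct.equivFinsuppOfBasisLeft b (s i) l) fun i j => by
      have := DFunLike.congr_fun (congrArg (TensorProduct.equivFinsuppOfBasisLeft b) (h i j)) l
      rwa [equivFinsuppOfBasisLeft_lTensor, equivFinsuppOfBasisLeft_lTensor] at this
  -- a finite subcover bounds the support
  obtain ⟨T, hT⟩ := (NoetherianSpace.isCompact (W : Set X)).elim_finite_subcover
    (fun i => (U i : Set X)) (fun i => (U i).2) (by
      intro x hx
      obtain ⟨i, hi⟩ := Opens.mem_iSup.1 (hW hx)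
      exact Set.mem_iUnion.2 ⟨i, hi⟩)
  have hsupp : ∀ l, t l ≠ 0 →
      l ∈ T.biUnion fun i => (TensorProduct.equivFinsuppOfBasisLeft b (s i)).support := by
    intro l hl
    by_contra hc
    refine hl (Reg.ext_cover (fun i : T => U i) (fun i => hU i) (fun x hx => ?_) fun i => ?_)
    · obtain ⟨i, hi, hxi⟩ := Set.mem_iUnion₂.1 (hT hx)
      exact Opens.mem_iSup.2 ⟨⟨i, hi⟩, hxi⟩
    · rw [ht, map_zero]
      by_contra h0
      exact hc (Finset.mem_biUnion.2 ⟨i, i.2, Finsupp.mem_support_iff.2 h0⟩)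
  refine ⟨(TensorProduct.equivFinsuppOfBasisLeft b).symm (Finsupp.onFinset _ t hsupp), fun i => ?_⟩
  refine (TensorProduct.equivFinsuppOfBasisLeft b).injective (Finsupp.ext fun l => ?_)
  rw [equivFinsuppOfBasisLeft_lTensor, LinearEquiv.apply_symm_apply, Finsupp.onFinset_apply]
  exact ht l i

end

/-! ### Gluing sheaves of vertex algebras -/

section
variable {X : TopCat.{0}} {ι : Type}

/-- A sheaf of vector spaces `L` on a topological space, with vertex algebra structures over the
open subsets of the members of a covering, and transition isomorphisms between these structures
which satisfy the cocycle condition. -/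
structure GluingDatum (U : ι → Opens X) (L : Opens X → Type) [∀ W, AddCommGroup (L W)]
    [∀ W, Module ℂ (L W)] where
  cover : ⨆ i, U i = ⊤
  res : ∀ {W W' : Opens X}, W' ≤ W → L W →ₗ[ℂ] L W'
  res_self : ∀ {W} (a : L W), res le_rfl a = a
  res_res : ∀ {W W' W'' : Opens X} (h : W'' ≤ W') (h' : W' ≤ W) (a : L W),
    res h (res h' a) = res (h.trans h') a
  ext : ∀ {I : Type} {W : Opens X} (U : I → Opens X) (hU : ∀ i, U i ≤ W) (_ : W ≤ ⨆ i, U i)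
    {s t : L W}, (∀ i, res (hU i) s = res (hU i) t) → s = t
  glue : ∀ {I : Type} {W : Opens X} (U : I → Opens X) (hU : ∀ i, U i ≤ W) (_ : W ≤ ⨆ i, U i)
    (s : ∀ i, L (U i)), (∀ i j, res (inf_le_left : U i ⊓ U j ≤ U i) (s i) =
      res (inf_le_right : U i ⊓ U j ≤ U j) (s j)) → ∃ t, ∀ i, res (hU i) t = s i
  A : ∀ (i : ι) (W : Opens X), W ≤ U i → VertexAlgebra (L W)
  Φ : ∀ (i j : ι) (W : Opens X), W ≤ U i → W ≤ U j → (L W ≃ₗ[ℂ] L W)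
  isHom_res : ∀ i W W' (hW : W ≤ U i) (hW' : W' ≤ W),
    (A i W hW).IsHom (A i W' (hW'.trans hW)) (res hW')
  isHom_Φ : ∀ i j W (hi : W ≤ U i) (hj : W ≤ U j),
    (A j W hj).IsHom (A i W hi) (Φ i j W hi hj).toLinearMap
  Φ_res : ∀ i j W W' (hi : W ≤ U i) (hj : W ≤ U j) (hW' : W' ≤ W) (a : L W),
    Φ i j W' (hW'.trans hi) (hW'.trans hj) (res hW' a) = res hW' (Φ i j W hi hj a)
  Φ_Φ : ∀ i j l W (hi : W ≤ U i) (hj : W ≤ U j) (hl : W ≤ U l) (a : L W),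
    Φ i j W hi hj (Φ j l W hj hl a) = Φ i l W hi hl a

namespace GluingDatum
variable {U : ι → Opens X} {L : Opens X → Type} [∀ W, AddCommGroup (L W)] [∀ W, Module ℂ (L W)]
  (G : GluingDatum U L)

/-- `𝒱` is glued from the local vertex algebras by means of the isomorphisms `θ_i`. -/
structure IsGlued (𝒱 : VertexAlgebraSheaf X)
    (θ : ∀ (i : ι) (W : Opens X), W ≤ U i → (𝒱.sheaf.presheaf.obj (op W) ≃ₗ[ℂ] L W)) : Prop where
  isHom : ∀ i W (h : W ≤ U i), (𝒱.va W).IsHom (G.A i W h) (θ i W h).toLinearMap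
  res : ∀ i W W' (h : W ≤ U i) (h' : W' ≤ W) (a : 𝒱.sheaf.presheaf.obj (op W)),
    θ i W' (h'.trans h) ((𝒱.sheaf.presheaf.map (homOfLE h').op).hom a) = G.res h' (θ i W h a)
  glue : ∀ i j W (hi : W ≤ U i) (hj : W ≤ U j) (a : 𝒱.sheaf.presheaf.obj (op W)),
    θ i W hi a = G.Φ i j W hi hj (θ j W hj a)

theorem Φ_self (i : ι) (W : Opens X) (h : W ≤ U i) (a : L W) : G.Φ i i W h h a = a :=
  (G.Φ i i W h h).injective (G.Φ_Φ i i i W h h h a)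

include G in
theorem le_iSup_inf (W : Opens X) : W ≤ ⨆ i, W ⊓ U i := by
  rw [← inf_iSup_eq, G.cover, inf_top_eq]

/-- The sections of the glued sheaf: families of elements of `L(W ∩ U_i)` which are compatible with
the transition isomorphisms. -/
def sections (W : Opens X) : Submodule ℂ (∀ i, L (W ⊓ U i)) where
  carrier := {a | ∀ i j W' (hi : W' ≤ W ⊓ U i) (hj : W' ≤ W ⊓ U j), G.res hi (a i) =
    G.Φ i j W' (hi.trans inf_le_right) (hj.trans inf_le_right) (G.res hj (a j))}
  zero_mem' i j W' hi hj := by simp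
  add_mem' {a b} ha hb i j W' hi hj := by
    rw [Pi.add_apply, Pi.add_apply, map_add, map_add, map_add, ha, hb]
  smul_mem' r a ha i j W' hi hj := by
    rw [Pi.smul_apply, Pi.smul_apply, map_smul, map_smul, map_smul, ha]

/-- The restriction of sections. -/
def resSections {W W' : Opens X} (h : W' ≤ W) : G.sections W →ₗ[ℂ] G.sections W' :=
  (LinearMap.pi fun i => G.res (inf_le_inf_right (U i) h) ∘ₗ LinearMap.proj i).restrict
    fun a ha i j W'' hi hj => by
      change G.res hi (G.res _ (a i)) = G.Φ i j W'' _ _ (G.res hj (G.res _ (a j)))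
      rw [G.res_res, G.res_res]
      exact ha i j W'' _ _

/-- The glued presheaf. -/
def presheaf : TopCat.Presheaf (ModuleCat.{0} ℂ) X where
  obj W := ModuleCat.of ℂ (G.sections W.unop)
  map f := ModuleCat.ofHom (G.resSections f.unop.le)
  map_id W := by
    refine ModuleCat.hom_ext (LinearMap.ext fun a => Subtype.ext (funext fun i => ?_))
    exact G.res_self _
  map_comp f g := by
    refine ModuleCat.hom_ext (LinearMap.ext fun a => Subtype.ext (funext fun i => ?_))
    exact (G.res_res _ _ _).symm

theorem isSheaf_presheaf : G.presheaf.IsSheaf := by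
  refine (TopCat.Presheaf.isSheaf_iff_isSheafUniqueGluing _).2 fun I Y s hs => ?_
  have s' : ∀ α, G.sections (Y α) := s
  have le : ∀ i α, Y α ⊓ U i ≤ iSup Y ⊓ U i := fun i α => inf_le_inf_right _ (le_iSup Y α)
  have cov : ∀ i, iSup Y ⊓ U i ≤ ⨆ α, Y α ⊓ U i := fun i => (iSup_inf_eq _ _).le
  have comp : ∀ α β i, G.res (inf_le_inf_right (U i) inf_le_left : Y α ⊓ Y β ⊓ U i ≤ _)
      ((show G.sections (Y α) from s α).1 i) =
      G.res (inf_le_inf_right (U i) inf_le_right) ((show G.sections (Y β) from s β).1 i) :=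
    fun α β i => congrFun (congrArg Subtype.val (hs α β)) i
  choose t ht using fun i => G.glue (fun α => Y α ⊓ U i) (le i) (cov i)
    (fun α => (show G.sections (Y α) from s α).1 i) fun α β => by
      have h1 : Y α ⊓ U i ⊓ (Y β ⊓ U i) ≤ Y α ⊓ Y β ⊓ U i :=
        le_inf (inf_le_inf inf_le_left inf_le_left) (inf_le_left.trans inf_le_right)
      have := congrArg (G.res h1) (comp α β i)
      rwa [G.res_res, G.res_res] at this
  have mem : t ∈ G.sections (iSup Y) := fun i j W' hi hj => by
    refine G.ext (fun α => W' ⊓ Y α) (fun α => inf_le_left) ?_ fun α => ?_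
    · rw [← inf_iSup_eq]
      exact le_inf le_rfl (hi.trans inf_le_left)
    · have hi' : W' ⊓ Y α ≤ Y α ⊓ U i :=
        le_inf inf_le_right (inf_le_left.trans (hi.trans inf_le_right))
      have hj' : W' ⊓ Y α ≤ Y α ⊓ U j :=
        le_inf inf_le_right (inf_le_left.trans (hj.trans inf_le_right))
      have e1 := congrArg (G.res hi') (ht i α)
      have e2 := congrArg (G.res hj') (ht j α)
      rw [G.res_res] at e1 e2
      rw [← G.Φ_res, G.res_res, G.res_res]
      refine e1.trans (((show G.sections (Y α) from s α).2 i j _ hi' hj').trans ?_)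
      exact congrArg _ e2.symm
  refine ⟨(show G.sections (iSup Y) from ⟨t, mem⟩), fun α => ?_, fun t' h' => ?_⟩
  · exact Subtype.ext (funext fun i => ht i α)
  · refine Subtype.ext (funext fun i => ?_)
    refine G.ext (fun α => Y α ⊓ U i) (le i) (cov i) fun α => ?_
    rw [ht]
    exact congrFun (congrArg Subtype.val (h' α)) i

variable [Finite ι]

theorem Y_mem_sections (W : Opens X) {a b : ∀ i, L (W ⊓ U i)} (ha : a ∈ G.sections W)
    (hb : b ∈ G.sections W) (n : ℤ) :
    (VertexAlgebra.pi fun i => G.A i (W ⊓ U i) inf_le_right).Y a n b ∈ G.sections W := by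
  intro i j W' hi hj
  change G.res hi ((G.A i _ _).Y (a i) n (b i)) =
    G.Φ i j W' _ _ (G.res hj ((G.A j _ _).Y (a j) n (b j)))
  rw [(G.isHom_res i _ W' inf_le_right hi).map_Y, (G.isHom_res j _ W' inf_le_right hj).map_Y,
    ha i j W' hi hj, hb i j W' hi hj]
  exact ((G.isHom_Φ i j W' _ _).map_Y _ _ n).symm

/-- The vertex algebra of sections over an open subset. -/
def va (W : Opens X) : VertexAlgebra (G.sections W) :=
  (VertexAlgebra.pi fun i => G.A i (W ⊓ U i) inf_le_right).restrict (G.sections W)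
    (fun i j W' hi hj => by
      change G.res hi (G.A i _ _).vac = G.Φ i j W' _ _ (G.res hj (G.A j _ _).vac)
      rw [(G.isHom_res i _ W' inf_le_right hi).map_vac,
        (G.isHom_res j _ W' inf_le_right hj).map_vac]
      exact (G.isHom_Φ i j W' _ _).map_vac.symm)
    fun _ ha n _ hb => G.Y_mem_sections W ha hb n

/-- The glued sheaf of vertex algebras. -/
def vertexAlgebraSheaf : VertexAlgebraSheaf X where
  sheaf := ⟨G.presheaf, G.isSheaf_presheaf⟩
  va W := G.va W
  isHom_res _ _ _ :=
    { map_vac := Subtype.ext (funext fun i => (G.isHom_res i _ _ _ _).map_vac)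
      map_Y := fun _ _ n => Subtype.ext (funext fun i => (G.isHom_res i _ _ _ _).map_Y _ _ n) }

/-- The sections over an open subset of `U_i`. -/
def θ (i : ι) (W : Opens X) (h : W ≤ U i) : G.sections W ≃ₗ[ℂ] L W where
  toFun a := G.res (le_inf le_rfl h) (a.1 i)
  map_add' a b := by rw [Submodule.coe_add, Pi.add_apply, map_add]
  map_smul' r a := by rw [Submodule.coe_smul, Pi.smul_apply, map_smul, RingHom.id_apply]
  invFun a := ⟨fun j => G.Φ j i _ inf_le_right (inf_le_left.trans h) (G.res inf_le_left a),
    fun j l W' hj hl => by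
      rw [← G.Φ_res, ← G.Φ_res, G.Φ_Φ, G.res_res, G.res_res]⟩
  left_inv a := Subtype.ext (funext fun j => by
    have := a.2 j i (W ⊓ U j) le_rfl (le_inf inf_le_left (inf_le_left.trans h))
    rw [G.res_self] at this
    change G.Φ j i _ _ _ (G.res inf_le_left (G.res _ (a.1 i))) = a.1 j
    rw [this, G.res_res])
  right_inv a := by
    change G.res _ (G.Φ i i _ _ _ _) = a
    rw [G.Φ_self, G.res_res, G.res_self]

theorem isGlued : G.IsGlued G.vertexAlgebraSheaf G.θ where
  isHom i W h :=
    { map_vac := (G.isHom_res i _ W _ _).map_vac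
      map_Y := fun a b n => (G.isHom_res i _ W inf_le_right (le_inf le_rfl h)).map_Y _ _ n }
  res i W W' h h' a := by
    change G.res _ (G.res _ (a.1 i)) = G.res _ (G.res _ (a.1 i))
    rw [G.res_res, G.res_res]
  glue i j W hi hj a := a.2 i j W (le_inf le_rfl hi) (le_inf le_rfl hj)

section
variable {G} {𝒱 : VertexAlgebraSheaf X}
  {θ : ∀ (i : ι) (W : Opens X), W ≤ U i → (𝒱.sheaf.presheaf.obj (op W) ≃ₗ[ℂ] L W)}
  (h : G.IsGlued 𝒱 θ)
include h

/-- The comparison of two glued sheaves. -/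
def IsGlued.toSections (W : Opens X) : 𝒱.sheaf.presheaf.obj (op W) →ₗ[ℂ] G.sections W :=
  (LinearMap.pi fun i => (θ i (W ⊓ U i) inf_le_right).toLinearMap ∘ₗ
    (𝒱.sheaf.presheaf.map (homOfLE inf_le_left).op).hom).codRestrict _ fun a i j W' hi hj => by
      change G.res hi (θ i _ _ _) = G.Φ i j W' _ _ (G.res hj (θ j _ _ _))
      rw [← h.res i _ W' inf_le_right hi, ← h.res j _ W' inf_le_right hj, h.glue i j W']
      rw [← LinearMap.comp_apply, ← LinearMap.comp_apply, ← ModuleCat.hom_comp, ← ModuleCat.hom_comp,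
        ← Functor.map_comp, ← Functor.map_comp]
      rfl

omit [Finite ι] in
theorem IsGlued.toSections_bijective (W : Opens X) : Function.Bijective (h.toSections W) := by
  refine ⟨fun s t hst => 𝒱.sheaf.eq_of_locally_eq' (fun i => W ⊓ U i) W
    (fun _ => homOfLE inf_le_left) (G.le_iSup_inf W) s t fun i =>
      (θ i _ inf_le_right).injective (congrFun (congrArg Subtype.val hst) i), fun a => ?_⟩
  obtain ⟨t, ht, -⟩ := 𝒱.sheaf.existsUnique_gluing' (fun i => W ⊓ U i) W
    (fun i => homOfLE inf_le_left) (G.le_iSup_inf W)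
    (fun i => (θ i (W ⊓ U i) inf_le_right).symm (a.1 i)) fun i j => by
      refine (θ i (W ⊓ U i ⊓ (W ⊓ U j)) (inf_le_left.trans inf_le_right)).injective ?_
      refine (h.res i _ _ inf_le_right inf_le_left _).trans ?_
      refine Eq.trans ?_ (h.glue i j _ _ (inf_le_right.trans inf_le_right) _).symm
      refine Eq.trans ?_ (congrArg _ (h.res j _ _ inf_le_right inf_le_right _).symm)
      rw [LinearEquiv.apply_symm_apply, LinearEquiv.apply_symm_apply]
      exact a.2 i j _ _ _
  refine ⟨t, Subtype.ext (funext fun i => ?_)⟩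
  refine (congrArg (θ i (W ⊓ U i) inf_le_right) (ht i)).trans ?_
  exact LinearEquiv.apply_symm_apply _ _

theorem IsGlued.isHom_toSections (W : Opens X) :
    (𝒱.va W).IsHom (G.va W) (h.toSections W) where
  map_vac := Subtype.ext (funext fun i => by
    refine (congrArg (θ i (W ⊓ U i) inf_le_right) (𝒱.isHom_res W (W ⊓ U i) inf_le_left).map_vac).trans
      ?_
    exact (h.isHom i _ _).map_vac)
  map_Y a b n := Subtype.ext (funext fun i => by
    refine (congrArg (θ i (W ⊓ U i) inf_le_right)
      ((𝒱.isHom_res W (W ⊓ U i) inf_le_left).map_Y a b n)).trans ?_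
    exact (h.isHom i _ _).map_Y _ _ n)

omit [Finite ι] in
theorem IsGlued.θ_toSections (i : ι) (W : Opens X) (hW : W ≤ U i)
    (a : 𝒱.sheaf.presheaf.obj (op W)) : G.θ i W hW (h.toSections W a) = θ i W hW a := by
  change G.res _ (θ i _ _ _) = _
  rw [← h.res i _ W inf_le_right (le_inf le_rfl hW), ← LinearMap.comp_apply, ← ModuleCat.hom_comp,
    ← Functor.map_comp]
  congr 1
  have : (homOfLE (inf_le_left : W ⊓ U i ≤ W)).op ≫ (homOfLE (le_inf le_rfl hW)).op = 𝟙 (op W) :=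
    rfl
  rw [this, CategoryTheory.Functor.map_id]
  rfl

omit [Finite ι] in
theorem IsGlued.toSections_res {W W' : Opens X} (hW : W' ≤ W)
    (a : 𝒱.sheaf.presheaf.obj (op W)) :
    h.toSections W' ((𝒱.sheaf.presheaf.map (homOfLE hW).op).hom a) =
      G.resSections hW (h.toSections W a) := Subtype.ext (funext fun i => by
  change θ i _ _ _ = G.res _ (θ i _ _ _)
  rw [← h.res i _ (W' ⊓ U i) inf_le_right (inf_le_inf_right _ hW), ← LinearMap.comp_apply,
    ← LinearMap.comp_apply, ← ModuleCat.hom_comp, ← ModuleCat.hom_comp, ← Functor.map_comp,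
    ← Functor.map_comp]
  rfl)

/-- A glued sheaf is isomorphic to the sheaf of compatible families. -/
def IsGlued.iso : G.vertexAlgebraSheaf.sheaf ≅ 𝒱.sheaf :=
  ((fullyFaithfulSheafToPresheaf _ _).preimageIso (NatIso.ofComponents
    (fun W => (LinearEquiv.ofBijective (h.toSections W.unop)
      (h.toSections_bijective W.unop)).toModuleIso)
    (fun f => ModuleCat.hom_ext (LinearMap.ext fun a => h.toSections_res f.unop.le a)))).symm

theorem IsGlued.toSections_iso (W : Opens X) (a : G.sections W) :
    h.toSections W ((h.iso.hom.hom.app (op W)).hom a) = a :=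
  (LinearEquiv.ofBijective (h.toSections W) (h.toSections_bijective W)).apply_symm_apply a

/-- **The uniqueness of the glued sheaf.** -/
theorem IsGlued.existsUnique_iso : ∃! e : G.vertexAlgebraSheaf.sheaf ≅ 𝒱.sheaf,
    (∀ W : Opens X, (G.vertexAlgebraSheaf.va W).IsHom (𝒱.va W) (e.hom.hom.app (op W)).hom) ∧
    (∀ i W (hW : W ≤ U i) (a : G.vertexAlgebraSheaf.sheaf.presheaf.obj (op W)),
      θ i W hW ((e.hom.hom.app (op W)).hom a) = G.θ i W hW a) := by
  refine ⟨h.iso, ⟨fun W => ?_, fun i W hW a => ?_⟩, fun e he => ?_⟩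
  · exact VertexAlgebra.IsHom.symm (A := 𝒱.va W) (A' := G.va W)
      (e := LinearEquiv.ofBijective (h.toSections W) (h.toSections_bijective W))
      (h.isHom_toSections W)
  · rw [← h.θ_toSections]
    exact congrArg _ (h.toSections_iso W a)
  · refine Iso.ext (Sheaf.hom_ext (NatTrans.ext (funext fun W => ModuleCat.hom_ext
      (LinearMap.ext fun a => ?_))))
    refine (h.toSections_bijective W.unop).1 ((Eq.trans ?_ (h.toSections_iso W.unop a).symm))
    refine Subtype.ext (funext fun i => ?_)
    have nat := ConcreteCategory.congr_hom (e.hom.hom.naturality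
      (homOfLE (inf_le_left : W.unop ⊓ U i ≤ W.unop)).op) a
    refine (congrArg (θ i (W.unop ⊓ U i) inf_le_right) nat.symm).trans ?_
    refine (he.2 i _ _ _).trans ?_
    change G.res _ (G.res _ (a.1 i)) = a.1 i
    rw [G.res_res, G.res_self]

end

end GluingDatum
end

/-! ### The sheaf of vertex algebras -/

section
variable {X : Scheme.{0}} {π : X ⟶ Spec (.of ℂ)} {N : ℕ}
  {𝔤 : Type} [LieRing 𝔤] [LieAlgebra ℂ 𝔤] {B : InvForm 𝔤} {c k : ℂ}

theorem Loc.res_self {W : X.Opens} (a : Loc π N B c k W) : Loc.res (le_refl W) a = a := by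
  have : (Reg.res π (le_refl W)).toLinearMap = LinearMap.id := LinearMap.ext Reg.res_self
  rw [Loc.res, this, LinearMap.lTensor_id, LinearMap.id_apply]

theorem Loc.res_res {W W' W'' : X.Opens} (h : W'' ≤ W') (h' : W' ≤ W) (a : Loc π N B c k W) :
    Loc.res h (Loc.res h' a) = Loc.res (h.trans h') a := by
  have : (Reg.res π h).toLinearMap ∘ₗ (Reg.res π h').toLinearMap =
      (Reg.res π (h.trans h')).toLinearMap := LinearMap.ext (Reg.res_res π h h')
  rw [Loc.res, Loc.res, Loc.res, ← LinearMap.comp_apply, ← LinearMap.lTensor_comp, this]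

end

section
variable {N : ℕ} {𝔤 : Type} [LieRing 𝔤] [LieAlgebra ℂ 𝔤] {B : InvForm 𝔤} {c k : ℂ}

/-- The vertex algebra structure on `V` is unique, as its generating fields generate `V`. -/
theorem IsTensorStructure.ext {A A' : VertexAlgebra (VSpace N B c k)}
    (h : IsTensorStructure A) (h' : IsTensorStructure A') : A' = A := by
  refine VertexAlgebra.Generates.ext (S := Set.range VSpace.state) (fun P hP hS => ?_)
    (h'.vac.trans h.vac.symm) ?_
  · refine VSpace.eq_top P (h'.vac ▸ hP) fun a n w hw => ?_
    rw [← h'.gen]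
    exact hS _ ⟨a, rfl⟩ n w hw
  · rintro _ ⟨a, rfl⟩
    exact funext fun n => (h'.gen a n).trans (h.gen a n).symm

variable (N B c k) in
theorem exists_isTensorStructure : ∃ A : VertexAlgebra (VSpace N B c k), IsTensorStructure A := by
  obtain ⟨A, hv, -, hg⟩ := (VSpace.freeFields N B c k).exists_vertexAlgebra
  exact ⟨A, hv, fun a n => congrFun (hg a) n⟩

theorem IsTensorStructure.D_eq {A : VertexAlgebra (VSpace N B c k)} (h : IsTensorStructure A) :
    A.D = (VSpace.freeFields N B c k).translation := by
  obtain ⟨A', hv, hD, hg⟩ := (VSpace.freeFields N B c k).exists_vertexAlgebra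
  rw [IsTensorStructure.ext ⟨hv, fun a n => congrFun (hg a) n⟩ h, hD]

variable {X : Scheme.{0}} {π : X ⟶ Spec (.of ℂ)} {κ : Chart π N} {W : X.Opens} {hW : W ≤ κ.U}
  {A : VertexAlgebra (Loc π N B c k W)} (h : IsLocalStructure κ hW A)
include h

theorem IsLocalStructure.ext {A' : VertexAlgebra (Loc π N B c k W)}
    (h' : IsLocalStructure κ hW A') : A' = A :=
  ((isLocalStructure_iff κ hW).1 h).ext ((isLocalStructure_iff κ hW).1 h')

/-- The fields of `V ⊗ 𝒪(W)` are normally ordered products of the generating ones. -/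
theorem IsLocalStructure.Y_mode (a : Gen N 𝔤) (j : ℕ) (w x : Loc π N B c k W) (n : ℤ) :
    A.Y (Loc.mode κ hW a (-j - 1) w) n x =
      normalOrder (dividedDeriv j (Loc.mode κ hW a)) (A.Y w) n x := by
  have e : A.Y (Loc.state a) = Loc.mode κ hW a := funext (h.gen a)
  exact e ▸ A.Y_Y_eq_normalOrder (Loc.state a) w x j n

theorem IsLocalStructure.D_tmul {AV : VertexAlgebra (VSpace N B c k)} (hV : IsTensorStructure AV)
    (ν : VSpace N B c k) (f : Reg π W) :
    A.D (ν ⊗ₜ f) = AV.D ν ⊗ₜ f + ∑ p, VSpace.mode (.u p) (-1) ν ⊗ₜ κ.pd hW p f :=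
  ((isLocalStructure_iff κ hW).1 h).D_tmul (κ.pd_comm hW) hV.D_eq ν f

theorem IsLocalStructure.isHom_tmul_one {AV : VertexAlgebra (VSpace N B c k)}
    (hV : IsTensorStructure AV) :
    AV.IsHom A ((TensorProduct.mk ℂ (VSpace N B c k) (Reg π W)).flip 1) :=
  LocalModel.isHom_tmul_one (𝓥 := VSpace.freeFields N B c k) hV.vac (fun a => funext (hV.gen a))
    h.vac ((isLocalStructure_iff κ hW).1 h).gen

end

section
variable {X : Scheme.{0}} {π : X ⟶ Spec (.of ℂ)} [NoetherianSpace X] {N : ℕ}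
  {𝔤 : Type} [LieRing 𝔤] [LieAlgebra ℂ 𝔤] {B : InvForm 𝔤} {c k : ℂ}

/-- The sheaf glued from the local vertex algebras, and its uniqueness. -/
theorem exists_isGlued {ι : Type} [Finite ι] {U : ι → X.Opens} (hU : ⨆ i, U i = ⊤)
    {A : ∀ (i : ι) (W : X.Opens), W ≤ U i → VertexAlgebra (Loc π N B c k W)}
    {Φ : ∀ (i j : ι) (W : X.Opens), W ≤ U i → W ≤ U j →
      (Loc π N B c k W ≃ₗ[ℂ] Loc π N B c k W)}
    (isHom_res : ∀ i W W' (hW : W ≤ U i) (hW' : W' ≤ W),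
      (A i W hW).IsHom (A i W' (hW'.trans hW)) (Loc.res hW'))
    (isHom_Φ : ∀ i j W (hi : W ≤ U i) (hj : W ≤ U j),
      (A j W hj).IsHom (A i W hi) (Φ i j W hi hj).toLinearMap)
    (Φ_res : ∀ i j W W' (hi : W ≤ U i) (hj : W ≤ U j) (hW' : W' ≤ W) (a : Loc π N B c k W),
      Φ i j W' (hW'.trans hi) (hW'.trans hj) (Loc.res hW' a) = Loc.res hW' (Φ i j W hi hj a))
    (Φ_Φ : ∀ i j l W (hi : W ≤ U i) (hj : W ≤ U j) (hl : W ≤ U l) (a : Loc π N B c k W),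
      Φ i j W hi hj (Φ j l W hj hl a) = Φ i l W hi hl a) :
    ∃ (𝒱 : VertexAlgebraSheaf X) (θ : ∀ (i : ι) (W : X.Opens), W ≤ U i →
        (𝒱.sheaf.presheaf.obj (op W) ≃ₗ[ℂ] Loc π N B c k W)),
      IsGlued U A Φ 𝒱 θ ∧
      ∀ (𝒱' : VertexAlgebraSheaf X) (θ' : ∀ (i : ι) (W : X.Opens), W ≤ U i →
          (𝒱'.sheaf.presheaf.obj (op W) ≃ₗ[ℂ] Loc π N B c k W)),
        IsGlued U A Φ 𝒱' θ' →
        ∃! e : 𝒱.sheaf ≅ 𝒱'.sheaf,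
          (∀ W : X.Opens, (𝒱.va W).IsHom (𝒱'.va W) (e.hom.hom.app (op W)).hom) ∧
          (∀ i W (hW : W ≤ U i) (a : 𝒱.sheaf.presheaf.obj (op W)),
            θ' i W hW ((e.hom.hom.app (op W)).hom a) = θ i W hW a) := by
  let G : GluingDatum U (Loc π N B c k) :=
    { cover := hU
      res := Loc.res
      res_self := Loc.res_self
      res_res := Loc.res_res
      ext := fun U hU hW _ _ h => tensorReg_ext U hU hW h
      glue := fun U hU hW s h => tensorReg_glue U hU hW s h
      A := A
      Φ := Φ
      isHom_res := isHom_res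
      isHom_Φ := isHom_Φ
      Φ_res := Φ_res
      Φ_Φ := Φ_Φ }
  refine ⟨G.vertexAlgebraSheaf, G.θ, ⟨G.isGlued.isHom, G.isGlued.res, G.isGlued.glue⟩,
    fun 𝒱' θ' h' => ?_⟩
  have h : G.IsGlued 𝒱' θ' := ⟨h'.isHom, h'.res, h'.glue⟩
  exact h.existsUnique_iso

end
end VOASheaf
end

open CategoryTheory AlgebraicGeometry Opposite TensorProduct VOASheaf in
theorem theorem2p5 {X : Scheme.{0}} (π : X ⟶ Spec (.of ℂ)) [IsIntegral X] [IsSeparated π]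
    [LocallyOfFiniteType π] [QuasiCompact π] (N : ℕ) [SmoothOfRelativeDimension N π]
    {𝔤 : Type} [LieRing 𝔤] [LieAlgebra ℂ 𝔤] [FiniteDimensional ℂ 𝔤] [LieAlgebra.IsSimple ℂ 𝔤]
    (B : InvForm 𝔤) (h c : ℂ) (hh : killingForm ℂ 𝔤 = (2 * h) • B.form) (hc : c ≠ -h)
    (k : ℂ) (hk : k = -(c * Module.finrank ℂ 𝔤 / (c + h)))
    {ι : Type} [Finite ι] (κ : ι → Chart π N) (hκ : ⨆ i, (κ i).U = ⊤) :
    -- the vertex algebra `V`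
    ∃ AV : VertexAlgebra (VSpace N B c k), IsTensorStructure AV ∧
      (∀ AV' : VertexAlgebra (VSpace N B c k), IsTensorStructure AV' → AV' = AV) ∧
    -- the vertex algebras `V ⊗ 𝒪_X(W)`, for open subsets `W` of the charts
    ∃ A : ∀ (i : ι) (W : X.Opens), W ≤ (κ i).U → VertexAlgebra (Loc π N B c k W),
      (∀ i W (hW : W ≤ (κ i).U),
        IsLocalStructure (κ i) hW (A i W hW) ∧
        (∀ A' : VertexAlgebra (Loc π N B c k W), IsLocalStructure (κ i) hW A' → A' = A i W hW) ∧
        (∀ (a : Gen N 𝔤) (j : ℕ) (w x : Loc π N B c k W) (n : ℤ),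
          (A i W hW).Y (Loc.mode (κ i) hW a (-j - 1) w) n x =
            normalOrder (dividedDeriv j (Loc.mode (κ i) hW a)) ((A i W hW).Y w) n x) ∧
        (∀ (ν : VSpace N B c k) (f : Reg π W), (A i W hW).D (ν ⊗ₜ f) =
          AV.D ν ⊗ₜ f + ∑ p, VSpace.mode (.u p) (-1) ν ⊗ₜ (κ i).pd hW p f) ∧
        AV.IsHom (A i W hW) ((TensorProduct.mk ℂ (VSpace N B c k) (Reg π W)).flip 1)) ∧
      (∀ i W W' (hW : W ≤ (κ i).U) (hW' : W' ≤ W),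
        (A i W hW).IsHom (A i W' (hW'.trans hW)) (Loc.res hW')) ∧
    -- the gluing maps `Φ_ij`
    ∃ Φ : ∀ (i j : ι) (W : X.Opens), W ≤ (κ i).U → W ≤ (κ j).U →
        (Loc π N B c k W ≃ₗ[ℂ] Loc π N B c k W),
      (∀ i j W (hi : W ≤ (κ i).U) (hj : W ≤ (κ j).U),
        (A j W hj).IsHom (A i W hi) (Φ i j W hi hj).toLinearMap ∧
        IsGluing (κ i) (κ j) hi hj (Φ i j W hi hj).toLinearMap ∧
        (∀ φ : Loc π N B c k W →ₗ[ℂ] Loc π N B c k W, (A j W hj).IsHom (A i W hi) φ →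
          IsGluing (κ i) (κ j) hi hj φ → φ = (Φ i j W hi hj).toLinearMap)) ∧
      (∀ i j W W' (hi : W ≤ (κ i).U) (hj : W ≤ (κ j).U) (hW' : W' ≤ W) (a : Loc π N B c k W),
        Φ i j W' (hW'.trans hi) (hW'.trans hj) (Loc.res hW' a) =
          Loc.res hW' (Φ i j W hi hj a)) ∧
      (∀ i j l W (hi : W ≤ (κ i).U) (hj : W ≤ (κ j).U) (hl : W ≤ (κ l).U) (a : Loc π N B c k W),
        Φ i j W hi hj (Φ j l W hj hl a) = Φ i l W hi hl a) ∧
    -- the sheaf `𝒱`, and its uniqueness up to unique isomorphism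
    ∃ (𝒱 : VertexAlgebraSheaf X) (θ : ∀ (i : ι) (W : X.Opens), W ≤ (κ i).U →
        (𝒱.sheaf.presheaf.obj (op W) ≃ₗ[ℂ] Loc π N B c k W)),
      IsGlued (fun i => (κ i).U) A Φ 𝒱 θ ∧
      ∀ (𝒱' : VertexAlgebraSheaf X) (θ' : ∀ (i : ι) (W : X.Opens), W ≤ (κ i).U →
          (𝒱'.sheaf.presheaf.obj (op W) ≃ₗ[ℂ] Loc π N B c k W)),
        IsGlued (fun i => (κ i).U) A Φ 𝒱' θ' →
        ∃! e : 𝒱.sheaf ≅ 𝒱'.sheaf,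
          (∀ W : X.Opens, (𝒱.va W).IsHom (𝒱'.va W) (e.hom.hom.app (op W)).hom) ∧
          (∀ i W (hW : W ≤ (κ i).U) (a : 𝒱.sheaf.presheaf.obj (op W)),
            θ' i W hW ((e.hom.hom.app (op W)).hom a) = θ i W hW a) := by
  have : IsNoetherian X :=
    { toIsLocallyNoetherian := LocallyOfFiniteType.isLocallyNoetherian π
      toCompactSpace := QuasiCompact.compactSpace_of_compactSpace π }
  refine Exists.elim (exists_isTensorStructure N B c k) fun AV hV =>
    Exists.elim (exists_local_structures π B c k κ) fun A H => Exists.elim H fun Φ H =>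
      ⟨AV, hV, fun _ => hV.ext, A, fun i W hW => ?_, H.2.1, Φ, H.2.2.1, H.2.2.2.1, H.2.2.2.2, ?_⟩
  · have hA := H.1 i W hW
    exact ⟨hA, fun _ => hA.ext, hA.Y_mode, hA.D_tmul hV, hA.isHom_tmul_one hV⟩
  · exact exists_isGlued hκ H.2.1 (fun i j W hi hj => (H.2.2.1 i j W hi hj).1) H.2.2.2.1
      H.2.2.2.2
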